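/- **Model.** External memory model: a word RAM whose words have $w$ bits, with an internal memory of $M$ words and a constant number of registers, attached to a disk accessed in blocks of $B$ consecutive words, where $B\ge 1$ and $2B\le M<2^w$. The I/O cost of a program is the number of blocks moved between internal memory and disk; internal computation is free. Words have $\Theta(\log n)$ bits, the constant being sufficiently large; only $w\ge c\log_2 n$ is needed. **Factorizations.** Let $X$ be a string of length $n\ge 2$ over the alphabet $\{0,\dots,\sigma-1\}$ with $2\le\sigma\le n^{a}$. A parsing of $X$ partitions it, left to right, into literal phrases (single symbols) and repeat phrases: a repeat phrase at position $i$ is a pair $(p,\ell)$ with $p<i$, $\ell\ge 1$ and $X[p..p+\ell)=X[i..i+\ell)$. The parsing is the *LZ77 factorization* of $X$ if it is greedy: every repeat phrase has the largest possible $\ell$ at its position, and a literal phrase is used only where no repeat phrase exists. It is an *LZ77-type factorization* (with constant $a$) if the number of repeat phrases is at most $a\,n/\log_\sigma n$. The parsing is encoded sequentially, each literal phrase with $O(\log\sigma)$ bits (a zero length and the symbol) and each repeat phrase with $O(\log n)$ bits (its source position and its length as fixed-length integers), packed into words; the output is the string $X$ packed into words, with $\lfloor w/\log_2\sigma\rfloor$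 symbols per word. **Theorem 2 (upper bound).** There is a single program which, given $n,\sigma,w,M,B$ and, on disk, the encoding of the LZ77 factorization or of any LZ77-type factorization of $X$, writes $X$ to disk using $$O\!\left(\frac{n}{B\log_\sigma n}\,\log_{M/B}\frac{n}{B\log_\sigma n}\right)$$ I/Os. More precisely, for every $a$ there are constants $c$ and $C$, depending only on $a$, such that, for all $n,\sigma,w,M,B,X$ as above with $w\ge c\log_2 n$ and all such factorizations, the number of I/Os is at most $$C\cdot\max\Bigl(1,\frac{n}{B\log_\sigma n}\Bigr)\cdot\max\Bigl(1,\log_{M/B}\frac{n}{B\log_\sigma n}\Bigr).$$ (If $n/\log_\sigma n\ge M$, i.e. if the string does not fit in internal memory, both maxima equal their second argument.) -/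

import Mathlib

/-! ### The external memory model

A word RAM with `M` words of internal memory and a constant number of registers (the finitely many
that a program mentions), attached to a disk that is accessed in blocks of `B` consecutive words.
A word has `w` bits. Internal computation is free; the cost of a run is the number of blocks moved
between RAM and disk. -/

namespace ExtMem

/-- The parameters of a machine: `w` bits per word, `M` words of RAM, `B` words per disk block. -/
structure Machine where
  w : ℕ
  M : ℕ
  B : ℕ

/-- Arithmetic operations on words. -/
inductive Op
  | add | sub | mul | div | mod | lt | eq

/-- The value of an operation before reduction to `w` bits: subtraction is truncated at `0`,
`x / 0 = 0`, `x % 0 = x`, and comparisons return `1` (true) or `0` (false). -/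
def Op.apply : Op → ℕ → ℕ → ℕ
  | .add, x, y => x + y
  | .sub, x, y => x - y
  | .mul, x, y => x * y
  | .div, x, y => x / y
  | .mod, x, y => x % y
  | .lt, x, y => if x < y then 1 else 0
  | .eq, x, y => if x = y then 1 else 0

/-- Expressions over constants, registers, and RAM cells (`mem e` is the cell with address `e`). -/
inductive Expr
  | const (v : ℕ)
  | reg (x : ℕ)
  | mem (e : Expr)
  | op (o : Op) (e₁ e₂ : Expr)

/-- The contents of the registers, of the RAM (cells `0, …, M - 1` are used) and of the disk,
whose block number `b` consists of the cells `b * B, …, b * B + B - 1`. -/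
structure State where
  reg : ℕ → ℕ
  ram : ℕ → ℕ
  disk : ℕ → ℕ

/-- The value of an expression; every result is reduced to a `w`-bit word. An address outside the
RAM yields `0`. -/
def Expr.eval (m : Machine) (s : State) : Expr → ℕ
  | .const v => v % 2 ^ m.w
  | .reg x => s.reg x
  | .mem e => if e.eval m s < m.M then s.ram (e.eval m s) else 0
  | .op o e₁ e₂ => o.apply (e₁.eval m s) (e₂.eval m s) % 2 ^ m.w

/-- Programs. A program is a fixed finite object and does not depend on the machine. -/
inductive Cmd
  /-- do nothing -/
  | skip
  /-- set the register `x` to the value of `e` -/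
  | assign (x : ℕ) (e : Expr)
  /-- set the RAM cell `addr` to the value of `e` -/
  | store (addr e : Expr)
  /-- copy the disk block `blk` to the RAM cells `addr, …, addr + B - 1` -/
  | readBlock (blk addr : Expr)
  /-- copy the RAM cells `addr, …, addr + B - 1` to the disk block `blk` -/
  | writeBlock (blk addr : Expr)
  | seq (c₁ c₂ : Cmd)
  | ite (e : Expr) (c₁ c₂ : Cmd)
  | while (e : Expr) (c : Cmd)

/-- `dst` after the cells `d, …, d + B - 1` are overwritten by the cells `a, …, a + B - 1`
of `src`. -/
def copyBlock (B : ℕ) (src : ℕ → ℕ) (a : ℕ) (dst : ℕ → ℕ) (d : ℕ) : ℕ → ℕ :=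
  fun i => if d ≤ i ∧ i < d + B then src (a + (i - d)) else dst i

/-- `Run m c s s' t`: on the machine `m`, the program `c` started in the state `s` halts in the
state `s'`, and exactly `t` blocks are moved between RAM and disk. A program that writes to the
RAM, or transfers a block from or to it, outside the cells `0, …, M - 1` is stuck: it has no run. -/
inductive Run (m : Machine) : Cmd → State → State → ℕ → Prop
  | skip (s : State) : Run m .skip s s 0
  | assign (s : State) (x : ℕ) (e : Expr) :
      Run m (.assign x e) s { s with reg := Function.update s.reg x (e.eval m s) } 0
  | store (s : State) (addr e : Expr) (h : addr.eval m s < m.M) :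
      Run m (.store addr e) s
        { s with ram := Function.update s.ram (addr.eval m s) (e.eval m s) } 0
  | readBlock (s : State) (blk addr : Expr) (h : addr.eval m s + m.B ≤ m.M) :
      Run m (.readBlock blk addr) s
        { s with ram :=
            copyBlock m.B s.disk (blk.eval m s * m.B) s.ram (addr.eval m s) } 1
  | writeBlock (s : State) (blk addr : Expr) (h : addr.eval m s + m.B ≤ m.M) :
      Run m (.writeBlock blk addr) s
        { s with disk :=
            copyBlock m.B s.ram (addr.eval m s) s.disk (blk.eval m s * m.B) } 1
  | seq {c₁ c₂ : Cmd} {s s₁ s₂ : State} {t₁ t₂ : ℕ}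
      (h₁ : Run m c₁ s s₁ t₁) (h₂ : Run m c₂ s₁ s₂ t₂) : Run m (.seq c₁ c₂) s s₂ (t₁ + t₂)
  | iteTrue {e : Expr} {c₁ c₂ : Cmd} {s s' : State} {t : ℕ}
      (he : e.eval m s ≠ 0) (h : Run m c₁ s s' t) : Run m (.ite e c₁ c₂) s s' t
  | iteFalse {e : Expr} {c₁ c₂ : Cmd} {s s' : State} {t : ℕ}
      (he : e.eval m s = 0) (h : Run m c₂ s s' t) : Run m (.ite e c₁ c₂) s s' t
  | whileTrue {e : Expr} {c : Cmd} {s s₁ s₂ : State} {t₁ t₂ : ℕ}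
      (he : e.eval m s ≠ 0) (h₁ : Run m c s s₁ t₁) (h₂ : Run m (.while e c) s₁ s₂ t₂) :
      Run m (.while e c) s s₂ (t₁ + t₂)
  | whileFalse {e : Expr} {c : Cmd} {s : State}
      (he : e.eval m s = 0) : Run m (.while e c) s s 0

/-- The number of symbols of the alphabet `{0, …, σ - 1}` that fit in a word of `w` bits:
the largest `k` with `σ ^ k ≤ 2 ^ w`. -/
def symbolsPerWord (σ w : ℕ) : ℕ := Nat.log σ (2 ^ w)

/-- Word number `i` of the packed representation of a string over `{0, …, σ - 1}`: it holds the
symbols number `i * k, …, i * k + k - 1` as digits in base `σ`, the first one being the least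
significant, where `k` is the number of symbols per word. Beyond the string, all digits are `0`. -/
def pack (σ w : ℕ) (X : List ℕ) (i : ℕ) : ℕ :=
  Nat.ofDigits σ ((X.drop (i * symbolsPerWord σ w)).take (symbolsPerWord σ w))

/-- The initial state for the input string `I` over `{0, …, σ - 1}`: the disk holds the packed
string from cell `0` on, the RAM is cleared, and the registers `0, …, 4` hold `n`, `σ`, `w`, `M`
and `B`. -/
def initial (m : Machine) (n σ : ℕ) (I : List ℕ) : State where
  reg x := if x = 0 then n else if x = 1 then σ else if x = 2 then m.w else
    if x = 3 then m.M else if x = 4 then m.B else 0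
  ram _ := 0
  disk := pack σ m.w I

/-- The state `s` holds the string `X` over `{0, …, σ - 1}` as output: `X` is stored on the disk
in packed form, in consecutive blocks starting with the one whose number is in register `0`. -/
def Outputs (m : Machine) (s : State) (σ : ℕ) (X : List ℕ) : Prop :=
  ∀ i, i * symbolsPerWord σ m.w < X.length → s.disk (s.reg 0 * m.B + i) = pack σ m.w X i

end ExtMem

/-! ### LZ77 factorizations. Positions in a string are counted from `0`. -/

namespace LZ

/-- A phrase: a literal symbol, or a repeat given by the source position and the length. -/
inductive Phrase
  | lit (c : ℕ)
  | rep (p l : ℕ)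

/-- The number of text symbols that a phrase represents. -/
def Phrase.len : Phrase → ℕ
  | .lit _ => 1
  | .rep _ l => l

/-- The phrase is a valid description of `X` at position `i`. The source of a repeat phrase starts
before `i`; it may overlap the phrase. -/
def Phrase.IsAt (X : List ℕ) (i : ℕ) : Phrase → Prop
  | .lit c => X[i]? = some c
  | .rep p l => p < i ∧ 0 < l ∧ i + l ≤ X.length ∧ ∀ j < l, X[p + j]? = X[i + j]?

/-- The phrase is the one chosen by the greedy parsing at position `i`: a longest previous factor,
or a literal if the symbol at `i` has no earlier occurrence. -/
def Phrase.IsGreedyAt (X : List ℕ) (i : ℕ) : Phrase → Prop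
  | .lit c => (Phrase.lit c).IsAt X i ∧ ∀ p l, ¬ (Phrase.rep p l).IsAt X i
  | .rep p l => (Phrase.rep p l).IsAt X i ∧ ∀ p' l', (Phrase.rep p' l').IsAt X i → l' ≤ l

/-- The phrases parse the suffix of `X` that starts at a given position, each phrase satisfying
`P` at the position where it starts. -/
def Parses (X : List ℕ) (P : ℕ → Phrase → Prop) : ℕ → List Phrase → Prop
  | i, [] => i = X.length
  | i, f :: F => P i f ∧ Parses X P (i + f.len) F

/-- The number of repeat phrases. -/
def repCount (F : List Phrase) : ℕ :=
  F.countP fun f => match f with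
    | .lit _ => false
    | .rep _ _ => true

/-- `F` is the (greedy) LZ77 factorization of `X`, up to the choice of the sources. -/
def IsLZ77 (X : List ℕ) (F : List Phrase) : Prop :=
  Parses X (Phrase.IsGreedyAt X) 0 F

/-- The size in words of a string of length `n` over an alphabet of size `σ`: `n / log_σ n`. -/
noncomputable def textWords (n σ : ℕ) : ℝ := n / Real.logb σ n

/-- `F` is an LZ77-type factorization of the string `X` over an alphabet of size `σ`: it consists
of literal and repeat phrases, and the number of repeat phrases is at most `a * n / log_σ n`. -/
def IsLZ77Type (a σ : ℕ) (X : List ℕ) (F : List Phrase) : Prop :=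
  Parses X (Phrase.IsAt X) 0 F ∧ (repCount F : ℝ) ≤ a * textWords X.length σ

/-- The representation of `v < σ ^ d` by exactly `d` digits in base `σ`. -/
def fixedDigits (σ d v : ℕ) : List ℕ := (List.range d).map fun j => v / σ ^ j % σ

/-- The encoding of a phrase by symbols in `{0, …, σ - 1}`, for a text of length `n`. For a literal
phrase, the symbol `0` (the length) is followed by the literal. For a repeat phrase, the symbol `1`
(nonzero length) is followed by the source position and the length, both written with the number
of digits of `n`. -/
def Phrase.encode (σ n : ℕ) : Phrase → List ℕ
  | .lit c => [0, c]
  | .rep p l => 1 :: (fixedDigits σ (Nat.log σ n + 1) p ++ fixedDigits σ (Nat.log σ n + 1) l)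

/-- The encoding of a factorization is the concatenation of those of its phrases. -/
def encode (σ n : ℕ) (F : List Phrase) : List ℕ := F.flatMap (Phrase.encode σ n)

/-- `(N / B) * log_{M / B} (N / B)` for `N = n / log_σ n`, where, as usual in the external memory
model, both factors are understood to be at least `1`. -/
noncomputable def ioBound (n σ M B : ℕ) : ℝ :=
  max 1 (textWords n σ / B) * max 1 (Real.logb (M / B) (textWords n σ / B))

end LZ

/-! The method is time-forward processing. The text is cut into units of `d = log σ n + 1` symbols,
each kept as one number below `D = σ ^ d`. The factorization is rewritten as pieces (`parse_wp`):
runs of literals inside a unit, and stretches of repeat phrases whose target and source each stay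
inside a unit. A repeat phrase is cut only at unit boundaries of its target or its source, so `z`
repeat phrases lead to `O(n / d + z)` pieces, each of which is one word. For LZ77-type
factorizations `z = O(n / log_σ n)` by definition; for the greedy one it follows by counting
distinct windows (`LZ.Parses.mul_repCount_le`, `repCount_le_textWords`). So only `O(n / log_σ n)`
words have to be moved around.

A chunk consists of `m * b` units, where `m` is about `M / B` and `b` about `B`; it fits in RAM.
Chunks are computed from left to right. Literals, and pieces whose source lies in their own chunk,
are handled in RAM. For every other piece a request is sent at the start to the chunk of its source;
once that chunk is known, the request becomes an answer that carries the copied symbols to the chunk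
of the piece. Answers to chunk `c` have leading component `2 * c` and requests `2 * c + 1`. Thus
increasing keys visit the chunks in order, and all answers to a chunk exist before it is computed
(`between_even`). One round is `computeChunk_wp` and `answerChunk_wp`; the rounds are summed up in
`resolve_wp`.

The priority queue never deletes. Sorted blocks are merged `m` at a time, like carries in a counter
in base `m`, so every block is rewritten at most once per level and `x` blocks cost `O(x log_m x)`
(`levelCost_le`). Each group that is not yet part of a larger one has a pointer that separates the
messages already delivered. Delivering everything below a new key resumes each such group at its
pointer, at the price of `O(1)` transfers per group and one per `b` messages (`extract_wp`). There
are at most about `m` groups per level and about `n / (d * m * b)` chunks, so this too adds up to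
`O(n / (d * b) * log_m x)`. Answers created during a scan have larger keys and are only appended, so
they do not disturb it.

Since words have `w ≥ c log n` bits with a large `c`, sixteen numbers below `V = 2 ^ (w / 16)` share
a word. This provides eight arrays of `M` entries even if `M = 2 * B` (`packedLayout`), hence
merging with the full fan-in `M / B`. Input and output use whole words (`rawLayout`); `repack_wp`
turns units into packed output. Programs are written in a small language and verified by weakest
preconditions that also count transfers (`wp_sound`). `program_run` joins the phases, and
`DecodeCost.le_ioBound` converts the rounded counts into the claimed bound. -/

set_option linter.constructorNameAsVariable false

namespace ExtMem

open Nat Finset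

/-! ### A structured language over arrays that are stored in the RAM -/

/-- The user variables of the structured language. -/
inductive Var
  | n | sg | w | M | B | d | k | D | b | m | G | cu | U | pad | inf | V
  | e | cw | y | pos | len | src | acc | pc | num | pow | z1 | z2 | z3
  | kk | bb | bs | out
  | f0 | f1 | f2 | f3 | val | cnt | x1 | x0 | th | i | j | q | q1 | q2 | q3
  | lv | sb | pw | off | yy | cur | go | key | best | bj | o | ptr | s1 | s2 | s3
  | uu | ue | qi | v1 | v2 | v3 | rp | v4
  deriving DecidableEq

/-- The register that holds a user variable. -/
def Var.idx (x : Var) : ℕ := x.ctorIdx + 10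

theorem Var.idx_injective : Function.Injective Var.idx := by
  intro x y h; have h' : x.ctorIdx = y.ctorIdx := Nat.add_right_cancel h
  rw [← Var.ofNat_ctorIdx x, ← Var.ofNat_ctorIdx y, h']

@[simp] theorem Var.idx_inj {x y : Var} : x.idx = y.idx ↔ x = y := Var.idx_injective.eq_iff

theorem Var.ten_le_idx (x : Var) : 10 ≤ x.idx := Nat.le_add_left _ _

/-- Expressions over constants, user variables and array entries. -/
inductive AExpr
  | c (v : ℕ)
  | r (x : Var)
  | get (f : ℕ) (i : AExpr)
  | op (o : Op) (a b : AExpr)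

/-- Commands of the structured language. -/
inductive ACmd
  | skip
  | assign (x : Var) (e : AExpr)
  | set (f : ℕ) (i e : AExpr)
  | read (q : AExpr) (f : ℕ) (j : AExpr)
  | write (q : AExpr) (f : ℕ) (j : AExpr)
  | seq (c₁ c₂ : ACmd)
  | ite (e : AExpr) (c₁ c₂ : ACmd)
  | loop (e : AExpr) (c : ACmd)

/-- Contents of the variables, the arrays, and the disk (block number and offset). -/
@[ext] structure AState where
  reg : Var → ℕ
  arr : ℕ → ℕ → ℕ
  disk : ℕ → ℕ → ℕ

namespace AState

def setReg (A : AState) (x : Var) (v : ℕ) : AState :=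
  { A with reg := fun y => if y = x then v else A.reg y }

def setArr (A : AState) (f i v : ℕ) : AState :=
  { A with arr := fun f' i' => if f' = f ∧ i' = i then v else A.arr f' i' }

def readArr (A : AState) (b q f j : ℕ) : AState :=
  { A with arr := fun f' i' =>
      if f' = f ∧ j ≤ i' ∧ i' < j + b then A.disk q (i' - j) else A.arr f' i' }

def writeDisk (A : AState) (b q f j : ℕ) : AState :=
  { A with disk := fun q' o' =>
      if q' = q then (if o' < b then A.arr f (j + o') else 0) else A.disk q' o' }

variable (A : AState)

theorem setReg_self (x) : A.setReg x (A.reg x) = A := by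
  ext y
  · simp only [setReg]; split_ifs with h <;> simp [h]
  · rfl
  · rfl

@[simp] theorem setReg_reg (x v y) : (A.setReg x v).reg y = if y = x then v else A.reg y := rfl
@[simp] theorem setReg_arr (x v) : (A.setReg x v).arr = A.arr := rfl
@[simp] theorem setReg_disk (x v) : (A.setReg x v).disk = A.disk := rfl
@[simp] theorem setArr_reg (f i v) : (A.setArr f i v).reg = A.reg := rfl
@[simp] theorem setArr_arr (f i v f' i') :
    (A.setArr f i v).arr f' i' = if f' = f ∧ i' = i then v else A.arr f' i' := rfl
@[simp] theorem setArr_disk (f i v) : (A.setArr f i v).disk = A.disk := rfl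
@[simp] theorem readArr_reg (b q f j) : (A.readArr b q f j).reg = A.reg := rfl
@[simp] theorem readArr_disk (b q f j) : (A.readArr b q f j).disk = A.disk := rfl
@[simp] theorem readArr_arr (b q f j f' i') : (A.readArr b q f j).arr f' i' =
    if f' = f ∧ j ≤ i' ∧ i' < j + b then A.disk q (i' - j) else A.arr f' i' := rfl
@[simp] theorem writeDisk_reg (b q f j) : (A.writeDisk b q f j).reg = A.reg := rfl
@[simp] theorem writeDisk_arr (b q f j) : (A.writeDisk b q f j).arr = A.arr := rfl
@[simp] theorem writeDisk_disk (b q f j q' o') : (A.writeDisk b q f j).disk q' o' =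
    if q' = q then (if o' < b then A.arr f (j + o') else 0) else A.disk q' o' := rfl

end AState

/-- The exact value of an expression. -/
def AExpr.val (A : AState) : AExpr → ℕ
  | .c v => v
  | .r x => A.reg x
  | .get f i => A.arr f (i.val A)
  | .op o a b => o.apply (a.val A) (b.val A)

/-- The syntax by which arrays are stored in the RAM and transferred to and from the disk.
Registers `7` and `8` hold the arguments of the commands. -/
structure Access where
  getE : ℕ → Expr → Expr
  setC : ℕ → Cmd
  readC : ℕ → Cmd
  writeC : ℕ → Cmd

def AExpr.compile (a : Access) : AExpr → Expr
  | .c v => .const v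
  | .r x => .reg x.idx
  | .get f i => a.getE f (i.compile a)
  | .op o e1 e2 => .op o (e1.compile a) (e2.compile a)

def ACmd.compile (a : Access) : ACmd → Cmd
  | .skip => .skip
  | .assign x e => .assign x.idx (e.compile a)
  | .set f i e => .seq (.assign 7 (i.compile a)) (.seq (.assign 8 (e.compile a)) (a.setC f))
  | .read q f j => .seq (.assign 7 (q.compile a)) (.seq (.assign 8 (j.compile a)) (a.readC f))
  | .write q f j => .seq (.assign 7 (q.compile a)) (.seq (.assign 8 (j.compile a)) (a.writeC f))
  | .seq c1 c2 => .seq (c1.compile a) (c2.compile a)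
  | .ite e c1 c2 => .ite (e.compile a) (c1.compile a) (c2.compile a)
  | .loop e c => .while (e.compile a) (c.compile a)

/-- All words of the state have at most `w` bits. -/
structure State.WF (m : Machine) (s : State) : Prop where
  reg : ∀ x, s.reg x < 2 ^ m.w
  ram : ∀ x, s.ram x < 2 ^ m.w
  disk : ∀ x, s.disk x < 2 ^ m.w

theorem Expr.eval_lt {m : Machine} {s : State} (hs : s.WF m) (e : Expr) : e.eval m s < 2 ^ m.w := by
  have hp : 0 < 2 ^ m.w := by positivity
  cases e with
  | const v => exact mod_lt _ hp
  | reg x => exact hs.reg x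
  | mem e =>
    simp only [Expr.eval]
    split
    · exact hs.ram _
    · exact hp
  | op o a b => exact mod_lt _ hp

theorem Run.wf {m : Machine} {c : Cmd} {s s' : State} {t : ℕ} (h : Run m c s s' t) : s.WF m → s'.WF m := by
  induction h with
  | skip s => exact id
  | assign s x e =>
    refine fun hs => ⟨fun y => ?_, hs.ram, hs.disk⟩; simp only [Function.update_apply]
    split
    · exact Expr.eval_lt hs e
    · exact hs.reg y
  | store s a e _ =>
    refine fun hs => ⟨hs.reg, fun y => ?_, hs.disk⟩; simp only [Function.update_apply]
    split
    · exact Expr.eval_lt hs e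
    · exact hs.ram y
  | readBlock s q a _ =>
    refine fun hs => ⟨hs.reg, fun y => ?_, hs.disk⟩; simp only [copyBlock]
    split
    · exact hs.disk _
    · exact hs.ram y
  | writeBlock s q a _ =>
    refine fun hs => ⟨hs.reg, hs.ram, fun y => ?_⟩; simp only [copyBlock]
    split
    · exact hs.ram _
    · exact hs.disk y
  | seq _ _ ih1 ih2 => exact fun hs => ih2 (ih1 hs)
  | iteTrue _ _ ih => exact ih
  | iteFalse _ _ ih => exact ih
  | whileTrue _ _ _ ih1 ih2 => exact fun hs => ih2 (ih1 hs)
  | whileFalse _ => exact id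

/-- An implementation of arrays in the RAM: `narr` arrays of `cap` entries that are less than
`bound`, where disk blocks are used up to their first `blk` words. -/
structure Layout (m : Machine) (a : Access) where
  narr : ℕ
  cap : ℕ
  bound : ℕ
  blk : ℕ
  Inv : (ℕ → ℕ) → Prop
  arr : (ℕ → ℕ) → ℕ → ℕ → ℕ
  -- All constants of the structured language are below 64, so they fit in a word.
  width : 64 ≤ 2 ^ m.w
  bound_le : bound ≤ 2 ^ m.w
  blk_le : blk ≤ m.B
  -- Registers 7 and 8 pass arguments, 9 is a loop counter, and user variables start at 10; so an
  -- invariant may only depend on the registers below 7.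
  inv_congr : ∀ r r' : ℕ → ℕ, (∀ x < 7, r x = r' x) → Inv r → Inv r'
  arr_lt : ∀ ram f j, (∀ x, ram x < 2 ^ m.w) → f < narr → j < cap → arr ram f j < bound
  get_eval : ∀ (s : State) f (e : Expr), Inv s.reg → s.WF m → f < narr → e.eval m s < cap →
    (a.getE f e).eval m s = arr s.ram f (e.eval m s)
  set_run : ∀ (s : State) f, Inv s.reg → s.WF m → f < narr → s.reg 7 < cap → s.reg 8 < bound →
    ∃ s', Run m (a.setC f) s s' 0 ∧ (∀ x, x < 7 ∨ 10 ≤ x → s'.reg x = s.reg x) ∧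
      s'.disk = s.disk ∧ ∀ f' j', f' < narr → j' < cap →
        arr s'.ram f' j' = if f' = f ∧ j' = s.reg 7 then s.reg 8 else arr s.ram f' j'
  read_run : ∀ (s : State) f, Inv s.reg → s.WF m → f < narr → s.reg 8 + blk ≤ cap →
    (∀ o < blk, s.disk (s.reg 7 * m.B + o) < bound) →
    ∃ s', Run m (a.readC f) s s' 1 ∧ (∀ x, x < 7 ∨ 10 ≤ x → s'.reg x = s.reg x) ∧
      s'.disk = s.disk ∧ ∀ f' j', f' < narr → j' < cap →
        arr s'.ram f' j' = if f' = f ∧ s.reg 8 ≤ j' ∧ j' < s.reg 8 + blk then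
          s.disk (s.reg 7 * m.B + (j' - s.reg 8)) else arr s.ram f' j'
  write_run : ∀ (s : State) f, Inv s.reg → s.WF m → f < narr → s.reg 8 + blk ≤ cap →
    ∃ s', Run m (a.writeC f) s s' 1 ∧ (∀ x, x < 7 ∨ 10 ≤ x → s'.reg x = s.reg x) ∧
      (∀ f' j', f' < narr → j' < cap → arr s'.ram f' j' = arr s.ram f' j') ∧
      (∀ o < blk, s'.disk (s.reg 7 * m.B + o) = arr s.ram f (s.reg 8 + o)) ∧
      (∀ i, i < s.reg 7 * m.B ∨ s.reg 7 * m.B + m.B ≤ i → s'.disk i = s.disk i)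

variable {m : Machine} {a : Access}

/-- No overflow and no access out of bounds occurs in the evaluation of an expression. -/
def AExpr.ok (L : Layout m a) (A : AState) : AExpr → Prop
  | .c v => v < 64
  | .r _ => True
  | .get f i => i.ok L A ∧ f < L.narr ∧ i.val A < L.cap
  | .op o e1 e2 => e1.ok L A ∧ e2.ok L A ∧ match o with
    | .add => e1.val A + e2.val A < 2 ^ m.w
    | .mul => e1.val A * e2.val A < 2 ^ m.w
    | _ => True

namespace Layout

/-- The structured view of a machine state. -/
def abs (L : Layout m a) (s : State) : AState where
  reg x := s.reg x.idx
  -- Everything out of range is read as 0, here and on the disk. The effect of a command is then an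
  -- equality of views, without side conditions on indices.
  arr f j := if f < L.narr ∧ j < L.cap then L.arr s.ram f j else 0
  disk q o := if o < L.blk then s.disk (q * m.B + o) else 0

theorem abs_reg (L : Layout m a) (s x) : (L.abs s).reg x = s.reg x.idx := rfl

theorem abs_arr (L : Layout m a) (s f j) :
    (L.abs s).arr f j = if f < L.narr ∧ j < L.cap then L.arr s.ram f j else 0 := rfl

theorem abs_disk (L : Layout m a) (s q o) : (L.abs s).disk q o = if o < L.blk then s.disk (q * m.B + o) else 0 := rfl

/-- `ok` has to rule out overflow only for sums and products: difference, quotient and remainder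
never exceed the first operand, and comparisons are at most 1. Hence no reduction to `w` bits takes
effect. -/
theorem eval_compile (L : Layout m a) {s : State} (hi : L.Inv s.reg) (hs : s.WF m) (e : AExpr)
    (hok : e.ok L (L.abs s)) : (e.compile a).eval m s = e.val (L.abs s) := by
  induction e with
  | c v =>
    simp only [AExpr.ok] at hok; exact mod_eq_of_lt (lt_of_lt_of_le hok L.width)
  | r x => rfl
  | get f i ih =>
    obtain ⟨h1, h2, h3⟩ := hok; have h := ih h1; simp only [AExpr.compile, AExpr.val]
    rw [L.get_eval s f _ hi hs h2 (h ▸ h3), h]; simp [abs, h2] at h3 ⊢; intro h4; exact absurd h3 (not_lt.2 h4)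
  | op o e1 e2 ih1 ih2 =>
    obtain ⟨h1, h2, h3⟩ := hok; have l1 := Expr.eval_lt hs (e1.compile a); have l2 := Expr.eval_lt hs (e2.compile a)
    have hw := L.width; simp only [AExpr.compile, AExpr.val, Expr.eval]; rw [ih1 h1] at l1 ⊢; rw [ih2 h2] at l2 ⊢
    refine mod_eq_of_lt ?_
    cases o with
    | add => exact h3
    | mul => exact h3
    | sub => exact lt_of_le_of_lt (sub_le _ _) l1
    | div => exact lt_of_le_of_lt (Nat.div_le_self _ _) l1
    | mod => exact lt_of_le_of_lt (mod_le _ _) l1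
    | lt => simp only [Op.apply]; split <;> omega
    | eq => simp only [Op.apply]; split <;> omega

/-! ### Weakest preconditions and their soundness. -/

/-- The command, started in a state whose view is `A` after `t` transfers, halts in a state that
satisfies `Q`. -/
def Spec (L : Layout m a) (c : ACmd) (Q : AState → ℕ → Prop) (A : AState) (t : ℕ) : Prop :=
  ∀ s : State, s.WF m → L.Inv s.reg → L.abs s = A →
    ∃ s' t', Run m (c.compile a) s s' t' ∧ L.Inv s'.reg ∧ Q (L.abs s') (t + t')

/-- Weakest preconditions. -/
def wp (L : Layout m a) : ACmd → (AState → ℕ → Prop) → AState → ℕ → Prop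
  | .skip, Q => Q
  | .assign x e, Q => fun A t => e.ok L A ∧ Q (A.setReg x (e.val A)) t
  | .set f i e, Q => fun A t => (i.ok L A ∧ e.ok L A ∧ f < L.narr ∧ i.val A < L.cap ∧
      e.val A < L.bound) ∧ Q (A.setArr f (i.val A) (e.val A)) t
  | .read q f j, Q => fun A t => (q.ok L A ∧ j.ok L A ∧ f < L.narr ∧ j.val A + L.blk ≤ L.cap ∧
      ∀ o < L.blk, A.disk (q.val A) o < L.bound) ∧
      Q (A.readArr L.blk (q.val A) f (j.val A)) (t + 1)
  -- The continuation may assume that the written values are below the bound. Real states satisfy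
  -- this by `arr_lt`, so programs need not track bounds on the unused part of a buffer.
  | .write q f j, Q => fun A t => (q.ok L A ∧ j.ok L A ∧ f < L.narr ∧ j.val A + L.blk ≤ L.cap) ∧
      ((∀ o < L.blk, A.arr f (j.val A + o) < L.bound) → Q (A.writeDisk L.blk (q.val A) f (j.val A)) (t + 1))
  | .seq c1 c2, Q => wp L c1 (wp L c2 Q)
  | .ite e c1 c2, Q => fun A t => e.ok L A ∧ (e.val A ≠ 0 → wp L c1 Q A t) ∧ (e.val A = 0 → wp L c2 Q A t)
  -- Loops have no structural precondition; the semantic one is used, and `wp_while` is the way to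
  -- establish it.
  | .loop e c, Q => L.Spec (.loop e c) Q

theorem abs_congr (L : Layout m a) {s s' : State} (hr : ∀ x, 10 ≤ x → s'.reg x = s.reg x)
    (ha : s'.ram = s.ram) (hd : s'.disk = s.disk) : L.abs s' = L.abs s := by
  ext x
  · exact hr _ x.ten_le_idx
  · simp [abs, ha]
  · simp [abs, hd]

/-- The two argument registers are loaded. -/
theorem run_args (L : Layout m a) {s : State} (hs : s.WF m) (hi : L.Inv s.reg) {e1 e2 : AExpr}
    (h1 : e1.ok L (L.abs s)) (h2 : e2.ok L (L.abs s)) {c : Cmd} {t : ℕ}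
    {P : State → Prop}
    (h : ∀ s1 : State, s1.WF m → L.Inv s1.reg → L.abs s1 = L.abs s →
      s1.reg 7 = e1.val (L.abs s) → s1.reg 8 = e2.val (L.abs s) → s1.disk = s.disk →
      s1.ram = s.ram → (∀ x, x < 7 ∨ 10 ≤ x → s1.reg x = s.reg x) →
      ∃ s', Run m c s1 s' t ∧ P s') :
    ∃ s', Run m (.seq (.assign 7 (e1.compile a)) (.seq (.assign 8 (e2.compile a)) c)) s s' t ∧ P s' := by
  have v1 := L.eval_compile hi hs e1 h1; have r1 := Run.assign (m := m) s 7 (e1.compile a); have w1 := r1.wf hs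
  revert r1 w1
  generalize hs1 : ({ s with reg := _ } : State) = s1; intro r1 w1
  have f1 : ∀ x, x ≠ 7 → s1.reg x = s.reg x := fun x hx => by rw [← hs1]; exact Function.update_of_ne hx _ _
  have a1 : L.abs s1 = L.abs s := by apply L.abs_congr (fun x hx => f1 x (by omega)) <;> rw [← hs1]
  have i1 : L.Inv s1.reg := L.inv_congr _ _ (fun x hx => (f1 x (by omega)).symm) hi
  have v2 := L.eval_compile i1 w1 e2 (a1 ▸ h2); have r2 := Run.assign (m := m) s1 8 (e2.compile a); have w2 := r2.wf w1
  revert r2 w2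
  generalize hs2 : ({ s1 with reg := _ } : State) = s2; intro r2 w2
  have f2 : ∀ x, x ≠ 8 → s2.reg x = s1.reg x := fun x hx => by rw [← hs2]; exact Function.update_of_ne hx _ _
  have a2 : L.abs s2 = L.abs s1 := by apply L.abs_congr (fun x hx => f2 x (by omega)) <;> rw [← hs2]
  have i2 : L.Inv s2.reg := L.inv_congr _ _ (fun x hx => (f2 x (by omega)).symm) i1
  obtain ⟨s', hr, hp⟩ := h s2 w2 i2 (a2.trans a1) (by rw [f2 7 (by omega), ← hs1]; simpa using v1)
    (by rw [← hs2]; simpa [a1] using v2)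
    (by rw [← hs2, ← hs1]) (by rw [← hs2, ← hs1])
    (fun x hx => by rw [f2 x (by omega), f1 x (by omega)])
  refine ⟨s', ?_, hp⟩; have := Run.seq r1 (Run.seq r2 hr); simpa using this

/-- Structural induction: the layout provides the runs of the three array commands, sequences add up
their transfers, and the case of a loop holds by definition of `wp`. -/
theorem wp_sound (L : Layout m a) (c : ACmd) (Q : AState → ℕ → Prop) (A : AState) (t : ℕ)
    (h : L.wp c Q A t) : L.Spec c Q A t := by
  induction c generalizing Q A t with
  | skip => exact fun s hs hi hA => ⟨s, 0, .skip s, hi, hA ▸ h⟩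
  | assign x e =>
    rintro s hs hi rfl
    refine ⟨_, 0, .assign s _ _, L.inv_congr _ _ (fun y hy => ?_) hi, ?_⟩
    · have := x.ten_le_idx; exact (Function.update_of_ne (by omega) _ _).symm
    · rw [L.eval_compile hi hs e h.1]; rw [add_zero]; convert h.2 using 1
      ext y <;> simp [abs, Function.update_apply, AState.setReg]
  | set f i e =>
    rintro s hs hi rfl; obtain ⟨⟨h1, h2, h3, h4, h5⟩, h⟩ := h
    obtain ⟨s', hr, hp⟩ := L.run_args hs hi h1 h2 (c := a.setC f) (t := 0)
      (P := fun s' => L.Inv s'.reg ∧ Q (L.abs s') t) (by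
        intro s1 w1 i1 a1 r7 r8 hd hram hreg
        obtain ⟨s', hr, hr', hd', ha'⟩ := L.set_run s1 f i1 w1 h3 (r7 ▸ h4) (r8 ▸ h5)
        refine ⟨s', hr, L.inv_congr _ _ (fun x hx => (hr' x (.inl hx)).symm) i1, ?_⟩; convert h using 1; ext x y
        · simp [abs, hr' _ (.inr x.ten_le_idx), hreg _ (.inr x.ten_le_idx)]
        · by_cases hxy : x < L.narr ∧ y < L.cap
          · simp only [abs, hxy, AState.setArr_arr]; rw [if_pos ⟨trivial, trivial⟩, ha' x y hxy.1 hxy.2, r7, r8]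
            simp [hram, abs]
          · simp only [abs, hxy, AState.setArr_arr, if_false]; rw [if_neg]; rintro ⟨rfl, rfl⟩; exact hxy ⟨h3, h4⟩
        · simp [abs, hd', hd])
    exact ⟨s', 0, hr, hp⟩
  | read q f j =>
    rintro s hs hi rfl; obtain ⟨⟨h1, h2, h3, h4, h5⟩, h⟩ := h
    obtain ⟨s', hr, hp⟩ := L.run_args hs hi h1 h2 (c := a.readC f) (t := 1)
      (P := fun s' => L.Inv s'.reg ∧ Q (L.abs s') (t + 1)) (by
        intro s1 w1 i1 a1 r7 r8 hd hram hreg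
        obtain ⟨s', hr, hr', hd', ha'⟩ := L.read_run s1 f i1 w1 h3 (r8 ▸ h4) (by
          intro o ho; have := h5 o ho
          simpa [r7, hd, abs, ho] using this)
        refine ⟨s', hr, L.inv_congr _ _ (fun x hx => (hr' x (.inl hx)).symm) i1, ?_⟩; convert h using 1; ext x y
        · simp [abs, hr' _ (.inr x.ten_le_idx), hreg _ (.inr x.ten_le_idx)]
        · by_cases hxy : x < L.narr ∧ y < L.cap
          · simp only [AState.readArr_arr]
            rw [abs_arr, if_pos hxy, ha' x y hxy.1 hxy.2, r7, r8, hram, hd]; split_ifs with g1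
            · rw [abs_disk, if_pos (by omega)]
            · rw [abs_arr, if_pos hxy]
          · simp only [AState.readArr_arr]; rw [if_neg]
            · rw [abs_arr, abs_arr, if_neg hxy, if_neg hxy]
            · rintro ⟨rfl, g1, g2⟩; exact hxy ⟨h3, by omega⟩
        · simp [abs, hd', hd])
    exact ⟨s', 1, hr, hp⟩
  | write q f j =>
    rintro s hs hi rfl; obtain ⟨⟨h1, h2, h3, h4⟩, h⟩ := h
    replace h := h fun o ho => by rw [abs_arr, if_pos ⟨h3, by omega⟩]; exact L.arr_lt _ _ _ hs.ram h3 (by omega)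
    obtain ⟨s', hr, hp⟩ := L.run_args hs hi h1 h2 (c := a.writeC f) (t := 1)
      (P := fun s' => L.Inv s'.reg ∧ Q (L.abs s') (t + 1)) (by
        intro s1 w1 i1 a1 r7 r8 hd hram hreg
        obtain ⟨s', hr, hr', ha', hd1, hd2⟩ := L.write_run s1 f i1 w1 h3 (r8 ▸ h4)
        refine ⟨s', hr, L.inv_congr _ _ (fun x hx => (hr' x (.inl hx)).symm) i1, ?_⟩; convert h using 1; ext x y
        · simp [abs, hr' _ (.inr x.ten_le_idx), hreg _ (.inr x.ten_le_idx)]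
        · by_cases hxy : x < L.narr ∧ y < L.cap
          · simp only [AState.writeDisk_arr]; simp only [abs, hxy]
            rw [if_pos ⟨trivial, trivial⟩, ha' x y hxy.1 hxy.2, hram, if_pos ⟨trivial, trivial⟩]
          · simp only [AState.writeDisk_arr]; simp only [abs, hxy, if_false]
        -- Blocks start `B` cells apart and only their first `blk ≤ B` cells are visible, so writing
        -- one block changes no other block of the view.
        · simp only [AState.writeDisk_disk]; have hb := L.blk_le
          by_cases hxq : x = q.val (L.abs s)
          · subst hxq
            by_cases hy : y < L.blk
            · rw [if_pos rfl, if_pos hy, abs_disk, if_pos hy, ← r7, hd1 y hy, r8, hram, abs_arr, if_pos ⟨h3, by omega⟩]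
            · rw [if_pos rfl, if_neg hy, abs_disk, if_neg hy]
          · rw [if_neg hxq]
            by_cases hy : y < L.blk
            · simp only [abs, hy, if_true]; rw [hd2, hd]; rw [r7]; rcases lt_or_gt_of_ne hxq with g | g
              · left
                calc x * m.B + y < x * m.B + m.B := by omega
                  _ = (x + 1) * m.B := by ring
                  _ ≤ _ := Nat.mul_le_mul_right _ g
              · right
                calc _ = (q.val (L.abs s) + 1) * m.B := by ring
                  _ ≤ x * m.B := Nat.mul_le_mul_right _ g
                  _ ≤ _ := Nat.le_add_right _ _
            · simp [abs, hy])
    exact ⟨s', 1, hr, hp⟩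
  | seq c1 c2 ih1 ih2 =>
    rintro s hs hi rfl; obtain ⟨s1, t1, r1, i1, q1⟩ := ih1 _ _ _ h s hs hi rfl
    obtain ⟨s2, t2, r2, i2, q2⟩ := ih2 _ _ _ q1 s1 (r1.wf hs) i1 rfl
    exact ⟨s2, t1 + t2, .seq r1 r2, i2, by rwa [← add_assoc]⟩
  | ite e c1 c2 ih1 ih2 =>
    rintro s hs hi rfl; obtain ⟨ho, h1, h2⟩ := h; have hv := L.eval_compile hi hs e ho
    by_cases he : e.val (L.abs s) = 0
    · obtain ⟨s', t', r, i, q⟩ := ih2 _ _ _ (h2 he) s hs hi rfl; exact ⟨s', t', .iteFalse (hv.trans he) r, i, q⟩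
    · obtain ⟨s', t', r, i, q⟩ := ih1 _ _ _ (h1 he) s hs hi rfl; exact ⟨s', t', .iteTrue (by rwa [hv]) r, i, q⟩
  | loop e c ih => exact h

theorem Spec.mono {L : Layout m a} {c : ACmd} {Q Q' : AState → ℕ → Prop} {A : AState} {t : ℕ}
    (h : L.Spec c Q A t) (hQ : ∀ A t, Q A t → Q' A t) : L.Spec c Q' A t := by
  intro s hs hi hA; obtain ⟨s', t', hr, hi', hq⟩ := h s hs hi hA; exact ⟨s', t', hr, hi', hQ _ _ hq⟩

theorem wp_mono {L : Layout m a} {c : ACmd} {Q Q' : AState → ℕ → Prop} {A : AState} {t : ℕ}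
    (h : L.wp c Q A t) (hQ : ∀ A t, Q A t → Q' A t) : L.wp c Q' A t := by
  induction c generalizing Q Q' A t with
  | skip => exact hQ _ _ h
  | assign | set | read => exact ⟨h.1, hQ _ _ h.2⟩
  | write => exact ⟨h.1, fun hb => hQ _ _ (h.2 hb)⟩
  | seq c1 c2 ih1 ih2 => exact ih1 h fun A t h' => ih2 h' hQ
  | ite e c1 c2 ih1 ih2 => exact ⟨h.1, fun he => ih1 (h.2.1 he) hQ, fun he => ih2 (h.2.2 he) hQ⟩
  | loop e c => exact Spec.mono h hQ

/-- The rule for loops, with invariant `I` and variant `μ`. -/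
theorem wp_while {L : Layout m a} {e : AExpr} {c : ACmd} {Q : AState → ℕ → Prop}
    (I : AState → ℕ → Prop) (μ : AState → ℕ) {A : AState} {t : ℕ} (h0 : I A t)
    (hok : ∀ A t, I A t → e.ok L A)
    (hstep : ∀ A t, I A t → e.val A ≠ 0 → L.wp c (fun A' t' => I A' t' ∧ μ A' < μ A) A t)
    (hend : ∀ A t, I A t → e.val A = 0 → Q A t) : L.wp (.loop e c) Q A t := by
  change L.Spec _ _ _ _
  induction hμ : μ A using Nat.strong_induction_on generalizing A t with
  | _ k ih =>
    rintro s hs hi rfl; have hv := L.eval_compile hi hs e (hok _ _ h0)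
    by_cases he : e.val (L.abs s) = 0
    · exact ⟨s, 0, .whileFalse (hv.trans he), hi, hend _ _ h0 he⟩
    · obtain ⟨s1, t1, r1, i1, q1, q1'⟩ := L.wp_sound _ _ _ _ (hstep _ _ h0 he) s hs hi rfl
      obtain ⟨s2, t2, r2, i2, q2⟩ := ih _ (hμ ▸ q1') q1 rfl s1 (r1.wf hs) i1 rfl
      exact ⟨s2, t1 + t2, .whileTrue (by rwa [hv]) r1 r2, i2, by rwa [← add_assoc]⟩

end Layout

/-- `for x < e do c`, where `c` preserves `x` and the value of `e`. -/
def ACmd.for (x : Var) (e : AExpr) (c : ACmd) : ACmd :=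
  .seq (.assign x (.c 0)) (.loop (.op .lt (.r x) e) (.seq c (.assign x (.op .add (.r x) (.c 1)))))

/-- The bound `e` is evaluated anew in each round, so the invariant must keep its value at `N`. The
body has to establish the next invariant for the state in which the counter is already increased; `N
< 2 ^ w` keeps the counter from overflowing. -/
theorem Layout.wp_for {L : Layout m a} {x : Var} {e : AExpr} {c : ACmd} {Q : AState → ℕ → Prop}
    (N : ℕ) (I : ℕ → AState → ℕ → Prop) {A : AState} {t : ℕ} (hN : N < 2 ^ m.w)
    (h0 : I 0 (A.setReg x 0) t)
    (hok : ∀ j A t, j ≤ N → I j A t → A.reg x = j → e.ok L A ∧ e.val A = N)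
    (hstep : ∀ j A t, j < N → I j A t → A.reg x = j →
      L.wp c (fun A' t' => A'.reg x = j ∧ I (j + 1) (A'.setReg x (j + 1)) t') A t)
    (hend : ∀ A t, I N A t → A.reg x = N → Q A t) : L.wp (.for x e c) Q A t := by
  refine ⟨by simp [AExpr.ok], ?_⟩
  refine wp_while (fun A t => ∃ j, j ≤ N ∧ A.reg x = j ∧ I j A t) (fun A => N - A.reg x) ?_ ?_ ?_ ?_
  · exact ⟨0, Nat.zero_le _, by simp [AExpr.val], h0⟩
  · rintro A t ⟨j, hj, hx, hI⟩; exact ⟨trivial, (hok j A t hj hI hx).1, trivial⟩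
  · rintro A t ⟨j, hj, hx, hI⟩ he
    simp only [AExpr.val, Op.apply, (hok j A t hj hI hx).2, hx] at he; have hj' : j < N := by by_contra h; simp [h] at he
    change L.wp c _ A t; refine wp_mono (hstep j A t hj' hI hx) ?_; rintro A' t' ⟨hx', hI'⟩
    refine ⟨?_, ⟨j + 1, hj', ?_, ?_⟩, ?_⟩
    · simp only [AExpr.ok, AExpr.val, hx', true_and]; exact ⟨by norm_num, by omega⟩
    · simp [AExpr.val, Op.apply, hx']
    · simpa [AExpr.val, Op.apply, hx'] using hI'
    · simp [AExpr.val, Op.apply, hx', hx]; omega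
  · rintro A t ⟨j, hj, hx, hI⟩ he
    simp only [AExpr.val, Op.apply, (hok j A t hj hI hx).2, hx] at he
    have hj' : j = N := by by_contra h; simp [show j < N by omega] at he
    subst hj'; exact hend A t hI hx

/-! ### Two layouts of arrays in the RAM -/

/-- Two arrays of `B` words. Registers `3` and `4` hold `M` and `B`. -/
def rawBase (f : ℕ) : Expr := if f = 0 then .const 0 else .reg 4

def rawAccess : Access where
  getE f e := .mem (.op .add (rawBase f) e)
  setC f := .store (.op .add (rawBase f) (.reg 7)) (.reg 8)
  readC f := .readBlock (.reg 7) (rawBase f)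
  writeC f := .writeBlock (.reg 7) (rawBase f)

theorem rawBase_eval {m : Machine} {s : State} (hi : s.reg 4 = m.B) {f : ℕ} (hf : f < 2) :
    (rawBase f).eval m s = f * m.B := by
  have : f = 0 ∨ f = 1 := by omega
  rcases this with rfl | rfl <;> simp [rawBase, Expr.eval, hi]

theorem rawBase_add_eval {m : Machine} {s : State} (hi : s.reg 4 = m.B) {f : ℕ} (hf : f < 2)
    (hM : 2 * m.B ≤ m.M) (hMw : m.M < 2 ^ m.w) {e : Expr} (he : e.eval m s < m.B) :
    (Expr.op .add (rawBase f) e).eval m s = f * m.B + e.eval m s ∧ f * m.B + e.eval m s < m.M := by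
  have h : f * m.B + e.eval m s < m.M := by have : f * m.B ≤ 1 * m.B := Nat.mul_le_mul_right _ (by omega); omega
  refine ⟨?_, h⟩; simp only [Expr.eval, rawBase_eval hi hf, Op.apply]; exact mod_eq_of_lt (by omega)

/-- Input and output words use all `w` bits, so here entries are whole words and nothing is packed.
Two buffers, one for reading and one for writing, are all that `2 * B ≤ M` guarantees. -/
def rawLayout (m : Machine) (hw : 64 ≤ 2 ^ m.w) (hM : 2 * m.B ≤ m.M) (hMw : m.M < 2 ^ m.w) : Layout m rawAccess where
  narr := 2
  cap := m.B
  bound := 2 ^ m.w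
  blk := m.B
  Inv r := r 3 = m.M ∧ r 4 = m.B
  arr ram f j := ram (f * m.B + j)
  width := hw
  bound_le := le_rfl
  blk_le := le_rfl
  inv_congr r r' h hr := by rwa [← h 3 (by norm_num), ← h 4 (by norm_num)]
  arr_lt ram f j h _ _ := h _
  get_eval s f e hi hs hf he := by
    obtain ⟨h1, h2⟩ := rawBase_add_eval hi.2 hf hM hMw he; simp only [rawAccess]; rw [Expr.eval, h1, if_pos h2]
  set_run s f hi hs hf h7 h8 := by
    obtain ⟨h1, h2⟩ := rawBase_add_eval (e := .reg 7) hi.2 hf hM hMw h7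
    refine ⟨_, .store s _ _ (by rw [h1]; exact h2), fun _ _ => rfl, rfl, fun f' j' hf' hj' => ?_⟩; rw [h1]
    simp only [Function.update_apply, Expr.eval]
    have : f' * m.B + j' = f * m.B + s.reg 7 ↔ f' = f ∧ j' = s.reg 7 := by
      have h01 : ∀ g < 2, g = 0 ∨ g = 1 := by omega
      rcases h01 f hf with rfl | rfl <;> rcases h01 f' hf' with rfl | rfl <;> omega
    simp [this]
  read_run s f hi hs hf h8 _ := by
    -- A block fills a whole array, so the only admissible offset is 0.
    have h8' : s.reg 8 = 0 := by omega
    have hb := rawBase_eval hi.2 hf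
    have hfB : f * m.B ≤ 1 * m.B := Nat.mul_le_mul_right _ (by omega)
    refine ⟨_, .readBlock s _ _ (by rw [hb]; omega), fun _ _ => rfl, rfl, fun f' j' hf' hj' => ?_⟩; rw [hb]
    simp only [copyBlock, Expr.eval, h8']; have h01 : ∀ g < 2, g = 0 ∨ g = 1 := by omega
    have : (f * m.B ≤ f' * m.B + j' ∧ f' * m.B + j' < f * m.B + m.B) ↔ (f' = f ∧ 0 ≤ j' ∧ j' < 0 + m.B) := by
      rcases h01 f hf with rfl | rfl <;> rcases h01 f' hf' with rfl | rfl <;> omega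
    simp only [this]; split_ifs with h
    · rw [h.1]; congr 1; omega
    · rfl
  write_run s f hi hs hf h8 := by
    have hb := rawBase_eval hi.2 hf
    have hfB : f * m.B ≤ 1 * m.B := Nat.mul_le_mul_right _ (by omega)
    refine ⟨_, .writeBlock s _ _ (by rw [hb]; omega), fun _ _ => rfl, fun _ _ _ _ => rfl, ?_, ?_⟩
    · intro o ho; simp only [copyBlock, Expr.eval, hb]; rw [if_pos (by omega)]; congr 1; omega
    · intro i h; refine if_neg ?_; simp only [Expr.eval]; omega

/-! ### Words as vectors of fields in base `V`. -/

/-- The value of a word after field number `e` is replaced by `v`. -/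
def setField (V e x v : ℕ) : ℕ := x - x / V ^ e % V * V ^ e + v * V ^ e

/-- Both sides split the word into the fields above `e`, field `e`, and the fields below; this form
makes quotients and remainders by powers of `V` readable. -/
theorem setField_eq (V e x v : ℕ) :
    setField V e x v = x / V ^ (e + 1) * V ^ (e + 1) + (v * V ^ e + x % V ^ e) := by
  have h1 := div_add_mod x (V ^ e)
  have h2 := div_add_mod (x / V ^ e) V
  have h3 : x / V ^ (e + 1) = x / V ^ e / V := by rw [pow_succ, Nat.div_div_eq_div_mul]
  rw [h3]
  set y := x / V ^ e
  have h4 : x = y / V * V ^ (e + 1) + y % V * V ^ e + x % V ^ e := by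
    conv_lhs => rw [← h1, ← h2]
    ring
  have : x - y % V * V ^ e = y / V * V ^ (e + 1) + x % V ^ e := by
    have key : ∀ p q l : ℕ, x = p + q + l → x - q = p + l := fun p q l h => by omega
    exact key _ _ _ h4
  rw [setField, this]
  ring

theorem setField_low {V : ℕ} (hV : 0 < V) (e x : ℕ) {v : ℕ} (hv : v < V) : v * V ^ e + x % V ^ e < V ^ (e + 1) := by
  have : x % V ^ e < V ^ e := mod_lt _ (by positivity)
  calc v * V ^ e + x % V ^ e < v * V ^ e + V ^ e := by omega
    _ = (v + 1) * V ^ e := by ring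
    _ ≤ V * V ^ e := Nat.mul_le_mul_right _ hv
    _ = V ^ (e + 1) := by ring

/-- Fields below `e` depend only on the residue modulo `V ^ e`, fields above `e` only on the
quotient by `V ^ (e + 1)`, and the update changes neither. -/
theorem setField_field {V : ℕ} (hV : 0 < V) (e x : ℕ) {v : ℕ} (hv : v < V) (e' : ℕ) :
    setField V e x v / V ^ e' % V = if e' = e then v else x / V ^ e' % V := by
  have hlow := setField_low hV e x hv; have heq := setField_eq V e x v
  have hdiv : setField V e x v / V ^ (e + 1) = x / V ^ (e + 1) := by
    rw [heq, mul_comm, mul_add_div (by positivity), div_eq_of_lt hlow, add_zero]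
  split_ifs with h
  · subst h
    rw [← mod_mul_right_div_self, ← pow_succ, heq, mul_add_mod_self_right,
      mod_eq_of_lt hlow, mul_comm v, mul_add_div (by positivity),
      div_eq_of_lt (mod_lt _ (by positivity)), add_zero]
  · rcases lt_or_gt_of_ne h with h | h
    · rw [← mod_mul_right_div_self, ← mod_mul_right_div_self, ← pow_succ]; congr 1
      obtain ⟨r, hr⟩ : V ^ (e' + 1) ∣ V ^ e := pow_dvd_pow V h
      have : setField V e x v ≡ x [MOD V ^ e] := by
        rw [heq]; unfold ModEq
        rw [pow_succ', ← mul_assoc, ← add_assoc, ← add_mul, mul_add_mod_self_right, mod_mod]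
      exact this.of_dvd (pow_dvd_pow V h)
    · obtain ⟨r, rfl⟩ : ∃ r, e' = e + 1 + r := ⟨e' - (e + 1), by omega⟩
      rw [pow_add, ← Nat.div_div_eq_div_mul, ← Nat.div_div_eq_div_mul, hdiv]

/-- Divisibility rather than an inequality is needed: the quotient by `V ^ (e + 1)` is unchanged and
below `W / V ^ (e + 1)`, which must leave room for any value of the lower fields. This is why
`PackedOk` asks for `V ^ 16 ∣ 2 ^ w`. -/
theorem setField_lt {V W : ℕ} (hV : 0 < V) {e x v : ℕ} (hv : v < V) (hx : x < W)
    (hW : V ^ (e + 1) ∣ W) : setField V e x v < W := by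
  obtain ⟨r, rfl⟩ := hW; have hlow := setField_low hV e x hv; rw [setField_eq]
  have : x / V ^ (e + 1) < r := Nat.div_lt_of_lt_mul hx
  calc _ < x / V ^ (e + 1) * V ^ (e + 1) + V ^ (e + 1) := by omega
    _ = (x / V ^ (e + 1) + 1) * V ^ (e + 1) := by ring
    _ ≤ r * V ^ (e + 1) := Nat.mul_le_mul_right _ this
    _ = _ := mul_comm _ _

/-- `V ^ (2 * f)` for the number `V` in register `5`. -/
def powE : ℕ → Expr
  | 0 => .const 1
  | f + 1 => .op .mul (powE f) (.op .mul (.reg 5) (.reg 5))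

/-- The weight of the field that holds entry `e` of array `f`. -/
def fieldE (f : ℕ) (e : Expr) : Expr :=
  -- `1 + (e % 2) * (V - 1)` is `V ^ (e % 2)`, without a conditional.
  .op .mul (powE f) (.op .add (.const 1) (.op .mul (.op .mod e (.const 2)) (.op .sub (.reg 5) (.const 1))))

/-- The RAM cell that holds entry `e` of an array. -/
def cellE (e : Expr) : Expr := .op .add (.reg 4) (.op .div e (.const 2))

def packedGet (f : ℕ) (e : Expr) : Expr :=
  .op .mod (.op .div (.mem (cellE e)) (fieldE f e)) (.reg 5)

def packedSet (f : ℕ) (e v : Expr) : Cmd :=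
  .store (cellE e) (.op .add
    (.op .sub (.mem (cellE e)) (.op .mul (packedGet f e) (fieldE f e))) (.op .mul v (fieldE f e)))

def countLoop (c : Cmd) : Cmd :=
  .seq (.assign 9 (.const 0)) (.while (.op .lt (.reg 9) (.reg 6)) (.seq c (.assign 9 (.op .add (.reg 9) (.const 1)))))

/-- Eight arrays of `M` entries, which share the RAM cells from `B` on. Registers `5` and `6` hold
the bound on the entries and the number of words used per block. -/
def packedAccess : Access where
  getE := packedGet
  setC f := packedSet f (.reg 7) (.reg 8)
  readC f := .seq (.readBlock (.reg 7) (.const 0))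
    (countLoop (packedSet f (.op .add (.reg 8) (.reg 9)) (.mem (.reg 9))))
  writeC f := .seq (countLoop (.store (.reg 9) (packedGet f (.op .add (.reg 8) (.reg 9)))))
    (.writeBlock (.reg 7) (.const 0))

/-- The parameters of a packed layout: `V` is the bound, `b` the number of words per block. -/
structure PackedOk (m : Machine) (V b : ℕ) : Prop where
  width : 64 ≤ 2 ^ m.w
  two_B_le : 2 * m.B ≤ m.M
  M_lt : m.M < 2 ^ m.w
  two_le : 2 ≤ V
  dvd : V ^ 16 ∣ 2 ^ m.w
  b_le : b ≤ m.B
  b_pos : 0 < b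

structure PackedInv (m : Machine) (V b : ℕ) (r : ℕ → ℕ) : Prop where
  reg_B : r 4 = m.B
  reg_V : r 5 = V
  reg_b : r 6 = b

/-- Each cell from `B` on holds two consecutive entries of each of the eight arrays, hence sixteen
fields; the first `B` cells stay free for transfers. -/
def packedArr (m : Machine) (V : ℕ) (ram : ℕ → ℕ) (f j : ℕ) : ℕ :=
  ram (m.B + j / 2) / V ^ (2 * f + j % 2) % V

section Packed

variable {m : Machine} {V b : ℕ} (h : PackedOk m V b)
include h

theorem PackedOk.pow_lt {e : ℕ} (he : e < 16) : V ^ e < 2 ^ m.w :=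
  lt_of_lt_of_le (Nat.pow_lt_pow_right h.two_le he) (le_of_dvd (by positivity) h.dvd)

variable {s : State} (hi : PackedInv m V b s.reg)
include hi

theorem powE_eval {f : ℕ} (hf : f < 8) : (powE f).eval m s = V ^ (2 * f) := by
  induction f with
  | zero =>
    have := h.width; simp only [powE, Expr.eval]; exact mod_eq_of_lt (by omega)
  | succ f ih =>
    have h2 := h.pow_lt (e := 2) (by norm_num); have h3 := h.pow_lt (e := 2 * (f + 1)) (by omega)
    simp only [powE, Expr.eval, Op.apply, ih (by omega), hi.reg_V]
    rw [← sq, mod_eq_of_lt h2, ← pow_add, show 2 * f + 2 = 2 * (f + 1) by ring, mod_eq_of_lt h3]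

theorem fieldE_eval {f : ℕ} (hf : f < 8) (e : Expr) : (fieldE f e).eval m s = V ^ (2 * f + e.eval m s % 2) := by
  have hw := h.width; have hV := h.two_le; have h1 := h.pow_lt (e := 1) (by norm_num); rw [pow_one] at h1
  have h2 := h.pow_lt (e := 2 * f + e.eval m s % 2) (by omega)
  simp only [fieldE, Expr.eval, Op.apply, powE_eval h hi hf, hi.reg_V]
  rw [mod_eq_of_lt (show 1 < 2 ^ m.w by omega), mod_eq_of_lt (show 2 < 2 ^ m.w by omega),
    mod_eq_of_lt (show V - 1 < 2 ^ m.w by omega)]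
  rcases mod_two_eq_zero_or_one (e.eval m s) with h01 | h01
  · rw [h01] at h2 ⊢; simp only [zero_mod, zero_mul, add_zero] at h2 ⊢
    rw [mod_eq_of_lt (show 1 < 2 ^ m.w by omega), mul_one, mod_eq_of_lt h2]
  · rw [h01] at h2 ⊢
    rw [mod_eq_of_lt (show 1 < 2 ^ m.w by omega), one_mul,
      mod_eq_of_lt (show V - 1 < 2 ^ m.w by omega), show 1 + (V - 1) = V by omega,
      mod_eq_of_lt h1, ← pow_succ, mod_eq_of_lt h2]

/-- `M` entries take about `M / 2` cells, and `B ≤ M / 2`, so the arrays fit behind the transfer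
buffer. -/
theorem cellE_eval {e : Expr} (he : e.eval m s < m.M) :
    (cellE e).eval m s = m.B + e.eval m s / 2 ∧ m.B + e.eval m s / 2 < m.M := by
  have hw := h.width; have hM := h.M_lt; have h2 := h.two_B_le; have hlt : m.B + e.eval m s / 2 < m.M := by omega
  refine ⟨?_, hlt⟩; simp only [cellE, Expr.eval, Op.apply, hi.reg_B]
  rw [mod_eq_of_lt (show 2 < 2 ^ m.w by omega),
    mod_eq_of_lt (show e.eval m s / 2 < 2 ^ m.w by omega), mod_eq_of_lt (by omega)]

theorem packedGet_eval (hs : s.WF m) {f : ℕ} (hf : f < 8) {e : Expr} (he : e.eval m s < m.M) :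
    (packedGet f e).eval m s = packedArr m V s.ram f (e.eval m s) := by
  obtain ⟨h1, h2⟩ := cellE_eval h hi he; have hV := h.pow_lt (e := 1) (by norm_num); rw [pow_one] at hV
  have hV0 := h.two_le
  simp only [packedGet, Expr.eval, Op.apply, fieldE_eval h hi hf, h1, if_pos h2, hi.reg_V, packedArr]
  rw [mod_eq_of_lt (lt_of_le_of_lt (Nat.div_le_self _ _) (hs.ram _)), mod_eq_of_lt (lt_trans (mod_lt _ (by omega)) hV)]

theorem packedSet_run (hs : s.WF m) {f : ℕ} (hf : f < 8) {e v : Expr} (he : e.eval m s < m.M) (hv : v.eval m s < V) :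
    ∃ ram, Run m (packedSet f e v) s { s with ram := ram } 0 ∧ (∀ i < m.B, ram i = s.ram i) ∧
      ∀ f' j', packedArr m V ram f' j' = if f' = f ∧ j' = e.eval m s then v.eval m s else
        packedArr m V s.ram f' j' := by
  obtain ⟨h1, h2⟩ := cellE_eval h hi he; have hV0 := h.two_le
  have hr : s.ram (m.B + e.eval m s / 2) < 2 ^ m.w := hs.ram _
  have hdvd : V ^ (2 * f + e.eval m s % 2 + 1) ∣ 2 ^ m.w :=
    (pow_dvd_pow V (by omega)).trans h.dvd
  -- No intermediate result overflows: the old field with its weight is at most the word, and the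
  -- new field with its weight is at most the updated word, which `setField_lt` bounds.
  have hval : (Expr.op .add (.op .sub (.mem (cellE e)) (.op .mul (packedGet f e) (fieldE f e)))
      (.op .mul v (fieldE f e))).eval m s =
      setField V (2 * f + e.eval m s % 2) (s.ram (m.B + e.eval m s / 2)) (v.eval m s) := by
    have hlt := setField_lt (by omega : 0 < V) hv hr hdvd; rw [setField] at hlt ⊢
    have hc : (Expr.mem (cellE e)).eval m s = s.ram (m.B + e.eval m s / 2) := by simp only [Expr.eval, h1, if_pos h2]
    have hg := packedGet_eval h hi hs hf he; rw [packedArr] at hg; set x := s.ram (m.B + e.eval m s / 2)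
    have ho : x / V ^ (2 * f + e.eval m s % 2) % V * V ^ (2 * f + e.eval m s % 2) ≤ x :=
      (Nat.mul_le_mul_right _ (mod_le _ _)).trans (div_mul_le_self _ _)
    simp only [Expr.eval.eq_4, Op.apply, fieldE_eval h hi hf, hg, hc]
    rw [mod_eq_of_lt (show _ * _ < 2 ^ m.w from lt_of_le_of_lt ho hr), mod_eq_of_lt (show x - _ < 2 ^ m.w by omega),
      mod_eq_of_lt (show v.eval m s * _ < 2 ^ m.w by omega), mod_eq_of_lt hlt]
  refine ⟨_, .store s _ _ (by rw [h1]; exact h2), ?_, ?_⟩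
  · intro i hi; rw [h1, Function.update_of_ne (by omega)]
  · intro f' j'; rw [h1, hval]; simp only [packedArr, Function.update_apply]
    by_cases hj : m.B + j' / 2 = m.B + e.eval m s / 2
    · rw [if_pos hj, setField_field (by omega) _ _ hv, hj]
      have : 2 * f' + j' % 2 = 2 * f + e.eval m s % 2 ↔ f' = f ∧ j' = e.eval m s := by omega
      simp only [this]
    · rw [if_neg hj, if_neg]; rintro ⟨-, rfl⟩; exact hj rfl

end Packed

/-- A counting loop at machine level, needed because packed transfers are themselves small programs.
Its body makes no transfer and leaves the counter register alone. -/
theorem run_countLoop {m : Machine} {c : Cmd} {b : ℕ} (hw : 64 ≤ 2 ^ m.w) (hb : b < 2 ^ m.w)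
    (I : ℕ → State → Prop) {s : State} (h0 : I 0 { s with reg := Function.update s.reg 9 0 })
    (hI : ∀ i s, I i s → s.reg 9 = i ∧ s.reg 6 = b)
    (hstep : ∀ i s, i < b → I i s → ∃ s', Run m c s s' 0 ∧ s'.reg 9 = i ∧
      I (i + 1) { s' with reg := Function.update s'.reg 9 (i + 1) }) :
    ∃ s', Run m (countLoop c) s s' 0 ∧ I b s' := by
  have key : ∀ k i s, i + k = b → I i s → ∃ s', Run m (.while (.op .lt (.reg 9) (.reg 6))
      (.seq c (.assign 9 (.op .add (.reg 9) (.const 1))))) s s' 0 ∧ I b s' := by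
    intro k
    induction k with
    | zero =>
      intro i s hi h; obtain ⟨h9, h6⟩ := hI i s h; refine ⟨s, .whileFalse ?_, by rwa [← hi]⟩
      simp [Expr.eval, Op.apply, h9, h6, ← hi]
    | succ k ih =>
      intro i s hi h; obtain ⟨h9, h6⟩ := hI i s h; obtain ⟨s', hr, h9', h'⟩ := hstep i s (by omega) h
      obtain ⟨s'', hr', h''⟩ := ih (i + 1) _ (by omega) h'; refine ⟨s'', ?_, h''⟩
      have he : (Expr.op .lt (.reg 9) (.reg 6)).eval m s ≠ 0 := by
        simp only [Expr.eval, Op.apply, h9, h6]; rw [if_pos (by omega), mod_eq_of_lt (by omega)]; norm_num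
      have ha := Run.assign (m := m) s' 9 (.op .add (.reg 9) (.const 1))
      have hv : (Expr.op .add (.reg 9) (.const 1)).eval m s' = i + 1 := by
        simp only [Expr.eval, Op.apply, h9']
        rw [mod_eq_of_lt (show 1 < 2 ^ m.w by omega), mod_eq_of_lt (by omega)]
      rw [hv] at ha; exact .whileTrue he (.seq hr ha) hr'
  obtain ⟨s', hr, h'⟩ := key b 0 _ (by omega) h0; have ha := Run.assign (m := m) s 9 (.const 0)
  rw [show (Expr.const 0).eval m s = 0 by simp [Expr.eval]] at ha; exact ⟨s', .seq ha hr, h'⟩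

theorem PackedInv.congr {m : Machine} {V b : ℕ} {r r' : ℕ → ℕ} (h : PackedInv m V b r)
    (hr : ∀ x < 7, r x = r' x) : PackedInv m V b r' :=
  ⟨by rw [← hr 4 (by norm_num), h.reg_B], by rw [← hr 5 (by norm_num), h.reg_V], by rw [← hr 6 (by norm_num), h.reg_b]⟩

/-- A transfer goes through the cells below `B`: a block is read there and its first `b` words are
distributed into fields, or fields are collected there and the block is written. The copying is
internal, so a transfer still costs 1. Only words below `V` survive the distribution, hence the
bound required in `read_run`. -/
def packedLayout (m : Machine) (V b : ℕ) (h : PackedOk m V b) : Layout m packedAccess where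
  narr := 8
  cap := m.M
  bound := V
  blk := b
  Inv := PackedInv m V b
  arr := packedArr m V
  width := h.width
  bound_le := by simpa using (h.pow_lt (e := 1) (by norm_num)).le
  blk_le := h.b_le
  inv_congr r r' hr hi := hi.congr hr
  arr_lt ram f j _ _ _ := mod_lt _ (by have := h.two_le; omega)
  get_eval s f e hi hs hf he := packedGet_eval h hi hs hf he
  set_run s f hi hs hf h7 h8 := by
    obtain ⟨ram, hr, _, ha⟩ := packedSet_run h hi hs hf (e := .reg 7) (v := .reg 8) h7 h8
    exact ⟨_, hr, fun _ _ => rfl, rfl, fun f' j' _ _ => ha f' j'⟩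
  read_run s f hi hs hf h8 hd := by
    have hw := h.width; have hM := h.M_lt; have h2 := h.two_B_le; have hb := h.b_le
    have h0 : (Expr.const 0).eval m s = 0 := by simp [Expr.eval]
    have hrd := Run.readBlock (m := m) s (.reg 7) (.const 0) (by rw [h0]; omega); rw [h0] at hrd; have wf1 := hrd.wf hs
    revert hrd wf1
    generalize hs1 : ({ s with ram := _ } : State) = s1; intro hrd wf1; have hreg1 : s1.reg = s.reg := by rw [← hs1]
    have hdisk1 : s1.disk = s.disk := by rw [← hs1]
    have hlow1 : ∀ i < m.B, s1.ram i = s.disk (s.reg 7 * m.B + i) := by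
      intro i hi; rw [← hs1]; simp [copyBlock, Expr.eval, hi]
    have hhigh1 : ∀ f j, packedArr m V s1.ram f j = packedArr m V s.ram f j := by
      intro f j; rw [← hs1]; simp [packedArr, copyBlock]
    obtain ⟨s', hr, hreg, hdk, hinv, wf, hlow, ha⟩ := run_countLoop (m := m) (b := b)
      (c := packedSet f (.op .add (.reg 8) (.reg 9)) (.mem (.reg 9))) hw (by omega)
      (fun i s' => s'.reg = Function.update s.reg 9 i ∧ s'.disk = s.disk ∧ PackedInv m V b s'.reg ∧ s'.WF m ∧
        (∀ i < m.B, s'.ram i = s.disk (s.reg 7 * m.B + i)) ∧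
        ∀ f' j', packedArr m V s'.ram f' j' = if f' = f ∧ s.reg 8 ≤ j' ∧ j' < s.reg 8 + i then
          s.disk (s.reg 7 * m.B + (j' - s.reg 8)) else packedArr m V s.ram f' j')
      (s := s1) (by
        refine ⟨by rw [hreg1], hdisk1, hi.congr fun x hx => ?_, ⟨fun x => ?_, wf1.ram, wf1.disk⟩,
          hlow1, fun f' j' => ?_⟩
        · simp only [hreg1]; rw [Function.update_of_ne (by omega)]
        · simp only [Function.update_apply]
          split
          · omega
          · exact wf1.reg x
        · rw [if_neg (by omega)]; exact hhigh1 f' j')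
      (by
        rintro i s' ⟨hreg, -, hinv, -⟩
        exact ⟨by simp [hreg], hinv.reg_b⟩)
      (by
        rintro i s' hib ⟨hreg, hdk, hinv, wf, hlow, ha⟩; have r9 : s'.reg 9 = i := by simp [hreg]
        have r8 : s'.reg 8 = s.reg 8 := by simp [hreg]
        have he : (Expr.op .add (.reg 8) (.reg 9)).eval m s' = s.reg 8 + i := by
          simp only [Expr.eval, Op.apply, r8, r9]; exact mod_eq_of_lt (by omega)
        have hv : (Expr.mem (.reg 9)).eval m s' = s.disk (s.reg 7 * m.B + i) := by
          simp only [Expr.eval, r9, if_pos (show i < m.M by omega)]; exact hlow i (by omega)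
        obtain ⟨ram, hr, hl, hp⟩ := packedSet_run h hinv wf hf
          (e := .op .add (.reg 8) (.reg 9)) (v := .mem (.reg 9)) (by rw [he]; omega)
          (by rw [hv]; exact hd i hib)
        have wf' := hr.wf wf
        refine ⟨_, hr, r9, ?_, hdk, hinv.congr fun x hx => ?_, ⟨fun x => ?_, wf'.ram, wf'.disk⟩,
          fun k hk => ?_, fun f' j' => ?_⟩
        · simp only [hreg, Function.update_idem]
        · simp only; rw [Function.update_of_ne (by omega)]
        · simp only [Function.update_apply]
          split
          · omega
          · exact wf.reg x
        · simp only [hl k hk, hlow k hk]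
        · simp only [hp, he, hv, ha]
          by_cases hf' : f' = f
          · by_cases hj : j' = s.reg 8 + i
            · rw [if_pos ⟨hf', hj⟩, if_pos ⟨hf', by omega, by omega⟩]; congr 2; omega
            · rw [if_neg (by omega)]
              have : (f' = f ∧ s.reg 8 ≤ j' ∧ j' < s.reg 8 + i) ↔
                (f' = f ∧ s.reg 8 ≤ j' ∧ j' < s.reg 8 + (i + 1)) := by omega
              simp only [this]
          · simp [hf'])
    refine ⟨s', ?_, fun x hx => ?_, hdk, fun f' j' _ _ => ha f' j'⟩
    · exact .seq hrd hr
    · rw [hreg, Function.update_of_ne (by omega)]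
  write_run s f hi hs hf h8 := by
    have hw := h.width; have hM := h.M_lt; have h2 := h.two_B_le; have hb := h.b_le
    obtain ⟨s', hr, hreg, hdk, hinv, wf, hlow, ha⟩ := run_countLoop (m := m) (b := b)
      (c := .store (.reg 9) (packedGet f (.op .add (.reg 8) (.reg 9)))) hw (by omega)
      (fun i s' => s'.reg = Function.update s.reg 9 i ∧ s'.disk = s.disk ∧ PackedInv m V b s'.reg ∧ s'.WF m ∧
        (∀ k < i, s'.ram k = packedArr m V s.ram f (s.reg 8 + k)) ∧
        ∀ f' j', packedArr m V s'.ram f' j' = packedArr m V s.ram f' j')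
      (s := s) (by
        refine ⟨rfl, rfl, hi.congr fun x hx => ?_, ⟨fun x => ?_, hs.ram, hs.disk⟩,
          fun k hk => absurd hk (Nat.not_lt_zero _), fun _ _ => rfl⟩
        · simp only; rw [Function.update_of_ne (by omega)]
        · simp only [Function.update_apply]
          split
          · omega
          · exact hs.reg x)
      (by
        rintro i s' ⟨hreg, -, hinv, -⟩
        exact ⟨by simp [hreg], hinv.reg_b⟩)
      (by
        rintro i s' hib ⟨hreg, hdk, hinv, wf, hlow, ha⟩; have r9 : s'.reg 9 = i := by simp [hreg]
        have r8 : s'.reg 8 = s.reg 8 := by simp [hreg]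
        have he : (Expr.op .add (.reg 8) (.reg 9)).eval m s' = s.reg 8 + i := by
          simp only [Expr.eval, Op.apply, r8, r9]; exact mod_eq_of_lt (by omega)
        have hv := packedGet_eval h hinv wf hf (e := .op .add (.reg 8) (.reg 9)) (by rw [he]; omega)
        have h9 : (Expr.reg 9).eval m s' = i := r9
        have hr := Run.store (m := m) s' (.reg 9) (packedGet f (.op .add (.reg 8) (.reg 9))) (by rw [h9]; omega)
        rw [h9, hv, he, ha] at hr; have wf' := hr.wf wf
        refine ⟨_, hr, r9, ?_, hdk, hinv.congr fun x hx => ?_, ⟨fun x => ?_, wf'.ram, wf'.disk⟩,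
          fun k hk => ?_, fun f' j' => ?_⟩
        · simp only [hreg, Function.update_idem]
        · simp only; rw [Function.update_of_ne (by omega)]
        · simp only [Function.update_apply]
          split
          · omega
          · exact wf.reg x
        · simp only [Function.update_apply]; split_ifs with hki
          · rw [hki]
          · exact hlow k (by omega)
        · rw [← ha f' j']; simp only [packedArr]
          rw [Function.update_of_ne (by omega)])
    have h0 : (Expr.const 0).eval m s' = 0 := by simp [Expr.eval]
    have r7 : s'.reg 7 = s.reg 7 := by simp [hreg]
    have hwr := Run.writeBlock (m := m) s' (.reg 7) (.const 0) (by rw [h0]; omega)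
    refine ⟨_, .seq hr hwr, fun x hx => ?_, fun f' j' _ _ => ha f' j', fun o ho => ?_, fun i h => ?_⟩
    · simp only [hreg]; rw [Function.update_of_ne (by omega)]
    · simp only [copyBlock, Expr.eval, r7]; rw [if_pos (by omega), ← hlow o ho]; congr 1; simp
    · simp only [copyBlock, Expr.eval, r7, hdk]; rw [if_neg (by omega)]

open Layout AState

/-! ### Notation for the structured language -/

notation:max "§" x:max => AExpr.r x
infixr:30 " ;; " => ACmd.seq
infix:40 " ≔ " => ACmd.assign

instance : Add AExpr := ⟨.op .add⟩
instance : Sub AExpr := ⟨.op .sub⟩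
instance : Mul AExpr := ⟨.op .mul⟩
instance : Div AExpr := ⟨.op .div⟩
instance : Mod AExpr := ⟨.op .mod⟩
instance (n : ℕ) : OfNat AExpr n := ⟨.c n⟩

def AExpr.lt (e₁ e₂ : AExpr) : AExpr := .op .lt e₁ e₂
def AExpr.eq (e₁ e₂ : AExpr) : AExpr := .op .eq e₁ e₂

/-- One-armed conditional. -/
def ACmd.when (e : AExpr) (c : ACmd) : ACmd := .ite e c .skip

/-- The expression is nonzero. -/
def AExpr.Holds (A : AState) (e : AExpr) : Prop := e.val A ≠ 0

instance (A : AState) (e : AExpr) : Decidable (e.Holds A) := inferInstanceAs (Decidable (_ ≠ _))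

section Simp

variable {mc : Machine} {a : Access} (L : Layout mc a) (A : AState) (e e₁ e₂ : AExpr)

@[simp] theorem AExpr.val_ofNat (n : ℕ) :
    AExpr.val A (ofNat(n) : AExpr) = ofNat(n) := rfl
@[simp] theorem AExpr.val_r (x : Var) : AExpr.val A (.r x) = A.reg x := rfl
@[simp] theorem AExpr.val_get (f : ℕ) : AExpr.val A (.get f e) = A.arr f (e.val A) := rfl
@[simp] theorem AExpr.val_add : (e₁ + e₂).val A = e₁.val A + e₂.val A := rfl
@[simp] theorem AExpr.val_sub : (e₁ - e₂).val A = e₁.val A - e₂.val A := rfl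
@[simp] theorem AExpr.val_mul : (e₁ * e₂).val A = e₁.val A * e₂.val A := rfl
@[simp] theorem AExpr.val_div : (e₁ / e₂).val A = e₁.val A / e₂.val A := rfl
@[simp] theorem AExpr.val_mod : (e₁ % e₂).val A = e₁.val A % e₂.val A := rfl
@[simp] theorem AExpr.val_lt : (e₁.lt e₂).val A = if e₁.val A < e₂.val A then 1 else 0 := rfl
@[simp] theorem AExpr.val_eq : (e₁.eq e₂).val A = if e₁.val A = e₂.val A then 1 else 0 := rfl

@[simp] theorem AExpr.holds_lt : (e₁.lt e₂).Holds A ↔ e₁.val A < e₂.val A := by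
  simp only [AExpr.Holds, AExpr.val_lt]; split_ifs with h <;> simp [h]
@[simp] theorem AExpr.holds_eq : (e₁.eq e₂).Holds A ↔ e₁.val A = e₂.val A := by
  simp only [AExpr.Holds, AExpr.val_eq]; split_ifs with h <;> simp [h]
@[simp] theorem AExpr.ok_ofNat (n : ℕ) :
    AExpr.ok L A (ofNat(n) : AExpr) ↔ ofNat(n) < 64 := Iff.rfl
@[simp] theorem AExpr.ok_r (x : Var) : AExpr.ok L A (.r x) := trivial
@[simp] theorem AExpr.ok_get (f : ℕ) :
    AExpr.ok L A (.get f e) ↔ e.ok L A ∧ f < L.narr ∧ e.val A < L.cap := Iff.rfl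
@[simp] theorem AExpr.ok_add : (e₁ + e₂).ok L A ↔
    e₁.ok L A ∧ e₂.ok L A ∧ e₁.val A + e₂.val A < 2 ^ mc.w := Iff.rfl
@[simp] theorem AExpr.ok_mul : (e₁ * e₂).ok L A ↔
    e₁.ok L A ∧ e₂.ok L A ∧ e₁.val A * e₂.val A < 2 ^ mc.w := Iff.rfl
@[simp] theorem AExpr.ok_sub : (e₁ - e₂).ok L A ↔ e₁.ok L A ∧ e₂.ok L A :=
  ⟨fun h => ⟨h.1, h.2.1⟩, fun h => ⟨h.1, h.2, trivial⟩⟩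
@[simp] theorem AExpr.ok_div : (e₁ / e₂).ok L A ↔ e₁.ok L A ∧ e₂.ok L A :=
  ⟨fun h => ⟨h.1, h.2.1⟩, fun h => ⟨h.1, h.2, trivial⟩⟩
@[simp] theorem AExpr.ok_mod : (e₁ % e₂).ok L A ↔ e₁.ok L A ∧ e₂.ok L A :=
  ⟨fun h => ⟨h.1, h.2.1⟩, fun h => ⟨h.1, h.2, trivial⟩⟩
@[simp] theorem AExpr.ok_lt : (e₁.lt e₂).ok L A ↔ e₁.ok L A ∧ e₂.ok L A :=
  ⟨fun h => ⟨h.1, h.2.1⟩, fun h => ⟨h.1, h.2, trivial⟩⟩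
@[simp] theorem AExpr.ok_eq : (e₁.eq e₂).ok L A ↔ e₁.ok L A ∧ e₂.ok L A :=
  ⟨fun h => ⟨h.1, h.2.1⟩, fun h => ⟨h.1, h.2, trivial⟩⟩

variable (Q : AState → ℕ → Prop) (t : ℕ)

@[simp] theorem Layout.wp_assign (x : Var) :
    L.wp (.assign x e) Q A t ↔ e.ok L A ∧ Q (A.setReg x (e.val A)) t := Iff.rfl
@[simp] theorem Layout.wp_set (f : ℕ) (i : AExpr) :
    L.wp (.set f i e) Q A t ↔ (i.ok L A ∧ e.ok L A ∧ f < L.narr ∧ i.val A < L.cap ∧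
      e.val A < L.bound) ∧ Q (A.setArr f (i.val A) (e.val A)) t := Iff.rfl
@[simp] theorem Layout.wp_read (f : ℕ) :
    L.wp (.read e₁ f e₂) Q A t ↔ (e₁.ok L A ∧ e₂.ok L A ∧ f < L.narr ∧
      e₂.val A + L.blk ≤ L.cap ∧ ∀ o < L.blk, A.disk (e₁.val A) o < L.bound) ∧
      Q (A.readArr L.blk (e₁.val A) f (e₂.val A)) (t + 1) := Iff.rfl
@[simp] theorem Layout.wp_write (f : ℕ) :
    L.wp (.write e₁ f e₂) Q A t ↔ (e₁.ok L A ∧ e₂.ok L A ∧ f < L.narr ∧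
      e₂.val A + L.blk ≤ L.cap) ∧ ((∀ o < L.blk, A.arr f (e₂.val A + o) < L.bound) →
      Q (A.writeDisk L.blk (e₁.val A) f (e₂.val A)) (t + 1)) := Iff.rfl
@[simp] theorem Layout.wp_seq (c1 c2 : ACmd) :
    L.wp (.seq c1 c2) Q A t ↔ L.wp c1 (L.wp c2 Q) A t := Iff.rfl
@[simp] theorem Layout.wp_ite (c1 c2 : ACmd) :
    L.wp (.ite e c1 c2) Q A t ↔ e.ok L A ∧ (e.Holds A → L.wp c1 Q A t) ∧
      (¬ e.Holds A → L.wp c2 Q A t) := by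
  simp only [AExpr.Holds, not_not]; exact Iff.rfl
@[simp] theorem Layout.wp_when (c : ACmd) :
    L.wp (.when e c) Q A t ↔ e.ok L A ∧ (e.Holds A → L.wp c Q A t) ∧
      (¬ e.Holds A → Q A t) := by
  simp only [AExpr.Holds, not_not]; exact Iff.rfl
theorem Layout.wp_when_assign (x : Var) :
    L.wp (.when e (x ≔ e₁)) Q A t ↔ e.ok L A ∧ (e.Holds A → e₁.ok L A) ∧
      Q (A.setReg x (if e.Holds A then e₁.val A else A.reg x)) t := by
  rw [wp_when, wp_assign]
  by_cases h : e.Holds A <;> simp [h, setReg_self]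

end Simp

/-! ### Parameters and frames -/

/-- The variables that are constant after the initialization. -/
def Var.isPar : Var → Bool
  | .n | .sg | .w | .M | .B | .d | .k | .D | .b | .m | .G | .cu | .U | .pad | .inf | .V => true
  | _ => false

/-- The parameters have the values given by `P`. -/
def AState.Has (A : AState) (P : Var → ℕ) : Prop := ∀ x : Var, x.isPar → A.reg x = P x

/-- `A'` agrees with `A` except for some variables and arrays. -/
structure AState.Frame (A' A : AState) (xs : List Var) (fs : List ℕ) : Prop where
  reg : ∀ x, x ∉ xs → A'.reg x = A.reg x
  arr : ∀ f, f ∉ fs → A'.arr f = A.arr f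

namespace AState

theorem Has.frame {A A' : AState} {P : Var → ℕ} {xs : List Var} {fs : List ℕ} (h : A.Has P)
    (hf : A'.Frame A xs fs) (hx : ∀ x ∈ xs, x.isPar = false) : A'.Has P := by
  intro x hp; rw [hf.reg x fun hm => ?_, h x hp]; simp [hx x hm] at hp

theorem Has.setReg {A : AState} {P : Var → ℕ} (h : A.Has P) {x : Var} {v : ℕ}
    (hx : x.isPar = false) : (A.setReg x v).Has P := by
  intro y hy; rw [setReg_reg, if_neg, h y hy]; rintro rfl; simp [hx] at hy

theorem Frame.refl (A : AState) (xs : List Var) (fs : List ℕ) : A.Frame A xs fs :=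
  ⟨fun _ _ => rfl, fun _ _ => rfl⟩

theorem Frame.trans {A A' A'' : AState} {xs : List Var} {fs : List ℕ} (h : A''.Frame A' xs fs)
    (h' : A'.Frame A xs fs) : A''.Frame A xs fs :=
  ⟨fun x hx => (h.reg x hx).trans (h'.reg x hx), fun f hf => (h.arr f hf).trans (h'.arr f hf)⟩

theorem Frame.mono {A A' : AState} {xs ys : List Var} {fs gs : List ℕ} (h : A'.Frame A xs fs)
    (hx : xs ⊆ ys) (hf : fs ⊆ gs) : A'.Frame A ys gs :=
  ⟨fun x hx' => h.reg x fun h' => hx' (hx h'), fun f hf' => h.arr f fun h' => hf' (hf h')⟩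

theorem Frame.setReg {A A' : AState} {xs : List Var} {fs : List ℕ} (h : A'.Frame A xs fs)
    {x : Var} {v : ℕ} (hx : x ∈ xs) : (A'.setReg x v).Frame A xs fs := by
  refine ⟨fun y hy => ?_, h.arr⟩
  rw [setReg_reg, if_neg (by rintro rfl; exact hy hx), h.reg y hy]

theorem Frame.setArr {A A' : AState} {xs : List Var} {fs : List ℕ} (h : A'.Frame A xs fs)
    {f i v : ℕ} (hf : f ∈ fs) : (A'.setArr f i v).Frame A xs fs := by
  refine ⟨h.reg, fun g hg => ?_⟩; rw [← h.arr g hg]; ext j; rw [setArr_arr, if_neg]; rintro ⟨rfl, -⟩; exact hg hf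

theorem Frame.readArr {A A' : AState} {xs : List Var} {fs : List ℕ} (h : A'.Frame A xs fs)
    {b q f j : ℕ} (hf : f ∈ fs) : (A'.readArr b q f j).Frame A xs fs := by
  refine ⟨h.reg, fun g hg => ?_⟩; rw [← h.arr g hg]; ext j; rw [readArr_arr, if_neg]; rintro ⟨rfl, -⟩; exact hg hf

theorem Frame.writeDisk {A A' : AState} {xs : List Var} {fs : List ℕ} (h : A'.Frame A xs fs)
    {b q f j : ℕ} : (A'.writeDisk b q f j).Frame A xs fs := ⟨h.reg, h.arr⟩

@[simp] theorem frame_refl (A : AState) (xs : List Var) (fs : List ℕ) : A.Frame A xs fs :=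
  .refl A xs fs

@[simp] theorem frame_setReg {A A' : AState} {xs : List Var} {fs : List ℕ} {x : Var} {v : ℕ}
    (hx : x ∈ xs) : (A'.setReg x v).Frame A xs fs ↔ A'.Frame A xs fs := by
  refine ⟨fun h => ⟨fun y hy => ?_, h.arr⟩, fun h => h.setReg hx⟩
  rw [← h.reg y hy, setReg_reg, if_neg (by rintro rfl; exact hy hx)]

@[simp] theorem frame_setArr {A A' : AState} {xs : List Var} {fs : List ℕ} {f i v : ℕ}
    (hf : f ∈ fs) : (A'.setArr f i v).Frame A xs fs ↔ A'.Frame A xs fs := by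
  refine ⟨fun h => ⟨h.reg, fun g hg => ?_⟩, fun h => h.setArr hf⟩
  rw [← h.arr g hg]
  ext j
  rw [setArr_arr, if_neg]
  rintro ⟨rfl, -⟩
  exact hg hf

@[simp] theorem frame_readArr {A A' : AState} {xs : List Var} {fs : List ℕ} {b q f j : ℕ}
    (hf : f ∈ fs) : (A'.readArr b q f j).Frame A xs fs ↔ A'.Frame A xs fs := by
  refine ⟨fun h => ⟨h.reg, fun g hg => ?_⟩, fun h => h.readArr hf⟩
  rw [← h.arr g hg]
  ext j
  rw [readArr_arr, if_neg]
  rintro ⟨rfl, -⟩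
  exact hg hf

@[simp] theorem frame_writeDisk {A A' : AState} {xs : List Var} {fs : List ℕ} {b q f j : ℕ} :
    (A'.writeDisk b q f j).Frame A xs fs ↔ A'.Frame A xs fs :=
  ⟨fun h => ⟨h.reg, h.arr⟩, fun h => h.writeDisk⟩

end AState

theorem Layout.lt_width {mc : Machine} {a : Access} (L : Layout mc a) {x : ℕ} (hx : x < L.bound) :
    x < 2 ^ mc.w := lt_of_lt_of_le hx L.bound_le

/-- Bounds on the parameters. -/
structure Env {mc : Machine} {a : Access} (L : Layout mc a) (P : Var → ℕ) : Prop where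
  narr : 8 ≤ L.narr
  blk : L.blk = P .b
  b_pos : 0 < P .b
  two_le_m : 2 ≤ P .m
  cap : P .m * P .b ≤ L.cap
  cap_lt : L.cap < 2 ^ mc.w
  V_eq : P .V = L.bound
  inf_eq : P .inf = P .pad + 1
  inf_lt : P .inf < L.bound
  -- Levels are bounded only crudely, by `l ≤ G`; this makes all addresses up to `(8 + 2 * l) * G`
  -- representable.
  G_mul : P .G * (2 * P .G + 8) < L.bound
  Gb : P .G * P .b < L.bound

namespace Env

variable {mc : Machine} {a : Access} {L : Layout mc a} {P : Var → ℕ} (h : Env L P)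

include h

theorem m_le_cap : P .m ≤ L.cap :=
  (Nat.le_mul_of_pos_right _ h.b_pos).trans h.cap

theorem b_le_cap : P .b ≤ L.cap :=
  (Nat.le_mul_of_pos_left _ (by have := h.two_le_m; omega)).trans h.cap

theorem mul_add_lt {j o : ℕ} (hj : j < P .m) (ho : o < P .b) : j * P .b + o < L.cap := by
  have : (j + 1) * P .b ≤ P .m * P .b := Nat.mul_le_mul_right _ hj; have := h.cap; rw [add_mul] at *; omega

end Env

/-! ### Merging sorted runs -/

/-- Find the least head `best` of the runs; it belongs to run `bj`. -/
def minLoop : ACmd :=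
  .best ≔ §.inf ;; .bj ≔ 0 ;;
  .for .j §.m (.when ((AExpr.get 4 §.j).lt (§.pw * §.b)) (.when ((AExpr.get 3 (§.j * §.b + .get 4 §.j % §.b)).lt §.best)
      (.best ≔ .get 3 (§.j * §.b + .get 4 §.j % §.b) ;; .bj ≔ §.j)))

variable {mc : Machine} {a a' : Access} {L : Layout mc a} {L' : Layout mc a'} {P : Var → ℕ} {A A' : AState}
  {Q : AState → ℕ → Prop} {S : Multiset ℕ} {xs : List Var} {fs : List ℕ} {X wd : ℕ → ℕ}
  {x y v th th' p b i j k l lo len sg c f q base s n o g pw m u d N t : ℕ}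

/-- `inf` exceeds every entry, so it serves as the initial minimum: since some run is not exhausted,
the final value is smaller than `inf` and therefore the head of run `bj`. -/
theorem minLoop_wp (hE : Env L P) (hP : A.Has P) (hpw : A.reg .pw = pw) (hlen : pw * P .b < 2 ^ mc.w)
    (hlt : ∀ j < P .m, A.arr 4 j < pw * P .b → A.arr 3 (j * P .b + A.arr 4 j % P .b) < P .inf)
    (hex : ∃ j < P .m, A.arr 4 j < pw * P .b)
    (hQ : ∀ A', A'.Frame A [.j, .best, .bj] [] → A'.disk = A.disk → A'.reg .bj < P .m →
      A.arr 4 (A'.reg .bj) < pw * P .b →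
      A'.reg .best = A.arr 3 (A'.reg .bj * P .b + A.arr 4 (A'.reg .bj) % P .b) →
      (∀ j < P .m, A.arr 4 j < pw * P .b →
        A'.reg .best ≤ A.arr 3 (j * P .b + A.arr 4 j % P .b)) → Q A' t) :
    L.wp minLoop Q A t := by
  have hn := hE.narr
  have hb := hE.b_pos
  have hcap := hE.cap_lt
  have hm := hE.m_le_cap
  obtain ⟨I, hI⟩ : ∃ I : ℕ → AState → ℕ → Prop, ∀ j A' t', I j A' t' ↔ (t' = t ∧
    A'.Frame A [.j, .best, .bj] [] ∧ A'.disk = A.disk ∧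
    (A'.reg .best = P .inf ∨ (A'.reg .bj < P .m ∧ A.arr 4 (A'.reg .bj) < pw * P .b ∧
      A'.reg .best = A.arr 3 (A'.reg .bj * P .b + A.arr 4 (A'.reg .bj) % P .b))) ∧
    ∀ i < j, A.arr 4 i < pw * P .b → A'.reg .best ≤ A.arr 3 (i * P .b + A.arr 4 i % P .b)) :=
    ⟨_, fun _ _ _ => Iff.rfl⟩
  simp only [minLoop, wp_seq, wp_assign, AExpr.ok_r, true_and]
  refine ⟨by simp, wp_for (P .m) I (by omega) ?_ ?_ ?_ ?_⟩
  · rw [hI]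
    refine ⟨rfl, (((Frame.refl A _ _).setReg ?_).setReg ?_).setReg ?_, rfl, .inl ?_,
      fun i hi => absurd hi (Nat.not_lt_zero _)⟩ <;> simp [hP .inf rfl]
  · intro j A' t' hj h hx
    rw [hI] at h
    simp [(hP.frame h.2.1 (by decide)) .m rfl]
  · intro j A' t' hj h hx
    obtain ⟨rfl, hf, hd, hbest, hmin⟩ := (hI _ _ _).1 h
    have hP' := hP.frame hf (by decide)
    have e4 : A'.arr 4 = A.arr 4 := hf.arr 4 (by simp)
    have e3 : A'.arr 3 = A.arr 3 := hf.arr 3 (by simp)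
    have epw : A'.reg .pw = pw := by rw [hf.reg _ (by simp), hpw]
    have hc := hE.mul_add_lt hj (mod_lt (A.arr 4 j) hb)
    simp [hx, epw, hP' .b rfl, e4, e3, hI, hf, hd]
    have hsplit : ∀ i ≤ j, i < j ∨ i = j := fun i hi => lt_or_eq_of_le hi
    refine ⟨by omega, fun h1 => ⟨by omega, fun h2 => ⟨by omega, .inr ⟨hj, h1⟩, fun i hi h => ?_⟩,
      fun h2 => ⟨hbest, fun i hi h => ?_⟩⟩, fun h1 => ⟨hbest, fun i hi h => ?_⟩⟩
    all_goals
      rcases hsplit i hi with hi | rfl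
      · have := hmin i hi h; omega
      · omega
  · intro A' t' h hx
    obtain ⟨rfl, hf, hd, hbest, hmin⟩ := (hI _ _ _).1 h
    obtain ⟨j, hj, hjlt⟩ := hex
    have hne : A'.reg .best ≠ P .inf := ((hmin j hj hjlt).trans_lt (hlt j hj hjlt)).ne
    obtain ⟨h1, h2, h3⟩ := hbest.resolve_left hne
    exact hQ A' hf hd h1 h2 h3 hmin

/-! ### Sequences of words on the disk -/

/-- Word `i` of the sequence that starts at block `base`, with `b` words per block. -/
def AState.entry (A : AState) (b base i : ℕ) : ℕ := A.disk (base + i / b) (i % b)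

/-- The multiset of the first `n` words of the sequence that starts at block `base`. -/
def AState.content (A : AState) (b base n : ℕ) : Multiset ℕ :=
  (Multiset.range n).map (A.entry b base)

/-- The first `n` words of the sequence that starts at block `base` are sorted. -/
def AState.Sorted (A : AState) (b base n : ℕ) : Prop :=
  ∀ i k, i ≤ k → k < n → A.entry b base i ≤ A.entry b base k

theorem AState.entry_add_mul (A : AState) (hb : 0 < b) (base j pw i : ℕ) :
    A.entry b base (j * (pw * b) + i) = A.entry b (base + j * pw) i := by
  rw [entry, entry, ← mul_assoc, Nat.add_comm (j * pw * b), add_mul_div_right _ _ hb, add_mul_mod_self_right]; congr 1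
  ring

theorem AState.entry_block (A : AState) (base : ℕ) (ho : o < b) : A.entry b base (q * b + o) = A.disk (base + q) o := by
  rw [entry, Nat.add_comm (q * b), add_mul_div_right _ _ (by omega), div_eq_of_lt ho,
    zero_add, add_mul_mod_self_right, mod_eq_of_lt ho]

theorem mul_add_lt_mul (hq : q < n) (ho : o < b) : q * b + o < n * b :=
  calc q * b + o < (q + 1) * b := by rw [add_mul]; omega
    _ ≤ n * b := Nat.mul_le_mul_right _ hq

theorem AState.entry_congr (hb : 0 < b)
    (h : ∀ q < n, ∀ o < b, A'.disk (base + q) o = A.disk (base + q) o) (hi : i < n * b) :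
    A'.entry b base i = A.entry b base i :=
  h _ (Nat.div_lt_of_lt_mul (by rwa [mul_comm])) _ (mod_lt _ hb)

theorem AState.content_congr (hb : 0 < b) (h : ∀ q < n, ∀ o < b, A'.disk (base + q) o = A.disk (base + q) o) :
    A'.content b base (n * b) = A.content b base (n * b) :=
  Multiset.map_congr rfl fun _ hi => entry_congr hb h (Multiset.mem_range.1 hi)

theorem AState.Sorted.congr (hb : 0 < b) (hs : A.Sorted b base (n * b))
    (h : ∀ q < n, ∀ o < b, A'.disk (base + q) o = A.disk (base + q) o) :
    A'.Sorted b base (n * b) := by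
  intro i k hik hk
  rw [entry_congr hb h (lt_of_le_of_lt hik hk), entry_congr hb h hk]; exact hs i k hik hk

theorem map_range_mul (f : ℕ → ℕ) (m len : ℕ) : (Multiset.range (m * len)).map f =
    ∑ j ∈ range m, (Multiset.range len).map fun i => f (j * len + i) := by
  induction m with
  | zero => simp
  | succ m ih =>
    rw [sum_range_succ, ← ih, add_mul, one_mul, Multiset.range_add, Multiset.map_add, Multiset.map_map]; rfl

/-- The invariant of merging `m` sorted runs of length `len`: the first `idx j` entries of run `j`
have been output. -/
structure MergeInv (m len o : ℕ) (r : ℕ → ℕ → ℕ) (idx out : ℕ → ℕ) : Prop where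
  le : ∀ j < m, idx j ≤ len
  sum : ∑ j ∈ range m, idx j = o
  sorted : ∀ i k, i ≤ k → k < o → out i ≤ out k
  head : ∀ i < o, ∀ j < m, idx j < len → out i ≤ r j (idx j)
  mset : (Multiset.range o).map out =
    ∑ j ∈ range m, (Multiset.range (idx j)).map (r j)

namespace MergeInv

variable {r : ℕ → ℕ → ℕ} {idx out : ℕ → ℕ}

theorem zero (h : ∀ j < m, idx j = 0) : MergeInv m len 0 r idx out where
  le j hj := by simp [h j hj]
  sum := sum_eq_zero fun j hj => h j (mem_range.1 hj)
  sorted i k _ hk := absurd hk (Nat.not_lt_zero _)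
  head i hi := absurd hi (Nat.not_lt_zero _)
  mset := by rw [sum_eq_zero fun j hj => by simp [h j (mem_range.1 hj)]]; simp

theorem exists_lt (h : MergeInv m len o r idx out) (ho : o < m * len) : ∃ j < m, idx j < len := by
  by_contra! hc
  have : ∑ j ∈ range m, idx j = ∑ j ∈ range m, len :=
    sum_congr rfl fun j hj =>
      le_antisymm (h.le j (mem_range.1 hj)) (hc j (mem_range.1 hj))
  rw [h.sum] at this; simp at this; omega

theorem eq_len (h : MergeInv m len (m * len) r idx out) (hj : j < m) : idx j = len := by
  by_contra hne
  have : ∑ j ∈ range m, idx j < ∑ j ∈ range m, len :=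
    sum_lt_sum (fun i hi => h.le i (mem_range.1 hi)) ⟨j, mem_range.2 hj, lt_of_le_of_ne (h.le j hj) hne⟩
  rw [h.sum] at this; simp at this

/-- Stated for any commutative monoid: it is applied to counts, to costs, to multisets of entries,
and to digit sums. -/
theorem sum_update {M : Type*} [AddCommMonoid M] (hk : k < m) (f g : ℕ → M) (c : M)
    (hne : ∀ j, j ≠ k → g j = f j) (he : g k = f k + c) :
    ∑ j ∈ range m, g j = (∑ j ∈ range m, f j) + c := by
  rw [← add_sum_erase _ _ (mem_range.2 hk), ← add_sum_erase (range m) f (mem_range.2 hk), he,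
    sum_congr rfl fun j hj => hne j (ne_of_mem_erase hj)]
  rw [add_right_comm]

/-- Order is preserved because everything output so far is below all heads, in particular below the
one now output. The clause `head` survives since the chosen head is minimal and the run it comes
from is sorted. -/
theorem step (h : MergeInv m len o r idx out) (hr : ∀ j < m, ∀ i k, i ≤ k → k < len → r j i ≤ r j k) (hk : k < m)
    (hlt : idx k < len) (hmin : ∀ j < m, idx j < len → r k (idx k) ≤ r j (idx j)) {idx' : ℕ → ℕ}
    (hidx : ∀ j, idx' j = if j = k then idx k + 1 else idx j) {out' : ℕ → ℕ}
    (hout : ∀ i ≤ o, out' i = if i = o then r k (idx k) else out i) :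
    MergeInv m len (o + 1) r idx' out' where
  le j hj := by
    rw [hidx]; split_ifs with hjk
    · exact hlt
    · exact h.le j hj
  sum := by rw [sum_update hk idx idx' 1 (fun j hj => by rw [hidx, if_neg hj]) (by rw [hidx, if_pos rfl]), h.sum]
  sorted i k' hik hk' := by
    rw [hout i (by omega), hout k' (by omega)]; split_ifs with h1 h2 h2
    · exact le_rfl
    · omega
    · exact h.head i (by omega) k hk hlt
    · exact h.sorted i k' hik (by omega)
  head i hi j hj := by
    rw [hidx, hout i (by omega)]; intro hj'; split_ifs with h1 h2 h2
    · subst h2; rw [if_pos rfl] at hj'; exact hr j hj _ _ (by omega) hj'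
    · rw [if_neg h2] at hj'; exact hmin j hj hj'
    · subst h2; rw [if_pos rfl] at hj'
      exact (h.head i (by omega) j hj hlt).trans (hr j hj _ _ (by omega) hj')
    · rw [if_neg h2] at hj'; exact h.head i (by omega) j hj hj'
  mset := by
    rw [sum_update hk (fun j => (Multiset.range (idx j)).map (r j)) _ {r k (idx k)}
      (fun j hj => by rw [hidx, if_neg hj])
      (by rw [hidx, if_pos rfl, Multiset.range_succ, Multiset.map_cons, add_comm]; rfl),
      ← h.mset, Multiset.range_succ, Multiset.map_cons, hout o le_rfl, if_pos rfl, add_comm]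
    rw [Multiset.map_congr rfl fun i hi => by
      have := Multiset.mem_range.1 hi
      rw [hout i (by omega), if_neg (by omega)]]
    rfl

end MergeInv

/-! ### The merge program with its block buffers. -/

/-- Load the next block of run `bj`, of which `z1` words are consumed. -/
def mergeLoad : ACmd :=
  .when ((§.z1).lt (§.pw * §.b)) (.when ((§.z1 % §.b).eq 0)
    (.read (§.sb + §.s1 + §.bj * §.pw + §.z1 / §.b) 3 (§.bj * §.b)))

/-- Write the output block when it is full. -/
def mergeFlush : ACmd :=
  .when (((§.o + 1) % §.b).eq 0) (.write (§.sb + 2 * §.G + §.s1 + §.o / §.b) 5 0)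

/-- One output of the merging of `m` runs of `pw` blocks. -/
def mergeStep : ACmd :=
  minLoop ;;
  .set 5 (§.o % §.b) §.best ;;
  .when ((§.best).lt §.th) (.ptr ≔ §.ptr + 1) ;;
  .z1 ≔ .get 4 §.bj + 1 ;;
  .set 4 §.bj §.z1 ;;
  mergeLoad ;;
  mergeFlush

/-- Merge `m` sorted runs of `pw` blocks from block `sb + s1` on to block `sb + 2 * G + s1`. The
number of entries that are less than `th` goes to block `sb + 3 * G + s1`. -/
def merge : ACmd :=
  .for .j §.m (.read (§.sb + §.s1 + §.j * §.pw) 3 (§.j * §.b) ;; .set 4 §.j 0) ;;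
  .ptr ≔ 0 ;;
  .for .o (§.m * §.pw * §.b) mergeStep ;;
  .set 5 0 §.ptr ;;
  .write (§.sb + 3 * §.G + §.s1) 5 0

/-- The state of the buffers while runs are merged. -/
structure MergeState (P : Var → ℕ) (A₀ : AState) (src dst pw o : ℕ) (out : ℕ → ℕ) (A : AState) :
    Prop where
  inv : MergeInv (P .m) (pw * P .b) o (fun j => A₀.entry (P .b) (src + j * pw)) (A.arr 4) out
  buf : ∀ j < P .m, A.arr 4 j < pw * P .b → ∀ o' < P .b,
    A.arr 3 (j * P .b + o') = A₀.disk (src + j * pw + A.arr 4 j / P .b) o'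
  flushed : ∀ i < o, i / P .b < o / P .b → A.disk (dst + i / P .b) (i % P .b) = out i
  pending : ∀ i < o, i / P .b = o / P .b → A.arr 5 (i % P .b) = out i
  other : ∀ q o', (q < dst ∨ dst + P .m * pw ≤ q) → A.disk q o' = A₀.disk q o'

/-- The pointer `p` splits the first `o` entries of a sorted sequence at the value `th`. -/
def IsSplit (th o p : ℕ) (out : ℕ → ℕ) : Prop :=
  p ≤ o ∧ (∀ i < p, out i < th) ∧ ∀ i, p ≤ i → i < o → th ≤ out i

/-- If the new last value is below `th`, then so are all earlier ones, which forces `p = o`; hence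
advancing the pointer by one is right. -/
theorem IsSplit.succ {out out' : ℕ → ℕ} (h : IsSplit th o p out)
    (hle : ∀ i < o, out i ≤ v) (hout : ∀ i ≤ o, out' i = if i = o then v else out i) :
    IsSplit th (o + 1) (if v < th then p + 1 else p) out' := by
  obtain ⟨h1, h2, h3⟩ := h; split_ifs with hv
  · have hp : p = o := by by_contra hne; have := h3 p le_rfl (by omega); have := hle p (by omega); omega
    subst hp; refine ⟨le_rfl, fun i hi => ?_, fun i _ _ => by omega⟩; rw [hout i (by omega)]; split_ifs with hi'
    · exact hv
    · exact h2 i (by omega)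
  · refine ⟨by omega, fun i hi => ?_, fun i hi hi' => ?_⟩
    · rw [hout i (by omega), if_neg (by omega)]; exact h2 i hi
    · rw [hout i (by omega)]; split_ifs with hio
      · omega
      · exact h3 i hi (by omega)

theorem mul_add_mem_block (ho : o < b) : (k * b ≤ j * b + o ∧ j * b + o < k * b + b) ↔ j = k := by
  constructor
  · rintro ⟨h1, h2⟩
    have h3 : k < j + 1 := Nat.lt_of_mul_lt_mul_right (a := b) (by rw [add_mul]; omega)
    have h4 : j < k + 1 := Nat.lt_of_mul_lt_mul_right (a := b) (by rw [add_mul]; omega); omega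
  · rintro rfl; omega

/-- The geometry of a merge step. -/
structure MergeGeom (L : Layout mc a) (P : Var → ℕ) (A₀ : AState) (sb s1 pw : ℕ) : Prop where
  pw_pos : 0 < pw
  le_G : s1 + P .m * pw ≤ P .G
  addr : sb + 4 * P .G < 2 ^ mc.w
  words : P .m * pw * P .b < L.bound
  sorted : ∀ j < P .m, A₀.Sorted (P .b) (sb + s1 + j * pw) (pw * P .b)
  lt_inf : ∀ j < P .m, ∀ i < pw * P .b, A₀.entry (P .b) (sb + s1 + j * pw) i < P .inf

/-- Transfers are charged to a potential: the number of completely consumed blocks of all runs plus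
the number of complete output blocks. A load occurs only when the first grows, a write only when the
second grows. -/
theorem mergeStep_wp (hE : Env L P) {A0 : AState}
    (hP : A.Has P) {sb s1 : ℕ} {out : ℕ → ℕ} (hG : MergeGeom L P A0 sb s1 pw)
    (hsb : A.reg .sb = sb) (hs1 : A.reg .s1 = s1) (hpw : A.reg .pw = pw) (ho : A.reg .o = o)
    (hth : A.reg .th = th) (hlt : o < P .m * (pw * P .b))
    (hM : MergeState P A0 (sb + s1) (sb + 2 * P .G + s1) pw o out A)
    (hptr : IsSplit th o (A.reg .ptr) out)
    (hQ : ∀ A' t' out', A'.Frame A [.j, .best, .bj, .z1, .ptr] [3, 4, 5] →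
      MergeState P A0 (sb + s1) (sb + 2 * P .G + s1) pw (o + 1) out' A' →
      IsSplit th (o + 1) (A'.reg .ptr) out' →
      t' + (∑ j ∈ range (P .m), A.arr 4 j / P .b + o / P .b) ≤
        t + (∑ j ∈ range (P .m), A'.arr 4 j / P .b + (o + 1) / P .b) → Q A' t') :
    L.wp mergeStep Q A t := by
  have hn := hE.narr; have hb := hE.b_pos; have hbl := L.bound_le; have hcap := hE.cap_lt; have hbcap := hE.b_le_cap
  have hmcap := hE.m_le_cap; have hblk := hE.blk; have hadr := hG.addr; have hleG := hG.le_G; have hwords := hG.words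
  have hmpos : 0 < P .m := by have := hE.two_le_m; omega
  have hpwb : pw * P .b < L.bound := by
    refine lt_of_le_of_lt ?_ hwords; rw [mul_assoc]; exact Nat.le_mul_of_pos_left _ hmpos
  have hhead : ∀ j < P .m, A.arr 4 j < pw * P .b →
      A.arr 3 (j * P .b + A.arr 4 j % P .b) = A0.entry (P .b) (sb + s1 + j * pw) (A.arr 4 j) :=
    fun j hj hj' => hM.buf j hj hj' _ (mod_lt _ hb)
  rw [mergeStep, wp_seq]
  refine minLoop_wp hE hP hpw (by omega) (fun j hj hj' => ?_) (hM.inv.exists_lt hlt) ?_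
  · rw [hhead j hj hj']; exact hG.lt_inf j hj _ hj'
  intro A1 hf1 hd1 hk hk' hbest hmin; have hP1 := hP.frame hf1 (by decide)
  generalize hkdef : A1.reg .bj = k at hk hk' hbest; rw [hhead k hk hk'] at hbest
  have hmin' : ∀ j < P .m, A.arr 4 j < pw * P .b → A0.entry (P .b) (sb + s1 + k * pw) (A.arr 4 k) ≤
      A0.entry (P .b) (sb + s1 + j * pw) (A.arr 4 j) := fun j hj hj' => by
    rw [← hhead j hj hj', ← hbest]; exact hmin j hj hj'
  set v := A0.entry (P .b) (sb + s1 + k * pw) (A.arr 4 k) with hv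
  have hvlt : v < P .inf := hG.lt_inf k hk _ hk'; have hinf := hE.inf_lt
  have e3 : A1.arr 3 = A.arr 3 := hf1.arr 3 (by simp); have e4 : A1.arr 4 = A.arr 4 := hf1.arr 4 (by simp)
  have e5 : A1.arr 5 = A.arr 5 := hf1.arr 5 (by simp); have eo : A1.reg .o = o := by rw [hf1.reg _ (by simp), ho]
  have eth : A1.reg .th = th := by rw [hf1.reg _ (by simp), hth]
  have eptr : A1.reg .ptr = A.reg .ptr := by rw [hf1.reg _ (by simp)]
  have epw : A1.reg .pw = pw := by rw [hf1.reg _ (by simp), hpw]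
  have esb : A1.reg .sb = sb := by rw [hf1.reg _ (by simp), hsb]
  have es1 : A1.reg .s1 = s1 := by rw [hf1.reg _ (by simp), hs1]
  have hob : o % P .b < P .b := mod_lt _ hb
  have hobound : o + 1 < 2 ^ mc.w := by rw [← mul_assoc] at hlt; omega
  have hdivlt : o / P .b < P .m * pw :=
    Nat.div_lt_of_lt_mul (by rw [mul_comm (P .b)]; linarith)
  obtain ⟨p', hp'⟩ : ∃ p', p' = if v < th then A.reg .ptr + 1 else A.reg .ptr := ⟨_, rfl⟩
  have hptr' : A.reg .ptr + 1 < 2 ^ mc.w := by have := hptr.1; omega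
  have hkb := hE.mul_add_lt hk (mod_lt 0 hb)
  have hkpw : k * pw + (A.arr 4 k + 1) / P .b ≤ P .m * pw := by
    have h1 : (A.arr 4 k + 1) / P .b ≤ pw := Nat.div_le_of_le_mul (by rw [mul_comm]; omega)
    have h2 : (k + 1) * pw ≤ P .m * pw := Nat.mul_le_mul_right _ hk; rw [add_mul] at h2; omega
  have hz1 := Nat.zero_le ((A.arr 4 k + 1) / P .b); have hz2 := Nat.zero_le (o / P .b)
  rw [wp_seq, wp_set, wp_seq, wp_when_assign, wp_seq, wp_assign, wp_seq, wp_set]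
  simp [eo, hP1 .b rfl, hbest, eth, eptr, hkdef, e4, ← hp']; refine ⟨by omega, fun _ => by omega, by omega, by omega, ?_⟩
  -- Intermediate condition between loading and flushing; its cost clause covers the reads only.
  refine wp_mono (Q := fun A' t' => A'.Frame A [.j, .best, .bj, .z1, .ptr] [3, 4, 5] ∧
    A'.disk = A.disk ∧ (∀ j, A'.arr 4 j = if j = k then A.arr 4 k + 1 else A.arr 4 j) ∧
    (∀ j, A'.arr 5 j = if j = o % P .b then v else A.arr 5 j) ∧ A'.reg .ptr = p' ∧
    (∀ j < P .m, A'.arr 4 j < pw * P .b → ∀ o' < P .b,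
      A'.arr 3 (j * P .b + o') = A0.disk (sb + s1 + j * pw + A'.arr 4 j / P .b) o') ∧
    t' + ∑ j ∈ range (P .m), A.arr 4 j / P .b ≤ t + ∑ j ∈ range (P .m), A'.arr 4 j / P .b) ?_ ?_
  · have hsum : ∑ x ∈ range (P .m), (if x = k then A.arr 4 k + 1 else A.arr 4 x) / P .b =
        ∑ j ∈ range (P .m), A.arr 4 j / P .b + if P .b ∣ A.arr 4 k + 1 then 1 else 0 :=
      MergeInv.sum_update hk (fun j => A.arr 4 j / P .b) _ _
        (fun j hj => by simp only [if_neg hj]) (by simp only [if_true, Nat.succ_div])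
    have hf1' := hf1.mono (ys := [.j, .best, .bj, .z1, .ptr]) (gs := [3, 4, 5]) (by simp) (by simp)
    have hbuf : ∀ j < P .m, j ≠ k → A.arr 4 j < pw * P .b → ∀ o' < P .b,
        A.arr 3 (j * P .b + o') = A0.disk (sb + s1 + j * pw + A.arr 4 j / P .b) o' :=
      fun j hj _ h => hM.buf j hj h
    -- The runs lie below `sb + 2 * G + s1`, where the output begins, so blocks still to be read are
    -- intact.
    have hother : ∀ o', A.disk (sb + s1 + k * pw + (A.arr 4 k + 1) / P .b) o' =
        A0.disk (sb + s1 + k * pw + (A.arr 4 k + 1) / P .b) o' := fun o' =>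
      hM.other _ _ (by left; omega)
    have hkb' : k * P .b + P .b ≤ L.cap := by have := hE.mul_add_lt hk (sub_lt hb one_pos); omega
    simp [mergeLoad, epw, hP1 .b rfl, esb, es1, hf1', hd1, e4, e5, e3, hblk, hkdef, hsum]
    refine ⟨by omega, fun h1 => ⟨fun h2 => ⟨⟨by omega, by omega, by omega, by omega,
      fun o' ho' => ?_⟩, fun j hj hj' o' ho' => ?_, ?_⟩, fun h2 j hj hj' o' ho' => ?_⟩,
      fun h1 j hj hj' o' ho' => ?_⟩
    · rw [hother]
      have := hG.lt_inf k hk _ (mul_add_lt_mul (q := (A.arr 4 k + 1) / P .b)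
        (Nat.div_lt_of_lt_mul (by rwa [mul_comm])) ho')
      rw [entry_block _ _ ho'] at this; omega
    · simp only [mul_add_mem_block ho']
      by_cases hjk : j = k
      · subst hjk; simp only [if_true, Nat.add_sub_cancel_left]; exact hother o'
      · simp only [if_neg hjk] at hj' ⊢; exact hbuf j hj hjk hj' o' ho'
    · rw [if_pos (dvd_of_mod_eq_zero h2)]; omega
    · by_cases hjk : j = k
      · subst hjk; simp only [if_true]; rw [hM.buf j hj hk' o' ho', succ_div_of_not_dvd]; rwa [dvd_iff_mod_eq_zero]
      · simp only [if_neg hjk] at hj' ⊢; exact hbuf j hj hjk hj' o' ho'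
    · have hjk : j ≠ k := by rintro rfl; simp only [if_true] at hj'; omega
      simp only [if_neg hjk] at hj' ⊢; exact hbuf j hj hjk hj' o' ho'
  · rintro A2 t2 ⟨hf2, hd2, h4, h5, hp2, hbuf2, hcost⟩; have hP2 := hP.frame hf2 (by decide)
    have eo2 : A2.reg .o = o := by rw [hf2.reg _ (by simp), ho]
    have esb2 : A2.reg .sb = sb := by rw [hf2.reg _ (by simp), hsb]
    have es1₂ : A2.reg .s1 = s1 := by rw [hf2.reg _ (by simp), hs1]
    have hinv := hM.inv.step (out' := fun i => if i = o then v else out i) hG.sorted hk hk' hmin' h4 (fun i _ => rfl)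
    have hsplit := hptr.succ (v := v) (fun i hi => hM.inv.head i hi k hk hk')
      (out' := fun i => if i = o then v else out i) fun i _ => rfl
    rw [← hp', ← hp2] at hsplit; have hdivo := @Nat.succ_div o (P .b)
    have hpend : ∀ i < o, i / P .b = o / P .b → A2.arr 5 (i % P .b) = out i := by
      intro i hi hio; rw [h5, if_neg, hM.pending i hi hio]; intro h; have h1 := div_add_mod i (P .b)
      have h2 := div_add_mod o (P .b); rw [hio, h] at h1; omega
    simp [mergeFlush, eo2, hP2 .b rfl, hP2 .G rfl, esb2, es1₂, hblk]
    refine ⟨by omega, fun h1 => ⟨by omega, fun _ => hQ _ _ (fun i => if i = o then v else out i) (by simpa)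
      ⟨hinv, hbuf2, fun i hi hio => ?_, fun i hi hio => ?_, fun q o' hq => ?_⟩ hsplit ?_⟩,
      fun h1 => hQ _ _ (fun i => if i = o then v else out i) hf2
      ⟨hinv, hbuf2, fun i hi hio => ?_, fun i hi hio => ?_, fun q o' hq => ?_⟩ hsplit ?_⟩
    · rw [if_pos (dvd_of_mod_eq_zero h1)] at hdivo; have hi' : i % P .b < P .b := mod_lt _ hb
      simp only [writeDisk_disk, Nat.add_left_cancel_iff, hi', if_true, zero_add]; split_ifs with h2 h3 h3
      · rw [h3, h5, if_pos rfl]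
      · exact hpend i (by omega) h2
      · exact absurd (by rw [h3]) h2
      · rw [hd2]; exact hM.flushed i (by omega) (by omega)
    · rw [if_pos (dvd_of_mod_eq_zero h1)] at hdivo
      have := Nat.div_le_div_right (c := P .b) (show i ≤ o by omega); omega
    · simp only [writeDisk_disk]; rw [if_neg (by omega), hd2]; exact hM.other q o' hq
    · simp only [writeDisk_arr]; rw [if_pos (dvd_of_mod_eq_zero h1)] at hdivo; omega
    · rw [if_neg (by rwa [dvd_iff_mod_eq_zero])] at hdivo; have hne : i ≠ o := by rintro rfl; omega
      rw [hd2]; simp only [if_neg hne]; exact hM.flushed i (by omega) (by omega)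
    · rw [if_neg (by rwa [dvd_iff_mod_eq_zero])] at hdivo; split_ifs with h3
      · rw [h3, h5, if_pos rfl]
      · exact hpend i (by omega) (by omega)
    · rw [hd2]; exact hM.other q o' hq
    · rw [if_neg (by rwa [dvd_iff_mod_eq_zero])] at hdivo; omega

theorem IsSplit.congr {f g : ℕ → ℕ} (h : IsSplit th o p f) (hfg : ∀ i < o, g i = f i) : IsSplit th o p g :=
  ⟨h.1, fun i hi => by rw [hfg i (lt_of_lt_of_le hi h.1)]; exact h.2.1 i hi,
    fun i hi hi' => by rw [hfg i hi']; exact h.2.2 i hi hi'⟩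

/-- There are `m` initial reads, at most `m * pw` further reads, `m * pw` writes, and one write of
the new pointer, in total at most `4 * (m * pw)`. Delivered entries are merged along with the
others; counting the outputs below `th` yields the pointer of the merged run. -/
theorem merge_wp (hE : Env L P) (hP : A.Has P) {sb s1 : ℕ} (hG : MergeGeom L P A sb s1 pw)
    (hsb : A.reg .sb = sb) (hs1 : A.reg .s1 = s1) (hpw : A.reg .pw = pw)
    (hth : A.reg .th = th)
    (hQ : ∀ A' t', A'.Frame A [.j, .best, .bj, .z1, .ptr, .o] [3, 4, 5] →
      (∀ q o', (q < sb + 2 * P .G + s1 ∨ sb + 2 * P .G + s1 + P .m * pw ≤ q) →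
        q ≠ sb + 3 * P .G + s1 → A'.disk q o' = A.disk q o') →
      A'.Sorted (P .b) (sb + 2 * P .G + s1) (P .m * pw * P .b) →
      A'.content (P .b) (sb + 2 * P .G + s1) (P .m * pw * P .b) = A.content (P .b) (sb + s1) (P .m * pw * P .b) →
      IsSplit th (P .m * pw * P .b) (A'.disk (sb + 3 * P .G + s1) 0) (A'.entry (P .b) (sb + 2 * P .G + s1)) →
      (∀ o < P .b, A'.disk (sb + 3 * P .G + s1) o < P .V) →
      t' ≤ t + 4 * (P .m * pw) → Q A' t') :
    L.wp merge Q A t := by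
  have hn := hE.narr; have hb := hE.b_pos; have hbl := L.bound_le; have hcap := hE.cap_lt; have hbcap := hE.b_le_cap
  have hmcap := hE.m_le_cap; have hblk := hE.blk; have hadr := hG.addr; have hleG := hG.le_G; have hwords := hG.words
  have hinf := hE.inf_lt; have hmpos : 0 < P .m := by have := hE.two_le_m; omega
  have hmpw : 0 < P .m * pw := Nat.mul_pos hmpos hG.pw_pos
  have hmle : P .m ≤ P .m * pw := Nat.le_mul_of_pos_right _ hG.pw_pos
  have hbpw : P .b ≤ pw * P .b := Nat.le_mul_of_pos_left _ hG.pw_pos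
  set xs : List Var := [.j, .best, .bj, .z1, .ptr, .o] with hxs
  obtain ⟨I, hI⟩ : ∃ I : ℕ → AState → ℕ → Prop, ∀ j A' t', I j A' t' ↔ (t' = t + j ∧
    A'.Frame A xs [3, 4, 5] ∧ A'.disk = A.disk ∧
    ∀ i < j, A'.arr 4 i = 0 ∧ ∀ o' < P .b, A'.arr 3 (i * P .b + o') =
      A.disk (sb + s1 + i * pw) o') := ⟨_, fun _ _ _ => Iff.rfl⟩
  rw [merge, wp_seq]; refine wp_for (P .m) I (by omega) ?_ ?_ ?_ ?_
  · rw [hI]; simp [hxs]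
  · intro j A' t' hj h hx; rw [hI] at h; simp [(hP.frame h.2.1 (by decide)) .m rfl]
  · intro j A' t' hj h hx; obtain ⟨rfl, hf, hd, hbuf⟩ := (hI _ _ _).1 h; have hP' := hP.frame hf (by decide)
    have epw : A'.reg .pw = pw := by rw [hf.reg _ (by simp [hxs]), hpw]
    have esb : A'.reg .sb = sb := by rw [hf.reg _ (by simp [hxs]), hsb]
    have es1 : A'.reg .s1 = s1 := by rw [hf.reg _ (by simp [hxs]), hs1]
    have hjb : j * P .b + P .b ≤ L.cap := by have := hE.mul_add_lt hj (sub_lt hb one_pos); omega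
    have hjpw : j * pw ≤ P .m * pw := Nat.mul_le_mul_right _ hj.le
    simp [hx, epw, esb, es1, hP' .b rfl, hI, hd, hblk, hxs]
    refine ⟨⟨by omega, by omega, by omega, by omega, fun o' ho' => ?_⟩, by omega, by omega, ?_, ?_⟩
    · have := hG.lt_inf j hj o' (by omega)
      rw [entry, div_eq_of_lt ho', mod_eq_of_lt ho', add_zero] at this; omega
    · exact hf
    · intro i hi; refine ⟨fun hij => (hbuf i (by omega)).1, fun o' ho' => ?_⟩; simp only [mul_add_mem_block ho']
      split_ifs with hij
      · simp [hij]
      · exact (hbuf i (by omega)).2 o' ho'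
  intro A1 t1 h _; obtain ⟨rfl, hf1, hd1, hbuf1⟩ := (hI _ _ _).1 h; clear h hI I; rw [wp_seq, wp_assign, wp_seq]
  refine ⟨by simp, ?_⟩
  obtain ⟨I, hI⟩ : ∃ I : ℕ → AState → ℕ → Prop, ∀ o A' t', I o A' t' ↔ ∃ out, A'.Frame A xs [3, 4, 5] ∧
    MergeState P A (sb + s1) (sb + 2 * P .G + s1) pw o out A' ∧
    IsSplit th o (A'.reg .ptr) out ∧
    t' ≤ t + P .m + (∑ j ∈ range (P .m), A'.arr 4 j / P .b + o / P .b) :=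
      ⟨_, fun _ _ _ => Iff.rfl⟩
  refine wp_for (P .m * pw * P .b) I (by omega) ?_ ?_ ?_ ?_
  · rw [hI]
    refine ⟨fun _ => 0, ?_, ⟨MergeInv.zero fun j hj => ?_, fun j hj _ o' ho' => ?_, ?_, ?_, ?_⟩, ?_, ?_⟩
    · rw [frame_setReg (by simp [hxs]), frame_setReg (by simp [hxs])]; exact hf1
    · exact (hbuf1 j hj).1
    · simp only [setReg_arr, (hbuf1 j hj).1, (hbuf1 j hj).2 o' ho', Nat.zero_div, add_zero]
    · exact fun i hi => absurd hi (Nat.not_lt_zero _)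
    · exact fun i hi => absurd hi (Nat.not_lt_zero _)
    · intro q o' _; simp [hd1]
    · simp [IsSplit]
    · exact Nat.le_add_right _ _
  · intro o A' t' ho h hx; obtain ⟨out, hf, -⟩ := (hI _ _ _).1 h; have hP' := hP.frame hf (by decide)
    have epw : A'.reg .pw = pw := by rw [hf.reg _ (by simp [hxs]), hpw]
    simp [hP' .m rfl, hP' .b rfl, epw]; omega
  · intro o A' t' ho h hx; obtain ⟨out, hf, hM, hs, ht⟩ := (hI _ _ _).1 h; have hP' := hP.frame hf (by decide)
    refine mergeStep_wp hE hP' hG (by rw [hf.reg _ (by simp [hxs]), hsb])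
      (by rw [hf.reg _ (by simp [hxs]), hs1]) (by rw [hf.reg _ (by simp [hxs]), hpw]) hx
      (by rw [hf.reg _ (by simp [hxs]), hth]) (by rwa [← mul_assoc]) hM hs ?_
    intro A2 t2 out2 hf2 hM2 hs2 ht2; refine ⟨by rw [hf2.reg _ (by simp), hx], ?_⟩; rw [hI]
    refine ⟨out2, ?_, ⟨hM2.inv, hM2.buf, hM2.flushed, hM2.pending, hM2.other⟩, hs2, ?_⟩
    · rw [frame_setReg (by simp [hxs])]; exact (hf2.mono (by simp [hxs]) (by simp)).trans hf
    · simp only [setReg_arr]; omega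
  intro A2 t2 h _; obtain ⟨out, hf2, hM, hs, ht⟩ := (hI _ _ _).1 h; clear h hI I; have hP2 := hP.frame hf2 (by decide)
  have esb : A2.reg .sb = sb := by rw [hf2.reg _ (by simp [hxs]), hsb]
  have es1 : A2.reg .s1 = s1 := by rw [hf2.reg _ (by simp [hxs]), hs1]
  have hptr := hs.1; simp [hP2 .G rfl, esb, es1, hblk]; refine ⟨by omega, by omega, fun hbd => ?_⟩
  have hend : P .m * pw * P .b / P .b = P .m * pw := Nat.mul_div_cancel _ hb
  have hflush : ∀ i < P .m * pw * P .b, A2.entry (P .b) (sb + 2 * P .G + s1) i = out i := by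
    intro i hi; refine hM.flushed i hi ?_; rw [hend]; exact Nat.div_lt_of_lt_mul (by rwa [mul_comm])
  have hne : ∀ q < P .m * pw, sb + 2 * P .G + s1 + q ≠ sb + 3 * P .G + s1 := by omega
  have hflush' : ∀ i < P .m * pw * P .b, ((A2.setArr 5 0 (A2.reg Var.ptr)).writeDisk (P .b)
      (sb + 3 * P .G + s1) 5 0).entry (P .b) (sb + 2 * P .G + s1) i = out i := by
    intro i hi; rw [← hflush i hi]; refine entry_congr hb (n := P .m * pw) ?_ hi; intro q hq o ho; simp [hne q hq]
  rw [mul_assoc] at hM; have hidx := fun j (hj : j < P .m) => hM.inv.eq_len hj; refine hQ _ _ ?_ ?_ ?_ ?_ ?_ ?_ ?_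
  · rw [frame_writeDisk, frame_setArr (by simp)]; exact hf2
  · intro q o' hq hq'; simp only [writeDisk_disk, if_neg hq', setArr_disk]; exact hM.other q o' hq
  · intro i k hik hk; rw [hflush' i (by omega), hflush' k hk]; exact hM.inv.sorted i k hik (by rwa [← mul_assoc])
  · rw [content, Multiset.map_congr rfl fun i hi => hflush' i (Multiset.mem_range.1 hi),
      mul_assoc, hM.inv.mset, content, map_range_mul]
    refine sum_congr rfl fun j hj => ?_; rw [hidx j (mem_range.1 hj)]; refine Multiset.map_congr rfl fun i _ => ?_
    rw [entry_add_mul _ hb]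
  · have : ((A2.setArr 5 0 (A2.reg Var.ptr)).writeDisk (P .b) (sb + 3 * P .G + s1) 5 0).disk
        (sb + 3 * P .G + s1) 0 = A2.reg .ptr := by simp [hb]
    rw [this]; exact hs.congr hflush'
  · intro o ho; simpa [ho, hE.V_eq] using hbd o ho
  · have : ∑ j ∈ range (P .m), A2.arr 4 j / P .b = P .m * pw := by
      rw [sum_congr rfl fun j hj => by rw [hidx j (mem_range.1 hj), Nat.mul_div_cancel _ hb]]; simp
    rw [this, hend] at ht; omega

/-! ### The queue: blocks of level zero and the current batch -/

/-- Insert the value `val` into the sorted batch; a full batch is written to the disk. -/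
def emit : ACmd :=
  .for .j §.cnt (.z1 ≔ .get 6 §.j ;; .when ((§.val).lt §.z1) (.set 6 §.j §.val ;; .val ≔ §.z1)) ;;
  .set 6 §.cnt §.val ;;
  .cnt ≔ §.cnt + 1 ;;
  .when ((§.cnt).eq §.b) (.write (4 * §.G + §.x1) 6 0 ;; .x1 ≔ §.x1 + 1 ;; .cnt ≔ 0)

/-- Fill the batch up with the value `pad`. -/
def flush : ACmd := .loop §.cnt (.val ≔ §.pad ;; emit)

/-- The blocks of level zero are sorted and hold, together with the batch, the multiset `S`, and
some copies of `pad`. The entries of the batch and of the blocks from `x` on are at least `lo`. -/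
structure Queue (P : Var → ℕ) (A : AState) (x lo : ℕ) (S : Multiset ℕ) : Prop where
  cnt_lt : A.reg .cnt < P .b
  batch_sorted : ∀ i j, i ≤ j → j < A.reg .cnt → A.arr 6 i ≤ A.arr 6 j
  batch_mem : ∀ i < A.reg .cnt, A.arr 6 i ≤ P .pad ∧ lo ≤ A.arr 6 i
  sorted : ∀ q < A.reg .x1, ∀ i k, i ≤ k → k < P .b →
    A.disk (4 * P .G + q) i ≤ A.disk (4 * P .G + q) k
  le_pad : ∀ q < A.reg .x1, ∀ o < P .b, A.disk (4 * P .G + q) o ≤ P .pad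
  le_x1 : x ≤ A.reg .x1
  lo_le : ∀ q, x ≤ q → q < A.reg .x1 → ∀ o < P .b, lo ≤ A.disk (4 * P .G + q) o
  mset : (A.content (P .b) (4 * P .G) (A.reg .x1 * P .b) +
    (Multiset.range (A.reg .cnt)).map (A.arr 6)).filter (· < P .pad) = S

/-- Insertion of `v` into a sorted array `f` of `c` entries: after `j` steps the value `u` is to be
inserted into the rest. -/
structure InsertInv (f : ℕ → ℕ) (c v j : ℕ) (g : ℕ → ℕ) (u : ℕ) : Prop where
  sorted : ∀ i k, i ≤ k → k < j → g i ≤ g k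
  le : ∀ i < j, g i ≤ u
  rest : ∀ i, j ≤ i → g i = f i
  rest_le : ∀ i < j, ∀ k, j ≤ k → k < c → g i ≤ f k
  mset : u ::ₘ (Multiset.range j).map g = v ::ₘ (Multiset.range j).map f

theorem InsertInv.zero (f : ℕ → ℕ) (c v : ℕ) : InsertInv f c v 0 f v :=
  ⟨fun _ _ _ h => absurd h (Nat.not_lt_zero _), fun _ h => absurd h (Nat.not_lt_zero _),
    fun _ _ => rfl, fun _ h => absurd h (Nat.not_lt_zero _), rfl⟩

/-- At each position the smaller of the carried value and the old entry stays, and the larger one is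
carried on. -/
theorem InsertInv.step {f : ℕ → ℕ} {g : ℕ → ℕ}
    (hf : ∀ i k, i ≤ k → k < c → f i ≤ f k) (h : InsertInv f c v j g u) (hj : j < c)
    {g' : ℕ → ℕ} (hg : ∀ i, g' i = if i = j then min u (f j) else g i) :
    InsertInv f c v (j + 1) g' (max u (f j)) where
  sorted i k hik hk := by
    rw [hg, hg]; split_ifs with h1 h2 h2
    · exact le_rfl
    · omega
    · exact le_min (h.le i (by omega)) (h.rest_le i (by omega) j le_rfl hj)
    · exact h.sorted i k hik (by omega)
  le i hi := by
    rw [hg]; split_ifs with h1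
    · exact min_le_max
    · exact (h.le i (by omega)).trans (le_max_left _ _)
  rest i hi := by rw [hg, if_neg (by omega)]; exact h.rest i (by omega)
  rest_le i hi k hk hkc := by
    rw [hg]; split_ifs with h1
    · exact (min_le_right _ _).trans (hf _ _ (by omega) hkc)
    · exact h.rest_le i (by omega) k (by omega) hkc
  mset := by
    have h1 : (Multiset.range j).map g' = (Multiset.range j).map g :=
      Multiset.map_congr rfl fun i hi => by have := Multiset.mem_range.1 hi; rw [hg, if_neg (by omega)]
    rw [Multiset.range_succ, Multiset.map_cons, Multiset.map_cons, h1, hg, if_pos rfl, Multiset.cons_swap v, ← h.mset]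
    rcases le_total u (f j) with h2 | h2
    · rw [max_eq_right h2, min_eq_left h2]
    · rw [max_eq_left h2, min_eq_right h2, Multiset.cons_swap]

theorem AState.content_add (A : AState) (hb : 0 < b) (base p q : ℕ) :
    A.content b base ((p + q) * b) = A.content b base (p * b) + A.content b (base + p) (q * b) := by
  rw [content, add_mul, Multiset.range_add, Multiset.map_add, Multiset.map_map]; congr 1
  refine Multiset.map_congr rfl fun i _ => ?_; have := A.entry_add_mul hb base p 1 i; simpa using this

theorem AState.content_one (A : AState) (base : ℕ) : A.content b base b = (Multiset.range b).map (A.disk base) := by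
  refine Multiset.map_congr rfl fun i hi => ?_; have := Multiset.mem_range.1 hi
  rw [entry, div_eq_of_lt this, mod_eq_of_lt this, add_zero]

/-- The batch after the insertion of `v`. -/
structure Queue.Inserted (P : Var → ℕ) (A : AState) (v lo : ℕ) (g : ℕ → ℕ) : Prop where
  sorted : ∀ i k, i ≤ k → k < A.reg .cnt + 1 → g i ≤ g k
  mset : (Multiset.range (A.reg .cnt + 1)).map g = v ::ₘ (Multiset.range (A.reg .cnt)).map (A.arr 6)
  mem : ∀ i < A.reg .cnt + 1, g i ≤ P .pad ∧ lo ≤ g i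

theorem Queue.inserted (hq : Queue P A x lo S) (hv : v ≤ P .pad) (hlo : lo ≤ v) {f g : ℕ → ℕ}
    (h : InsertInv (A.arr 6) (A.reg .cnt) v (A.reg .cnt) f u)
    (hg : ∀ i, g i = if i = A.reg .cnt then u else f i) : Inserted P A v lo g := by
  have gm : (Multiset.range (A.reg .cnt + 1)).map g = v ::ₘ (Multiset.range (A.reg .cnt)).map (A.arr 6) := by
    rw [← h.mset, Multiset.range_succ, Multiset.map_cons, hg, if_pos rfl]; congr 1
    refine Multiset.map_congr rfl fun i hi => ?_; have := Multiset.mem_range.1 hi; rw [hg, if_neg (by omega)]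
  refine ⟨fun i k hik hk => ?_, gm, fun i hi => ?_⟩
  · rw [hg, hg]; split_ifs with h1 h2 h2
    · exact le_rfl
    · omega
    · exact h.le i (by omega)
    · exact h.sorted i k hik (by omega)
  · have : g i ∈ (Multiset.range (A.reg .cnt + 1)).map g :=
      Multiset.mem_map_of_mem _ (Multiset.mem_range.2 hi)
    rw [gm, Multiset.mem_cons, Multiset.mem_map] at this; rcases this with h | ⟨k, hk, hk'⟩
    · omega
    · rw [← hk']; exact hq.batch_mem k (Multiset.mem_range.1 hk)

theorem Queue.keep (hq : Queue P A x lo S) (hg : Inserted P A v lo (A'.arr 6)) (hc : A'.reg .cnt = A.reg .cnt + 1)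
    (hlt : A'.reg .cnt < P .b) (hx : A'.reg .x1 = A.reg .x1) (hd : A'.disk = A.disk) :
    Queue P A' x lo (S + ({v} : Multiset ℕ).filter (· < P .pad)) := by
  refine ⟨hlt, hc ▸ hg.sorted, hc ▸ hg.mem, ?_, ?_, ?_, ?_, ?_⟩
  · rw [hx, hd]; exact hq.sorted
  · rw [hx, hd]; exact hq.le_pad
  · rw [hx]; exact hq.le_x1
  · rw [hx, hd]; exact hq.lo_le
  · rw [← hq.mset, hx, hc, hg.mset, content, content, ← Multiset.filter_add]; congr 1
    rw [add_assoc, ← Multiset.singleton_add, add_comm ({v} : Multiset ℕ)]; congr 1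
    refine Multiset.map_congr rfl fun i _ => ?_; simp [entry, hd]

theorem Queue.written {g : ℕ → ℕ} (hq : Queue P A x lo S) (hg : Inserted P A v lo g) (hc : A.reg .cnt + 1 = P .b)
    (hc' : A'.reg .cnt = 0) (hx : A'.reg .x1 = A.reg .x1 + 1)
    (hd : ∀ q o, o < P .b → A'.disk q o = if q = 4 * P .G + A.reg .x1 then g o else A.disk q o) :
    Queue P A' x lo (S + ({v} : Multiset ℕ).filter (· < P .pad)) := by
  have h1 : ∀ q < A'.reg .x1, q < A.reg .x1 ∨ q = A.reg .x1 := by omega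
  have h2 : ∀ q < A.reg .x1, ∀ o < P .b, A'.disk (4 * P .G + q) o = A.disk (4 * P .G + q) o :=
    fun q hq o ho => by rw [hd _ _ ho, if_neg (by omega)]
  have h3 : ∀ o < P .b, A'.disk (4 * P .G + A.reg .x1) o = g o :=
    fun o ho => by rw [hd _ _ ho, if_pos rfl]
  have hb : 0 < P .b := by omega
  refine ⟨by omega, by omega, by omega, ?_, ?_, ?_, ?_, ?_⟩
  · intro q hqx i k hik hk; rcases h1 q hqx with hqx | rfl
    · rw [h2 q hqx k hk, h2 q hqx i (by omega)]; exact hq.sorted q hqx i k hik hk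
    · rw [h3 k hk, h3 i (by omega)]; exact hg.sorted i k hik (by omega)
  · intro q hqx o ho; rcases h1 q hqx with hqx | rfl
    · rw [h2 q hqx o ho]; exact hq.le_pad q hqx o ho
    · rw [h3 o ho]; exact (hg.mem o (by omega)).1
  · have := hq.le_x1; omega
  · intro q hq' hqx o ho; rcases h1 q hqx with hqx | rfl
    · rw [h2 q hqx o ho]; exact hq.lo_le q hq' hqx o ho
    · rw [h3 o ho]; exact (hg.mem o (by omega)).2
  · rw [← hq.mset, hx, hc', content_add _ hb, one_mul, content_one, content_congr hb h2, ← Multiset.filter_add]; congr 1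
    rw [Multiset.map_congr rfl fun o ho => h3 o (Multiset.mem_range.1 ho), ← hc, hg.mset,
      Multiset.range_zero, Multiset.map_zero, add_zero, add_assoc, ← Multiset.singleton_add,
      add_comm ({v} : Multiset ℕ)]

theorem Env.four_mul_G_add_lt (hE : Env L P) (hx : x ≤ P .G) : 4 * P .G + x < L.bound := by
  have := hE.G_mul; rcases Nat.eq_zero_or_pos (P .G) with h0 | h0
  · rw [h0] at this hx; omega
  · have : P .G * 8 ≤ P .G * (2 * P .G + 8) := Nat.mul_le_mul_left _ (by omega); omega

/-- `x1 * b + cnt` grows by exactly one per message and transfers equal the growth of `x1`; these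
two facts are all that later cost estimates use. The value `pad` may be emitted too: it fills a
block and is invisible in `S`. -/
theorem emit_wp (hE : Env L P) (hP : A.Has P) (hq : Queue P A x lo S) (hx1 : A.reg .x1 < P .G)
    (hval : A.reg .val ≤ P .pad) (hlo : lo ≤ A.reg .val)
    (hQ : ∀ A' t', A'.Frame A [.j, .z1, .val, .cnt, .x1] [6] →
      Queue P A' x lo (S + ({A.reg .val} : Multiset ℕ).filter (· < P .pad)) →
      (∀ q, q ≠ 4 * P .G + A.reg .x1 → A'.disk q = A.disk q) →
      A'.reg .x1 * P .b + A'.reg .cnt = A.reg .x1 * P .b + A.reg .cnt + 1 →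
      (A'.reg .x1 = A.reg .x1 ∨ A'.reg .x1 = A.reg .x1 + 1 ∧ A'.reg .cnt = 0) →
      t' + A.reg .x1 = t + A'.reg .x1 → Q A' t') :
    L.wp emit Q A t := by
  have hn := hE.narr; have hbl := L.bound_le; have hcap := hE.cap_lt; have hbcap := hE.b_le_cap; have hblk := hE.blk
  have hinf := hE.inf_lt; have hinf' := hE.inf_eq; have hcnt := hq.cnt_lt; have hG := hE.four_mul_G_add_lt hx1.le
  obtain ⟨I, hI⟩ : ∃ I : ℕ → AState → ℕ → Prop, ∀ j A' t', I j A' t' ↔ (t' = t ∧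
    A'.Frame A [.j, .z1, .val] [6] ∧ A'.disk = A.disk ∧
    InsertInv (A.arr 6) (A.reg .cnt) (A.reg .val) j (A'.arr 6) (A'.reg .val) ∧
    (A'.reg .val ≤ P .pad)) :=
    ⟨_, fun _ _ _ => Iff.rfl⟩
  rw [emit, wp_seq]; refine wp_for (A.reg .cnt) I (by omega) ?_ ?_ ?_ ?_
  · rw [hI]; simp [InsertInv.zero, hval]
  · intro j A' t' hj h hx; rw [hI] at h; simp [h.2.1.reg .cnt (by simp)]
  · intro j A' t' hj h hx; obtain ⟨rfl, hf, hd, hins, hv⟩ := (hI _ _ _).1 h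
    have hr : A'.arr 6 j = A.arr 6 j := hins.rest j le_rfl; have hle := (hq.batch_mem j hj).1; simp [hx, hI, hf, hd, hr]
    refine ⟨by omega, fun h1 => ⟨⟨by omega, by omega⟩, ?_, by omega⟩, fun h1 => ⟨?_, by omega⟩⟩
    · have := hins.step hq.batch_sorted hj (g' := fun i => if i = j then A'.reg .val else A'.arr 6 i)
        (fun i => by rw [min_eq_left h1.le])
      rw [max_eq_right h1.le] at this; convert this using 1; funext i; simp
    · have := hins.step hq.batch_sorted hj (g' := A'.arr 6) (fun i => by
        rw [min_eq_right h1]; split_ifs with h2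
        · rw [h2, hr]
        · rfl)
      rwa [max_eq_left h1] at this
  intro A1 t1 h _; obtain ⟨rfl, hf, hd, hins, hv⟩ := (hI _ _ _).1 h; clear h hI I; have hP' := hP.frame hf (by decide)
  have ec : A1.reg .cnt = A.reg .cnt := hf.reg _ (by simp); have ex : A1.reg .x1 = A.reg .x1 := hf.reg _ (by simp)
  have hg := hq.inserted hval hlo hins (g := (A1.setArr 6 (A.reg .cnt) (A1.reg .val)).arr 6) (fun i => by simp)
  have hfr : A1.Frame A [.j, .z1, .val, .cnt, .x1] [6] := hf.mono (by simp) (by simp)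
  simp [ec, hP' .b rfl, hP' .G rfl, hblk, ex]
  refine ⟨by omega, by omega, fun h1 => ⟨by omega, fun _ => ⟨by omega, hQ _ _ (by simpa using hfr)
    (hq.written hg h1 (by simp) (by simp) (fun q o ho => by simp [ho, hd])) ?_ ?_ ?_ ?_⟩⟩,
    fun h1 => hQ _ _ (by simpa using hfr) (hq.keep hg (by simp) ?_ (by simp [ex]) (by simp [hd])) ?_ ?_ ?_ ?_⟩
  · intro q hq; funext o; simp [hq, hd]
  · simp [← h1]; ring
  · simp
  · simp; omega
  · simp; omega
  · simp [hd]
  · simp [ex]; omega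
  · simp [ex]
  · simp [ex]

theorem flush_wp (hE : Env L P) (hP : A.Has P) (hq : Queue P A x lo S) (hx1 : A.reg .x1 < P .G) (hlo : lo ≤ P .pad)
    (hQ : ∀ A' t', A'.Frame A [.j, .z1, .val, .cnt, .x1] [6] → Queue P A' x lo S → A'.reg .cnt = 0 →
      (∀ q, q ≠ 4 * P .G + A.reg .x1 → A'.disk q = A.disk q) →
      A'.reg .x1 ≤ A.reg .x1 + 1 →
      A'.reg .x1 * P .b ≤ A.reg .x1 * P .b + A.reg .cnt + P .b →
      t' + A.reg .x1 = t + A'.reg .x1 → Q A' t') :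
    L.wp flush Q A t := by
  refine wp_while (fun A' t' => A'.Frame A [.j, .z1, .val, .cnt, .x1] [6] ∧
      Queue P A' x lo S ∧ (∀ q, q ≠ 4 * P .G + A.reg .x1 → A'.disk q = A.disk q) ∧
      (A'.reg .x1 = A.reg .x1 ∨ A'.reg .x1 = A.reg .x1 + 1 ∧ A'.reg .cnt = 0) ∧
      t' + A.reg .x1 = t + A'.reg .x1)
    -- The count rises until it wraps around from `b` to 0, where the loop ends; the wrapped state
    -- needs the value 0.
    (fun A' => if A'.reg .cnt = 0 then 0 else P .b - A'.reg .cnt) ?_ ?_ ?_ ?_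
  · exact ⟨.refl _ _ _, hq, fun _ _ => rfl, .inl rfl, rfl⟩
  · intro A' t' _; simp
  · rintro A' t' ⟨hf, hq', hd, hx, ht⟩ hc; simp only [AExpr.val_r] at hc; have hP' := hP.frame hf (by decide)
    have hx' : A'.reg .x1 = A.reg .x1 := by omega
    simp only [wp_seq, wp_assign]; refine ⟨by simp, ?_⟩
    refine emit_wp hE (x := x) (lo := lo) (S := S) (hP'.setReg (by decide)) ?_ (by simpa [hx'])
      (by simp [hP' .pad rfl]) (by simpa [hP' .pad rfl]) ?_
    · exact ⟨hq'.cnt_lt, hq'.batch_sorted, hq'.batch_mem, hq'.sorted, hq'.le_pad, hq'.le_x1, hq'.lo_le, hq'.mset⟩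
    · intro A2 t2 hf2 hq2 hd2 hsum hx2 ht2
      simp [hP' .pad rfl, hx', Multiset.filter_singleton] at hq2 hd2 hsum hx2 ht2; have hlt := hq2.cnt_lt
      have hlt' := hq'.cnt_lt
      refine ⟨⟨hf2.trans (hf.setReg (by simp)), hq2, fun q hq => by rw [hd2 q hq, hd q hq], by omega, by omega⟩, ?_⟩
      rcases hx2 with h | ⟨h, h'⟩
      · rw [h] at hsum; split_ifs <;> omega
      · rw [if_pos h', if_neg hc]; omega
  · rintro A' t' ⟨hf, hq', hd, hx, ht⟩ hc; simp only [AExpr.val_r] at hc; refine hQ A' t' hf hq' hc hd (by omega) ?_ ht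
    rcases hx with h | ⟨h, -⟩ <;> rw [h]
    · omega
    · rw [add_mul]; omega

/-! ### The levels of the queue

Group `g` of level `l` holds, in sorted order, the words of the blocks `g * m ^ l, …,
(g + 1) * m ^ l - 1` of level zero. -/

/-- The first block of level `l`. -/
def levelBase (P : Var → ℕ) (l : ℕ) : ℕ := (4 + 2 * l) * P .G

/-- The first block of the pointers of level `l`. -/
def ptrBase (P : Var → ℕ) (l : ℕ) : ℕ := (5 + 2 * l) * P .G

def GroupData (P : Var → ℕ) (A : AState) (l g : ℕ) : Prop :=
  A.Sorted (P .b) (levelBase P l + g * P .m ^ l) (P .m ^ l * P .b) ∧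
  A.content (P .b) (levelBase P l + g * P .m ^ l) (P .m ^ l * P .b) =
    A.content (P .b) (4 * P .G + g * P .m ^ l) (P .m ^ l * P .b)

def GroupPtr (P : Var → ℕ) (A : AState) (th l g : ℕ) : Prop :=
  IsSplit th (P .m ^ l * P .b) (A.disk (ptrBase P l + g * P .m ^ l) 0) (A.entry (P .b) (levelBase P l + g * P .m ^ l)) ∧
    ∀ o < P .b, A.disk (ptrBase P l + g * P .m ^ l) o < P .V

/-- When there are `x` blocks of level zero, the active groups, i.e., those that are not part of
a larger group, partition them. -/
def Active (m x l g : ℕ) : Prop := (g + 1) * m ^ l ≤ x ∧ g / m = x / m ^ (l + 1)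

structure Levels (P : Var → ℕ) (A : AState) (x th : ℕ) : Prop where
  data : ∀ l g, (g + 1) * P .m ^ l ≤ x → GroupData P A l g
  ptr : ∀ l g, Active (P .m) x l g → GroupPtr P A th l g

/-- The groups that exist when the levels up to `l` are updated for block `x - 1` of level zero. -/
structure Carry (P : Var → ℕ) (A : AState) (x th l : ℕ) : Prop where
  pos : 0 < x
  dvd : P .m ^ l ∣ x
  data : ∀ l' g, (g + 1) * P .m ^ l' ≤ x → l' ≤ l ∨ (g + 1) * P .m ^ l' < x → GroupData P A l' g
  ptr : ∀ l' g, Active (P .m) (x - 1) l' g ∨ l' ≤ l ∧ (g + 1) * P .m ^ l' = x →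
    GroupPtr P A th l' g

/-- The disk is divided into regions of `G` blocks; this separates the data and the pointers of
different levels. -/
theorem region_ne {G a a' q' : ℕ} (ha : a ≠ a') (hq : q < G) (hq' : q' < G) : a * G + q ≠ a' * G + q' := by
  intro h; have h1 := congrArg (· / G) h
  simp only [Nat.add_comm (_ * G), add_mul_div_right _ _ (by omega : 0 < G),
    div_eq_of_lt hq, div_eq_of_lt hq', zero_add] at h1
  exact ha h1

theorem levelBase_zero : levelBase P 0 = 4 * P .G := rfl

theorem GroupData.congr (hb : 0 < P .b) (h : GroupData P A l g)
    (h1 : ∀ q < P .m ^ l, ∀ o < P .b, A'.disk (levelBase P l + g * P .m ^ l + q) o =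
      A.disk (levelBase P l + g * P .m ^ l + q) o)
    (h0 : ∀ q < P .m ^ l, ∀ o < P .b, A'.disk (4 * P .G + g * P .m ^ l + q) o =
      A.disk (4 * P .G + g * P .m ^ l + q) o) : GroupData P A' l g :=
  ⟨h.1.congr hb h1, by rw [content_congr hb h1, content_congr hb h0, h.2]⟩

theorem GroupPtr.congr (hb : 0 < P .b) (h : GroupPtr P A th l g)
    (h1 : ∀ q < P .m ^ l, ∀ o < P .b, A'.disk (levelBase P l + g * P .m ^ l + q) o =
      A.disk (levelBase P l + g * P .m ^ l + q) o)
    (h2 : A'.disk (ptrBase P l + g * P .m ^ l) = A.disk (ptrBase P l + g * P .m ^ l)) :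
    GroupPtr P A' th l g := by
  rw [GroupPtr, h2]
  exact ⟨IsSplit.congr h.1 fun i hi => entry_congr hb h1 hi, h.2⟩

/-- Only the quotient `x / m ^ (l + 1)` could differ for `x - 1`, namely if `m ^ (l + 1)` divides
`x`. But then the condition on `g / m` puts the start of the group at `x` or later, although it ends
by `x`. -/
theorem Active.of_pred (hm : 0 < m) (h : Active m x l g) (hne : (g + 1) * m ^ l ≠ x) : Active m (x - 1) l g := by
  obtain ⟨h1, h2⟩ := h
  have hx : x - 1 + 1 = x := by
    have : 0 < (g + 1) * m ^ l := by positivity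
    omega
  refine ⟨by omega, ?_⟩; have h3 := @Nat.succ_div (x - 1) (m ^ (l + 1)); rw [hx] at h3; split_ifs at h3 with hd
  · exfalso
    have h4 : x / m ^ (l + 1) * m ^ (l + 1) = x := Nat.div_mul_cancel hd; rw [← h2, pow_succ'] at h4
    have h5 : g / m * (m * m ^ l) ≤ g * m ^ l := by rw [← mul_assoc]; exact Nat.mul_le_mul_right _ (div_mul_le_self _ _)
    rw [add_mul] at h1; have : 0 < m ^ l := by positivity
    omega
  · omega

/-- A group of level above `l` that ends at `x` would make `m ^ (l + 1)` divide `x`. So all groups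
that end at `x` have been built, and the others existed before. -/
theorem Carry.finish (hm : 0 < P .m) (h : Carry P A x th l) (hd : ¬ P .m ∣ x / P .m ^ l) : Levels P A x th := by
  have key : ∀ l' g, (g + 1) * P .m ^ l' = x → l' ≤ l := by
    intro l' g hg; by_contra hlt; apply hd
    have h1 : P .m ^ (l + 1) ∣ x :=
      (Nat.pow_dvd_pow _ (show l + 1 ≤ l' by omega)).trans (Dvd.intro_left (g + 1) hg)
    rw [pow_succ] at h1; exact (dvd_div_iff_mul_dvd h.dvd).2 h1
  refine ⟨fun l' g hg => h.data l' g hg ?_, fun l' g hg => h.ptr l' g ?_⟩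
  · rcases hg.eq_or_lt with h1 | h1
    · exact .inl (key l' g h1)
    · exact .inr h1
  · by_cases h1 : (g + 1) * P .m ^ l' = x
    · exact .inr ⟨key l' g h1, h1⟩
    · exact .inl (hg.of_pred hm h1)

/-- A single block is a group of level zero, and the only group of that level that ends at `x + 1`.
-/
theorem Carry.start (h : Levels P A x th) (hs : A.Sorted (P .b) (4 * P .G + x) (P .b))
    (hp : IsSplit th (P .b) (A.disk (5 * P .G + x) 0) (A.entry (P .b) (4 * P .G + x)))
    (hv : ∀ o < P .b, A.disk (5 * P .G + x) o < P .V) :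
    Carry P A (x + 1) th 0 := by
  have h0 : GroupData P A 0 x := by simpa [GroupData, levelBase]
  have h1 : GroupPtr P A th 0 x := by simpa [GroupPtr, levelBase, ptrBase] using ⟨hp, hv⟩
  refine ⟨by omega, by simp, fun l' g hg hl => ?_, fun l' g hg => ?_⟩
  · by_cases hx : (g + 1) * P .m ^ l' ≤ x
    · exact h.data l' g hx
    · obtain rfl : l' = 0 := by omega
      simp only [pow_zero, mul_one] at hx hg; obtain rfl : g = x := by omega
      exact h0
  · rcases hg with hg | ⟨hl, hg⟩
    · exact h.ptr l' g (by simpa using hg)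
    · obtain rfl : l' = 0 := by omega
      simp only [pow_zero, mul_one] at hg; obtain rfl : g = x := by omega
      exact h1

theorem AState.content_mul (A : AState) (hb : 0 < b) (base n len : ℕ) : A.content b base (n * len * b) =
      ∑ j ∈ range n, A.content b (base + j * len) (len * b) := by
  rw [content, mul_assoc, map_range_mul]
  refine sum_congr rfl fun j _ => Multiset.map_congr rfl fun i _ => ?_; rw [A.entry_add_mul hb]

/-- The merge writes only into the blocks of the new group and its pointer block, so every other
group keeps its data and its pointer. The content of the new group is the sum of the contents of its
`m` parts, each of which already agrees with level zero. -/
theorem Carry.next (hb : 0 < P .b) (hm : 2 ≤ P .m) (h : Carry P A x th l)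
    (hG : x ≤ P .G) (hy : x = (y + 1) * P .m ^ (l + 1))
    (hd : ∀ q o, (q < levelBase P (l + 1) + y * P .m ^ (l + 1) ∨
      levelBase P (l + 1) + y * P .m ^ (l + 1) + P .m ^ (l + 1) ≤ q) →
      q ≠ ptrBase P (l + 1) + y * P .m ^ (l + 1) → A'.disk q o = A.disk q o)
    (hs : A'.Sorted (P .b) (levelBase P (l + 1) + y * P .m ^ (l + 1)) (P .m ^ (l + 1) * P .b))
    (hc : A'.content (P .b) (levelBase P (l + 1) + y * P .m ^ (l + 1)) (P .m ^ (l + 1) * P .b) =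
      A.content (P .b) (levelBase P l + y * P .m ^ (l + 1)) (P .m ^ (l + 1) * P .b))
    (hp : GroupPtr P A' th (l + 1) y) : Carry P A' x th (l + 1) := by
  have hpos : ∀ l, 0 < P .m ^ l := fun l => by positivity
  have hy' : y * P .m ^ (l + 1) + P .m ^ (l + 1) = x := by rw [hy]; ring
  have hlev : ∀ l' q, q < P .G → (l' ≠ l + 1 ∨ q < y * P .m ^ (l + 1)) → ∀ o,
      A'.disk (levelBase P l' + q) o = A.disk (levelBase P l' + q) o := by
    intro l' q hq hl o; have hpl := hpos (l + 1)
    refine hd _ _ ?_ (region_ne (show 4 + 2 * l' ≠ 5 + 2 * (l + 1) by omega) hq (by omega)); by_contra hcon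
    push Not at hcon
    by_cases hll : l' = l + 1
    · subst hll; omega
    · obtain ⟨q', hq'⟩ := Nat.exists_eq_add_of_le hcon.1; rw [add_assoc] at hq'
      exact region_ne (a := 4 + 2 * l') (a' := 4 + 2 * (l + 1)) (q' := y * P .m ^ (l + 1) + q')
        (by omega) hq (by have := hcon.2; rw [hq', levelBase] at this; omega) hq'
  have hlev0 : ∀ q, q < P .G → ∀ o, A'.disk (4 * P .G + q) o = A.disk (4 * P .G + q) o :=
    fun q hq => hlev 0 q hq (.inl (by omega))
  have hptr : ∀ l' q, q < P .G → (l' ≠ l + 1 ∨ q < y * P .m ^ (l + 1)) →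
      A'.disk (ptrBase P l' + q) = A.disk (ptrBase P l' + q) := by
    intro l' q hq hl; have hpl := hpos (l + 1); funext o; refine hd _ _ ?_ ?_
    · by_contra hcon
      push Not at hcon
      obtain ⟨q', hq'⟩ := Nat.exists_eq_add_of_le hcon.1; rw [add_assoc] at hq'
      exact region_ne (a := 5 + 2 * l') (a' := 4 + 2 * (l + 1)) (q' := y * P .m ^ (l + 1) + q')
        (by omega) hq (by have := hcon.2; rw [hq', levelBase] at this; omega) hq'
    · by_cases hll : l' = l + 1
      · subst hll; omega
      · exact region_ne (show 5 + 2 * l' ≠ 5 + 2 * (l + 1) by omega) hq (by omega)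
  have hgrp : ∀ l' g, (g + 1) * P .m ^ l' ≤ x → l' ≠ l + 1 ∨ (g + 1) * P .m ^ l' < x →
      ∀ q < P .m ^ l', g * P .m ^ l' + q < P .G ∧ (l' ≠ l + 1 ∨ g * P .m ^ l' + q < y * P .m ^ (l + 1)) := by
    intro l' g hg hl q hq; rw [add_mul] at hg; refine ⟨by omega, ?_⟩
    by_cases hll : l' = l + 1
    · right; subst hll
      have h1 : (g + 1) * P .m ^ (l + 1) < (y + 1) * P .m ^ (l + 1) := by rw [← hy]; exact hl.resolve_left (by omega)
      have h2 : g + 1 < y + 1 := Nat.lt_of_mul_lt_mul_right h1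
      exact lt_of_lt_of_le (show _ < (g + 1) * P .m ^ (l + 1) by rw [add_mul]; omega)
        (Nat.mul_le_mul_right _ (by omega))
    · exact .inl hll
  have hdata : ∀ l' g, (g + 1) * P .m ^ l' ≤ x → l' ≠ l + 1 ∨ (g + 1) * P .m ^ l' < x →
      GroupData P A l' g → GroupData P A' l' g := by
    intro l' g hg hl hG; have h1 := hgrp l' g hg hl; refine hG.congr hb (fun q hq o _ => ?_) (fun q hq o _ => ?_)
    · rw [add_assoc]; exact hlev _ _ (h1 q hq).1 (h1 q hq).2 o
    · rw [add_assoc]; exact hlev0 _ (h1 q hq).1 o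
  have hnew : GroupData P A' (l + 1) y := by
    refine ⟨hs, hc.trans ?_⟩
    have h0 : A'.content (P .b) (4 * P .G + y * P .m ^ (l + 1)) (P .m ^ (l + 1) * P .b) =
        A.content (P .b) (4 * P .G + y * P .m ^ (l + 1)) (P .m ^ (l + 1) * P .b) :=
      content_congr hb fun q hq o _ => by rw [add_assoc]; exact hlev0 _ (by omega) o
    rw [h0, pow_succ', A.content_mul hb, A.content_mul hb]; refine sum_congr rfl fun j hj => ?_
    have hj' := mem_range.1 hj
    have h2 : (y * P .m + j + 1) * P .m ^ l ≤ x := by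
      rw [hy, pow_succ', ← mul_assoc]; refine Nat.mul_le_mul_right _ ?_; rw [add_mul]; omega
    have := (h.data l (y * P .m + j) h2 (.inl le_rfl)).2
    rw [show y * (P .m * P .m ^ l) = y * P .m * P .m ^ l by ring, add_assoc, ← add_mul, this, add_assoc, ← add_mul]
  refine ⟨h.pos, ⟨y + 1, by rw [hy, mul_comm]⟩, fun l' g hg hl => ?_, fun l' g hg => ?_⟩
  · by_cases h1 : l' = l + 1 ∧ (g + 1) * P .m ^ l' = x
    · obtain ⟨rfl, h1⟩ := h1; rw [hy] at h1
      obtain rfl : g = y := by have := eq_of_mul_eq_mul_right (hpos _) h1; omega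
      exact hnew
    · have h2 : l' ≠ l + 1 ∨ (g + 1) * P .m ^ l' < x := by omega
      exact hdata l' g hg h2 (h.data l' g hg (by omega))
  · by_cases h1 : l' = l + 1 ∧ (g + 1) * P .m ^ l' = x
    · obtain ⟨rfl, h1⟩ := h1; rw [hy] at h1
      obtain rfl : g = y := by have := eq_of_mul_eq_mul_right (hpos _) h1; omega
      exact hp
    · have h2 : (g + 1) * P .m ^ l' ≤ x := by
        rcases hg with hg | hg
        · have := hg.1; omega
        · omega
      have h3 : l' ≠ l + 1 ∨ (g + 1) * P .m ^ l' < x := by omega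
      have h4 := hgrp l' g h2 h3
      have h5 : GroupPtr P A th l' g := by
        refine h.ptr l' g ?_; rcases hg with hg | ⟨hg, hg'⟩
        · exact .inl hg
        · exact .inr ⟨by omega, hg'⟩
      refine h5.congr hb (fun q hq o _ => ?_) ?_
      · rw [add_assoc]; exact hlev _ _ (h4 q hq).1 (h4 q hq).2 o
      · have := h4 0 (hpos _); exact hptr _ _ this.1 this.2

/-! ### Adding blocks to the levels, and the amortized cost. -/

/-- Merge the last `m` groups of a level as long as they are complete. -/
def carryLoop : ACmd :=
  .loop ((§.q % §.m).eq 0) ( .s1 ≔ §.x0 - §.pw * §.m ;; merge ;; .pw ≔ §.pw * §.m ;; .sb ≔ §.sb + 2 * §.G ;;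
    .q ≔ §.q / §.m)

/-- Add one block of level zero to the levels. -/
def addBlock : ACmd :=
  .set 5 0 0 ;;
  .write (5 * §.G + §.x0) 5 0 ;;
  .x0 ≔ §.x0 + 1 ;;
  .sb ≔ 4 * §.G ;;
  .pw ≔ 1 ;;
  .q ≔ §.x0 ;;
  carryLoop

/-- Add all new blocks of level zero to the levels. -/
def normalize : ACmd := .loop ((§.x0).lt §.x1) addBlock

/-- The cost of the levels for `x` blocks. -/
def levelCost (m K x : ℕ) : ℕ := x + 4 * ∑ l ∈ range K, m ^ (l + 1) * (x / m ^ (l + 1))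

/-- The floor of `x / m ^ (i + 1)` jumps exactly when `m ^ (i + 1)` divides `x + 1`, which is when a
merge at that level is due. The summand 1 pays for the initial pointer block. -/
theorem levelCost_succ {K : ℕ} (hl : l ≤ K) (hd : m ^ l ∣ x + 1) :
    levelCost m K x + 1 + 4 * ∑ i ∈ range l, m ^ (i + 1) ≤ levelCost m K (x + 1) := by
  have h1 : ∑ i ∈ range l, m ^ (i + 1) ≤ ∑ i ∈ range K, if m ^ (i + 1) ∣ x + 1 then m ^ (i + 1) else 0 := by
    calc ∑ i ∈ range l, m ^ (i + 1) = ∑ i ∈ range l,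
          if m ^ (i + 1) ∣ x + 1 then m ^ (i + 1) else 0 := by
          refine sum_congr rfl fun i hi => (if_pos ?_).symm; exact (pow_dvd_pow _ (mem_range.1 hi)).trans hd
      _ ≤ _ := sum_le_sum_of_subset (range_mono hl)
  have h2 : ∑ i ∈ range K, m ^ (i + 1) * ((x + 1) / m ^ (i + 1)) = ∑ i ∈ range K, m ^ (i + 1) * (x / m ^ (i + 1)) +
      ∑ i ∈ range K, if m ^ (i + 1) ∣ x + 1 then m ^ (i + 1) else 0 := by
    rw [← sum_add_distrib]; refine sum_congr rfl fun i _ => ?_; rw [Nat.succ_div, mul_add]; split_ifs <;> simp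
  rw [levelCost, levelCost, h2]; omega

/-- Each level contributes at most `x`, and levels from `log m x` on contribute nothing; thus the
number `K` of levels provided is irrelevant. -/
theorem levelCost_le {K : ℕ} (hm : 2 ≤ m) : levelCost m K x ≤ x + 4 * (x * log m x) := by
  have h : ∑ l ∈ range K, m ^ (l + 1) * (x / m ^ (l + 1)) ≤ ∑ l ∈ range K, if l < log m x then x else 0 := by
    refine sum_le_sum fun l _ => ?_; split_ifs with hl
    · exact mul_div_le _ _
    · rw [div_eq_of_lt (lt_pow_of_log_lt (by omega) (by omega)), mul_zero]
  have h' : ∑ l ∈ range K, (if l < log m x then x else 0) ≤ x * log m x := by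
    rw [← sum_filter, sum_const, smul_eq_mul, mul_comm]; refine Nat.mul_le_mul_left _ ?_
    calc _ ≤ (range (log m x)).card := card_le_card fun i hi => by simp at hi ⊢; omega
      _ = _ := card_range _
  rw [levelCost]; omega

theorem Queue.congr (hb : 0 < P .b) (h : Queue P A x lo S) (hc : A'.reg .cnt = A.reg .cnt) (hx : A'.reg .x1 = A.reg .x1)
    (h6 : A'.arr 6 = A.arr 6)
    (hd : ∀ q < A.reg .x1, A'.disk (4 * P .G + q) = A.disk (4 * P .G + q)) :
    Queue P A' x lo S := by
  refine ⟨hc ▸ h.cnt_lt, ?_, ?_, ?_, ?_, hx ▸ h.le_x1, ?_, ?_⟩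
  · rw [hc, h6]; exact h.batch_sorted
  · rw [hc, h6]; exact h.batch_mem
  · rw [hx]; intro q hq; rw [hd q hq]; exact h.sorted q hq
  · rw [hx]; intro q hq; rw [hd q hq]; exact h.le_pad q hq
  · rw [hx]; intro q hq hq'; rw [hd q hq']; exact h.lo_le q hq hq'
  · rw [hx, hc, h6, content_congr (A := A) hb fun q hq o _ => by rw [hd q hq]]; exact h.mset

theorem Queue.mono {x' lo' : ℕ} (h : Queue P A x lo S) (hx : x ≤ x') (hx' : x' ≤ A.reg .x1) (hlo : lo' ≤ lo) :
    Queue P A x' lo' S :=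
  ⟨h.cnt_lt, h.batch_sorted, fun i hi => ⟨(h.batch_mem i hi).1, hlo.trans (h.batch_mem i hi).2⟩,
    h.sorted, h.le_pad, hx',
    fun q hq hq' o ho => hlo.trans (h.lo_le q (hx.trans hq) hq' o ho), h.mset⟩

/-- Sorting only permutes: every entry of a group occurs in its level-zero blocks, so bounds need to
be maintained for level zero only. -/
theorem GroupData.exists_entry (h : GroupData P A l g) (hi : i < P .m ^ l * P .b) : ∃ q < P .m ^ l, ∃ o < P .b,
      A.entry (P .b) (levelBase P l + g * P .m ^ l) i = A.disk (4 * P .G + g * P .m ^ l + q) o := by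
  have hm : A.entry (P .b) (levelBase P l + g * P .m ^ l) i ∈
      A.content (P .b) (levelBase P l + g * P .m ^ l) (P .m ^ l * P .b) :=
    Multiset.mem_map_of_mem _ (Multiset.mem_range.2 hi)
  rw [h.2, content, Multiset.mem_map] at hm; obtain ⟨k, hk, hk'⟩ := hm; rw [Multiset.mem_range] at hk
  refine ⟨k / P .b, Nat.div_lt_of_lt_mul (by rwa [mul_comm]), k % P .b, mod_lt _ ?_, hk'.symm⟩
  rcases Nat.eq_zero_or_pos (P .b) with h0 | h0
  · simp [h0] at hk
  · exact h0

theorem GroupData.entry_le (h : GroupData P A l g) (hq : Queue P A x lo S) (hg : (g + 1) * P .m ^ l ≤ A.reg .x1)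
    (hi : i < P .m ^ l * P .b) :
    A.entry (P .b) (levelBase P l + g * P .m ^ l) i ≤ P .pad := by
  obtain ⟨q, hq', o, ho, he⟩ := h.exists_entry hi; rw [he, add_assoc]; rw [add_mul] at hg
  exact hq.le_pad _ (by omega) o ho

theorem Env.level_lt (hE : Env L P) (h : P .m ^ l ≤ P .G) : l < P .G :=
  lt_of_lt_of_le (Nat.lt_pow_self (by have := hE.two_le_m; omega)) h

theorem Env.addr_lt (hE : Env L P) (h : l ≤ P .G) : (8 + 2 * l) * P .G < L.bound := by
  refine lt_of_le_of_lt ?_ hE.G_mul; rw [mul_comm]; exact Nat.mul_le_mul_left _ (by omega)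

/-- Incrementing a counter in base `m`: as long as the current digit of `x` is 0, its last `m`
groups of this level are complete and are merged. Round `i` costs `4 * m ^ (i + 1)`. -/
theorem carryLoop_wp (hE : Env L P) (hP : A.Has P) (hq : Queue P A y lo S) (hx1 : A.reg .x1 ≤ P .G)
    (hx : A.reg .x0 = x) (hxx : x ≤ A.reg .x1) (hth : A.reg .th = th) (hC : Carry P A x th 0)
    (hsb : A.reg .sb = 4 * P .G) (hpw : A.reg .pw = 1) (hq0 : A.reg .q = x)
    (hQ : ∀ A' t' l, A'.Frame A [.j, .best, .bj, .z1, .ptr, .o, .s1, .pw, .sb, .q] [3, 4, 5] →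
      (∀ q < 5 * P .G, A'.disk q = A.disk q) → Levels P A' x th →
      P .m ^ l ∣ x → t' ≤ t + 4 * ∑ i ∈ range l, P .m ^ (i + 1) → Q A' t') :
    L.wp carryLoop Q A t := by
  have hb := hE.b_pos; have hw := L.width; have hbl := L.bound_le; have hm2 := hE.two_le_m
  refine wp_while (fun A' t' => ∃ l, A'.Frame A [.j, .best, .bj, .z1, .ptr, .o, .s1, .pw, .sb, .q] [3, 4, 5] ∧
      (∀ q < 5 * P .G, A'.disk q = A.disk q) ∧ Carry P A' x th l ∧
      A'.reg .sb = levelBase P l ∧ A'.reg .pw = P .m ^ l ∧ A'.reg .q = x / P .m ^ l ∧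
      t' ≤ t + 4 * ∑ i ∈ range l, P .m ^ (i + 1)) (fun A' => A'.reg .q) ?_ ?_ ?_ ?_
  · exact ⟨0, .refl _ _ _, fun _ _ => rfl, hC, hsb, by simpa, by simpa, by simp⟩
  · intro A' t' _; simp
  · rintro A' t' ⟨l, hf, hd, hC, hsb', hpw', hq', ht⟩ hmod; have hP' := hP.frame hf (by decide)
    have hmod' : x / P .m ^ l % P .m = 0 := by
      have : ((§.q % §.m).eq 0).Holds A' := hmod; simpa [hq', hP' .m rfl] using this
    have hpos : 0 < P .m ^ l := by positivity
    obtain ⟨y', hy'⟩ : ∃ y', x = (y' + 1) * P .m ^ (l + 1) := by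
      have h1 := Nat.div_mul_cancel hC.dvd; have h2 := Nat.div_mul_cancel (dvd_of_mod_eq_zero hmod')
      refine ⟨x / P .m ^ l / P .m - 1, ?_⟩
      have h3 : x / P .m ^ l / P .m ≠ 0 := by
        intro h0; rw [h0, zero_mul] at h2; rw [← h2, zero_mul] at h1; have := hC.pos; omega
      rw [Nat.sub_add_cancel (Nat.pos_of_ne_zero h3), pow_succ', ← mul_assoc, h2, h1]
    have hs1 : x - P .m ^ l * P .m = y' * P .m ^ (l + 1) := by rw [hy', pow_succ, add_mul]; omega
    have hpowle : P .m ^ (l + 1) ≤ P .G :=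
      le_trans (hy' ▸ Nat.le_mul_of_pos_left _ (by omega)) (hxx.trans hx1)
    have hlt := hE.level_lt hpowle; have haddr := hE.addr_lt (l := l) (by omega)
    have ex0 : A'.reg .x0 = x := by rw [hf.reg _ (by simp), hx]
    have eth : A'.reg .th = th := by rw [hf.reg _ (by simp), hth]
    have ex1 : A'.reg .x1 = A.reg .x1 := hf.reg _ (by simp)
    have hmm : P .m ^ l * P .m = P .m ^ (l + 1) := (pow_succ _ _).symm; have hGb := hE.Gb
    have hG1 : P .G ≤ P .G * P .b := Nat.le_mul_of_pos_right _ hb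
    have hqq : Queue P A' y lo S := hq.congr hb (hf.reg _ (by simp)) ex1 (hf.arr _ (by simp))
      fun q hq => hd _ (by omega)
    have hsb2 : levelBase P l + 4 * P .G = (8 + 2 * l) * P .G := by rw [levelBase]; ring
    have hsb4 : levelBase P l + 4 * P .G < 2 ^ mc.w := by rw [hsb2]; exact lt_of_lt_of_le haddr hbl
    have hgl : ∀ j < P .m, (y' * P .m + j + 1) * P .m ^ l ≤ x := by
      intro j hj; rw [hy', pow_succ', ← mul_assoc]; refine Nat.mul_le_mul_right _ ?_; rw [add_mul]; omega
    have hbase : ∀ j, levelBase P l + y' * P .m ^ (l + 1) + j * P .m ^ l =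
        levelBase P l + (y' * P .m + j) * P .m ^ l := by
      intro j; rw [pow_succ']; ring
    rw [wp_seq, wp_assign]; refine ⟨?_, ?_⟩
    · simp [hpw', hP' .m rfl]; omega
    simp only [AExpr.val_sub, AExpr.val_mul, AExpr.val_r, hpw', hP' .m rfl, ex0, hs1]; rw [wp_seq]
    refine merge_wp hE (sb := levelBase P l) (s1 := y' * P .m ^ (l + 1)) (pw := P .m ^ l) (th := th)
      (hP'.setReg (by decide)) ⟨hpos, ?_, ?_, ?_, ?_, ?_⟩ (by simp [hsb']) (by simp) (by simp [hpw'])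
      (by simp [eth]) ?_
    · rw [← _root_.pow_succ']; refine le_trans (le_of_eq ?_) (hxx.trans hx1); rw [hy']; ring
    · exact hsb4
    · rw [← _root_.pow_succ']; exact lt_of_le_of_lt (Nat.mul_le_mul_right _ hpowle) hGb
    · intro j hj; rw [hbase]; exact (hC.data l _ (hgl j hj) (.inl le_rfl)).1
    · intro j hj i hi; rw [hbase, hE.inf_eq]
      exact lt_succ_of_le ((hC.data l _ (hgl j hj) (.inl le_rfl)).entry_le hqq ((hgl j hj).trans (ex1 ▸ hxx)) hi)
    · intro A2 t2 hf2 hd2 hs2 hc2 hp2 hv2 ht2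
      have e2 : levelBase P l + 2 * P .G = levelBase P (l + 1) := by simp only [levelBase]; ring
      have e3 : levelBase P l + 3 * P .G = ptrBase P (l + 1) := by simp only [levelBase, ptrBase]; ring
      rw [e2, e3] at hd2; rw [e2] at hs2 hc2; rw [e2, e3] at hp2; rw [e3] at hv2
      rw [← _root_.pow_succ'] at hd2 hs2 hc2 hp2 ht2
      have hf3 : A2.Frame A [.j, .best, .bj, .z1, .ptr, .o, .s1, .pw, .sb, .q] [3, 4, 5] :=
        (hf2.mono (by simp) (by simp)).trans (hf.setReg (by simp))
      have hP2 := hP.frame hf3 (by decide)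
      have hpw2 : A2.reg .pw = P .m ^ l := by rw [hf2.reg _ (by simp)]; simp [hpw']
      have hsb₂ : A2.reg .sb = levelBase P l := by rw [hf2.reg _ (by simp)]; simp [hsb']
      have hq2 : A2.reg .q = x / P .m ^ l := by rw [hf2.reg _ (by simp)]; simp [hq']
      simp [hpw2, hP2 .m rfl, hP2 .G rfl, hsb₂, hq2]
      refine ⟨by omega, by omega, ⟨hf3, fun q hq => ?_, l + 1, ?_, e2, hmm, ?_, ?_⟩, ?_⟩
      · rw [← hd q hq]; funext o; refine hd2 q o ?_ ?_
        · left; rw [levelBase]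
          have : 6 * P .G ≤ (4 + 2 * (l + 1)) * P .G := Nat.mul_le_mul_right _ (by omega); omega
        · rw [ptrBase]
          have : 7 * P .G ≤ (5 + 2 * (l + 1)) * P .G := Nat.mul_le_mul_right _ (by omega); omega
      · exact (Carry.next hb hm2 hC (hxx.trans hx1) hy' hd2 hs2 hc2 ⟨hp2, hv2⟩)
      · rw [pow_succ, Nat.div_div_eq_div_mul]
      · rw [sum_range_succ]; omega
      · rw [hq']; refine Nat.div_lt_self ?_ hm2; exact Nat.div_pos (le_of_dvd hC.pos hC.dvd) hpos
  · rintro A' t' ⟨l, hf, hd, hC, hsb', hpw', hq', ht⟩ hmod; have hP' := hP.frame hf (by decide)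
    have hmod' : ¬ x / P .m ^ l % P .m = 0 := by
      have : ¬ ((§.q % §.m).eq 0).Holds A' := not_not.2 hmod; simpa [hq', hP' .m rfl] using this
    exact hQ A' t' l hf hd (hC.finish (by omega) (by rwa [dvd_iff_mod_eq_zero])) hC.dvd ht

/-- The new block starts with pointer 0. This is a valid split since blocks not yet in the levels
only contain values that are at least `lo`, and `th ≤ lo`: nothing in them has been delivered. -/
theorem addBlock_wp (hE : Env L P) (hP : A.Has P) (hq : Queue P A x lo S) (hx1 : A.reg .x1 ≤ P .G)
    (hx : A.reg .x0 = x) (hxx : x < A.reg .x1) (hth : A.reg .th = th) (hlo : th ≤ lo)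
    (hL : Levels P A x th)
    (hQ : ∀ A' t', A'.Frame A [.j, .best, .bj, .z1, .ptr, .o, .x0, .s1, .pw, .sb, .q] [3, 4, 5] →
      (∀ q < 5 * P .G, A'.disk q = A.disk q) → A'.reg .x0 = x + 1 → Levels P A' (x + 1) th →
      t' + levelCost (P .m) (P .G) x ≤ t + levelCost (P .m) (P .G) (x + 1) → Q A' t') :
    L.wp addBlock Q A t := by
  have hn := hE.narr; have hb := hE.b_pos; have hbcap := hE.b_le_cap; have hbl := L.bound_le; have hw := L.width
  have hm2 := hE.two_le_m; have hblk := hE.blk; have hGb := hE.Gb; have hadr := hE.addr_lt (l := 0) (by omega)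
  obtain ⟨A1, hA1⟩ : ∃ A1, A1 = ((A.setArr 5 0 0).writeDisk (P .b) (5 * P .G + x) 5 0) := ⟨_, rfl⟩
  have hd1 : ∀ q, q ≠ 5 * P .G + x → A1.disk q = A.disk q := by intro q hq; funext o; simp [hA1, hq]
  have hC : (∀ o < P .b, A.arr 5 o < L.bound ∨ o = 0) → Carry P A1 (x + 1) th 0 := by
    intro hbd
    have hrow : ∀ o, A1.disk (4 * P .G + x) o = A.disk (4 * P .G + x) o := fun o => by rw [hd1 _ (by omega)]
    have hlev : ∀ l q, q < x → A1.disk (levelBase P l + q) = A.disk (levelBase P l + q) :=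
      fun l q hq => hd1 _ (region_ne (show 4 + 2 * l ≠ 5 by omega) (by omega) (by omega))
    have hptr : ∀ l q, q < x → A1.disk (ptrBase P l + q) = A.disk (ptrBase P l + q) := by
      intro l q hq; refine hd1 _ ?_; rcases Nat.eq_zero_or_pos l with rfl | hl
      · rw [ptrBase]; omega
      · exact region_ne (show 5 + 2 * l ≠ 5 by omega) (by omega) (by omega)
    have hpos : ∀ l, 0 < P .m ^ l := fun l => by positivity
    have hL1 : Levels P A1 x th := by
      refine ⟨fun l g hg => ?_, fun l g hg => ?_⟩
      · have hg' := hg; rw [add_mul] at hg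
        refine (hL.data l g hg').congr hb (fun q hq o _ => ?_) (fun q hq o _ => ?_)
        · rw [add_assoc, hlev l _ (by omega)]
        · rw [add_assoc]; exact congrFun (hlev 0 _ (by omega)) o
      · have hg' := hg.1; have := hpos l; rw [add_mul] at hg'; refine (hL.ptr l g hg).congr hb (fun q hq o _ => ?_) ?_
        · rw [add_assoc, hlev l _ (by omega)]
        · rw [hptr l _ (by omega)]
    have hent : ∀ i < P .b, A1.entry (P .b) (4 * P .G + x) i = A.disk (4 * P .G + x) i := by
      intro i hi; rw [entry, div_eq_of_lt hi, mod_eq_of_lt hi, add_zero, hrow]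
    refine Carry.start hL1 ?_ ?_ ?_
    · intro i k hik hk; rw [hent i (by omega), hent k hk]; exact hq.sorted x hxx i k hik hk
    · have : A1.disk (5 * P .G + x) 0 = 0 := by simp [hA1, hb]
      rw [this]; refine ⟨by omega, by omega, fun i _ hi => ?_⟩; rw [hent i hi]
      exact hlo.trans (hq.lo_le x le_rfl hxx i hi)
    · intro o ho; have := hbd o ho; simp [hA1, ho, hE.V_eq]; split_ifs <;> omega
  have hf1 : A1.Frame A [.j, .best, .bj, .z1, .ptr, .o, .x0, .s1, .pw, .sb, .q] [3, 4, 5] := by rw [hA1]; simp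
  have hP1 := hP.frame hf1 (by decide); have ex0 : A1.reg .x0 = x := by rw [hA1]; simpa
  have ex1 : A1.reg .x1 = A.reg .x1 := hf1.reg _ (by simp); simp [addBlock, hP .G rfl, hx, hblk, ← hA1, ex0, hP1 .G rfl]
  refine ⟨by omega, by omega, fun hbd => ⟨by omega, by omega, ?_⟩⟩
  replace hC := hC fun o ho => by have := hbd o ho; split_ifs at this <;> omega
  have hq1 : Queue P A1 x lo S := hq.congr hb (hf1.reg _ (by simp)) ex1 (hf1.arr _ (by simp))
    fun q hq => hd1 _ (by omega)
  refine carryLoop_wp hE (x := x + 1) (y := x) (th := th) (lo := lo) (S := S) ?_ ?_ ?_ ?_ ?_ ?_ ?_ ?_ ?_ ?_ ?_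
  · exact (((hP1.setReg rfl).setReg rfl).setReg rfl).setReg rfl
  · exact hq1.congr hb (by simp) (by simp) (by simp) (by simp)
  · simpa [ex1]
  · simp
  · simpa [ex1]
  · simp [hf1.reg .th (by simp), hth]
  · exact ⟨hC.pos, hC.dvd, hC.data, hC.ptr⟩
  · simp
  · simp
  · simp
  · intro A2 t2 l hf2 hd2 hL2 hdvd ht2
    have hle : l ≤ P .G := by have h1 := le_of_dvd (by omega) hdvd; exact (hE.level_lt (by omega)).le
    have hc := levelCost_succ (m := P .m) hle hdvd
    refine hQ _ _ ((hf2.mono (by simp) (by simp)).trans (by simpa using hf1)) (fun q hq => ?_) ?_ hL2 (by omega)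
    · rw [hd2 q hq]; exact hd1 q (by omega)
    · rw [hf2.reg _ (by simp)]; simp

theorem normalize_wp (hE : Env L P) (hP : A.Has P) (hq : Queue P A x lo S) (hx1 : A.reg .x1 ≤ P .G)
    (hx : A.reg .x0 = x) (hth : A.reg .th = th) (hlo : th ≤ lo)
    (hL : Levels P A x th)
    (hQ : ∀ A' t', A'.Frame A [.j, .best, .bj, .z1, .ptr, .o, .x0, .s1, .pw, .sb, .q] [3, 4, 5] →
      (∀ q < 5 * P .G, A'.disk q = A.disk q) → A'.reg .x0 = A.reg .x1 →
      Levels P A' (A.reg .x1) th → Queue P A' (A.reg .x1) lo S →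
      t' + levelCost (P .m) (P .G) x ≤ t + levelCost (P .m) (P .G) (A.reg .x1) → Q A' t') :
    L.wp normalize Q A t := by
  have hb := hE.b_pos
  refine wp_while (fun A' t' =>
      A'.Frame A [.j, .best, .bj, .z1, .ptr, .o, .x0, .s1, .pw, .sb, .q] [3, 4, 5] ∧
      (∀ q < 5 * P .G, A'.disk q = A.disk q) ∧ Levels P A' (A'.reg .x0) th ∧
      Queue P A' (A'.reg .x0) lo S ∧
      t' + levelCost (P .m) (P .G) x ≤ t + levelCost (P .m) (P .G) (A'.reg .x0))
    (fun A' => A.reg .x1 - A'.reg .x0) ?_ ?_ ?_ ?_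
  · exact ⟨.refl _ _ _, fun _ _ => rfl, hx ▸ hL, hx ▸ hq, by rw [hx]⟩
  · intro A' t' _; simp
  · rintro A' t' ⟨hf, hd, hL', hq', ht⟩ hlt
    have hlt' : A'.reg .x0 < A'.reg .x1 := by have : ((§.x0).lt §.x1).Holds A' := hlt; simpa using this
    have ex1 : A'.reg .x1 = A.reg .x1 := hf.reg _ (by simp)
    refine addBlock_wp hE (hP.frame hf (by decide)) hq' (ex1 ▸ hx1) rfl hlt'
      (by rw [hf.reg _ (by simp), hth]) hlo hL' ?_
    intro A2 t2 hf2 hd2 hx2 hL2 ht2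
    refine ⟨⟨hf2.trans hf, fun q hq => by rw [hd2 q hq, hd q hq], hx2 ▸ hL2, ?_, ?_⟩, ?_⟩
    · refine (hq'.mono (x' := A2.reg .x0) (by omega) (by omega) le_rfl).congr hb
        (hf2.reg _ (by simp)) (hf2.reg _ (by simp)) (hf2.arr _ (by simp)) fun q hq => hd2 _ ?_
      omega
    · rw [hx2]; omega
    · omega
  · rintro A' t' ⟨hf, hd, hL', hq', ht⟩ hlt
    have hlt' : ¬ A'.reg .x0 < A'.reg .x1 := by have : ¬ ((§.x0).lt §.x1).Holds A' := not_not.2 hlt; simpa using this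
    have ex1 : A'.reg .x1 = A.reg .x1 := hf.reg _ (by simp); have hle := hq'.le_x1
    have he : A'.reg .x0 = A.reg .x1 := by omega
    rw [he] at hL' hq' ht; exact hQ A' t' hf hd he hL' hq' ht

/-! ### Delivery of all messages below a key. -/

/-- Load the block of entry number `ptr` of the current group, if there is such an entry. -/
def groupLoad : ACmd :=
  .when ((§.ptr).lt (§.pw * §.b)) (.read (§.sb + §.off + §.ptr / §.b) 2 0)

/-- Run `h` for the entry number `ptr`, and advance. -/
def groupNext (h : ACmd) : ACmd :=
  .val ≔ .get 2 (§.ptr % §.b) ;; h ;; .ptr ≔ §.ptr + 1 ;;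
  .when ((§.ptr % §.b).eq 0) groupLoad

/-- Run `h` for all entries of group `q` from its pointer on that are less than `key`. -/
def groupScan (h : ACmd) : ACmd :=
  .off ≔ §.q * §.pw ;;
  .read (§.sb + §.G + §.off) 2 0 ;;
  .ptr ≔ .get 2 0 ;;
  groupLoad ;;
  .loop ((§.ptr).lt (§.pw * §.b) * (AExpr.get 2 (§.ptr % §.b)).lt §.key) (groupNext h) ;;
  .set 2 0 §.ptr ;;
  .write (§.sb + §.G + §.off) 2 0

/-- Run `h` for all entries of the queue that are less than `key` and were not extracted before. -/
def extract (h : ACmd) : ACmd :=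
  .q ≔ §.x0 ;; .pw ≔ 1 ;; .sb ≔ 4 * §.G ;;
  .loop §.q (.ite (§.q % §.m) (.q ≔ §.q - 1 ;; groupScan h)
    (.q ≔ §.q / §.m ;; .pw ≔ §.pw * §.m ;; .sb ≔ §.sb + 2 * §.G))

/-- The command `h` preserves the invariant `J` when the entries of `T` are handled one by one. -/
structure Handler (L : Layout mc a) (P : Var → ℕ) (h : ACmd) (J : Multiset ℕ → AState → Prop)
    (T : Multiset ℕ) (x : ℕ) (hxs : List Var) (hfs : List ℕ) : Prop where
  par : ∀ y ∈ hxs, y.isPar = false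
  regs : ∀ y ∈ hxs, y ∉ [Var.q, .pw, .sb, .off, .ptr, .key, .x0]
  arrs : 2 ∉ hfs
  stable : ∀ H A A', A'.Frame A [.q, .pw, .sb, .off, .ptr, .val] [2] →
    (∀ q < 5 * P .G, A'.disk q = A.disk q) → J H A → J H A'
  run : ∀ H A t, A.Has P → A.reg .x0 = x → J H A → (A.reg .val ::ₘ H ≤ T) →
    L.wp h (fun A' t' => A'.Frame A hxs hfs ∧ J (A.reg .val ::ₘ H) A' ∧
      -- The handler may send messages, but only into level-zero blocks from `x` on, so the groups
      -- being scanned stay intact. Its transfers are paid by the growth of `x1`.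
      (∀ q, (q < 4 * P .G + x ∨ 5 * P .G ≤ q) → A'.disk q = A.disk q) ∧
      t' + A.reg .x1 ≤ t + A'.reg .x1) A t

/-- The values in the range from `lo` to `hi - 1`. -/
def between (lo hi : ℕ) (S : Multiset ℕ) : Multiset ℕ := S.filter fun v => lo ≤ v ∧ v < hi

theorem between_add (lo hi : ℕ) (S T : Multiset ℕ) :
    between lo hi (S + T) = between lo hi S + between lo hi T := Multiset.filter_add ..

/-- The state of the scan of a group with the entries `e`. -/
structure ScanInv (e : ℕ → ℕ) (th th' len p₀ p : ℕ) : Prop where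
  le : p₀ ≤ p
  le_len : p ≤ len
  lt : ∀ i < p, e i < th'
  ge : ∀ i, p₀ ≤ i → i < len → th ≤ e i
  sorted : ∀ i k, i ≤ k → k < len → e i ≤ e k

theorem ScanInv.zero {e : ℕ → ℕ} (h : IsSplit th len p e) (hth : th ≤ th')
    (hs : ∀ i k, i ≤ k → k < len → e i ≤ e k) : ScanInv e th th' len p p :=
  ⟨le_rfl, h.1, fun i hi => lt_of_lt_of_le (h.2.1 i hi) hth, h.2.2, hs⟩

/-- Entries before the pointer were delivered earlier, being below the old threshold; so a scan that
resumes at the pointer delivers each message once. -/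
theorem ScanInv.start {e : ℕ → ℕ} (h : IsSplit th len p e) : between th th' ((Multiset.range p).map e) = 0 := by
  rw [between, Multiset.filter_eq_nil]; intro v hv; obtain ⟨i, hi, rfl⟩ := Multiset.mem_map.1 hv
  have := h.2.1 i (Multiset.mem_range.1 hi); omega

theorem ScanInv.step {e : ℕ → ℕ} {p0 : ℕ} (h : ScanInv e th th' len p0 p)
    (hp : p < len) (hlt : e p < th') : ScanInv e th th' len p0 (p + 1) :=
  ⟨h.le.trans (le_succ _), hp, fun i hi => by
    rcases Nat.lt_succ_iff_lt_or_eq.1 hi with hi | rfl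
    · exact h.lt i hi
    · exact hlt, h.ge, h.sorted⟩

theorem ScanInv.cons {e : ℕ → ℕ} {p0 : ℕ} (h : ScanInv e th th' len p0 p)
    (hp : p < len) (hlt : e p < th') : between th th' ((Multiset.range (p + 1)).map e) =
      e p ::ₘ between th th' ((Multiset.range p).map e) := by
  rw [Multiset.range_succ, Multiset.map_cons, between, between, Multiset.filter_cons_of_pos _ ⟨h.ge p h.le hp, hlt⟩]

theorem ScanInv.le_all {e : ℕ → ℕ} (hp : p ≤ len) :
    between th th' ((Multiset.range p).map e) ≤ between th th' ((Multiset.range len).map e) := by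
  refine Multiset.filter_le_filter _ (Multiset.map_le_map ?_); obtain ⟨k, rfl⟩ := Nat.exists_eq_add_of_le hp
  rw [Multiset.range_add]; exact Multiset.le_add_right _ _

/-- By sortedness, the first entry that reaches `th'` bounds all later ones; the stopping position
is thus the new pointer and nothing in range was missed. -/
theorem ScanInv.finish {e : ℕ → ℕ} {p0 : ℕ} (h : ScanInv e th th' len p0 p)
    (hp : p < len → th' ≤ e p) : IsSplit th' len p e ∧
      between th th' ((Multiset.range p).map e) = between th th' ((Multiset.range len).map e) := by
  have hge : ∀ i, p ≤ i → i < len → th' ≤ e i := fun i hi hi' =>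
    (hp (lt_of_le_of_lt hi hi')).trans (h.sorted p i hi hi')
  refine ⟨⟨h.le_len, h.lt, hge⟩, ?_⟩; obtain ⟨k, rfl⟩ := Nat.exists_eq_add_of_le h.le_len
  rw [Multiset.range_add, Multiset.map_add, between_add, Multiset.map_map]
  have : between th th' ((Multiset.range k).map (e ∘ (p + ·))) = 0 := by
    rw [between, Multiset.filter_eq_nil]; intro v hv; obtain ⟨i, hi, rfl⟩ := Multiset.mem_map.1 hv
    have := hge (p + i) (by omega) (by have := Multiset.mem_range.1 hi; omega); simp only [Function.comp]; omega
  rw [this, add_zero]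

theorem AExpr.holds_mul (e1 e2 : AExpr) : (e1 * e2).Holds A ↔ e1.Holds A ∧ e2.Holds A := by simp [AExpr.Holds]

theorem groupLoad_wp (hE : Env L P) (hP : A.Has P) (hp : A.reg .ptr = p) (hpw : A.reg .pw = pw)
    (hbase : A.reg .sb + A.reg .off = base) (haddr : base + pw < 2 ^ mc.w)
    (hlen : pw * P .b < 2 ^ mc.w)
    (hbd : p < pw * P .b → ∀ o < P .b, A.disk (base + p / P .b) o < L.bound)
    (hQ : ∀ A' t', A'.Frame A [] [2] → A'.disk = A.disk →
      (p < pw * P .b → ∀ o < P .b, A'.arr 2 o = A.disk (base + p / P .b) o) → t' ≤ t + 1 → Q A' t') :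
    L.wp groupLoad Q A t := by
  have hn := hE.narr; have hbcap := hE.b_le_cap; have hblk := hE.blk
  have hdiv : p < pw * P .b → p / P .b < pw := fun h => Nat.div_lt_of_lt_mul (by rwa [mul_comm])
  simp [groupLoad, hp, hpw, hbase, hP .b rfl, hblk]
  refine ⟨hlen, fun h1 => ⟨⟨⟨by omega, by have := hdiv h1; omega⟩, by omega, hbcap, hbd h1⟩,
    hQ _ _ (by simp) (by simp) ?_ (by omega)⟩, fun h1 => hQ _ _ (by simp) rfl ?_ (by omega)⟩
  · intro _ o ho; simp [ho]
  · omega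

/-- Besides the handler there are a read and a write of the pointer block, one initial load, and one
load per block boundary that is crossed. Moving from `p0` to `p` crosses at most `(p - p0) / b + 1`
boundaries. The bound is multiplied by `b`, so that the fractional parts of different groups can be
added before rounding. -/
theorem groupScan_wp (hE : Env L P) {h : ACmd} {J : Multiset ℕ → AState → Prop}
    {T : Multiset ℕ} {hxs : List Var} {hfs : List ℕ} (hH : Handler L P h J T x hxs hfs) (hP : A.Has P)
    (hx : A.reg .x0 = x) (hxG : x ≤ P .G) (hg : (g + 1) * P .m ^ l ≤ x) (hq : A.reg .q = g)
    (hpw : A.reg .pw = P .m ^ l) (hsb : A.reg .sb = levelBase P l) (hkey : A.reg .key = th')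
    (hD : GroupData P A l g) (hpt : GroupPtr P A th l g) (hth : th ≤ th')
    (hpb : ∀ o < P .b, A.disk (ptrBase P l + g * P .m ^ l) o < L.bound)
    (hpad : ∀ i < P .m ^ l * P .b, A.entry (P .b) (levelBase P l + g * P .m ^ l) i ≤ P .pad)
    {H : Multiset ℕ} (hJ : J H A)
    (hT : H + between th th' (A.content (P .b) (levelBase P l + g * P .m ^ l) (P .m ^ l * P .b)) ≤ T)
    (hQ : ∀ A' t', A'.Frame A ([.q, .pw, .sb, .off, .ptr, .val] ++ hxs) ([2] ++ hfs) →
      A'.reg .q = g → A'.reg .pw = P .m ^ l → A'.reg .sb = levelBase P l →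
      (∀ q, (q < 4 * P .G + x ∨ 5 * P .G ≤ q) → q ≠ ptrBase P l + g * P .m ^ l → A'.disk q = A.disk q) →
      (∀ o < P .b, A'.disk (ptrBase P l + g * P .m ^ l) o < L.bound) →
      GroupPtr P A' th' l g →
      J (H + between th th' (A.content (P .b) (levelBase P l + g * P .m ^ l) (P .m ^ l * P .b))) A' →
      P .b * (t' + A.reg .x1) ≤ P .b * (t + A'.reg .x1) + 4 * P .b +
        (between th th' (A.content (P .b) (levelBase P l + g * P .m ^ l) (P .m ^ l * P .b))).card →
      Q A' t') :
    L.wp (groupScan h) Q A t := by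
  have hn := hE.narr; have hb := hE.b_pos; have hbcap := hE.b_le_cap; have hbl := L.bound_le; have hw := L.width
  have hm2 := hE.two_le_m; have hblk := hE.blk; have hGb := hE.Gb; have hinf := hE.inf_lt; have hinf' := hE.inf_eq
  have hpos : 0 < P .m ^ l := by positivity
  have hg' : g * P .m ^ l + P .m ^ l ≤ x := by rwa [add_mul, one_mul] at hg
  have hlt := hE.level_lt (l := l) (by omega); have haddr := hE.addr_lt (l := l) (by omega)
  have hlb : levelBase P l + 4 * P .G = (8 + 2 * l) * P .G := by rw [levelBase]; ring
  have hpb' : levelBase P l + P .G = ptrBase P l := by rw [levelBase, ptrBase]; ring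
  have hlen : P .m ^ l * P .b < L.bound :=
    lt_of_le_of_lt (Nat.mul_le_mul_right _ (by omega)) hGb
  have hpb5 : 5 * P .G ≤ ptrBase P l := Nat.mul_le_mul_right _ (by omega)
  obtain ⟨off, hoff⟩ : ∃ off, off = g * P .m ^ l := ⟨_, rfl⟩
  obtain ⟨len, hlen'⟩ : ∃ len, len = P .m ^ l * P .b := ⟨_, rfl⟩
  simp only [GroupPtr, ← hoff, ← hlen'] at hpt hQ hT hpad hpb hlen hg'; rw [GroupData, ← hoff, ← hlen'] at hD
  obtain ⟨e, he⟩ : ∃ e, e = A.entry (P .b) (levelBase P l + off) := ⟨_, rfl⟩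
  obtain ⟨p0, hp0⟩ : ∃ p0, p0 = A.disk (ptrBase P l + off) 0 := ⟨_, rfl⟩; rw [← he, ← hp0] at hpt
  rw [content, ← he] at hT hQ; rw [← he] at hpad
  have hS0 : ScanInv e th th' len p0 p0 := ScanInv.zero hpt.1 hth (by rw [he]; exact hD.1)
  have hlevel : ∀ q < P .m ^ l, levelBase P l + off + q < 4 * P .G + x ∨ 5 * P .G ≤ levelBase P l + off + q := by
    intro q hq; rcases Nat.eq_zero_or_pos l with rfl | hl
    · left; rw [levelBase]; omega
    · right
      have : 5 * P .G ≤ (4 + 2 * l) * P .G := Nat.mul_le_mul_right _ (by omega); rw [levelBase]; omega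
  have hdiv : ∀ p < len, p / P .b < P .m ^ l := fun p hp =>
    Nat.div_lt_of_lt_mul (by rwa [mul_comm, ← hlen'])
  have hrow : ∀ A' : AState, (∀ q, (q < 4 * P .G + x ∨ 5 * P .G ≤ q) → A'.disk q = A.disk q) →
      ∀ p < len, ∀ o < P .b, A'.disk (levelBase P l + off + p / P .b) o = e (p / P .b * P .b + o) := by
    intro A' hA' p hp o ho; rw [hA' _ (hlevel _ (hdiv p hp)), he, entry_block _ _ ho]
  have hebd : ∀ p < len, ∀ o < P .b, e (p / P .b * P .b + o) < L.bound := by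
    intro p hp o ho
    have := hpad _ (lt_of_lt_of_le (mul_add_lt_mul (hdiv p hp) ho) hlen'.ge); omega
  set xs : List Var := [.q, .pw, .sb, .off, .ptr, .val] ++ hxs with hxs'
  have hpar : ∀ y ∈ xs, y.isPar = false := by
    intro y hy; rw [hxs', List.mem_append] at hy; rcases hy with hy | hy
    · simp at hy; rcases hy with rfl | rfl | rfl | rfl | rfl | rfl <;> rfl
    · exact hH.par y hy
  have hkeep : ∀ y ∈ [Var.q, .pw, .sb, .off, .ptr, .key, .x0], y ∉ hxs :=
    fun y hy hy' => hH.regs y hy' hy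
  obtain ⟨I, hI⟩ : ∃ I : ℕ → AState → ℕ → Prop, ∀ p A' t', I p A' t' ↔
    (A'.Frame A xs ([2] ++ hfs) ∧ A'.reg .q = g ∧ A'.reg .pw = P .m ^ l ∧
    A'.reg .sb = levelBase P l ∧ A'.reg .off = off ∧ A'.reg .key = th' ∧ A'.reg .x0 = x ∧
    A'.reg .ptr = p ∧ (p < len → ∀ o < P .b, A'.arr 2 o = e (p / P .b * P .b + o)) ∧
    (∀ q, (q < 4 * P .G + x ∨ 5 * P .G ≤ q) → A'.disk q = A.disk q) ∧
    J (H + between th th' ((Multiset.range p).map e)) A' ∧ ScanInv e th th' len p0 p ∧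
    t' + A.reg .x1 + p0 / P .b ≤ t + A'.reg .x1 + 2 + p / P .b) := ⟨_, fun _ _ _ => Iff.rfl⟩
  simp [groupScan, hpw, hsb, hq, hP .G rfl, hblk, hb, hpb', ← hoff, ← hp0]; have hoffG : off ≤ P .G := by omega
  have hadr2 : levelBase P l + P .G + off < 2 ^ mc.w := by omega
  rw [hpb'] at hadr2
  refine ⟨by omega, ⟨⟨by omega, hadr2⟩, by omega, hbcap, ?_⟩, ⟨by omega, by omega⟩, ?_⟩
  · intro o ho; rw [← hE.V_eq]; exact hpt.2 o ho
  refine groupLoad_wp hE (p := p0) (base := levelBase P l + off) (pw := P .m ^ l) ?_ (by simp)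
    (by simp [hpw]) (by simp [hsb]) (by omega) (by omega) ?_ ?_
  · exact ((hP.setReg rfl).setReg rfl)
  · intro hp o ho; rw [← hlen'] at hp; simp only [setReg_disk, readArr_disk]; rw [hrow A (fun _ _ => rfl) p0 hp o ho]
    exact hebd p0 hp o ho
  intro A1 t1 hf1 hd1 hbuf1 ht1; simp at hd1 hbuf1
  have hfr1 : A1.Frame A [.q, .pw, .sb, .off, .ptr, .val] [2] :=
    (hf1.mono (by simp) (by simp)).trans (by simp)
  refine wp_while (fun A' t' => ∃ p, I p A' t') (fun A' => len - A'.reg .ptr) ?_ ?_ ?_ ?_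
  · refine ⟨p0, (hI _ _ _).2 ⟨hfr1.mono (by simp [hxs']) (by simp), ?_, ?_, ?_, ?_, ?_, ?_, ?_, ?_,
      fun q _ => by rw [hd1], ?_, hS0, ?_⟩⟩
    · simp [hf1.reg, hq]
    · simp [hf1.reg, hpw]
    · simp [hf1.reg, hsb]
    · simp [hf1.reg]
    · simp [hf1.reg, hkey]
    · simp [hf1.reg, hx]
    · simp [hf1.reg]
    · intro hp o ho
      rw [hbuf1 (by rwa [← hlen']) o ho, hrow A (fun _ _ => rfl) p0 hp o ho]
    · rw [ScanInv.start hpt.1, add_zero]; exact hH.stable H A A1 hfr1 (fun q _ => by rw [hd1]) hJ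
    · simp [hf1.reg]; omega
  · rintro A' t' ⟨p, h⟩
    obtain ⟨hf, hq', hpw', hsb', hoff', hkey', hx', hp, hbuf, hd, hJ', hS, ht⟩ := (hI _ _ _).1 h
    have hP' := hP.frame hf hpar; have hmod := mod_lt p hb; simp [hpw', hP' .b rfl, hp, ← hlen']
    refine ⟨by omega, ⟨by omega, by omega⟩, ?_⟩; split_ifs <;> omega
  · rintro A' t' ⟨p, h⟩ hc
    obtain ⟨hf, hq', hpw', hsb', hoff', hkey', hx', hp, hbuf, hd, hJ', hS, ht⟩ := (hI _ _ _).1 h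
    have hP' := hP.frame hf hpar; have hmod := mod_lt p hb
    have hc' := (AExpr.holds_mul _ _).1 (show AExpr.Holds A' _ from hc)
    simp [hpw', hP' .b rfl, hp, ← hlen', hkey'] at hc'; have hplt := hc'.1
    have hval : A'.arr 2 (p % P .b) = e p := by rw [hbuf hplt _ hmod, div_add_mod']
    rw [hval] at hc'; have hS' := hS.step hplt hc'.2; have hcons := hS.cons hplt hc'.2
    simp only [groupNext, wp_seq, wp_assign]; refine ⟨by simp [hp, hP' .b rfl]; omega, ?_⟩
    have hT' : e p ::ₘ (H + between th th' ((Multiset.range p).map e)) ≤ T := by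
      refine le_trans ?_ hT; rw [← Multiset.add_cons, ← hcons]; exact add_le_add_right (ScanInv.le_all hplt) _
    have hrun := hH.run (H + between th th' ((Multiset.range p).map e)) (A'.setReg .val (e p)) t'
      (hP'.setReg rfl) (by simp [hx']) (hH.stable _ A' _ (by simp) (by simp) hJ') (by simpa using hT')
    simp only [AExpr.val_get, AExpr.val_mod, AExpr.val_r, hp, hP' .b rfl, hval]; refine wp_mono hrun ?_
    rintro A2 t2 ⟨hf2, hJ2, hd2, ht2⟩
    have k2 : ∀ y ∈ [Var.q, .pw, .sb, .off, .ptr, .key, .x0], A2.reg y = A'.reg y := by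
      intro y hy; rw [hf2.reg y (hkeep y hy), setReg_reg, if_neg]; rintro rfl; simp at hy
    have hP2 := (hP'.setReg (x := .val) (v := e p) rfl).frame hf2 hH.par; have kq := k2 .q (by simp)
    have kpw := k2 .pw (by simp); have ksb := k2 .sb (by simp); have koff := k2 .off (by simp)
    have kptr := k2 .ptr (by simp); have kkey := k2 .key (by simp); have kx0 := k2 .x0 (by simp); rw [hq'] at kq
    rw [hpw'] at kpw; rw [hsb'] at ksb; rw [hoff'] at koff; rw [hp] at kptr; rw [hkey'] at kkey; rw [hx'] at kx0
    simp at hJ2 hd2 ht2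
    have harr2 : A2.arr 2 = A'.arr 2 := by rw [hf2.arr 2 hH.arrs]; rfl
    have hfr2 : A2.Frame A xs ([2] ++ hfs) :=
      (hf2.mono (fun y hy => by simp [hxs', hy]) (by simp)).trans (hf.setReg (by simp [hxs']))
    have hd2' : ∀ q, (q < 4 * P .G + x ∨ 5 * P .G ≤ q) → A2.disk q = A.disk q :=
      fun q hq => by rw [hd2 q hq, hd q hq]
    have hsucc := @Nat.succ_div p (P .b)
    have hfin : ∀ A3 t3, A3.Frame (A2.setReg .ptr (p + 1)) [] [2] → A3.disk = A2.disk →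
        (p + 1 < len → ∀ o < P .b, A3.arr 2 o = e ((p + 1) / P .b * P .b + o)) →
        t3 + p / P .b ≤ t2 + (p + 1) / P .b → (fun A' t' => ∃ p, I p A' t') A3 t3 ∧
        len - A3.reg .ptr < len - p := by
      intro A3 t3 hf3 hd3 hbuf3 ht3
      have e3 : ∀ y, A3.reg y = (A2.setReg .ptr (p + 1)).reg y := fun y => hf3.reg y (by simp)
      refine ⟨⟨p + 1, (hI _ _ _).2 ⟨(hf3.mono (by simp) (by simp)).trans (hfr2.setReg (by simp [hxs'])),
        ?_, ?_, ?_, ?_, ?_, ?_, ?_, hbuf3, fun q hq => by rw [hd3, hd2' q hq], ?_, hS', ?_⟩⟩, ?_⟩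
      · simp [e3, kq]
      · simp [e3, kpw]
      · simp [e3, ksb]
      · simp [e3, koff]
      · simp [e3, kkey]
      · simp [e3, kx0]
      · simp [e3]
      · rw [hcons, Multiset.add_cons]; refine hH.stable _ A2 _ ?_ (fun q _ => by rw [hd3]) hJ2
        exact (hf3.mono (by simp) (by simp)).trans (by simp)
      · simp [e3]; omega
      · simp [e3]; omega
    rw [wp_seq, wp_assign]; refine ⟨by simp [kptr]; omega, ?_⟩
    simp only [AExpr.val_add, AExpr.val_r, AExpr.val_ofNat, kptr]; rw [wp_when]
    refine ⟨by simp, fun h1 => ?_, fun h1 => ?_⟩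
    · simp [hP2 .b rfl] at h1
      refine groupLoad_wp hE (p := p + 1) (base := levelBase P l + off) (pw := P .m ^ l) (hP2.setReg rfl) (by simp)
        (by simp [kpw]) (by simp [ksb, koff]) (by omega) (by omega) ?_ ?_
      · intro hp o ho; rw [← hlen'] at hp; simp only [setReg_disk]; rw [hrow A2 hd2' (p + 1) hp o ho]
        exact hebd _ hp o ho
      · intro A3 t3 hf3 hd3 hbuf3 ht3
        refine hfin A3 t3 hf3 (by simpa using hd3) (fun hp o ho => ?_) ?_
        · rw [hbuf3 (by rwa [← hlen']) o ho]; exact hrow A2 hd2' (p + 1) hp o ho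
        · rw [if_pos (dvd_of_mod_eq_zero h1)] at hsucc; omega
    · simp [hP2 .b rfl] at h1; rw [if_neg (by rwa [dvd_iff_mod_eq_zero])] at hsucc
      refine hfin _ _ (.refl _ _ _) rfl (fun hp o ho => ?_) (by omega)
      rw [setReg_arr, harr2, hbuf hplt o ho, hsucc, add_zero]
  · rintro A' t' ⟨p, h⟩ hc
    obtain ⟨hf, hq', hpw', hsb', hoff', hkey', hx', hp, hbuf, hd, hJ', hS, ht⟩ := (hI _ _ _).1 h
    have hP' := hP.frame hf hpar; have hmod := mod_lt p hb
    have hc' : ¬ (_ ∧ _) := fun hh => (show ¬ AExpr.Holds A' _ from not_not.2 hc) ((AExpr.holds_mul _ _).2 hh)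
    simp [hpw', hP' .b rfl, hp, ← hlen', hkey'] at hc'
    have hfin := hS.finish fun hplt => by have := hc' hplt; rwa [hbuf hplt _ hmod, div_add_mod'] at this
    have hple := hS.le_len; simp [hp, hsb', hP' .G rfl, hoff', hblk, hpb']
    refine ⟨⟨by omega, by omega, by omega⟩, ⟨⟨by omega, hadr2⟩, by omega, hbcap⟩, fun hbd => ?_⟩
    refine hQ _ _ (by simpa using hf) (by simpa) (by simpa) (by simpa) ?_ ?_ ?_ ?_ ?_
    · intro q hq hne; funext o; simp [hne]; rw [hd q hq]
    · intro o ho; simpa [ho] using hbd o ho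
    · refine ⟨?_, fun o ho => by simpa [ho, hE.V_eq] using hbd o ho⟩; simp [hb]
      refine IsSplit.congr hfin.1 fun i hi => ?_; have h1 := hrow A' hd i hi (i % P .b) (mod_lt _ hb)
      rw [div_add_mod'] at h1; rw [← h1, entry, writeDisk_disk, if_neg]
      · rfl
      · have := hlevel _ (hdiv i hi); have := hdiv i hi; rw [levelBase, ptrBase, add_assoc]
        exact region_ne (by omega) (by omega) (by omega)
    · rw [← hfin.2]; refine hH.stable _ A' _ (by simp) (fun q hq => ?_) hJ'; funext o
      rw [writeDisk_disk, if_neg (by omega)]; simp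
    · have hcard : p - p0 ≤ (between th th' ((Multiset.range len).map e)).card := by
        rw [← hfin.2]; obtain ⟨k, rfl⟩ := Nat.exists_eq_add_of_le hS.le
        rw [Multiset.range_add, Multiset.map_add, between_add, Multiset.card_add]
        have : between th th' ((((Multiset.range k).map (p0 + ·))).map e) =
            ((Multiset.range k).map (p0 + ·)).map e := by
          rw [between, Multiset.filter_eq_self]; intro v hv; obtain ⟨i, hi, rfl⟩ := Multiset.mem_map.1 hv
          obtain ⟨k', hk', rfl⟩ := Multiset.mem_map.1 hi; have := Multiset.mem_range.1 hk'
          exact ⟨hS.ge _ (by omega) (by omega), hS.lt _ (by omega)⟩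
        rw [this]; simp
      -- Rounding the two pointers to blocks costs at most one extra block, the fourth of the four
      -- that are allowed.
      have h1 : P .b * (p / P .b) ≤ p := mul_div_le _ _
      have h2 : p0 < P .b * (p0 / P .b) + P .b := lt_mul_div_succ p0 hb; simp; have h3 := Nat.mul_le_mul_left (P .b) ht
      simp only [mul_add] at h3 ⊢; have h4 := hS.le; omega

/-- The state of an extraction: the groups of the levels below `l`, and those of level `l` from
number `q` on, were scanned. -/
structure ExtractInv (P : Var → ℕ) (A₀ A : AState) (J : Multiset ℕ → AState → Prop)
    (T : Multiset ℕ) (x th th' l q : ℕ) (H : Multiset ℕ) : Prop where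
  le : q ≤ x / P .m ^ l
  div : q / P .m = x / P .m ^ (l + 1)
  pow_le : x ≠ 0 → P .m ^ l ≤ x
  data : ∀ l' g, (g + 1) * P .m ^ l' ≤ x → GroupData P A l' g
  ptr : ∀ l' g, Active (P .m) x l' g →
    GroupPtr P A (if l' < l ∨ l' = l ∧ q ≤ g then th' else th) l' g
  disk : ∀ q < 4 * P .G + x, A.disk q = A₀.disk q
  inv : J H A
  rest : H + between th th' (A₀.content (P .b) (4 * P .G) (q * P .m ^ l * P .b)) = T

variable {A₀ : AState} {J : Multiset ℕ → AState → Prop} {T : Multiset ℕ} {H : Multiset ℕ}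

/-- When `m` divides `q`, the first `q` groups of level `l` are exactly the parts of the first `q /
m` groups of the next level, so no active group of level `l` is left. -/
theorem ExtractInv.up (hb : 0 < P .b) (hm : 2 ≤ P .m) (h : ExtractInv P A₀ A J T x th th' l q H)
    (hq : q ≠ 0) (hd : q % P .m = 0) (hJ : J H A')
    (hA : A'.disk = A.disk) : ExtractInv P A₀ A' J T x th th' (l + 1) (q / P .m) H := by
  have hqm : q / P .m * P .m = q := Nat.div_mul_cancel (dvd_of_mod_eq_zero hd)
  have hpos : q / P .m ≠ 0 := by intro h0; rw [h0, zero_mul] at hqm; omega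
  refine ⟨h.div.le, ?_, fun _ => ?_, fun l' g hg => ?_, fun l' g hg => ?_, by rw [hA]; exact h.disk, hJ, ?_⟩
  · rw [h.div, Nat.div_div_eq_div_mul, ← pow_succ]
  · by_contra hlt; rw [h.div, div_eq_of_lt (by omega)] at hpos; exact hpos rfl
  · exact (h.data l' g hg).congr hb (fun _ _ _ _ => by rw [hA]) (fun _ _ _ _ => by rw [hA])
  · have h1 : (if l' < l + 1 ∨ l' = l + 1 ∧ q / P .m ≤ g then th' else th) =
        if l' < l ∨ l' = l ∧ q ≤ g then th' else th := by
      refine if_congr ?_ rfl rfl; constructor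
      · rintro (h1 | ⟨rfl, h1⟩)
        · by_cases hl : l' = l
          · subst hl; right; refine ⟨rfl, ?_⟩; rw [← hqm, h.div, ← hg.2]; exact div_mul_le_self _ _
          · omega
        · have h2 : g + 1 ≤ x / P .m ^ (l + 1) := (Nat.le_div_iff_mul_le (by positivity)).2 hg.1; rw [← h.div] at h2
          omega
      · rintro (h1 | h1) <;> omega
    rw [h1]
    exact (h.ptr l' g hg).congr hb (fun _ _ _ _ => by rw [hA]) (by rw [hA])
  · rw [← h.rest, ← hqm]; congr 3; rw [Nat.mul_div_cancel _ (by omega)]; ring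

/-- Otherwise group `g = q - 1` is active. Its content moves from the unscanned prefix to the
handled multiset, and only its own pointer changes. -/
theorem ExtractInv.scan (hb : 0 < P .b) (hm : 2 ≤ P .m) (hG : x ≤ P .G)
    (h : ExtractInv P A₀ A J T x th th' l (g + 1) H) (hd : ¬ (g + 1) % P .m = 0)
    (hdk : ∀ q, (q < 4 * P .G + x ∨ 5 * P .G ≤ q) → q ≠ ptrBase P l + g * P .m ^ l → A'.disk q = A.disk q)
    (hp : GroupPtr P A' th' l g)
    (hJ : J (H + between th th' (A.content (P .b) (levelBase P l + g * P .m ^ l) (P .m ^ l * P .b))) A') :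
    ExtractInv P A₀ A' J T x th th' l g (H + between th th'
      (A.content (P .b) (levelBase P l + g * P .m ^ l) (P .m ^ l * P .b))) := by
  have hpos : ∀ l, 0 < P .m ^ l := fun l => by positivity
  have hgx : (g + 1) * P .m ^ l ≤ x := (Nat.le_div_iff_mul_le (hpos l)).1 h.le
  have hlev : ∀ l' q, q < x → A'.disk (levelBase P l' + q) = A.disk (levelBase P l' + q) := by
    intro l' q hq; have hpl := hpos l; rw [add_mul, one_mul] at hgx
    refine hdk _ ?_ (region_ne (show 4 + 2 * l' ≠ 5 + 2 * l by omega) (by omega) (by omega))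
    rcases Nat.eq_zero_or_pos l' with rfl | hl
    · left; rw [levelBase]; omega
    · right
      have : 5 * P .G ≤ (4 + 2 * l') * P .G := Nat.mul_le_mul_right _ (by omega); rw [levelBase]; omega
  refine ⟨by have := h.le; omega, ?_, h.pow_le, fun l' g' hg => ?_, fun l' g' hg => ?_, fun q hq => ?_, hJ, ?_⟩
  · have := h.div
    rwa [succ_div_of_not_dvd (by rwa [dvd_iff_mod_eq_zero])] at this
  · have hg' := hg; rw [add_mul, one_mul] at hg'
    refine (h.data l' g' hg).congr hb (fun q hq o _ => ?_) (fun q hq o _ => ?_)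
    · rw [add_assoc, hlev _ _ (by omega)]
    · rw [add_assoc]; exact congrFun (hlev 0 _ (by omega)) o
  · by_cases hlg : l' = l ∧ g' = g
    · obtain ⟨rfl, rfl⟩ := hlg; rw [if_pos (.inr ⟨rfl, le_rfl⟩)]; exact hp
    · have h1 : (if l' < l ∨ l' = l ∧ g ≤ g' then th' else th) = if l' < l ∨ l' = l ∧ g + 1 ≤ g' then th' else th :=
        if_congr (by omega) rfl rfl
      rw [h1]; have hg' := hg.1; have hpl := hpos l'; have hpl' := hpos l; rw [add_mul, one_mul] at hg' hgx
      refine (h.ptr l' g' hg).congr hb (fun q hq o _ => ?_) (hdk _ (.inr ?_) ?_)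
      · rw [add_assoc, hlev _ _ (by omega)]
      · have : 5 * P .G ≤ (5 + 2 * l') * P .G := Nat.mul_le_mul_right _ (by omega); rw [ptrBase]; omega
      · by_cases hl : l' = l
        · subst hl; intro he; have := eq_of_mul_eq_mul_right hpl (Nat.add_left_cancel he); exact hlg ⟨rfl, this⟩
        · exact region_ne (show 5 + 2 * l' ≠ 5 + 2 * l by omega) (by omega) (by omega)
  · rw [← h.disk q hq]; refine hdk q (.inl hq) ?_
    have : 5 * P .G ≤ (5 + 2 * l) * P .G := Nat.mul_le_mul_right _ (by omega); rw [ptrBase]; omega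
  · rw [← h.rest, (h.data l g hgx).2]
    have h1 : A.content (P .b) (4 * P .G + g * P .m ^ l) (P .m ^ l * P .b) =
        A₀.content (P .b) (4 * P .G + g * P .m ^ l) (P .m ^ l * P .b) := by
      refine content_congr hb fun q hq o _ => ?_; rw [add_mul, one_mul] at hgx; rw [h.disk _ (by omega)]
    rw [h1, add_mul g 1, one_mul, A₀.content_add hb, between_add, add_assoc,
      add_comm (between _ _ (A₀.content _ (4 * P .G) _))]

/-- The digits of `x` in base `m` enumerate the active groups: the counter `q` is decreased within a
level and divided by `m` to move up. The number of groups is bounded in two ways, by `x` because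
they are disjoint and nonempty, and by `m` per level. The first bound matters when there are few
blocks compared with `m`. -/
theorem extract_wp (hE : Env L P) {h : ACmd} {hxs : List Var} {hfs : List ℕ} (hH : Handler L P h J T x hxs hfs)
    (hP : A.Has P) (hx : A.reg .x0 = x) (hxG : x ≤ P .G)
    (hpad : ∀ q < x, ∀ o < P .b, A.disk (4 * P .G + q) o ≤ P .pad)
    (hth : th ≤ th') (hkey : A.reg .key = th') (hL : Levels P A x th) (hJ : J 0 A)
    (hT : between th th' (A.content (P .b) (4 * P .G) (x * P .b)) = T)
    (hQ : ∀ A' t', A'.Frame A ([.q, .pw, .sb, .off, .ptr, .val] ++ hxs) ([2] ++ hfs) →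
      (∀ q < 4 * P .G + x, A'.disk q = A.disk q) → Levels P A' x th' → J T A' →
      P .b * (t' + A.reg .x1) ≤ P .b * (t + A'.reg .x1) +
        4 * P .b * min x (P .m * (log (P .m) x + 1)) + T.card → Q A' t') :
    L.wp (extract h) Q A t := by
  have hb := hE.b_pos; have hbl := L.bound_le; have hm2 := hE.two_le_m; have hGb := hE.Gb
  have hG1 : P .G ≤ P .G * P .b := Nat.le_mul_of_pos_right _ hb; have hpos : ∀ l, 0 < P .m ^ l := fun l => by positivity
  set xs : List Var := [.q, .pw, .sb, .off, .ptr, .val] ++ hxs with hxs'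
  have hpar : ∀ y ∈ xs, y.isPar = false := by
    intro y hy; rw [hxs', List.mem_append] at hy; rcases hy with hy | hy
    · simp at hy; rcases hy with rfl | rfl | rfl | rfl | rfl | rfl <;> rfl
    · exact hH.par y hy
  -- `vc` counts the groups scanned so far, and `H` collects the entries handled.
  obtain ⟨I, hI⟩ : ∃ I : ℕ → ℕ → AState → ℕ → Prop, ∀ l q A' t', I l q A' t' ↔ ∃ H vc,
    (A'.Frame A xs ([2] ++ hfs) ∧ A'.reg .q = q ∧ A'.reg .pw = P .m ^ l ∧
    A'.reg .sb = levelBase P l ∧ ExtractInv P A A' J T x th th' l q H ∧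
    P .b * (t' + A.reg .x1) ≤ P .b * (t + A'.reg .x1) + 4 * P .b * vc + H.card ∧
    vc ≤ P .m * l + (x / P .m ^ l - q) ∧ vc ≤ x - q * P .m ^ l) := ⟨_, fun _ _ _ _ => Iff.rfl⟩
  have hadr0 := hE.addr_lt (l := 0) (by omega); simp [extract, hx, hP .G rfl]; refine ⟨by omega, ?_⟩
  refine wp_while (fun A' t' => ∃ l q, I l q A' t') (fun A' => A'.reg .q) ?_ ?_ ?_ ?_
  · refine ⟨0, x, (hI _ _ _ _).2 ⟨0, 0, ?_, by simp, by simp, by simp [levelBase], ?_, by simp, by simp, by simp⟩⟩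
    · simp [hxs']
    · refine ⟨by simp, by simp, fun h => by simp; omega, hL.data, fun l g hg => ?_, fun _ _ => rfl, ?_, ?_⟩
      · rw [if_neg]
        · exact hL.ptr l g hg
        · rintro (h | ⟨rfl, h⟩)
          · omega
          · have := hg.1; simp at this; omega
      · exact hH.stable _ A _ (by simp) (by simp) hJ
      · simpa using hT
  · intro A' t' _; simp
  · rintro A' t' ⟨l, q, h⟩ hc
    obtain ⟨H, vc, hf, hq, hpw, hsb, hX, ht, hv, hv'⟩ := (hI _ _ _ _).1 h; simp [hq] at hc; have hP' := hP.frame hf hpar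
    have hx' : A'.reg .x0 = x := by
      rw [hf.reg _ ?_, hx]; intro hmem; rw [hxs', List.mem_append] at hmem; rcases hmem with hmem | hmem
      · simp at hmem
      · exact hH.regs _ hmem (by simp)
    have hkey' : A'.reg .key = th' := by
      rw [hf.reg _ ?_, hkey]; intro hmem; rw [hxs', List.mem_append] at hmem; rcases hmem with hmem | hmem
      · simp at hmem
      · exact hH.regs _ hmem (by simp)
    have hqx : q * P .m ^ l ≤ x := (Nat.le_div_iff_mul_le (hpos l)).1 hX.le; rw [wp_ite]
    refine ⟨by simp, fun h1 => ?_, fun h1 => ?_⟩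
    · have h1' : ¬ q % P .m = 0 := by simpa [AExpr.Holds, hq, hP' .m rfl] using h1
      obtain ⟨g, rfl⟩ : ∃ g, q = g + 1 := ⟨q - 1, by omega⟩
      have hact : Active (P .m) x l g := by
        refine ⟨hqx, ?_⟩; have := hX.div
        rwa [succ_div_of_not_dvd (by rwa [dvd_iff_mod_eq_zero])] at this
      have hptr := hX.ptr l g hact; rw [if_neg (by omega)] at hptr; rw [wp_seq, wp_assign]; refine ⟨by simp, ?_⟩
      simp only [AExpr.val_sub, AExpr.val_r, hq, AExpr.val_ofNat, Nat.add_sub_cancel]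
      have hcont : between th th' (A'.content (P .b) (levelBase P l + g * P .m ^ l)
          (P .m ^ l * P .b)) = between th th' (A.content (P .b) (4 * P .G + g * P .m ^ l)
          (P .m ^ l * P .b)) := by
        rw [(hX.data l g hqx).2]; congr 1; refine content_congr hb fun q hq o _ => ?_; rw [add_mul, one_mul] at hqx
        rw [hX.disk _ (by omega)]
      refine groupScan_wp hE hH (l := l) (g := g) (th := th) (th' := th') (H := H)
        (hP'.setReg rfl) (by simp [hx']) hxG hqx (by simp) (by simp [hpw]) (by simp [hsb])
        (by simp [hkey']) (hX.data l g hqx) hptr hth ?_ ?_ ?_ ?_ ?_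
      · intro o ho; rw [← hE.V_eq]; exact hptr.2 o ho
      · intro i hi
        obtain ⟨q', hq', o, ho, he⟩ := (hX.data l g hqx).exists_entry hi
        have he' : (A'.setReg .q g).entry (P .b) (levelBase P l + g * P .m ^ l) i =
          A'.entry (P .b) (levelBase P l + g * P .m ^ l) i := rfl
        rw [add_mul, one_mul] at hqx; rw [he', he, add_assoc, hX.disk _ (by omega)]; exact hpad _ (by omega) o ho
      · exact hH.stable _ A' _ (by simp) (by simp) hX.inv
      · have he' : (A'.setReg .q g).content (P .b) (levelBase P l + g * P .m ^ l)
          (P .m ^ l * P .b) = A'.content (P .b) (levelBase P l + g * P .m ^ l)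
          (P .m ^ l * P .b) := rfl
        rw [he', hcont, ← hX.rest, add_mul, one_mul, A.content_add hb, between_add]
        exact add_le_add_right (Multiset.le_add_left _ _) _
      · intro A2 t2 hf2 hq2 hpw2 hsb2 hd2 _ hp2 hJ2 ht2
        refine ⟨⟨l, g, (hI _ _ _ _).2 ⟨_, vc + 1, ?_, hq2, hpw2, hsb2,
          hX.scan hb hm2 hxG h1' hd2 hp2 hJ2, ?_, ?_, ?_⟩⟩, by omega⟩
        · exact hf2.trans (hf.setReg (by simp [hxs']))
        · rw [Multiset.card_add]; simp at ht2; simp only [mul_add, mul_one] at ht ht2 ⊢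
          have hc' : (A'.setReg .q g).content (P .b) (levelBase P l + g * P .m ^ l)
            (P .m ^ l * P .b) = A'.content (P .b) (levelBase P l + g * P .m ^ l)
            (P .m ^ l * P .b) := rfl
          rw [hc'] at ht2; omega
        · have := hX.le; omega
        · rw [add_mul, one_mul] at hqx hv'; have := hpos l; omega
    · have h1' : q % P .m = 0 := by simpa [AExpr.Holds, hq, hP' .m rfl] using h1
      have hq0 : q / P .m ≠ 0 := by
        have := Nat.div_mul_cancel (dvd_of_mod_eq_zero h1'); intro h0; rw [h0, zero_mul] at this; omega
      have hX' : ∀ A'' : AState, A''.Frame A' [.q, .pw, .sb, .off, .ptr, .val] [2] →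
          A''.disk = A'.disk → ExtractInv P A A'' J T x th th' (l + 1) (q / P .m) H :=
        fun A'' hf'' hd'' => hX.up hb hm2 hc h1' (hH.stable _ A' _ hf'' (fun q _ => by rw [hd'']) hX.inv) hd''
      have hle : P .m ^ (l + 1) ≤ x := by by_contra hlt; rw [hX.div, div_eq_of_lt (by omega)] at hq0; exact hq0 rfl
      have hlt := hE.level_lt (l := l + 1) (by omega); have haddr := hE.addr_lt (l := l) (by omega)
      have hlb : levelBase P l + 4 * P .G = (8 + 2 * l) * P .G := by rw [levelBase]; ring
      have hlb' : levelBase P l + 2 * P .G = levelBase P (l + 1) := by simp only [levelBase]; ring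
      have hpow : P .m ^ l * P .m = P .m ^ (l + 1) := (pow_succ _ _).symm; simp only [wp_seq, wp_assign]
      refine ⟨by simp, ?_, ?_, ⟨l + 1, q / P .m, (hI _ _ _ _).2 ⟨H, vc, ?_, ?_, ?_, ?_,
        hX' _ (by simp) (by simp), ?_, ?_, ?_⟩⟩, ?_⟩
      · simp [hpw, hP' .m rfl]; omega
      · simp [hsb, hP' .G rfl]; omega
      · simp [hxs']; exact hf
      · simp [hq, hP' .m rfl]
      · simp [hpw, hP' .m rfl, hpow]
      · simp [hsb, hP' .G rfl, hlb']
      · simpa using ht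
      -- `q` is the largest multiple of `m` up to `x / m ^ l`, so the difference is below `m` and is
      -- paid by the additional term `m` of the next level.
      · have h2 : x / P .m ^ l / P .m = q / P .m := by rw [hX.div, pow_succ, Nat.div_div_eq_div_mul]
        have h3 := lt_mul_div_succ (x / P .m ^ l) (show 0 < P .m by omega)
        have h4 := Nat.mul_div_cancel' (dvd_of_mod_eq_zero h1'); rw [h2, mul_add, h4] at h3; rw [mul_add]; omega
      · have h4 := Nat.div_mul_cancel (dvd_of_mod_eq_zero h1'); rw [pow_succ', ← mul_assoc, h4]; exact hv'
      · simp [hq, hP' .m rfl]; exact Nat.div_lt_self (by omega) hm2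
  · rintro A' t' ⟨l, q, h⟩ hc
    obtain ⟨H, vc, hf, hq, hpw, hsb, hX, ht, hv, hv'⟩ := (hI _ _ _ _).1 h; simp [hq] at hc; subst hc
    have hrest := hX.rest; simp [content, between] at hrest; subst hrest
    refine hQ A' t' hf hX.disk ⟨hX.data, fun l' g hg => ?_⟩ hX.inv (ht.trans ?_)
    · have := hX.ptr l' g hg; rwa [if_pos] at this; by_contra hcon; have hl : l < l' := by omega
      have h1 : x / P .m ^ (l + 1) = 0 := by rw [← hX.div]; simp
      have h2 := lt_of_div_eq_zero (hpos _) h1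
      have h3 := Nat.pow_le_pow_right (show 0 < P .m by omega) (show l + 1 ≤ l' by omega)
      have h4 : P .m ^ l' ≤ (g + 1) * P .m ^ l' := Nat.le_mul_of_pos_left _ (by omega); have := hg.1; omega
    · refine Nat.add_le_add_right (Nat.add_le_add_left (Nat.mul_le_mul_left _ (le_min ?_ ?_)) _) _
      · omega
      · rcases Nat.eq_zero_or_pos x with rfl | hx0
        · omega
        · have h1 : l ≤ log (P .m) x :=
            le_log_of_pow_le (by omega) (hX.pow_le (by omega))
          have h2 : x / P .m ^ l / P .m = 0 := by rw [Nat.div_div_eq_div_mul, ← pow_succ, ← hX.div]; simp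
          have h3 := lt_of_div_eq_zero (show 0 < P .m by omega) h2
          calc vc ≤ P .m * l + P .m := by omega
            _ = P .m * (l + 1) := by ring
            _ ≤ _ := Nat.mul_le_mul_left _ (by omega)

/-! ### Digits -/

theorem sum_digits_lt {c : ℕ → ℕ} (hc : ∀ o < d, c o < sg) : ∑ o ∈ range d, c o * sg ^ o < sg ^ d := by
  induction d with
  | zero => simp
  | succ d ih =>
    rw [sum_range_succ, pow_succ']; have h1 := ih fun o ho => hc o (by omega)
    have h2 : (c d + 1) * sg ^ d ≤ sg * sg ^ d := Nat.mul_le_mul_right _ (hc d (by omega)); rw [add_mul] at h2; omega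

theorem sum_digits_div_mod (hsg : 0 < sg) {c : ℕ → ℕ} (hc : ∀ o < d, c o < sg) (hp : p + len ≤ d) :
    (∑ o ∈ range d, c o * sg ^ o) / sg ^ p % sg ^ len = ∑ j ∈ range len, c (p + j) * sg ^ j := by
  obtain ⟨r, rfl⟩ := Nat.exists_eq_add_of_le hp
  have h1 : ∑ o ∈ range (p + len + r), c o * sg ^ o =
      ∑ o ∈ range p, c o * sg ^ o + sg ^ p * (∑ j ∈ range len, c (p + j) * sg ^ j +
        sg ^ len * ∑ j ∈ range r, c (p + len + j) * sg ^ j) := by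
    rw [sum_range_add, sum_range_add, mul_add, mul_sum, mul_sum, mul_sum, add_assoc]; congr 2
    · exact sum_congr rfl fun j _ => by ring
    · exact sum_congr rfl fun j _ => by ring
  rw [h1, add_mul_div_left _ _ (by positivity), div_eq_of_lt (sum_digits_lt fun o ho => hc o (by omega)), zero_add,
    add_mul_mod_self_left, mod_eq_of_lt (sum_digits_lt fun o ho => hc _ (by omega))]

section

variable (sg d : ℕ) (X : ℕ → ℕ)

/-- The part of a unit of `d` digits that is given by the digits `t, …, t + len - 1`. -/
def value (t len : ℕ) : ℕ := ∑ j ∈ range len, X (t + j) * sg ^ (t % d + j)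

open Classical in
/-- Unit `u` of the text where only the digits that satisfy `K` are known; the others are `0`. -/
noncomputable def masked (K : ℕ → Prop) (u : ℕ) : ℕ :=
  ∑ o ∈ range d, (if K (u * d + o) then X (u * d + o) else 0) * sg ^ o

variable {sg d X}

/-- Unknown digits are stored as 0, so making a digit known is an addition. This is what allows
values to be added to units in any order. -/
theorem masked_insert (hd : 0 < d) {K K' : ℕ → Prop} (h : ∀ i, K' i ↔ K i ∨ i = s) (hs : ¬ K s) (u : ℕ) :
    masked sg d X K' u = masked sg d X K u + if s / d = u then X s * sg ^ (s % d) else 0 := by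
  classical
  have hds := div_add_mod' s d; have hmod := mod_lt s hd; split_ifs with hu
  · subst hu; unfold masked; refine MergeInv.sum_update hmod _ _ _ (fun o ho => ?_) ?_
    · have : K' (s / d * d + o) ↔ K (s / d * d + o) := by rw [h]; exact or_iff_left fun h' => ho (by omega)
      simp only [this]
    · simp only [hds]
      rw [if_neg hs, if_pos ((h s).2 (.inr rfl)), zero_mul, zero_add]
  · unfold masked; rw [add_zero]; refine sum_congr rfl fun o ho => ?_; have ho' := mem_range.1 ho
    have : K' (u * d + o) ↔ K (u * d + o) := by
      rw [h]; refine or_iff_left fun h' => hu ?_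
      rw [← h', Nat.add_comm, add_mul_div_right _ _ hd, div_eq_of_lt ho', zero_add]
    simp only [this]

theorem div_of_mod_add_lt (hd : 0 < d) (h : t % d + j < d) : (t + j) / d = t / d ∧ (t + j) % d = t % d + j := by
  have h1 : t + j = t % d + j + t / d * d := by have := div_add_mod' t d; omega
  rw [h1, add_mul_div_right _ _ hd, div_eq_of_lt h, zero_add, add_mul_mod_self_right, mod_eq_of_lt h]; exact ⟨rfl, rfl⟩

theorem masked_interval {K K' : ℕ → Prop}
    (h : ∀ i, K' i ↔ K i ∨ t ≤ i ∧ i < t + len) (hs : ∀ i, t ≤ i → i < t + len → ¬ K i)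
    (ht : t % d + len ≤ d) (u : ℕ) :
    masked sg d X K' u = masked sg d X K u + if t / d = u then value sg d X t len else 0 := by
  induction len generalizing K' with
  | zero =>
    have : K' = K := by funext i; rw [h]; exact propext (or_iff_left (by omega))
    simp [this, value]
  | succ len ih =>
    have h1 := ih (K' := fun i => K i ∨ t ≤ i ∧ i < t + len) (fun i => Iff.rfl)
      (fun i hi hi' => hs i hi (by omega)) (by omega)
    have hd := div_of_mod_add_lt (t := t) (d := d) (j := len) (by omega) (by omega)
    rw [masked_insert (K := fun i => K i ∨ t ≤ i ∧ i < t + len) (s := t + len) (by omega)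
      (fun i => ?_) ?_, h1, hd.1, hd.2, add_assoc]
    · congr 1; split_ifs
      · rw [value, value, sum_range_succ]
      · rfl
    · rintro (h' | h')
      · exact hs _ (by omega) (by omega) h'
      · omega
    · rw [h]; constructor
      · rintro (h | h)
        · exact .inl (.inl h)
        · by_cases hi : i = t + len
          · exact .inr hi
          · exact .inl (.inr (by omega))
      · rintro ((h | h) | h)
        · exact .inl h
        · exact .inr (by omega)
        · exact .inr (by omega)

theorem masked_lt (hsg : 0 < sg) (hX : ∀ i, X i < sg) (K : ℕ → Prop) (u : ℕ) : masked sg d X K u < sg ^ d := by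
  classical
  refine sum_digits_lt fun o _ => ?_; split_ifs
  · exact hX _
  · exact hsg

/-- Cutting out digits by a division and a remainder needs only these digits to be known; the rest
of the unit may be incomplete. -/
theorem masked_div_mod (hsg : 0 < sg) (hX : ∀ i, X i < sg) {K : ℕ → Prop}
    (hp : p % d + len ≤ d) (hK : ∀ j < len, K (p + j)) :
    masked sg d X K (p / d) / sg ^ (p % d) % sg ^ len = ∑ j ∈ range len, X (p + j) * sg ^ j := by
  classical
  unfold masked
  rw [sum_digits_div_mod hsg (fun o _ => by split_ifs <;> [exact hX _; exact hsg]) hp]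
  refine sum_congr rfl fun j hj => ?_
  rw [← add_assoc, div_add_mod', if_pos (hK j (mem_range.1 hj))]

theorem value_eq : value sg d X t len = (∑ j ∈ range len, X (t + j) * sg ^ j) * sg ^ (t % d) := by
  rw [value, sum_mul]; exact sum_congr rfl fun j _ => by ring

theorem value_lt (hsg : 0 < sg) (hX : ∀ i, X i < sg) (ht : t % d + len ≤ d) : value sg d X t len < sg ^ d := by
  have h1 := sum_digits_lt (c := fun j => X (t + j)) (d := len) fun o _ => hX _; rw [value_eq]
  calc _ < sg ^ len * sg ^ (t % d) := Nat.mul_lt_mul_of_pos_right h1 (by positivity)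
    _ = sg ^ (t % d + len) := by ring
    _ ≤ _ := Nat.pow_le_pow_right hsg ht

/-- The second alternative serves positions beyond the end of the text, where `X` is 0 and knowledge
is immaterial. -/
theorem masked_congr {K K' : ℕ → Prop} (h : ∀ o < d, (K (u * d + o) ↔ K' (u * d + o)) ∨ X (u * d + o) = 0) :
    masked sg d X K u = masked sg d X K' u := by
  classical
  unfold masked; refine sum_congr rfl fun o ho => ?_; rcases h o (mem_range.1 ho) with h | h
  · simp only [h]
  · simp [h]

end

/-! ### Coded quadruples -/

/-- A number that codes a quadruple. -/
def code (D k x y z : ℕ) : ℕ := ((k * D + x) * D + y) * D + z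

namespace code

variable {D z : ℕ}

theorem mod (hz : z < D) : code D k x y z % D = z := by rw [code, Nat.add_comm, add_mul_mod_self_right, mod_eq_of_lt hz]

theorem div (hz : z < D) : code D k x y z / D = (k * D + x) * D + y := by
  rw [code, Nat.add_comm, add_mul_div_right _ _ (by omega), div_eq_of_lt hz, zero_add]

theorem div_mod (hy : y < D) (hz : z < D) : code D k x y z / D % D = y := by
  rw [div hz, Nat.add_comm, add_mul_mod_self_right, mod_eq_of_lt hy]

theorem div_div (hy : y < D) (hz : z < D) : code D k x y z / D / D = k * D + x := by
  rw [div hz, Nat.add_comm, add_mul_div_right _ _ (by omega), div_eq_of_lt hy, zero_add]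

theorem div_div_mod (hx : x < D) (hy : y < D) (hz : z < D) : code D k x y z / D / D % D = x := by
  rw [div_div hy hz, Nat.add_comm, add_mul_mod_self_right, mod_eq_of_lt hx]

theorem div_div_div (hx : x < D) (hy : y < D) (hz : z < D) : code D k x y z / D / D / D = k := by
  rw [div_div hy hz, Nat.add_comm, add_mul_div_right _ _ (by omega), div_eq_of_lt hx, zero_add]

theorem le : k * D * D * D ≤ code D k x y z :=
  le_add_right_of_le (Nat.mul_le_mul_right _ (le_add_right_of_le (Nat.mul_le_mul_right _ (Nat.le_add_right _ _))))

theorem lt (hx : x < D) (hy : y < D) (hz : z < D) : code D k x y z < (k + 1) * D * D * D := by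
  have h1 : k * D + x + 1 ≤ (k + 1) * D := by rw [add_mul]; omega
  have h2 := Nat.mul_le_mul_right D h1
  have h3 : (k * D + x) * D + y + 1 ≤ (k + 1) * D * D := by rw [add_mul] at h2; omega
  have h4 := Nat.mul_le_mul_right D h3; rw [add_mul _ 1] at h4; rw [code]; omega

end code

/-! ### Pieces of the text

A piece is a coded quadruple. Its last two components are its start and its length. Either the first
component is `0` and the second one is its value, or the first one is `1` and the second one is the
position of its source. -/

def qkind (P : Var → ℕ) (v : ℕ) : ℕ := v / P .D / P .D / P .D
def qx (P : Var → ℕ) (v : ℕ) : ℕ := v / P .D / P .D % P .D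
def qy (P : Var → ℕ) (v : ℕ) : ℕ := v / P .D % P .D
def qz (P : Var → ℕ) (v : ℕ) : ℕ := v % P .D

/-- `v` is a piece of the text `X`. -/
structure Piece (P : Var → ℕ) (X : ℕ → ℕ) (v : ℕ) : Prop where
  lt : v < 2 * P .D * P .D * P .D
  len_pos : 0 < qz P v
  unit : qy P v % P .d + qz P v ≤ P .d
  le_n : qy P v + qz P v ≤ P .n
  lit : qkind P v = 0 → qx P v = value (P .sg) (P .d) X (qy P v) (qz P v)
  src_lt : qkind P v ≠ 0 → qx P v < qy P v
  src_unit : qkind P v ≠ 0 → qx P v % P .d + qz P v ≤ P .d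
  src : qkind P v ≠ 0 → ∀ j < qz P v, X (qx P v + j) = X (qy P v + j)

/-- The end of the first `i` pieces. -/
def pieceEnd (P : Var → ℕ) (wd : ℕ → ℕ) (i : ℕ) : ℕ := ∑ j ∈ range i, qz P (wd j)

/-- The words `wd 0, …, wd (N - 1)` are pieces that partition a prefix of the text. -/
structure Pieces (P : Var → ℕ) (X : ℕ → ℕ) (wd : ℕ → ℕ) (N : ℕ) : Prop where
  piece : ∀ i < N, Piece P X (wd i)
  start : ∀ i < N, qy P (wd i) = pieceEnd P wd i

/-- The source of the piece belongs to an earlier chunk. -/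
def IsFar (P : Var → ℕ) (v : ℕ) : Prop :=
  qkind P v ≠ 0 ∧ qx P v / P .d / P .cu < qy P v / P .d / P .cu

instance (P : Var → ℕ) : DecidablePred (IsFar P) := fun _ => inferInstanceAs (Decidable (_ ∧ _))

/-- The message to the chunk of the source of a piece. -/
def request (P : Var → ℕ) (v : ℕ) : ℕ :=
  code (P .D) (2 * (qx P v / P .d / P .cu) + 1) (qx P v) (qy P v) (qz P v)

/-- The message to the chunk of a piece. -/
def answer (P : Var → ℕ) (X : ℕ → ℕ) (v : ℕ) : ℕ :=
  code (P .D) (2 * (qy P v / P .d / P .cu)) 0 (qy P v / P .d % P .cu) (value (P .sg) (P .d) X (qy P v) (qz P v))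

/-- The pieces whose sources belong to earlier chunks. -/
def farPieces (P : Var → ℕ) (wd : ℕ → ℕ) (N : ℕ) : Multiset ℕ :=
  ((Multiset.range N).map wd).filter (IsFar P)

/-- The content of the queue when the chunks before `c` are processed. -/
def queueAt (P : Var → ℕ) (X wd : ℕ → ℕ) (N c : ℕ) : Multiset ℕ :=
  (farPieces P wd N).map (request P) + ((farPieces P wd N).filter fun v => qx P v / P .d / P .cu < c).map (answer P X)

/-- The digits that are known when the first `s` ones and the far pieces are known. -/
def Known (P : Var → ℕ) (wd : ℕ → ℕ) (N s i : ℕ) : Prop :=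
  i < s ∨ ∃ k < N, IsFar P (wd k) ∧ qy P (wd k) ≤ i ∧ i < qy P (wd k) + qz P (wd k)

/-- Relations between the parameters. -/
structure TextEnv {mc : Machine} {a : Access} (L : Layout mc a) (P : Var → ℕ) (X : ℕ → ℕ) : Prop
    extends Env L P where
  two_le_sg : 2 ≤ P .sg
  d_pos : 0 < P .d
  D_eq : P .D = P .sg ^ P .d
  n_pos : 0 < P .n
  n_lt : P .n < P .D
  cu_eq : P .cu = P .m * P .b
  lt_U : ∀ u, u < P .U ↔ u * P .d < P .n
  pad_eq : P .pad = (2 * P .U + 2) * P .D * P .D * P .D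
  X_lt : ∀ i, X i < P .sg
  X_zero : ∀ i, P .n ≤ i → X i = 0
  n_lt_G : 4 * P .n + 4 ≤ P .G
  U_add_cu : P .U + P .cu < L.bound

section

theorem TextEnv.cu_pos (h : TextEnv L P X) : 0 < P .cu := by
  rw [h.cu_eq]; exact Nat.mul_pos (by have := h.two_le_m; omega) h.b_pos

theorem TextEnv.D_pos (h : TextEnv L P X) : 0 < P .D := by have := h.n_lt; omega

theorem TextEnv.eight_mul_G_lt (h : TextEnv L P X) : 8 * P .G < L.bound := by
  have h1 : P .G * 8 ≤ P .G * (2 * P .G + 8) := Nat.mul_le_mul_left _ (by omega); have := h.G_mul; omega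

theorem TextEnv.U_le_n (h : TextEnv L P X) : P .U ≤ P .n := by
  rcases Nat.eq_zero_or_pos (P .U) with h0 | h0
  · omega
  · have h1 := (h.lt_U (P .U - 1)).1 (by omega); have := Nat.le_mul_of_pos_right (P .U - 1) h.d_pos; omega

theorem qx_lt (hD : 0 < P .D) (v : ℕ) : qx P v < P .D := mod_lt _ hD
theorem qy_lt (hD : 0 < P .D) (v : ℕ) : qy P v < P .D := mod_lt _ hD
theorem qz_lt (hD : 0 < P .D) (v : ℕ) : qz P v < P .D := mod_lt _ hD

theorem Pieces.pieceEnd_succ (h : Pieces P X wd N) (hi : i < N) :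
    pieceEnd P wd (i + 1) = qy P (wd i) + qz P (wd i) := by
  rw [pieceEnd, sum_range_succ, h.start i hi, pieceEnd]

theorem pieceEnd_mono (h : i ≤ j) : pieceEnd P wd i ≤ pieceEnd P wd j :=
  sum_le_sum_of_subset (range_mono h)

theorem Pieces.value_lt (hT : TextEnv L P X) (h : Piece P X v) : value (P .sg) (P .d) X (qy P v) (qz P v) < P .D := by
  rw [hT.D_eq]
  exact ExtMem.value_lt (by have := hT.two_le_sg; omega) hT.X_lt h.unit

theorem TextEnv.chunk_lt (hT : TextEnv L P X) (h : Piece P X v) : qy P v / P .d / P .cu < P .U := by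
  refine lt_of_le_of_lt (Nat.div_le_self _ _) ?_; rw [hT.lt_U]; refine lt_of_le_of_lt (div_mul_le_self _ _) ?_
  have := h.le_n; have := h.len_pos; omega

theorem mem_farPieces (hv : v ∈ farPieces P wd N) : ∃ i < N, wd i = v ∧ IsFar P v := by
  obtain ⟨h1, h2⟩ := Multiset.mem_filter.1 hv; obtain ⟨i, hi, rfl⟩ := Multiset.mem_map.1 h1
  exact ⟨i, Multiset.mem_range.1 hi, rfl, h2⟩

theorem card_farPieces_le : (farPieces P wd N).card ≤ N := by
  refine (Multiset.card_le_card (Multiset.filter_le _ _)).trans ?_; simp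

/-- The other three components are below `D`, so codes are ordered by the leading one first; a key
range of length `D ^ 3` selects one value of it. -/
theorem between_code {f : ℕ → ℕ} (g : ℕ → ℕ) (hf : ∀ v ∈ S, ∃ x y z, x < P .D ∧ y < P .D ∧ z < P .D ∧
      f v = code (P .D) (g v) x y z) :
    between (k * P .D * P .D * P .D) ((k + 1) * P .D * P .D * P .D) (S.map f) = (S.filter fun v => g v = k).map f := by
  rw [between, Multiset.filter_map]; congr 1; refine Multiset.filter_congr fun v hv => ?_
  obtain ⟨x, y, z, hx, hy, hz, h⟩ := hf v hv; simp only [Function.comp, h]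
  have h1 := code.le (D := P .D) (k := g v) (x := x) (y := y) (z := z); have h2 := code.lt (k := g v) hx hy hz
  constructor
  · rintro ⟨h3, h4⟩
    have h5 : k < g v + 1 := by
      have := lt_of_le_of_lt h3 h2; by_contra hc
      have : (g v + 1) * P .D * P .D * P .D ≤ k * P .D * P .D * P .D := by gcongr; omega
      omega
    have h6 : g v < k + 1 := by
      have := lt_of_le_of_lt h1 h4; by_contra hc
      have : (k + 1) * P .D * P .D * P .D ≤ g v * P .D * P .D * P .D := by gcongr; omega
      omega
    omega
  · intro h3; rw [← h3]; exact ⟨h1, h2⟩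

variable (hT : TextEnv L P X) (hW : Pieces P X wd N)
include hT hW

omit hW in
theorem request_fields (_ : v ∈ farPieces P wd N) : ∃ x y z, x < P .D ∧ y < P .D ∧
    z < P .D ∧ request P v = code (P .D) (2 * (qx P v / P .d / P .cu) + 1) x y z :=
  ⟨_, _, _, qx_lt hT.D_pos v, qy_lt hT.D_pos v, qz_lt hT.D_pos v, rfl⟩

theorem answer_fields (hv : v ∈ farPieces P wd N) : ∃ x y z, x < P .D ∧ y < P .D ∧
    z < P .D ∧ answer P X v = code (P .D) (2 * (qy P v / P .d / P .cu)) x y z := by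
  obtain ⟨i, hi, rfl, -⟩ := mem_farPieces hv
  refine ⟨_, _, _, hT.D_pos, ?_, Pieces.value_lt hT (hW.piece i hi), rfl⟩
  exact lt_of_le_of_lt ((mod_le _ _).trans (Nat.div_le_self _ _)) (qy_lt hT.D_pos _)

/-- Requests have odd leading components and drop out. An answer to chunk `c` comes from a far
piece, whose source chunk is smaller than `c`; so the restriction to sources before `c` is no loss,
and every answer is already in the queue. -/
theorem between_even (c : ℕ) : between (2 * c * P .D * P .D * P .D)
    ((2 * c + 1) * P .D * P .D * P .D) (queueAt P X wd N c) =
      ((farPieces P wd N).filter fun v => qy P v / P .d / P .cu = c).map (answer P X) := by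
  rw [queueAt, between_add, between_code (fun v => 2 * (qx P v / P .d / P .cu) + 1) fun v hv => request_fields hT hv,
    between_code (fun v => 2 * (qy P v / P .d / P .cu))
    fun v hv => answer_fields hT hW (Multiset.mem_of_mem_filter hv),
    Multiset.filter_eq_nil.2 fun v _ => by omega, Multiset.map_zero, zero_add,
    Multiset.filter_filter]
  congr 1; refine Multiset.filter_congr fun v hv => ?_; obtain ⟨i, hi, rfl, hfar⟩ := mem_farPieces hv; have := hfar.2
  omega

/-- Here the answers drop out by parity, and the requests were all sent at the start. -/
theorem between_odd (c : ℕ) : between ((2 * c + 1) * P .D * P .D * P .D)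
    ((2 * c + 2) * P .D * P .D * P .D) (queueAt P X wd N c) =
      ((farPieces P wd N).filter fun v => qx P v / P .d / P .cu = c).map (request P) := by
  rw [queueAt, between_add, between_code (fun v => 2 * (qx P v / P .d / P .cu) + 1) fun v hv => request_fields hT hv,
    between_code (fun v => 2 * (qy P v / P .d / P .cu))
    fun v hv => answer_fields hT hW (Multiset.mem_of_mem_filter hv),
    Multiset.filter_eq_nil (p := fun v => 2 * (qy P v / P .d / P .cu) = 2 * c + 1) |>.2
      fun v _ => by omega, Multiset.map_zero, add_zero]
  congr 1; exact Multiset.filter_congr fun v _ => by omega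

omit hT hW in
theorem queueAt_succ (c : ℕ) : queueAt P X wd N (c + 1) = queueAt P X wd N c +
    ((farPieces P wd N).filter fun v => qx P v / P .d / P .cu = c).map (answer P X) := by
  rw [queueAt, queueAt, add_assoc, ← Multiset.map_add]; congr 2
  induction farPieces P wd N using Multiset.induction with
  | empty => simp
  | cons v S ih =>
    rw [Multiset.filter_cons, Multiset.filter_cons, Multiset.filter_cons, ih]
    by_cases h1 : qx P v / P .d / P .cu < c
    · rw [if_pos (by omega), if_pos h1, if_neg (by omega)]; simp
    · by_cases h2 : qx P v / P .d / P .cu = c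
      · rw [if_pos (by omega), if_neg h1, if_pos h2]; rw [zero_add, add_left_comm]
      · rw [if_neg (by omega), if_neg h1, if_neg h2]; simp

theorem queueAt_lt_pad (hv : v ∈ queueAt P X wd N c) : v < P .pad := by
  have key : ∀ k x y z, k < 2 * P .U + 2 → x < P .D → y < P .D → z < P .D → code (P .D) k x y z < P .pad := by
    intro k x y z hk hx hy hz; refine lt_of_lt_of_le (code.lt hx hy hz) ?_; rw [hT.pad_eq]
    exact Nat.mul_le_mul_right _ (Nat.mul_le_mul_right _ (Nat.mul_le_mul_right _ hk))
  rw [queueAt, Multiset.mem_add, Multiset.mem_map, Multiset.mem_map] at hv; rcases hv with ⟨w, hw, rfl⟩ | ⟨w, hw, rfl⟩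
  · obtain ⟨i, hi, rfl, hfar⟩ := mem_farPieces hw; obtain ⟨x, y, z, hx, hy, hz, h⟩ := request_fields hT hw; rw [h]
    have h1 := hT.chunk_lt (hW.piece i hi)
    have h2 : qx P (wd i) / P .d / P .cu < qy P (wd i) / P .d / P .cu := hfar.2
    exact key _ _ _ _ (show 2 * (qx P (wd i) / P .d / P .cu) + 1 < 2 * P .U + 2 by omega) hx hy hz
  · have hw' := Multiset.mem_of_mem_filter hw; obtain ⟨i, hi, rfl, hfar⟩ := mem_farPieces hw'
    obtain ⟨x, y, z, hx, hy, hz, h⟩ := answer_fields hT hW hw'; rw [h]; have h1 := hT.chunk_lt (hW.piece i hi)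
    exact key _ _ _ _ (show 2 * (qy P (wd i) / P .d / P .cu) < 2 * P .U + 2 by omega) hx hy hz

omit hT in
-- Pieces are disjoint and none crosses a unit boundary, so the far digits of a unit are the sum of
-- the values of its far pieces; the pieces are added one at a time.
theorem masked_far (u : ℕ) : masked (P .sg) (P .d) X (Known P wd N 0) u =
    (((farPieces P wd N).filter fun v => qy P v / P .d = u).map
      fun v => value (P .sg) (P .d) X (qy P v) (qz P v)).sum := by
  have key : ∀ k ≤ N, masked (P .sg) (P .d) X (fun i => ∃ j < k, IsFar P (wd j) ∧
      qy P (wd j) ≤ i ∧ i < qy P (wd j) + qz P (wd j)) u =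
    (((((Multiset.range k).map wd).filter (IsFar P)).filter fun v => qy P v / P .d = u).map
      fun v => value (P .sg) (P .d) X (qy P v) (qz P v)).sum := by
    intro k hk
    induction k with
    | zero =>
      simp [masked]
    | succ k ih =>
      have hlt : ∀ j i, j < k → i < qy P (wd j) + qz P (wd j) → i < qy P (wd k) := by
        intro j i hj hi; rw [← hW.pieceEnd_succ (by omega)] at hi; rw [hW.start k (by omega)]
        exact lt_of_lt_of_le hi (pieceEnd_mono (by omega))
      rw [Multiset.range_succ, Multiset.map_cons]
      by_cases hfar : IsFar P (wd k)
      · rw [Multiset.filter_cons_of_pos _ hfar, Multiset.filter_cons, Multiset.map_add,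
          Multiset.sum_add, ← ih (by omega), masked_interval (K' := fun i => ∃ j < k + 1, _)
          (K := fun i => ∃ j < k, IsFar P (wd j) ∧ qy P (wd j) ≤ i ∧ i < qy P (wd j) + qz P (wd j)) (t := qy P (wd k))
          (len := qz P (wd k)) (fun i => ?_) ?_ (hW.piece k (by omega)).unit, add_comm]
        · congr 1; split_ifs <;> simp
        · rintro i hi - ⟨j, hj, -, -, hj'⟩; have := hlt j i hj hj'; omega
        · constructor
          · rintro ⟨j, hj, h⟩; rcases Nat.lt_succ_iff_lt_or_eq.1 hj with hj | rfl
            · exact .inl ⟨j, hj, h⟩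
            · exact .inr h.2
          · rintro (⟨j, hj, h⟩ | h)
            · exact ⟨j, by omega, h⟩
            · exact ⟨k, by omega, hfar, h⟩
      · rw [Multiset.filter_cons_of_neg _ hfar, ← ih (by omega)]; refine masked_congr fun o _ => .inl ?_; constructor
        · rintro ⟨j, hj, h⟩; rcases Nat.lt_succ_iff_lt_or_eq.1 hj with hj | rfl
          · exact ⟨j, hj, h⟩
          · exact absurd h.1 hfar
        · rintro ⟨j, hj, h⟩; exact ⟨j, by omega, h⟩
  rw [farPieces, ← key N le_rfl]; exact masked_congr fun o _ => .inl (by simp [Known])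

/-- An answer stores the index of the unit within its chunk and the value of the piece; adding up
the answers to one unit gives its far digits. -/
theorem sum_answers (hy : y < P .cu) :
    (((((farPieces P wd N).filter fun v => qy P v / P .d / P .cu = c).map (answer P X)).filter
      fun v => qy P v = y).map (qz P)).sum =
      masked (P .sg) (P .d) X (Known P wd N 0) (c * P .cu + y) := by
  rw [masked_far hW, Multiset.filter_map, Multiset.map_map, Multiset.filter_filter]
  have hv : ∀ v ∈ farPieces P wd N, qy P (answer P X v) = qy P v / P .d % P .cu ∧
      qz P (answer P X v) = value (P .sg) (P .d) X (qy P v) (qz P v) := by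
    intro v hv; obtain ⟨i, hi, rfl, -⟩ := mem_farPieces hv; have h1 := Pieces.value_lt hT (hW.piece i hi)
    refine ⟨code.div_mod ?_ h1, code.mod h1⟩
    exact lt_of_le_of_lt ((mod_le _ _).trans (Nat.div_le_self _ _)) (qy_lt hT.D_pos _)
  congr 1
  have hfil : ((farPieces P wd N).filter fun v => (Function.comp (fun v => qy P v = y) (answer P X)) v ∧
      qy P v / P .d / P .cu = c) =
      (farPieces P wd N).filter fun v => qy P v / P .d = c * P .cu + y := by
    refine Multiset.filter_congr fun v hv' => ?_; simp only [Function.comp, (hv v hv').1]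
    have h1 := div_add_mod' (qy P v / P .d) (P .cu); constructor
    · rintro ⟨h2, h3⟩; rw [h2, h3] at h1; exact h1.symm
    · intro h2
      rw [h2, Nat.add_comm, add_mul_mod_self_right, mod_eq_of_lt hy, add_mul_div_right _ _ hT.cu_pos, div_eq_of_lt hy]
      omega
  rw [hfil]
  exact Multiset.map_congr rfl fun v hv' => (hv v (Multiset.mem_of_mem_filter hv')).2

end

/-! ### Sending the requests -/

def kindE (v : Var) : AExpr := §v / §.D / §.D / §.D
def xE (v : Var) : AExpr := §v / §.D / §.D % §.D
def yE (v : Var) : AExpr := §v / §.D % §.D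
def zE (v : Var) : AExpr := §v % §.D
def codeE (k x y z : AExpr) : AExpr := ((k * §.D + x) * §.D + y) * §.D + z

/-- Make piece number `qi`, if it exists, the current piece. -/
def fetch : ACmd :=
  .when ((§.qi).lt §.num) ( .when ((§.qi % §.b).eq 0) (.read (§.G + §.qi / §.b) 1 0) ;; .cur ≔ .get 1 (§.qi % §.b))

/-- The current piece has its source in an earlier chunk. -/
def farE : AExpr := (AExpr.lt 0 (kindE .cur)) * ((xE .cur / §.d / §.cu).lt (yE .cur / §.d / §.cu))

/-- Send the request of the current piece. -/
def sendRequest : ACmd :=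
  .when farE ( .val ≔ codeE (2 * (xE .cur / §.d / §.cu) + 1) (xE .cur) (yE .cur) (zE .cur) ;; emit)

/-- Send all requests. -/
def sendRequests : ACmd :=
  .cnt ≔ 0 ;; .x1 ≔ 0 ;; .x0 ≔ 0 ;; .th ≔ 0 ;;
  .for .qi §.num (fetch ;; sendRequest) ;;
  flush ;; normalize

/-- The disk holds the pieces. -/
def Source (P : Var → ℕ) (wd : ℕ → ℕ) (N : ℕ) (A : AState) : Prop :=
  ∀ q, q * P .b < N → ∀ o < P .b, A.disk (P .G + q) o = wd (q * P .b + o) ∧ wd (q * P .b + o) < P .V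

/-- Array `1` holds the block of piece number `p`. -/
def Loaded (P : Var → ℕ) (wd : ℕ → ℕ) (p : ℕ) (A : AState) : Prop :=
  ∀ o < P .b, A.arr 1 o = wd (p / P .b * P .b + o)

section

section Val

variable (hP : A.Has P) (v : Var)
include hP

theorem val_kindE : (kindE v).val A = qkind P (A.reg v) := by simp [kindE, qkind, hP .D rfl]
theorem val_xE : (xE v).val A = qx P (A.reg v) := by simp [xE, qx, hP .D rfl]
theorem val_yE : (yE v).val A = qy P (A.reg v) := by simp [yE, qy, hP .D rfl]
theorem val_zE : (zE v).val A = qz P (A.reg v) := by simp [zE, qz, hP .D rfl]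

theorem val_codeE (k x y z : AExpr) : (codeE k x y z).val A = code (P .D) (k.val A) (x.val A) (y.val A) (z.val A) := by
  simp [codeE, code, hP .D rfl]

theorem ok_codeE (hD : 0 < P .D) {k x y z : AExpr} (hk : k.ok L A) (hx : x.ok L A) (hy : y.ok L A) (hz : z.ok L A)
    (h : code (P .D) (k.val A) (x.val A) (y.val A) (z.val A) < 2 ^ mc.w) :
    (codeE k x y z).ok L A := by
  have h1 : ∀ u, u ≤ u * P .D := fun u => Nat.le_mul_of_pos_right _ hD; have h2 := h1 (k.val A * P .D + x.val A)
  have h3 := h1 ((k.val A * P .D + x.val A) * P .D + y.val A); simp only [code] at h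
  simp [codeE, hk, hx, hy, hz, hP .D rfl]; omega

end Val

@[simp] theorem ok_kindE (A : AState) (v : Var) : (kindE v).ok L A := by simp [kindE]
@[simp] theorem ok_xE (A : AState) (v : Var) : (xE v).ok L A := by simp [xE]
@[simp] theorem ok_yE (A : AState) (v : Var) : (yE v).ok L A := by simp [yE]
@[simp] theorem ok_zE (A : AState) (v : Var) : (zE v).ok L A := by simp [zE]

theorem Source.congr (h : Source P wd N A) (hN : N ≤ P .G) (hb : 0 < P .b)
    (hd : ∀ q < 2 * P .G, A'.disk q = A.disk q) : Source P wd N A' := by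
  intro q hq o ho; have := Nat.le_mul_of_pos_right q hb; rw [hd _ (by omega)]; exact h q hq o ho

theorem Loaded.congr (h : Loaded P wd p A) (ha : A'.arr 1 = A.arr 1) :
    Loaded P wd p A' := fun o ho => by rw [ha, h o ho]

theorem fetch_wp (hE : Env L P) (hP : A.Has P)
    (hS : Source P wd N A) (hN : N ≤ P .G) (hp : A.reg .qi = p) (hnum : A.reg .num = N)
    (hl : p < N → p % P .b ≠ 0 → Loaded P wd p A)
    (hQ : ∀ A' t', A'.Frame A [.cur] [1] → A'.disk = A.disk → (p < N → A'.reg .cur = wd p ∧ Loaded P wd p A') →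
      t' ≤ t + (if P .b ∣ p then 1 else 0) → Q A' t') :
    L.wp fetch Q A t := by
  have hn := hE.narr; have hb := hE.b_pos; have hbl := L.bound_le; have hcap := hE.b_le_cap; have hblk := hE.blk
  have hG := hE.G_mul; have hmod := mod_lt p hb
  have h2G : 2 * P .G < 2 ^ mc.w := by
    have : P .G * 8 ≤ P .G * (2 * P .G + 8) := Nat.mul_le_mul_left _ (by omega); omega
  have hdv := Nat.div_le_self p (P .b); have hdm := div_mul_le_self p (P .b); rw [fetch, wp_when]
  refine ⟨by simp, fun h => ?_, fun h => ?_⟩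
  · simp [hp, hnum] at h; rw [wp_seq, wp_when]; refine ⟨by simp, fun h0 => ?_, fun h0 => ?_⟩
    · simp [hp, hP .b rfl] at h0; simp [hp, hP .b rfl, hP .G rfl, hblk]
      refine ⟨⟨by omega, by omega, by omega, fun o ho => ?_⟩, ⟨by omega, by omega⟩, ?_⟩
      · rw [(hS (p / P .b) (by omega) o ho).1, ← hE.V_eq]; exact (hS (p / P .b) (by omega) o ho).2
      · refine hQ _ _ (by simp) rfl (fun _ => ⟨?_, fun o ho => ?_⟩) (by simp [dvd_of_mod_eq_zero h0])
        · simp [hmod]; rw [(hS (p / P .b) (by omega) _ hmod).1, div_add_mod']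
        · simp [ho]; rw [(hS (p / P .b) (by omega) _ ho).1]
    · simp [hp, hP .b rfl] at h0; have hl' := hl h h0; simp [hp, hP .b rfl]; refine ⟨by omega, ?_⟩
      refine hQ _ _ (by simp) rfl (fun _ => ⟨?_, hl'.congr rfl⟩) (by omega); simp; rw [hl' _ hmod, div_add_mod']
  · simp [hp, hnum] at h; exact hQ _ _ (by simp) rfl (fun h' => by omega) (by omega)

theorem Pieces.le_pieceEnd (h : Pieces P X wd N) (hi : i ≤ N) : i ≤ pieceEnd P wd i := by
  induction i with
  | zero => simp
  | succ i ih =>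
    rw [h.pieceEnd_succ hi, h.start i hi]; have := ih (by omega); have := (h.piece i hi).len_pos; omega

theorem Pieces.pieceEnd_le (h : Pieces P X wd N) (hi : i ≤ N) : pieceEnd P wd i ≤ P .n := by
  rcases i with - | i
  · simp [pieceEnd]
  · rw [h.pieceEnd_succ hi]; exact (h.piece i hi).le_n

theorem Pieces.le_n (h : Pieces P X wd N) : N ≤ P .n :=
  (h.le_pieceEnd le_rfl).trans (h.pieceEnd_le le_rfl)

theorem val_farE (hP : A.Has P) : farE.Holds A ↔ IsFar P (A.reg .cur) := by
  rw [farE, AExpr.holds_mul, AExpr.holds_lt, AExpr.holds_lt, IsFar]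
  simp [val_kindE hP, val_xE hP, val_yE hP, hP .d rfl, hP .cu rfl, Nat.pos_iff_ne_zero]

theorem request_lt_pad (hT : TextEnv L P X) (hW : Pieces P X wd N) (hi : i < N)
    (hf : IsFar P (wd i)) : request P (wd i) < P .pad := by
  refine queueAt_lt_pad hT hW (c := 0) (Multiset.mem_add.2 (.inl (Multiset.mem_map_of_mem _ ?_)))
  exact Multiset.mem_filter.2 ⟨Multiset.mem_map_of_mem _ (Multiset.mem_range.2 hi), hf⟩

theorem TextEnv.pad_lt (hT : TextEnv L P X) : P .pad < 2 ^ mc.w :=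
  L.lt_width (by have := hT.inf_eq; have := hT.inf_lt; omega)

theorem ok_farE (A : AState) : farE.ok L A := by
  have hw := L.width
  simp only [farE, AExpr.ok_mul, AExpr.ok_lt, AExpr.ok_div, ok_kindE, ok_xE, ok_yE, AExpr.ok_r,
    AExpr.ok_ofNat, AExpr.val_lt]
  refine ⟨by simp, by simp, ?_⟩; split_ifs <;> omega

theorem sendRequest_wp (hT : TextEnv L P X) (hW : Pieces P X wd N) (hP : A.Has P) (hp : p < N) (hcur : A.reg .cur = wd p)
    (hq : Queue P A 0 0 ((farPieces P wd p).map (request P))) (hx1 : A.reg .x1 < P .G)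
    (hQ : ∀ A' t', A'.Frame A [.j, .z1, .val, .cnt, .x1] [6] → (∀ q < 4 * P .G, A'.disk q = A.disk q) →
      Queue P A' 0 0 ((farPieces P wd (p + 1)).map (request P)) →
      A'.reg .x1 * P .b + A'.reg .cnt ≤ A.reg .x1 * P .b + A.reg .cnt + 1 →
      t' + A.reg .x1 = t + A'.reg .x1 → Q A' t') :
    L.wp sendRequest Q A t := by
  have hpad := hT.pad_lt; have hw := L.width
  have hfp : (farPieces P wd (p + 1)).map (request P) = (farPieces P wd p).map (request P) +
      if IsFar P (wd p) then {request P (wd p)} else 0 := by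
    rw [farPieces, Multiset.range_succ, Multiset.map_cons, Multiset.filter_cons]; split_ifs
    · rw [Multiset.map_add, add_comm]; rfl
    · simp [farPieces]
  rw [sendRequest, wp_when]; refine ⟨ok_farE A, fun h => ?_, fun h => ?_⟩
  · rw [val_farE hP, hcur] at h; have hr := request_lt_pad hT hW hp h
    have hcode : code (P .D) (2 * (qx P (wd p) / P .d / P .cu) + 1) (qx P (wd p)) (qy P (wd p))
      (qz P (wd p)) < 2 ^ mc.w := lt_trans hr hpad
    have hk : 2 * (qx P (wd p) / P .d / P .cu) + 1 < 2 ^ mc.w := by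
      have h2 : qx P (wd p) / P .d / P .cu < qy P (wd p) / P .d / P .cu := h.2; have h3 := hT.n_lt_G
      have h4 := hT.eight_mul_G_lt; have h6 := L.bound_le
      have h7 : qy P (wd p) / P .d / P .cu ≤ qy P (wd p) := (Nat.div_le_self _ _).trans (Nat.div_le_self _ _)
      have h8 := (hW.piece p hp).le_n; omega
    rw [wp_seq, wp_assign]
    refine ⟨ok_codeE hP hT.D_pos ?_ (by simp) (by simp) (by simp) ?_, ?_⟩
    · simp [val_xE hP, hP .d rfl, hP .cu rfl, hcur]; omega
    · simpa [val_xE hP, val_yE hP, val_zE hP, hP .d rfl, hP .cu rfl, hcur] using hcode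
    · simp only [val_codeE hP, AExpr.val_add, AExpr.val_mul, AExpr.val_div, AExpr.val_ofNat,
        val_xE hP, val_yE hP, val_zE hP, AExpr.val_r, hP .d rfl, hP .cu rfl, hcur]
      change L.wp emit Q (A.setReg .val (request P (wd p))) t
      refine emit_wp hT.toEnv (hP.setReg rfl) (hq.congr hT.b_pos (by simp) (by simp) rfl (by simp))
        (by simpa) (by simpa using hr.le) (Nat.zero_le _) ?_
      intro A' t' hf hq' hd hs _ ht
      refine hQ A' t' (hf.trans (by simp)) (fun q hq => by rw [hd q (by omega)]; rfl) ?_ (by simpa using hs.le)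
        (by simpa using ht)
      rw [hfp, if_pos h]; simpa [Multiset.filter_singleton, hr] using hq'
  · rw [val_farE hP, hcur] at h; refine hQ _ _ (by simp) (fun _ _ => rfl) ?_ (by omega) rfl; rw [hfp, if_neg h, add_zero]
    exact hq

theorem Levels.zero (P : Var → ℕ) (A : AState) (hm : 0 < P .m) : Levels P A 0 0 := by
  have h : ∀ l g, ¬ (g + 1) * P .m ^ l ≤ 0 := fun l g => by
    have : 0 < (g + 1) * P .m ^ l := by positivity
    omega
  exact ⟨fun l g hg => absurd hg (h l g), fun l g hg => absurd hg.1 (h l g)⟩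

theorem ceil_succ (hb : 0 < b) (p : ℕ) : (p + 1 + b - 1) / b = (p + b - 1) / b + if b ∣ p then 1 else 0 := by
  have h := @Nat.succ_div (p + b - 1) b; rw [show p + b - 1 + 1 = p + b by omega] at h
  rw [show p + 1 + b - 1 = p + b by omega, h]; simp

/-- The bound on `x1 * b` counts at most one request per piece, plus one block of padding for the
flush. The cost is that of reading the pieces once, writing the queue blocks, and building the
levels. -/
theorem sendRequests_wp (hT : TextEnv L P X) (hW : Pieces P X wd N) (hP : A.Has P) (hS : Source P wd N A) (hnum : A.reg .num = N)
    (hQ : ∀ A' t', A'.Has P → A'.reg .num = N → (∀ q < 4 * P .G, A'.disk q = A.disk q) →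
      A'.reg .cnt = 0 → A'.reg .x0 = A'.reg .x1 → A'.reg .th = 0 → Queue P A' (A'.reg .x1) 0 (queueAt P X wd N 0) →
      Levels P A' (A'.reg .x1) 0 → A'.reg .x1 * P .b ≤ N + P .b →
      t' ≤ t + (N + P .b - 1) / P .b + levelCost (P .m) (P .G) (A'.reg .x1) + A'.reg .x1 →
      Q A' t') :
    L.wp sendRequests Q A t := by
  have hb := hT.b_pos; have hw := L.width; have hNn := hW.le_n; have hnG := hT.n_lt_G; have hGb := hT.Gb
  have hbl := L.bound_le
  have hG1 : P .G ≤ P .G * P .b := Nat.le_mul_of_pos_right _ hb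
  have hlev : levelCost (P .m) (P .G) 0 = 0 := by simp [levelCost]
  obtain ⟨I, hI⟩ : ∃ I : ℕ → AState → ℕ → Prop, ∀ p A' t', I p A' t' ↔
      (A'.Has P ∧ A'.reg .num = N ∧ (∀ q < 4 * P .G, A'.disk q = A.disk q) ∧
        Queue P A' 0 0 ((farPieces P wd p).map (request P)) ∧ A'.reg .x0 = 0 ∧ A'.reg .th = 0 ∧
        A'.reg .x1 * P .b + A'.reg .cnt ≤ p ∧ t' ≤ t + (p + P .b - 1) / P .b + A'.reg .x1 ∧
        (p % P .b ≠ 0 → Loaded P wd p A')) := ⟨_, fun _ _ _ => Iff.rfl⟩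
  have hx1 : ∀ x c p : ℕ, x * P .b + c ≤ p → x ≤ p := fun x c p h => by have := Nat.le_mul_of_pos_right x hb; omega
  rw [sendRequests]; simp only [wp_seq, wp_assign]; refine ⟨by simp, by simp, by simp, by simp, ?_⟩
  refine wp_for N I (by omega) ((hI _ _ _).2 ?_) ?_ ?_ ?_
  · refine ⟨((((hP.setReg rfl).setReg rfl).setReg rfl).setReg rfl).setReg rfl, ?_, fun _ _ => rfl,
      ⟨?_, ?_, ?_, ?_, ?_, ?_, ?_, ?_⟩, ?_⟩ <;>
      simp [hnum, farPieces, hb, content]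
  · intro j A' t' hj h hqi; rw [hI] at h; simp [h.2.1]
  · intro p A' t' hp h hqi
    obtain ⟨hP', hnum', hd, hq, hx0, hth, hcnt, ht, hl⟩ := (hI _ _ _).1 h; rw [wp_seq]
    refine fetch_wp hT.toEnv hP' (hS.congr (by omega) hb fun q hq => hd q (by omega)) (by omega)
      hqi hnum' (fun _ => hl) ?_
    intro A1 t1 hf1 hd1 hc1 ht1; obtain ⟨hcur, hl1⟩ := hc1 hp
    have e1 : ∀ x, x ≠ .cur → A1.reg x = A'.reg x := fun x hx => hf1.reg x (by simpa); have hle := hx1 _ _ _ hcnt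
    refine sendRequest_wp hT hW (hP'.frame hf1 (by decide)) hp hcur
      (hq.congr hb (e1 _ (by simp)) (e1 _ (by simp)) (hf1.arr 6 (by simp)) (fun _ _ => by rw [hd1]))
      (by rw [e1 _ (by simp)]; omega) ?_
    intro A2 t2 hf2 hd2 hq2 hs2 ht2
    have hf := (hf2.mono (ys := [.j, .z1, .val, .cnt, .x1, .cur]) (gs := [6, 1]) (by simp) (by simp)).trans
      (hf1.mono (by simp) (by simp))
    rw [e1 .x1 (by simp), e1 .cnt (by simp)] at hs2; rw [e1 .x1 (by simp)] at ht2
    refine ⟨by rw [hf.reg _ (by simp), hqi], (hI _ _ _).2 ⟨(hP'.frame hf (by decide)).setReg rfl, ?_,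
      fun q hq => by rw [setReg_disk, hd2 q hq, hd1, hd q hq], ?_, ?_, ?_, ?_, ?_, ?_⟩⟩
    · rw [setReg_reg, if_neg (by simp), hf.reg _ (by simp), hnum']
    · exact hq2.congr hb (by simp) (by simp) rfl (by simp)
    · rw [setReg_reg, if_neg (by simp), hf.reg _ (by simp), hx0]
    · rw [setReg_reg, if_neg (by simp), hf.reg _ (by simp), hth]
    · simp only [setReg_reg, reduceCtorEq, if_false]; omega
    · have := ceil_succ hb p; simp only [setReg_reg, reduceCtorEq, if_false]; omega
    · intro h0
      have : (p + 1) / P .b = p / P .b := by rw [Nat.succ_div, if_neg, add_zero]; rwa [dvd_iff_mod_eq_zero]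
      have h1 : Loaded P wd p A2 := hl1.congr (hf2.arr 1 (by simp)); intro o ho; rw [this]; exact h1 o ho
  · intro A' t' h _
    obtain ⟨hP', hnum', hd, hq, hx0, hth, hcnt, ht, -⟩ := (hI _ _ _).1 h; have hle := hx1 _ _ _ hcnt; rw [wp_seq]
    refine flush_wp hT.toEnv hP' hq (by omega) (Nat.zero_le _) ?_; intro A1 t1 hf1 hq1 hc1 hd1 hx₁ hs1 ht1
    refine normalize_wp hT.toEnv (hP'.frame hf1 (by decide)) hq1 (by omega)
      (by rw [hf1.reg _ (by simp), hx0]) (by rw [hf1.reg _ (by simp), hth]) le_rfl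
      (.zero _ _ (by have := hT.two_le_m; omega)) ?_
    intro A2 t2 hf2 hd2 hx2 hL2 hq2 ht2; have ex1 : A2.reg .x1 = A1.reg .x1 := hf2.reg _ (by simp)
    refine hQ A2 t2 ((hP'.frame hf1 (by decide)).frame hf2 (by decide)) ?_ ?_ ?_ ?_ ?_ ?_ ?_ ?_ ?_
    · rw [hf2.reg _ (by simp), hf1.reg _ (by simp), hnum']
    · intro q hq; rw [hd2 q (by omega), hd1 q (by omega), hd q hq]
    · rw [hf2.reg _ (by simp), hc1]
    · rw [hx2, ex1]
    · rw [hf2.reg _ (by simp), hf1.reg _ (by simp), hth]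
    · rw [ex1]; simpa [queueAt] using hq2
    · rwa [ex1]
    · rw [ex1]; omega
    · rw [ex1]; omega

end

/-! ### Processing the pieces of a chunk -/

/-- Set `x` to `sg ^ e`. -/
def power (x : Var) (e : AExpr) : ACmd := x ≔ 1 ;; .for .i e (x ≔ §x * §.sg)

/-- Copy the current piece digit by digit. -/
def copyNear : ACmd :=
  power .s1 (xE .cur % §.d) ;; power .s2 (yE .cur % §.d) ;;
  .for .s3 (zE .cur) ( .set 0 (yE .cur / §.d % §.cu) (.get 0 (yE .cur / §.d % §.cu) +
      .get 0 (xE .cur / §.d % §.cu) / §.s1 % §.sg * §.s2) ;;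
    .s1 ≔ §.s1 * §.sg ;; .s2 ≔ §.s2 * §.sg)

def applyPiece : ACmd :=
  .ite ((kindE .cur).eq 0) (.set 0 (yE .cur / §.d % §.cu) (.get 0 (yE .cur / §.d % §.cu) + xE .cur))
    (.ite farE .skip copyNear)

def applyChunk : ACmd :=
  .loop ((§.qi).lt §.num * (yE .cur / §.d / §.cu).eq §.uu) (applyPiece ;; .qi ≔ §.qi + 1 ;; fetch)

def writeChunk : ACmd :=
  .for .i §.m (.when (((§.uu * §.m + §.i) * §.b).lt §.U) (.write (2 * §.G + (§.uu * §.m + §.i)) 0 (§.i * §.b)))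

/-- Array `0` holds the known digits of chunk `c`. -/
def TextAt (P : Var → ℕ) (X wd : ℕ → ℕ) (N c s : ℕ) (A : AState) : Prop :=
  ∀ y < P .cu, A.arr 0 y = masked (P .sg) (P .d) X (Known P wd N s) (c * P .cu + y)

/-- A unit of the text. -/
noncomputable def unit (P : Var → ℕ) (X : ℕ → ℕ) (u : ℕ) : ℕ :=
  masked (P .sg) (P .d) X (fun _ => True) u

section

theorem power_wp {x : Var} {e : AExpr} (hx : x ≠ .i) (hx' : x ≠ .sg) (hsg : A.reg .sg = sg) (hsg0 : 0 < sg)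
    (hk : k < 2 ^ mc.w) (hpow : sg ^ k < 2 ^ mc.w)
    (he : ∀ v v', e.ok L ((A.setReg x v).setReg .i v') ∧ e.val ((A.setReg x v).setReg .i v') = k)
    (hQ : Q ((A.setReg x (sg ^ k)).setReg .i k) t) : L.wp (power x e) Q A t := by
  rw [power, wp_seq, wp_assign]; refine ⟨by simp, ?_⟩
  refine wp_for k (fun j A' t' => t' = t ∧ A' = (A.setReg x (sg ^ j)).setReg .i j) hk ⟨rfl, by simp⟩ ?_ ?_ ?_
  · rintro j A' t' hj ⟨rfl, rfl⟩ _; exact he _ _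
  · rintro j A' t' hj ⟨rfl, rfl⟩ _
    have : sg ^ j * sg < 2 ^ mc.w := by rw [← pow_succ]; exact lt_of_le_of_lt (Nat.pow_le_pow_right hsg0 hj) hpow
    simp [hx, hx'.symm,  hsg, this, hx.symm]; ext y <;> simp [pow_succ]; split_ifs <;> simp_all
  · rintro A' t' ⟨rfl, rfl⟩ _; exact hQ

theorem TextEnv.pow_le (hT : TextEnv L P X) (hk : k ≤ P .d) : P .sg ^ k ≤ P .D := by
  rw [hT.D_eq]
  exact Nat.pow_le_pow_right (by have := hT.two_le_sg; omega) hk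

theorem TextEnv.D_le_pad (hT : TextEnv L P X) : 2 * P .D ≤ P .pad := by
  rw [hT.pad_eq]
  have h1 := Nat.le_mul_of_pos_right ((2 * P .U + 2) * P .D) hT.D_pos
  have h2 := Nat.le_mul_of_pos_right ((2 * P .U + 2) * P .D * P .D) hT.D_pos
  have h3 : 2 * P .D ≤ (2 * P .U + 2) * P .D := Nat.mul_le_mul_right _ (by omega); omega

theorem TextEnv.D_lt (hT : TextEnv L P X) : 2 * P .D < L.bound := by
  have := hT.D_le_pad; have := hT.inf_eq; have := hT.inf_lt; omega

theorem TextEnv.d_lt (hT : TextEnv L P X) : P .d < P .D := by rw [hT.D_eq]; exact Nat.lt_pow_self hT.two_le_sg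

/-- Pieces are disjoint, so a position inside a piece that is not far belongs to no far piece and is
known only through the prefix. -/
theorem known_near (hW : Pieces P X wd N) (hk : k < N) (hf : ¬ IsFar P (wd k))
    (h1 : qy P (wd k) ≤ i) (h2 : i < qy P (wd k) + qz P (wd k)) :
    Known P wd N s i ↔ i < s := by
  refine ⟨fun h => h.resolve_right ?_, .inl⟩; rintro ⟨j, hj, hfj, h3, h4⟩; rw [← hW.pieceEnd_succ hk] at h2
  rw [← hW.pieceEnd_succ hj] at h4; rw [hW.start k hk] at h1; rw [hW.start j hj] at h3
  rcases lt_trichotomy j k with hjk | rfl | hjk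
  · have := pieceEnd_mono (P := P) (wd := wd) (show j + 1 ≤ k by omega); omega
  · exact hf hfj
  · have := pieceEnd_mono (P := P) (wd := wd) (show k + 1 ≤ j by omega); omega

variable (hT : TextEnv L P X) (hW : Pieces P X wd N)
include hT hW

/-- The source may overlap the piece. Copying digit by digit is still right: it starts before the
target, so digit `j` of the source precedes position `y + j`, up to which everything is known by
then. -/
theorem copyNear_wp (hP : A.Has P) (hp : p < N) (hcur : A.reg .cur = wd p) (hc : qy P (wd p) / P .d / P .cu = c)
    (hk : qkind P (wd p) ≠ 0) (hf : ¬ IsFar P (wd p)) (hA : TextAt P X wd N c (qy P (wd p)) A)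
    (hQ : ∀ A', A'.Frame A [.s1, .s2, .s3, .i] [0] → A'.disk = A.disk →
      TextAt P X wd N c (qy P (wd p) + qz P (wd p)) A' → Q A' t) :
    L.wp copyNear Q A t := by
  have hn := hT.narr; have hw := L.width; have hbl := L.bound_le; have hd := hT.d_pos; have hD := hT.D_lt
  have hdD := hT.d_lt; have hcu := hT.cu_pos; have hcap := hT.cap; rw [← hT.cu_eq] at hcap; have hsg := hT.two_le_sg
  have hpc := hW.piece p hp
  have hcx : qx P (wd p) / P .d / P .cu = c := by
    have h1 : ¬ qx P (wd p) / P .d / P .cu < qy P (wd p) / P .d / P .cu := fun h => hf ⟨hk, h⟩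
    have h2 : qx P (wd p) / P .d / P .cu ≤ qy P (wd p) / P .d / P .cu :=
      Nat.div_le_div_right (Nat.div_le_div_right (hpc.src_lt hk).le)
    omega
  have hsu := hpc.src_unit hk; have hyu := hpc.unit; have hsrc := hpc.src hk; have hlt := hpc.src_lt hk
  generalize hx : qx P (wd p) = x at *; generalize hy : qy P (wd p) = y at *; generalize hz : qz P (wd p) = z at *
  have hmx := mod_lt (x / P .d) hcu; have hmy := mod_lt (y / P .d) hcu
  have hux : c * P .cu + x / P .d % P .cu = x / P .d := by rw [← hcx, div_add_mod']
  have huy : c * P .cu + y / P .d % P .cu = y / P .d := by rw [← hc, div_add_mod']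
  have hpl : ∀ k ≤ P .d, P .sg ^ k < 2 ^ mc.w := fun k hk => by have := hT.pow_le hk; omega
  have hxd := mod_lt x hd; have hyd := mod_lt y hd; rw [copyNear, wp_seq]
  refine power_wp (by simp) (by simp) (hP .sg rfl) (by omega) (k := x % P .d) (by omega)
    (hpl _ hxd.le) (fun v v' => ⟨by simp, ?_⟩) ?_
  · have h' : ((A.setReg .s1 v).setReg .i v').Has P := (hP.setReg rfl).setReg rfl; simp [val_xE h', hP .d rfl, hcur, hx]
  rw [wp_seq]
  refine power_wp (by simp) (by simp) (by simpa using hP .sg rfl) (by omega) (k := y % P .d) (by omega)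
    (hpl _ hyd.le) (fun v v' => ⟨by simp, ?_⟩) ?_
  · have h' := (((hP.setReg (x := .s1) (v := P .sg ^ (x % P .d)) rfl).setReg (x := .i)
      (v := x % P .d) rfl).setReg (x := .s2) (v := v) rfl).setReg (x := .i) (v := v') rfl
    simp [val_yE h', hP .d rfl, hcur, hy]
  obtain ⟨I, hI⟩ : ∃ I : ℕ → AState → ℕ → Prop, ∀ j A' t', I j A' t' ↔
      (A'.Frame A [.s1, .s2, .s3, .i] [0] ∧ A'.disk = A.disk ∧ t' = t ∧
        A'.reg .s1 = P .sg ^ (x % P .d + j) ∧ A'.reg .s2 = P .sg ^ (y % P .d + j) ∧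
        TextAt P X wd N c (y + j) A') := ⟨_, fun _ _ _ => Iff.rfl⟩
  refine wp_for z I (by omega) ((hI _ _ _).2 ⟨by simp, rfl, rfl, by simp, by simp, hA⟩) ?_ ?_ ?_
  · intro j A' t' hj h hs3; obtain ⟨hfr, -⟩ := (hI _ _ _).1 h; have hP' := hP.frame hfr (by decide)
    exact ⟨by simp, by rw [val_zE hP', hfr.reg _ (by simp), hcur, hz]⟩
  · intro j A' t' hj h hs3; obtain ⟨hfr, hdk, rfl, h1, h2, hA'⟩ := (hI _ _ _).1 h; have hP' := hP.frame hfr (by decide)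
    have hcur' : A'.reg .cur = wd p := by rw [hfr.reg _ (by simp), hcur]
    have ex := div_of_mod_add_lt hd (show x % P .d + j < P .d by omega)
    have ey := div_of_mod_add_lt hd (show y % P .d + j < P .d by omega)
    have hdig : A'.arr 0 (x / P .d % P .cu) / P .sg ^ (x % P .d + j) % P .sg = X (y + j) := by
      rw [hA' _ hmx, hux, ← ex.1, ← ex.2]
      have := masked_div_mod (sg := P .sg) (d := P .d) (X := X) (K := Known P wd N (y + j)) (p := x + j)
        (len := 1) (by omega) hT.X_lt (by rw [ex.2]; omega) (fun i hi => .inl (by omega))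
      rw [pow_one] at this; rw [this]; simp [hsrc j hj]
    have hins := masked_insert (sg := P .sg) (X := X) hd (K := Known P wd N (y + j))
      (K' := Known P wd N (y + (j + 1))) (s := y + j) (fun i => by
        simp only [Known]; constructor
        · rintro (h | h)
          · by_cases h' : i = y + j
            · exact .inr h'
            · exact .inl (.inl (by omega))
          · exact .inl (.inr h)
        · rintro ((h | h) | h)
          · exact .inl (by omega)
          · exact .inr h
          · exact .inl (by omega))
      (by rw [known_near hW hp hf (by omega) (by omega)]; omega)
    have hnew := hins (y / P .d); rw [if_pos ey.1, ey.2] at hnew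
    have hnlt := masked_lt (d := P .d) (show 0 < P .sg by omega) hT.X_lt (Known P wd N (y + (j + 1))) (y / P .d)
    rw [← hT.D_eq] at hnlt; have hAy := hA' _ hmy; rw [huy] at hAy
    have hp1 : P .sg ^ (x % P .d + j) * P .sg < 2 ^ mc.w := by rw [← pow_succ]; exact hpl _ (by omega)
    have hp2 : P .sg ^ (y % P .d + j) * P .sg < 2 ^ mc.w := by rw [← pow_succ]; exact hpl _ (by omega)
    simp [val_xE hP', val_yE hP', hcur', hP' .d rfl, hP' .cu rfl, h1, h2, hP' .sg rfl, hx, hy, hdig, hs3, hp1, hp2]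
    refine ⟨⟨⟨⟨by omega, by omega⟩, ⟨⟨by omega, by omega⟩, by omega⟩, by omega⟩, by omega, by omega,
      by omega⟩, (hI _ _ _).2 ⟨by simpa using hfr, hdk, rfl, by simp; rw [← pow_succ, add_assoc],
      by simp; rw [← pow_succ, add_assoc], ?_⟩⟩
    intro u hu; simp only [setReg_arr, setArr_arr, true_and]; rw [hins (c * P .cu + u), ey.1]; split_ifs with g1 g2 g2
    · subst g1; rw [hAy, huy, ey.2]
    · subst g1; omega
    · omega
    · rw [hA' u hu, add_zero]
  · intro A' t' h _; obtain ⟨hfr, hdk, rfl, -, -, hA'⟩ := (hI _ _ _).1 h; exact hQ A' hfr hdk hA'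

theorem applyPiece_wp (hP : A.Has P) (hp : p < N) (hcur : A.reg .cur = wd p) (hc : qy P (wd p) / P .d / P .cu = c)
    (hA : TextAt P X wd N c (pieceEnd P wd p) A)
    (hQ : ∀ A', A'.Frame A [.s1, .s2, .s3, .i] [0] → A'.disk = A.disk →
      TextAt P X wd N c (pieceEnd P wd (p + 1)) A' → Q A' t) :
    L.wp applyPiece Q A t := by
  have hn := hT.narr; have hw := L.width; have hbl := L.bound_le; have hD := hT.D_lt; have hcu := hT.cu_pos
  have hcap := hT.cap; rw [← hT.cu_eq] at hcap; have hpc := hW.piece p hp; rw [hW.pieceEnd_succ hp] at hQ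
  rw [← hW.start p hp] at hA; have hmy := mod_lt (qy P (wd p) / P .d) hcu
  have huy : c * P .cu + qy P (wd p) / P .d % P .cu = qy P (wd p) / P .d := by rw [← hc, div_add_mod']
  rw [applyPiece, wp_ite]; refine ⟨by simp, fun h0 => ?_, fun h0 => ?_⟩
  · simp [val_kindE hP, hcur] at h0
    have hins := masked_interval (sg := P .sg) (d := P .d) (X := X) (K := Known P wd N (qy P (wd p)))
      (K' := Known P wd N (qy P (wd p) + qz P (wd p))) (t := qy P (wd p)) (len := qz P (wd p))
      (fun i => by
        simp only [Known]; constructor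
        · rintro (h | h)
          · by_cases h' : i < qy P (wd p)
            · exact .inl (.inl h')
            · exact .inr ⟨by omega, h⟩
          · exact .inl (.inr h)
        · rintro ((h | h) | h)
          · exact .inl (by omega)
          · exact .inr h
          · exact .inl h.2)
      (fun i h1 h2 => by
        rw [known_near hW hp (fun h => h.1 h0) h1 h2]
        omega) hpc.unit
    have hnew := hins (qy P (wd p) / P .d); rw [if_pos rfl, ← hpc.lit h0] at hnew
    have hnlt := masked_lt (d := P .d) (show 0 < P .sg by have := hT.two_le_sg; omega) hT.X_lt
      (Known P wd N (qy P (wd p) + qz P (wd p))) (qy P (wd p) / P .d)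
    rw [← hT.D_eq] at hnlt; have hAy := hA _ hmy; rw [huy] at hAy
    simp [val_xE hP, val_yE hP, hcur, hP .d rfl, hP .cu rfl]
    refine ⟨⟨⟨by omega, by omega⟩, by omega, by omega, by omega⟩, hQ _ (by simp) rfl ?_⟩; intro u hu
    simp only [setArr_arr, true_and]; rw [hins (c * P .cu + u)]; split_ifs with g1 g2 g2
    · subst g1; rw [hAy, huy, hpc.lit h0]
    · subst g1; omega
    · omega
    · rw [hA u hu, add_zero]
  · simp [val_kindE hP, hcur] at h0; rw [wp_ite]; refine ⟨ok_farE A, fun hf => ?_, fun hf => ?_⟩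
    -- The digits of a far piece were added with the answers, so moving the known prefix past it
    -- changes nothing.
    · rw [val_farE hP, hcur] at hf; refine hQ _ (by simp) rfl fun y hy => ?_; rw [hA y hy]
      refine masked_congr fun o _ => .inl ?_; simp only [Known]; constructor
      · rintro (h | h)
        · exact .inl (by omega)
        · exact .inr h
      · rintro (h | h)
        · by_cases h' : c * P .cu * P .d + y * P .d + o < qy P (wd p)
          · exact .inl (by rw [add_mul]; exact h')
          · exact .inr ⟨p, hp, hf, by rw [add_mul]; omega, h⟩
        · exact .inr h
    · rw [val_farE hP, hcur] at hf; exact copyNear_wp hT hW hP hp hcur hc h0 hf hA hQ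

end

/-! ### The messages to a chunk -/

/-- Add the answer `val` to the text. -/
def storeAnswer : ACmd := .set 0 (yE .val) (.get 0 (yE .val) + zE .val)

/-- Answer the request `val`. -/
def reply : ACmd :=
  power .s1 (xE .val % §.d) ;; power .s2 (zE .val) ;; power .s3 (yE .val % §.d) ;;
  .val ≔ codeE (2 * (yE .val / §.d / §.cu)) 0 (yE .val / §.d % §.cu)
    (.get 0 (xE .val / §.d % §.cu) / §.s1 % §.s2 * §.s3) ;;
  emit

/-- Piece number `p` is the current one. -/
structure Cursor (P : Var → ℕ) (wd : ℕ → ℕ) (N p : ℕ) (A : AState) : Prop where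
  num : A.reg .num = N
  qi : A.reg .qi = p
  le : p ≤ N
  cur : p < N → A.reg .cur = wd p ∧ Loaded P wd p A

/-- The pieces of the chunks before `c` are among the first `p` ones. -/
def Before (P : Var → ℕ) (wd : ℕ → ℕ) (N c p : ℕ) : Prop := p < N → c ≤ qy P (wd p) / P .d / P .cu

theorem Cursor.congr (h : Cursor P wd N p A)
    (h1 : A'.reg .num = A.reg .num) (h2 : A'.reg .qi = A.reg .qi) (h3 : A'.reg .cur = A.reg .cur)
    (h4 : A'.arr 1 = A.arr 1) : Cursor P wd N p A' :=
  ⟨by rw [h1, h.num], by rw [h2, h.qi], h.le, fun hp => ⟨by rw [h3, (h.cur hp).1], (h.cur hp).2.congr h4⟩⟩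

section

theorem request_fields_eq (hT : TextEnv L P X) (v : ℕ) : qx P (request P v) = qx P v ∧
    qy P (request P v) = qy P v ∧ qz P (request P v) = qz P v :=
  ⟨code.div_div_mod (qx_lt hT.D_pos v) (qy_lt hT.D_pos v) (qz_lt hT.D_pos v),
    code.div_mod (qy_lt hT.D_pos v) (qz_lt hT.D_pos v), code.mod (qz_lt hT.D_pos v)⟩

variable (hT : TextEnv L P X) (hW : Pieces P X wd N)
include hT

/-- Every partial sum is at most the sum over all of `T`, so the bound on the latter excludes
overflow whatever the order of delivery. -/
theorem storeAnswer_handler {T : Multiset ℕ} (hy : ∀ v ∈ T, qy P v < P .cu)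
    (hs : ∀ y < P .cu, ((T.filter fun v => qy P v = y).map (qz P)).sum < P .D) :
    Handler L P storeAnswer (fun H A => ∀ y < P .cu,
      A.arr 0 y = ((H.filter fun v => qy P v = y).map (qz P)).sum) T x [] [0] where
  par := by simp
  regs := by simp
  arrs := by simp
  stable H A A' hf _ h y hy := by rw [hf.arr 0 (by simp), h y hy]
  run H A t hP _ hJ hle := by
    have hn := hT.narr; have hbl := L.bound_le; have hD := hT.D_lt; have hcap := hT.cap; rw [← hT.cu_eq] at hcap
    have hv := hy _ (Multiset.subset_of_le hle (Multiset.mem_cons_self _ _)); have hsum := hs _ hv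
    obtain ⟨R, rfl⟩ := Multiset.le_iff_exists_add.1 hle
    have hcons : ∀ y, ((((A.reg .val) ::ₘ H).filter fun v => qy P v = y).map (qz P)).sum =
        ((H.filter fun v => qy P v = y).map (qz P)).sum + if y = qy P (A.reg .val) then qz P (A.reg .val) else 0 := by
      intro y
      rw [Multiset.filter_cons, Multiset.map_add, Multiset.sum_add, add_comm]; congr 1
      by_cases h : qy P (A.reg .val) = y
      · simp [h]
      · simp [h, Ne.symm h]
    rw [Multiset.filter_add, Multiset.map_add, Multiset.sum_add, hcons, if_pos rfl] at hsum; have hval := hJ _ hv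
    simp [storeAnswer, val_yE hP, val_zE hP]
    refine ⟨⟨⟨⟨by omega, by omega⟩, by omega⟩, by omega, by omega, by omega⟩, fun y hy => ?_⟩; rw [hcons]
    split_ifs with h
    · rw [h, hval]
    · rw [hJ y hy, add_zero]

include hW

/-- The answers go to chunks after `c`, so their keys are at least `2 * c + 2`, which is the end of
the current range: they are not due in this scan, and the new blocks respect the threshold that
holds afterwards. The hypothesis on the number of messages keeps level zero within its `G` blocks.
-/
theorem reply_handler {T : Multiset ℕ}
    (hv : ∀ v ∈ T, ∃ i < N, IsFar P (wd i) ∧ qx P (wd i) / P .d / P .cu = c ∧ v = request P (wd i))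
    (hx : x * P .b + T.card ≤ P .G * P .b) :
    Handler L P reply (fun H A => Queue P A x ((2 * c + 2) * P .D * P .D * P .D)
        (S + H.map (answer P X)) ∧ A.reg .x1 * P .b + A.reg .cnt = x * P .b + H.card ∧
        A.reg .x1 ≤ P .G ∧ ∀ y < P .cu, A.arr 0 y = unit P X (c * P .cu + y)) T x
      [.s1, .s2, .s3, .i, .j, .z1, .val, .cnt, .x1] [6] where
  par := by decide
  regs := by decide
  arrs := by simp
  stable H A A' hf hd h := by
    have ex1 : A'.reg .x1 = A.reg .x1 := hf.reg _ (by simp); have ecnt : A'.reg .cnt = A.reg .cnt := hf.reg _ (by simp)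
    refine ⟨h.1.congr hT.b_pos ecnt ex1 (hf.arr _ (by simp)) fun q hq => hd _ ?_, by rw [ex1, ecnt, h.2.1],
      ex1 ▸ h.2.2.1, by rw [hf.arr _ (by simp)]; exact h.2.2.2⟩
    have h1 := h.2.2.1; omega
  run H A t hP hx0 hJ hle := by
    obtain ⟨hq, hcnt, -, htext⟩ := hJ; have hn := hT.narr; have hw := L.width; have hbl := L.bound_le
    have hd := hT.d_pos; have hD := hT.D_lt; have hdD := hT.d_lt; have hcu := hT.cu_pos; have hcap := hT.cap
    rw [← hT.cu_eq] at hcap; have hsg := hT.two_le_sg; have hcard := Multiset.card_le_card hle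
    rw [Multiset.card_cons] at hcard
    have hx1 : A.reg .x1 < P .G := by refine lt_of_mul_lt_mul_right (a := P .b) ?_ (Nat.zero_le _); omega
    obtain ⟨i, hi, hfar, hc, hval⟩ := hv _ (Multiset.subset_of_le hle (Multiset.mem_cons_self _ _))
    obtain ⟨rx, ry, rz⟩ := request_fields_eq hT (wd i)
    have hmem : answer P X (wd i) ∈ queueAt P X wd N (c + 1) := by
      refine Multiset.mem_add.2 (.inr (Multiset.mem_map_of_mem _ (Multiset.mem_filter.2 ⟨?_, by omega⟩)))
      exact Multiset.mem_filter.2 ⟨Multiset.mem_map_of_mem _ (Multiset.mem_range.2 hi), hfar⟩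
    have hpad := queueAt_lt_pad hT hW hmem; have hpadw := hT.pad_lt
    -- A request repeats the last three components of its piece, and an answer depends only on the
    -- last two of them; thus it can be formed from the request.
    have hans : answer P X (request P (wd i)) = answer P X (wd i) := by simp only [answer, ry, rz]
    have hpc := hW.piece i hi; have hsu := hpc.src_unit hfar.1; have hyu := hpc.unit; have hvlt := Pieces.value_lt hT hpc
    have hcy : c < qy P (wd i) / P .d / P .cu := hc ▸ hfar.2
    have hlo : (2 * c + 2) * P .D * P .D * P .D ≤ answer P X (wd i) := by
      refine le_trans ?_ code.le
      exact Nat.mul_le_mul_right _ (Nat.mul_le_mul_right _ (Nat.mul_le_mul_right _ (by omega)))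
    have hvalue : A.arr 0 (qx P (wd i) / P .d % P .cu) / P .sg ^ (qx P (wd i) % P .d) %
        P .sg ^ qz P (wd i) * P .sg ^ (qy P (wd i) % P .d) = value (P .sg) (P .d) X (qy P (wd i)) (qz P (wd i)) := by
      rw [htext _ (mod_lt _ hcu), ← hc, div_add_mod', unit,
        masked_div_mod (by omega) hT.X_lt hsu (fun _ _ => trivial), value_eq]
      congr 1; refine sum_congr rfl fun j hj => ?_; rw [hpc.src hfar.1 j (mem_range.1 hj)]
    have hmx := mod_lt (qx P (wd i) / P .d) hcu; have hxd := mod_lt (qx P (wd i)) hd; have hyd := mod_lt (qy P (wd i)) hd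
    have hpl : ∀ k ≤ P .d, P .sg ^ k < 2 ^ mc.w := fun k hk => by have := hT.pow_le hk; omega
    rw [reply, wp_seq]
    refine power_wp (by simp) (by simp) (hP .sg rfl) (by omega) (k := qx P (wd i) % P .d) (by omega)
      (hpl _ hxd.le) (fun v v' => ⟨by simp, ?_⟩) ?_
    · have h' : ((A.setReg .s1 v).setReg .i v').Has P := (hP.setReg rfl).setReg rfl
      simp [val_xE h', hP .d rfl, hval, rx]
    rw [wp_seq]; generalize hA1 : (A.setReg .s1 _).setReg .i _ = A1
    have hP1 : A1.Has P := hA1 ▸ (hP.setReg rfl).setReg rfl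
    have v1 : A1.reg .val = request P (wd i) := by rw [← hA1]; simpa using hval
    refine power_wp (by simp) (by simp) (hP1 .sg rfl) (by omega) (k := qz P (wd i)) (by omega)
      (hpl _ (by omega)) (fun v v' => ⟨by simp, ?_⟩) ?_
    · have h' : ((A1.setReg .s2 v).setReg .i v').Has P := (hP1.setReg rfl).setReg rfl; simp [val_zE h', v1, rz]
    rw [wp_seq]; generalize hA2 : (A1.setReg .s2 _).setReg .i _ = A2
    have hP2 : A2.Has P := hA2 ▸ (hP1.setReg rfl).setReg rfl
    have v2 : A2.reg .val = request P (wd i) := by rw [← hA2]; simpa using v1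
    refine power_wp (by simp) (by simp) (hP2 .sg rfl) (by omega) (k := qy P (wd i) % P .d) (by omega)
      (hpl _ hyd.le) (fun v v' => ⟨by simp, ?_⟩) ?_
    · have h' : ((A2.setReg .s3 v).setReg .i v').Has P := (hP2.setReg rfl).setReg rfl
      simp [val_yE h', hP2 .d rfl, v2, ry]
    generalize hA3 : (A2.setReg .s3 _).setReg .i _ = A3; have hP3 : A3.Has P := hA3 ▸ (hP2.setReg rfl).setReg rfl
    have v3 : A3.reg .val = request P (wd i) := by rw [← hA3]; simpa using v2
    have hf3 : A3.Frame A [.s1, .s2, .s3, .i] [] := by rw [← hA3, ← hA2, ← hA1]; simp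
    have hd3 : A3.disk = A.disk := by rw [← hA3, ← hA2, ← hA1]; rfl
    have h0 : A3.arr 0 = A.arr 0 := hf3.arr 0 (by simp)
    have r1 : A3.reg .s1 = P .sg ^ (qx P (wd i) % P .d) := by rw [← hA3, ← hA2, ← hA1]; simp
    have r2 : A3.reg .s2 = P .sg ^ (qz P (wd i)) := by rw [← hA3, ← hA2]; simp
    have r3 : A3.reg .s3 = P .sg ^ (qy P (wd i) % P .d) := by rw [← hA3]; simp
    have hz : AExpr.val A3 (.get 0 (xE .val / §.d % §.cu) / §.s1 % §.s2 * §.s3) =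
        value (P .sg) (P .d) X (qy P (wd i)) (qz P (wd i)) := by
      simp only [AExpr.val_mul, AExpr.val_mod, AExpr.val_div, AExpr.val_get, AExpr.val_r, val_xE hP3,
        hP3 .d rfl, hP3 .cu rfl, v3, rx, r1, r2, r3, h0]
      exact hvalue
    have hvalc : AExpr.val A3 (codeE (2 * (yE .val / §.d / §.cu)) 0 (yE .val / §.d % §.cu)
        (.get 0 (xE .val / §.d % §.cu) / §.s1 % §.s2 * §.s3)) = answer P X (wd i) := by
      rw [val_codeE hP3, hz]; simp [val_yE hP3, hP3 .d rfl, hP3 .cu rfl, v3, ry, answer]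
    rw [wp_seq, wp_assign, hvalc]
    refine ⟨ok_codeE hP3 hT.D_pos ?_ (by simp) (by simp) ?_ ?_, ?_⟩
    · simp [val_yE hP3, hP3 .d rfl, hP3 .cu rfl, v3, ry]; have h1 := hT.chunk_lt hpc; have h2 := hT.U_le_n
      have h3 := hT.n_lt_G; have h4 := hT.eight_mul_G_lt; omega
    · simp only [AExpr.val_mod, AExpr.val_div, AExpr.val_get, AExpr.val_r, val_xE hP3,
        hP3 .d rfl, hP3 .cu rfl, v3, rx, r1, r2, r3, h0, AExpr.ok_mul, AExpr.ok_div, AExpr.ok_mod,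
        AExpr.ok_get, ok_xE, AExpr.ok_r, hvalue]
      simp only [true_and, and_true]; omega
    · rw [val_codeE hP3] at hvalc; rw [hvalc]; omega
    · have er : ∀ y, y ∉ [Var.s1, .s2, .s3, .i] → A3.reg y = A.reg y := hf3.reg
      refine emit_wp hT.toEnv (hP3.setReg rfl) (hq.congr hT.b_pos (by simp [er]) (by simp [er]) (hf3.arr 6 (by simp))
        (fun _ _ => by rw [setReg_disk, hd3])) (by simpa [er] using hx1) (by simpa using hpad.le)
        (by simpa using hlo) ?_
      intro A' t' hf' hq' hd' hs' hx' ht'; simp [er] at hd' hs' hx' ht'; simp [Multiset.filter_singleton, hpad] at hq'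
      refine ⟨(hf'.mono (by simp) (by simp)).trans ?_, ⟨?_, ?_, by omega, ?_⟩, ?_, by omega⟩
      · exact (hf3.mono (by simp) (by simp)).setReg (by simp)
      · rw [Multiset.map_cons, ← Multiset.singleton_add, add_comm ({_} : Multiset ℕ), ← add_assoc, hval, hans]; exact hq'
      · rw [Multiset.card_cons]; omega
      · rw [hf'.arr 0 (by simp), setReg_arr, h0]; exact htext
      · intro q hq'; have := hq.le_x1; rw [hd' q (by omega), hd3]

/-- Pieces come in text order, so those of chunk `c` are consecutive and the cursor never goes back.
Each block of pieces is therefore read once over all chunks, as expressed by the telescoping term `p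
/ b`. -/
theorem applyChunk_wp (hend : pieceEnd P wd N = P .n) (hP : A.Has P) (hS : Source P wd N A) (hC : Cursor P wd N p A)
    (hpos : pieceEnd P wd p ≤ (c + 1) * P .cu * P .d) (hbef : Before P wd N c p)
    (hc : A.reg .uu = c) (hA : TextAt P X wd N c (pieceEnd P wd p) A)
    (hQ : ∀ A' t' p', A'.Frame A [.s1, .s2, .s3, .i, .qi, .cur] [0, 1] → A'.disk = A.disk →
      Cursor P wd N p' A' → pieceEnd P wd p' ≤ (c + 1) * P .cu * P .d → Before P wd N (c + 1) p' →
      (∀ y < P .cu, A'.arr 0 y = unit P X (c * P .cu + y)) → t' + p / P .b ≤ t + p' / P .b → Q A' t') :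
    L.wp applyChunk Q A t := by
  have hw := L.width; have hbl := L.bound_le; have hb := hT.b_pos; have hd := hT.d_pos; have hcu := hT.cu_pos
  have hnG := hT.n_lt_G; have hNn := hW.le_n; have hGb := hT.Gb
  have hG1 : P .G ≤ P .G * P .b := Nat.le_mul_of_pos_right _ hb
  obtain ⟨I, hI⟩ : ∃ I : ℕ → AState → ℕ → Prop, ∀ p' A' t', I p' A' t' ↔
      (A'.Frame A [.s1, .s2, .s3, .i, .qi, .cur] [0, 1] ∧ A'.disk = A.disk ∧
      Cursor P wd N p' A' ∧ pieceEnd P wd p' ≤ (c + 1) * P .cu * P .d ∧ Before P wd N c p' ∧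
      TextAt P X wd N c (pieceEnd P wd p') A' ∧ t' + p / P .b ≤ t + p' / P .b) :=
    ⟨_, fun _ _ _ => Iff.rfl⟩
  refine wp_while (fun A' t' => ∃ p', I p' A' t') (fun A' => N - A'.reg .qi)
    ⟨p, (hI _ _ _).2 ⟨.refl _ _ _, rfl, hC, hpos, hbef, hA, le_rfl⟩⟩ ?_ ?_ ?_
  · rintro A' t' -
    simp only [AExpr.ok_mul, AExpr.ok_lt, AExpr.ok_eq, AExpr.ok_div, ok_yE, AExpr.ok_r, AExpr.val_lt, AExpr.val_eq]
    refine ⟨by simp, by simp, ?_⟩; split_ifs <;> omega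
  · rintro A' t' ⟨p', h⟩ hcond
    obtain ⟨hf, hd', hC', hpos', hbef', hA', ht'⟩ := (hI _ _ _).1 h; have hP' := hP.frame hf (by decide)
    have hcond' := (AExpr.holds_mul _ _).1 (show AExpr.Holds A' _ from hcond)
    simp [hC'.num, hC'.qi, val_yE hP', hP' .d rfl, hP' .cu rfl, hf.reg .uu, hc] at hcond'; obtain ⟨hp', hcc⟩ := hcond'
    rw [(hC'.cur hp').1] at hcc; rw [wp_seq]
    refine applyPiece_wp hT hW hP' hp' (hC'.cur hp').1 hcc hA' ?_; intro A1 hf1 hd1 hA1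
    have hP1 := hP'.frame hf1 (by decide)
    have hC1 : Cursor P wd N p' A1 := hC'.congr (hf1.reg _ (by simp)) (hf1.reg _ (by simp))
      (hf1.reg _ (by simp)) (hf1.arr _ (by simp))
    rw [wp_seq, wp_assign]
    simp only [AExpr.val_add, AExpr.val_r, AExpr.val_ofNat, hC1.qi]; refine ⟨by simp [hC1.qi]; omega, ?_⟩
    have hs := @Nat.succ_div p' (P .b)
    refine fetch_wp hT.toEnv (p := p' + 1) (hP1.setReg rfl)
      (hS.congr (by omega) hb fun q _ => by rw [setReg_disk, hd1, hd'])
      (by omega) (by simp) (by simpa using hC1.num) ?_ ?_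
    · intro _ h0
      have : (p' + 1) / P .b = p' / P .b := by rw [hs, if_neg, add_zero]; rwa [dvd_iff_mod_eq_zero]
      intro o ho; rw [this]; exact (hC1.cur hp').2 o ho
    · intro A2 t2 hf2 hd2 hc2 ht2
      have hqi : A2.reg .qi = p' + 1 := by rw [hf2.reg _ (by simp)]; simp
      refine ⟨⟨p' + 1, (hI _ _ _).2 ⟨?_, by rw [hd2, setReg_disk, hd1, hd'], ⟨?_, hqi, hp', hc2⟩, ?_, ?_,
        ?_, by omega⟩⟩, by rw [hqi, hC'.qi]; omega⟩
      · refine (hf2.mono (by simp) (by simp)).trans (Frame.setReg ?_ (by simp))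
        exact (hf1.mono (by simp) (by simp)).trans hf
      · rw [hf2.reg _ (by simp)]; simpa using hC1.num
      · rw [hW.pieceEnd_succ hp']; have h1 := (hW.piece p' hp').unit; have h2 := div_add_mod' (qy P (wd p')) (P .d)
        have h3 : qy P (wd p') / P .d < (c + 1) * P .cu := by rw [← Nat.div_lt_iff_lt_mul hcu]; omega
        have h4 : (qy P (wd p') / P .d + 1) * P .d ≤ (c + 1) * P .cu * P .d := Nat.mul_le_mul_right _ h3
        rw [add_mul] at h4; omega
      · intro hlt; rw [← hcc, hW.start _ hlt, hW.pieceEnd_succ hp']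
        exact Nat.div_le_div_right (Nat.div_le_div_right (Nat.le_add_right _ _))
      · intro y hy; rw [hf2.arr 0 (by simp)]; exact hA1 y hy
  · rintro A' t' ⟨p', h⟩ hcond
    obtain ⟨hf, hd', hC', hpos', hbef', hA', ht'⟩ := (hI _ _ _).1 h; have hP' := hP.frame hf (by decide)
    have hcond' : ¬ (_ ∧ _) := fun hh => (show ¬ AExpr.Holds A' _ from not_not.2 hcond) ((AExpr.holds_mul _ _).2 hh)
    simp [hC'.num, hC'.qi, val_yE hP', hP' .d rfl, hP' .cu rfl, hf.reg .uu, hc] at hcond'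
    have hbef'' : Before P wd N (c + 1) p' := fun hp' => by
      have h1 := hbef' hp'; have h2 := hcond' hp'; rw [(hC'.cur hp').1] at h2; omega
    refine hQ A' t' p' hf hd' hC' hpos' hbef'' ?_ ht'; intro y hy; rw [hA' y hy]; refine masked_congr fun o ho => ?_
    -- When the loop stops, either the next piece starts in a later chunk and the known prefix
    -- covers chunk `c`, or the prefix is the whole text and the remaining digits are 0.
    by_cases hn : P .n ≤ (c * P .cu + y) * P .d + o
    · exact .inr (hT.X_zero _ hn)
    refine .inl ⟨fun _ => trivial, fun _ => .inl ?_⟩; rcases hC'.le.lt_or_eq with hp' | rfl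
    · have h1 := hbef'' hp'
      rw [hW.start _ hp', Nat.le_div_iff_mul_le hcu, Nat.le_div_iff_mul_le hd] at h1
      have h2 : c * P .cu + y + 1 ≤ (c + 1) * P .cu := by rw [add_mul]; omega
      have h3 := Nat.mul_le_mul_right (P .d) h2; rw [add_mul _ 1] at h3; omega
    · omega

omit hW in
-- A chunk has `m` blocks of `b` units, of which only those that begin before unit `U` are written.
-- The truncated counts `min (c * m) ⌈U / b⌉` telescope, so all chunks together write `⌈U / b⌉`
-- blocks.
theorem writeChunk_wp {f : ℕ → ℕ} (hP : A.Has P) (hc : A.reg .uu = c) (hcU : c * P .cu < P .U)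
    (hA : ∀ y < P .cu, A.arr 0 y = f (c * P .cu + y))
    (hQ : ∀ A' t', A'.Frame A [.i] [] → (∀ q < 2 * P .G, A'.disk q = A.disk q) →
      (∀ q, 3 * P .G ≤ q → A'.disk q = A.disk q) →
      (∀ q < c * P .m, A'.disk (2 * P .G + q) = A.disk (2 * P .G + q)) →
      (∀ q, c * P .m ≤ q → q < (c + 1) * P .m → q * P .b < P .U → ∀ o < P .b,
        A'.disk (2 * P .G + q) o = f (q * P .b + o)) →
      t' + min (c * P .m) ((P .U + P .b - 1) / P .b) ≤ t + min ((c + 1) * P .m) ((P .U + P .b - 1) / P .b) → Q A' t') :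
    L.wp writeChunk Q A t := by
  have hn := hT.narr; have hw := L.width; have hbl := L.bound_le; have hb := hT.b_pos; have hUn := hT.U_le_n
  have hnG := hT.n_lt_G; have hG := hT.eight_mul_G_lt; have hUcu := hT.U_add_cu; have hcu := hT.cu_eq
  have hcap := hT.cap; have hcl := hT.cap_lt; have hm := hT.m_le_cap
  have hadd : ∀ j, (c * P .m + j) * P .b = c * P .cu + j * P .b := fun j => by rw [hcu]; ring
  have hbU : ∀ q, q * P .b < P .U → q < P .G := fun q hq => by have := Nat.le_mul_of_pos_right q hb; omega
  obtain ⟨I, hI⟩ : ∃ I : ℕ → AState → ℕ → Prop, ∀ j A' t', I j A' t' ↔ (A'.Frame A [.i] [] ∧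
      (∀ q, ¬ (2 * P .G + c * P .m ≤ q ∧ q < 3 * P .G) → A'.disk q = A.disk q) ∧
      (∀ q, c * P .m ≤ q → q < c * P .m + j → q * P .b < P .U → ∀ o < P .b,
        A'.disk (2 * P .G + q) o = f (q * P .b + o)) ∧
      t' + min (c * P .m) ((P .U + P .b - 1) / P .b) ≤
        t + min (c * P .m + j) ((P .U + P .b - 1) / P .b)) := ⟨_, fun _ _ _ => Iff.rfl⟩
  refine wp_for (P .m) I (by omega) ((hI _ _ _).2 ⟨by simp, fun _ _ => rfl, fun q h1 h2 => by omega, le_rfl⟩) ?_ ?_ ?_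
  · intro j A' t' _ h _; obtain ⟨hf, -⟩ := (hI _ _ _).1 h; simp [hf.reg .m, hP .m rfl]
  · intro j A' t' hj h hij; obtain ⟨hf, hd, hdn, ht⟩ := (hI _ _ _).1 h; have hP' := hP.frame hf (by decide)
    have huu : A'.reg .uu = c := by rw [hf.reg _ (by simp), hc]
    have hjb : j * P .b + P .b ≤ P .cu := by rw [hcu, ← succ_mul]; exact Nat.mul_le_mul_right _ hj
    have h1 := hadd j; have h2 := Nat.le_mul_of_pos_right (c * P .m + j) hb
    have hR : c * P .m + j < (P .U + P .b - 1) / P .b ↔ (c * P .m + j) * P .b < P .U := by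
      rw [← succ_le_iff, Nat.le_div_iff_mul_le hb, succ_mul]; omega
    rw [wp_when]; refine ⟨?_, fun hlt => ?_, fun hlt => ?_⟩
    · simp [huu, hij, hP' .m rfl, hP' .b rfl]; omega
    · simp [huu, hij, hP' .m rfl, hP' .b rfl, hP' .U rfl] at hlt; have hqG := hbU _ hlt
      simp [huu, hij, hP' .m rfl, hP' .b rfl, hP' .G rfl, hT.blk]
      refine ⟨⟨by omega, by omega, by omega, by omega⟩, fun hbd => (hI _ _ _).2 ⟨by simpa using hf, ?_, ?_, ?_⟩⟩
      · intro q hq; funext o; rw [setReg_disk, writeDisk_disk, if_neg (by omega), hd q hq]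
      · intro q hq1 hq2 hqU o ho; rw [setReg_disk, writeDisk_disk]; split_ifs with hqj
        · have : q = c * P .m + j := by omega
          rw [hf.arr 0 (by simp), hA _ (by omega), this, h1, add_assoc]
        · exact hdn q hq1 (by omega) hqU o ho
      · omega
    · simp [huu, hij, hP' .m rfl, hP' .b rfl, hP' .U rfl] at hlt
      refine ⟨hij, (hI _ _ _).2 ⟨hf.setReg (by simp), hd, fun q hq1 hq2 hqU => ?_, by omega⟩⟩; refine hdn q hq1 ?_ hqU
      rcases Nat.lt_or_ge q (c * P .m + j) with h' | h'
      · exact h'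
      · have : q = c * P .m + j := by omega
        rw [this] at hqU; omega
  · intro A' t' h _; obtain ⟨hf, hd, hdn, ht⟩ := (hI _ _ _).1 h
    rw [show c * P .m + P .m = (c + 1) * P .m by ring] at hdn ht
    exact hQ A' t' hf (fun q hq => hd q (by omega)) (fun q hq => hd q (by omega)) (fun q hq => hd _ (by omega)) hdn ht

end

/-! ### The resolution of the pieces -/

def zeroText : ACmd := .for .i §.cu (.set 0 §.i 0)

/-- Compute the text of chunk `uu`. -/
def computeChunk : ACmd :=
  zeroText ;; .key ≔ codeE (2 * §.uu + 1) 0 0 0 ;; extract storeAnswer ;; .th ≔ §.key ;;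
  applyChunk ;; writeChunk

/-- Answer the requests to chunk `uu`. -/
def answerChunk : ACmd :=
  .key ≔ codeE (2 * §.uu + 2) 0 0 0 ;; extract reply ;; .th ≔ §.key ;;
  flush ;; normalize ;; .uu ≔ §.uu + 1

def resolve : ACmd :=
  sendRequests ;; .uu ≔ 0 ;; .qi ≔ 0 ;; fetch ;;
  .loop ((§.uu * §.cu).lt §.U) (computeChunk ;; answerChunk)

/-- The state while chunk `c` is processed, when the messages before key `k` are delivered. -/
structure ChunkState (P : Var → ℕ) (X wd : ℕ → ℕ) (N c k p : ℕ) (A : AState) : Prop where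
  par : A.Has P
  uu : A.reg .uu = c
  cnt : A.reg .cnt = 0
  x0 : A.reg .x0 = A.reg .x1
  th : A.reg .th = k * P .D * P .D * P .D
  queue : Queue P A (A.reg .x1) 0 (queueAt P X wd N c)
  levels : Levels P A (A.reg .x1) (k * P .D * P .D * P .D)
  source : Source P wd N A
  cursor : Cursor P wd N p A

/-- The text of the chunks before `c` is on the disk. -/
def TextBefore (P : Var → ℕ) (X : ℕ → ℕ) (c : ℕ) (A : AState) : Prop :=
  ∀ q < c * P .m, q * P .b < P .U → ∀ o < P .b, A.disk (2 * P .G + q) o = unit P X (q * P .b + o)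

section

theorem Levels.congr (hb : 0 < P .b) (h : Levels P A x th)
    (hd : ∀ q, 4 * P .G ≤ q → (q < 4 * P .G + x ∨ 5 * P .G ≤ q) → A'.disk q = A.disk q) :
    Levels P A' x th := by
  have hdata : ∀ l g q, (g + 1) * P .m ^ l ≤ x → q < P .m ^ l →
      A'.disk (levelBase P l + g * P .m ^ l + q) = A.disk (levelBase P l + g * P .m ^ l + q) := by
    intro l g q hg hq; rw [add_mul, one_mul] at hg; rcases l with - | l
    · rw [levelBase_zero]; exact hd _ (by omega) (.inl (by omega))
    · have h4 : 6 * P .G ≤ levelBase P (l + 1) := Nat.mul_le_mul_right _ (by omega)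
      exact hd _ (by omega) (.inr (by omega))
  refine ⟨fun l g hg => (h.data l g hg).congr hb (fun q hq o _ => by rw [hdata l g q hg hq]) fun q hq o _ => ?_,
    fun l g hg => (h.ptr l g hg).congr hb (fun q hq o _ => by rw [hdata l g q hg.1 hq]) (hd _ ?_ (.inr ?_))⟩
  · rw [add_mul, one_mul] at hg; rw [hd _ (by omega) (.inl (by omega))]
  · have h5 : 5 * P .G ≤ ptrBase P l := Nat.mul_le_mul_right _ (by omega); omega
  · have h5 : 5 * P .G ≤ ptrBase P l := Nat.mul_le_mul_right _ (by omega); omega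

/-- With an empty batch and no block outside the levels, the lower bound speaks of nothing, so it
can be raised to the next key before answers are sent. -/
theorem Queue.relo {lo' : ℕ} (h : Queue P A x lo S) (hc : A.reg .cnt = 0) (hx : A.reg .x1 = x) : Queue P A x lo' S :=
  ⟨h.cnt_lt, h.batch_sorted, fun i hi => by omega, h.sorted, h.le_pad, h.le_x1, fun q h1 h2 => by omega, h.mset⟩

/-- Padding entries are not below `pad`, hence never below a key; they are stored but never
delivered. -/
theorem Queue.between_content (h : Queue P A x lo S) (hc : A.reg .cnt = 0) (hth : th' ≤ P .pad) :
    between th th' (A.content (P .b) (4 * P .G) (A.reg .x1 * P .b)) = between th th' S := by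
  rw [← h.mset, hc, Multiset.range_zero, Multiset.map_zero, add_zero, between, between, Multiset.filter_filter]
  exact Multiset.filter_congr fun v _ => by omega

theorem key_eq (D k : ℕ) : code D k 0 0 0 = k * D * D * D := by simp [code]

theorem TextEnv.key_le_pad (hT : TextEnv L P X) (hk : k ≤ 2 * P .U + 2) : k * P .D * P .D * P .D ≤ P .pad := by
  rw [hT.pad_eq]
  exact Nat.mul_le_mul_right _ (Nat.mul_le_mul_right _ (Nat.mul_le_mul_right _ hk))

variable (hT : TextEnv L P X) (hW : Pieces P X wd N)
include hT

theorem zeroText_wp (hP : A.Has P)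
    (hQ : ∀ A', A'.Frame A [.i] [0] → A'.disk = A.disk → (∀ y < P .cu, A'.arr 0 y = 0) → Q A' t) :
    L.wp zeroText Q A t := by
  have hn := hT.narr; have hcap := hT.cap; rw [← hT.cu_eq] at hcap; have hbd := hT.D_lt; have hcl := hT.cap_lt
  refine wp_for (P .cu) (fun j A' t' => A'.Frame A [.i] [0] ∧ A'.disk = A.disk ∧ t' = t ∧
    ∀ y < j, A'.arr 0 y = 0) (by omega) ⟨by simp, rfl, rfl, fun y hy => by omega⟩ ?_ ?_ ?_
  · rintro j A' t' _ ⟨hf, -⟩ _; simp [hf.reg .cu, hP .cu rfl]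
  · rintro j A' t' hj ⟨hf, hd, rfl, hz⟩ hi; simp [hi]
    refine ⟨⟨by omega, by omega, by omega⟩, by simpa using hf, hd, fun y hy hne => hz y (by omega)⟩
  · rintro A' t' ⟨hf, hd, rfl, hz⟩ _; exact hQ A' hf hd hz

include hW

/-- Delivering the keys with leading component `2 * c` fills in all far digits; the literal and near
pieces then fill the rest from left to right. The cost consists of one extraction, the blocks of
pieces read, and the blocks of text written. -/
theorem computeChunk_wp (hend : pieceEnd P wd N = P .n) {E : ℕ} (hA : ChunkState P X wd N c (2 * c) p A) (hcU : c * P .cu < P .U)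
    (hpos : pieceEnd P wd p ≤ c * P .cu * P .d) (hbef : Before P wd N c p) (htx : TextBefore P X c A)
    (hxG : A.reg .x1 ≤ P .G) (hE : min (A.reg .x1) (P .m * (log (P .m) (A.reg .x1) + 1)) ≤ E)
    (hQ : ∀ A' t' p', ChunkState P X wd N c (2 * c + 1) p' A' → A'.reg .x1 = A.reg .x1 →
      pieceEnd P wd p' ≤ (c + 1) * P .cu * P .d → Before P wd N (c + 1) p' →
      TextBefore P X (c + 1) A' → (∀ y < P .cu, A'.arr 0 y = unit P X (c * P .cu + y)) →
      P .b * (t' + p / P .b + min (c * P .m) ((P .U + P .b - 1) / P .b)) ≤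
        P .b * (t + p' / P .b + min ((c + 1) * P .m) ((P .U + P .b - 1) / P .b)) + 4 * P .b * E +
          ((farPieces P wd N).filter fun v => qy P v / P .d / P .cu = c).card → Q A' t') :
    L.wp computeChunk Q A t := by
  have hbl := L.bound_le; have hb := hT.b_pos; have hcu := hT.cu_pos; have hNn := hW.le_n; have hnG := hT.n_lt_G
  have hpadw := hT.pad_lt; have hUG := hT.U_le_n; have hG8 := hT.eight_mul_G_lt
  have hcU' : c < P .U := lt_of_le_of_lt (Nat.le_mul_of_pos_right _ hcu) hcU
  have hkey := hT.key_le_pad (k := 2 * c + 1) (by omega); obtain ⟨hP, huu, hcnt, hx0, hth, hq, hL, hS, hC⟩ := hA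
  rw [computeChunk, wp_seq]; refine zeroText_wp hT hP ?_; intro A1 hf1 hd1 hz; have hP1 := hP.frame hf1 (by decide)
  have huu1 : A1.reg .uu = c := by rw [hf1.reg _ (by simp), huu]
  have hval : AExpr.val A1 (codeE (2 * §.uu + 1) 0 0 0) = (2 * c + 1) * P .D * P .D * P .D := by
    rw [val_codeE hP1]; simp [huu1, key_eq]
  rw [wp_seq, wp_assign, hval]
  refine ⟨ok_codeE hP1 hT.D_pos (by simp [huu1]; omega) (by simp) (by simp) (by simp) ?_, ?_⟩
  · rw [← val_codeE hP1, hval]; omega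
  generalize hA2 : A1.setReg .key _ = A2
  have hf2 : A2.Frame A [.i, .key] [0] := by rw [← hA2]; exact (hf1.mono (by simp) (by simp)).setReg (by simp)
  have hd2 : A2.disk = A.disk := by rw [← hA2]; exact hd1
  have hz2 : ∀ y < P .cu, A2.arr 0 y = 0 := by rw [← hA2]; exact hz
  have hP2 := hP.frame hf2 (by decide); have ex2 : A2.reg .x1 = A.reg .x1 := hf2.reg _ (by simp)
  have hT2 := hq.between_content (th := 2 * c * P .D * P .D * P .D) hcnt hkey; rw [between_even hT hW] at hT2
  have hfields : ∀ v ∈ ((farPieces P wd N).filter fun v => qy P v / P .d / P .cu = c).map (answer P X),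
      qy P v < P .cu := by
    intro v hv; obtain ⟨w, hw', rfl⟩ := Multiset.mem_map.1 hv
    obtain ⟨i, hi, rfl, -⟩ := mem_farPieces (Multiset.mem_of_mem_filter hw'); have h1 := mod_lt (qy P (wd i) / P .d) hcu
    refine lt_of_eq_of_lt (code.div_mod ?_ (Pieces.value_lt hT (hW.piece i hi))) h1
    exact lt_of_le_of_lt ((mod_le _ _).trans (Nat.div_le_self _ _)) (qy_lt hT.D_pos _)
  rw [wp_seq]
  refine extract_wp hT.toEnv (x := A.reg .x1) (th := 2 * c * P .D * P .D * P .D)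
    (th' := (2 * c + 1) * P .D * P .D * P .D)
    (storeAnswer_handler hT hfields fun y hy => by
      rw [sum_answers hT hW hy, hT.D_eq]
      exact masked_lt (by have := hT.two_le_sg; omega) hT.X_lt _ _)
    hP2 (by rw [hf2.reg _ (by simp), hx0]) hxG
    (fun q hq' o ho => by rw [hd2]; exact hq.le_pad q hq' o ho)
    (Nat.mul_le_mul_right _ (Nat.mul_le_mul_right _ (Nat.mul_le_mul_right _ (by omega))))
    (by rw [← hA2]; simp) (hL.congr hb fun q _ _ => by rw [hd2]) (fun y hy => by simpa using hz2 y hy)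
    (by rw [← hT2]; exact congrArg _ (content_congr hb fun q _ _ _ => by rw [hd2])) ?_
  intro A3 t3 hf3 hd3 hL3 hJ3 ht3; have hP3 := hP2.frame hf3 (by decide)
  have hf3' := (hf3.mono (ys := [.i, .key, .q, .pw, .sb, .off, .ptr, .val]) (gs := [2, 0]) (by simp)
    (by simp)).trans (hf2.mono (by simp) (by simp))
  have ex3 : A3.reg .x1 = A.reg .x1 := hf3'.reg _ (by simp)
  have hd3' : ∀ q < 4 * P .G, A3.disk q = A.disk q := fun q hq => by rw [hd3 q (by omega), hd2]
  have hkey3 : A3.reg .key = (2 * c + 1) * P .D * P .D * P .D := by rw [hf3.reg _ (by simp), ← hA2]; simp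
  rw [wp_seq, wp_assign]; refine ⟨by simp, ?_⟩; rw [AExpr.val_r, hkey3, wp_seq]
  refine applyChunk_wp hT hW hend (p := p) (c := c) (hP3.setReg rfl)
    (hS.congr (by omega) hb fun q hq => by rw [setReg_disk, hd3' q (by omega)])
    (hC.congr (by simp [hf3'.reg]) (by simp [hf3'.reg]) (by simp [hf3'.reg]) (hf3'.arr 1 (by simp)))
    (hpos.trans (Nat.mul_le_mul_right _ (Nat.mul_le_mul_right _ (by omega)))) hbef
    (by simp [hf3'.reg, huu]) ?_ ?_
  · intro y hy; rw [setReg_arr, hJ3 y hy, sum_answers hT hW hy]; refine masked_congr fun o ho => .inl ?_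
    have h1 : c * P .cu * P .d ≤ (c * P .cu + y) * P .d := Nat.mul_le_mul_right _ (by omega); simp only [Known]
    constructor
    · rintro (h | h)
      · omega
      · exact .inr h
    · rintro (h | h)
      · omega
      · exact .inr h
  intro A4 t4 p' hf4 hd4 hC4 hpos4 hbef4 hun4 ht4
  have hP4 := (hP3.setReg (x := .th) (v := (2 * c + 1) * P .D * P .D * P .D) rfl).frame hf4 (by decide)
  rw [setReg_disk] at hd4
  have r4 : ∀ y, y ∉ [Var.i, .key, .q, .pw, .sb, .off, .ptr, .val, .th, .s1, .s2, .s3, .qi, .cur] →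
      A4.reg y = A.reg y := by
    intro y hy; simp only [List.mem_cons, not_or] at hy
    rw [hf4.reg y (by simp [hy]), setReg_reg, if_neg (by simp [hy]), hf3'.reg y (by simp [hy])]
  refine writeChunk_wp hT hP4 (by rw [r4 _ (by simp), huu]) hcU hun4 ?_; intro A5 t5 hf5 hlo5 hhi5 hold5 hnew5 ht5
  have ex5 : A5.reg .x1 = A.reg .x1 := by rw [hf5.reg _ (by simp), r4 _ (by simp)]
  have h6 : A5.arr 6 = A.arr 6 := by rw [hf5.arr _ (by simp), hf4.arr _ (by simp), setReg_arr, hf3'.arr _ (by simp)]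
  have hd5 : ∀ q, 4 * P .G ≤ q → A5.disk q = A3.disk q := fun q hq => by rw [hhi5 q (by omega), hd4]
  refine hQ A5 t5 p' ⟨hP4.frame hf5 (by decide), by rw [hf5.reg _ (by simp), r4 _ (by simp), huu],
    by rw [hf5.reg _ (by simp), r4 _ (by simp), hcnt], ?_, ?_, ?_, ?_, ?_, ?_⟩ ex5 hpos4 hbef4 ?_ ?_ ?_
  · rw [ex5, ← hx0, hf5.reg _ (by simp), r4 _ (by simp)]
  · rw [hf5.reg _ (by simp), hf4.reg _ (by simp)]; simp
  · rw [ex5]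
    refine hq.congr hb (by rw [hf5.reg _ (by simp), r4 _ (by simp)]) ex5 h6 fun q hq => ?_
    rw [hd5 _ (by omega), hd3 _ (by omega), hd2]
  · rw [ex5]; exact hL3.congr hb fun q hq _ => hd5 q hq
  · exact hS.congr (by omega) hb fun q hq => by rw [hlo5 q hq, hd4, hd3' q (by omega)]
  · exact hC4.congr (hf5.reg _ (by simp)) (hf5.reg _ (by simp)) (hf5.reg _ (by simp)) (hf5.arr _ (by simp))
  · intro q hq hqU o ho; rcases Nat.lt_or_ge q (c * P .m) with h' | h'
    · have := Nat.le_mul_of_pos_right q hb; rw [hold5 q h', hd4, hd3' _ (by omega)]; exact htx q h' hqU o ho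
    · exact hnew5 q h' hq hqU o ho
  · intro y hy; rw [hf5.arr _ (by simp)]; exact hun4 y hy
  · rw [ex3, ex2, Multiset.card_map] at ht3; have h1 := Nat.mul_le_mul_left (P .b) ht4
    have h2 := Nat.mul_le_mul_left (P .b) ht5; have h3 := Nat.mul_le_mul_left (4 * P .b) hE; simp only [mul_add] at *
    omega

/-- One extraction of the keys with leading component `2 * c + 1`, while the text of the chunk is
still in array 0. The flush adds at most one padded block, and `normalize` moves all new blocks into
the levels under the new threshold. -/
theorem answerChunk_wp {E : ℕ} (hA : ChunkState P X wd N c (2 * c + 1) p A) (hcU : c * P .cu < P .U)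
    (htx : TextBefore P X (c + 1) A) (hun : ∀ y < P .cu, A.arr 0 y = unit P X (c * P .cu + y))
    (hxG : A.reg .x1 * P .b + N + P .b ≤ P .G * P .b)
    (hE : min (A.reg .x1) (P .m * (log (P .m) (A.reg .x1) + 1)) ≤ E)
    (hQ : ∀ A' t', ChunkState P X wd N (c + 1) (2 * (c + 1)) p A' → TextBefore P X (c + 1) A' →
      A'.reg .x1 * P .b ≤ A.reg .x1 * P .b + P .b +
        ((farPieces P wd N).filter fun v => qx P v / P .d / P .cu = c).card →
      P .b * (t' + A.reg .x1 + levelCost (P .m) (P .G) (A.reg .x1)) ≤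
        P .b * (t + A'.reg .x1 + levelCost (P .m) (P .G) (A'.reg .x1)) + 4 * P .b * E +
          ((farPieces P wd N).filter fun v => qx P v / P .d / P .cu = c).card → Q A' t') :
    L.wp answerChunk Q A t := by
  have hw := L.width; have hbl := L.bound_le; have hb := hT.b_pos; have hcu := hT.cu_pos; have hNn := hW.le_n
  have hnG := hT.n_lt_G; have hpadw := hT.pad_lt; have hUG := hT.U_le_n; have hG8 := hT.eight_mul_G_lt
  have hcU' : c < P .U := lt_of_le_of_lt (Nat.le_mul_of_pos_right _ hcu) hcU
  have hkey := hT.key_le_pad (k := 2 * c + 2) (by omega); obtain ⟨hP, huu, hcnt, hx0, hth, hq, hL, hS, hC⟩ := hA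
  have hx1G : A.reg .x1 ≤ P .G := le_of_mul_le_mul_right (by omega) hb
  have hval : AExpr.val A (codeE (2 * §.uu + 2) 0 0 0) = (2 * c + 2) * P .D * P .D * P .D := by
    rw [val_codeE hP]; simp [huu, key_eq]
  rw [answerChunk, wp_seq, wp_assign, hval]
  refine ⟨ok_codeE hP hT.D_pos (by simp [huu]; omega) (by simp) (by simp) (by simp) ?_, ?_⟩
  · rw [← val_codeE hP, hval]; omega
  have hT2 := hq.between_content (th := (2 * c + 1) * P .D * P .D * P .D) hcnt hkey; rw [between_odd hT hW] at hT2
  have hcard : ((farPieces P wd N).filter fun v => qx P v / P .d / P .cu = c).card ≤ N :=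
    (Multiset.card_le_card (Multiset.filter_le _ _)).trans card_farPieces_le
  generalize hA1 : A.setReg .key _ = A1
  have r1 : ∀ y, y ≠ .key → A1.reg y = A.reg y := fun y hy => by rw [← hA1]; simp [hy]
  have hd1 : A1.disk = A.disk := by rw [← hA1]; rfl
  have ha1 : A1.arr = A.arr := by rw [← hA1]; rfl
  have hP1 : A1.Has P := hA1 ▸ hP.setReg rfl; rw [wp_seq]
  refine extract_wp hT.toEnv (x := A.reg .x1) (th := (2 * c + 1) * P .D * P .D * P .D)
    (th' := (2 * c + 2) * P .D * P .D * P .D) (T := ((farPieces P wd N).filter fun v =>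
      qx P v / P .d / P .cu = c).map (request P))
    (reply_handler hT hW (S := queueAt P X wd N c) (c := c) (fun v hv => ?_) ?_)
    hP1 (by rw [r1 _ (by simp), hx0]) hx1G
    (fun q hq' o ho => by rw [hd1]; exact hq.le_pad q hq' o ho)
    (Nat.mul_le_mul_right _ (Nat.mul_le_mul_right _ (Nat.mul_le_mul_right _ (by omega))))
    (by rw [← hA1]; simp) (hL.congr hb fun q _ _ => by rw [hd1]) ⟨?_, ?_, ?_, ?_⟩
    (by rw [← hT2]; exact congrArg _ (content_congr hb fun q _ _ _ => by rw [hd1])) ?_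
  · obtain ⟨w, hw', rfl⟩ := Multiset.mem_map.1 hv; obtain ⟨h1, h2⟩ := Multiset.mem_filter.1 hw'
    obtain ⟨i, hi, rfl, hf⟩ := mem_farPieces h1; exact ⟨i, hi, hf, h2, rfl⟩
  · rw [Multiset.card_map]; omega
  · rw [Multiset.map_zero, add_zero]
    refine (hq.relo hcnt rfl).congr hb (r1 _ (by simp)) (r1 _ (by simp)) (by rw [ha1]) fun q _ => by rw [hd1]
  · rw [r1 _ (by simp), r1 _ (by simp), hcnt]; simp
  · rwa [r1 _ (by simp)]
  · rwa [ha1]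
  intro A2 t2 hf2 hd2 hL2 ⟨hq2, hc2, hx2, hun2⟩ ht2; rw [Multiset.card_map] at hc2 ht2; rw [r1 _ (by simp)] at ht2
  have hP2 := hP1.frame hf2 (by decide)
  have hkey2 : A2.reg .key = (2 * c + 2) * P .D * P .D * P .D := by rw [hf2.reg _ (by simp), ← hA1]; simp
  have r2 : ∀ y, y ∉ [Var.q, .pw, .sb, .off, .ptr, .val, .s1, .s2, .s3, .i, .j, .z1, .cnt, .x1, .key] →
      A2.reg y = A.reg y := by
    intro y hy; simp only [List.mem_cons, not_or] at hy; rw [hf2.reg y (by simp [hy]), r1 y (by simp [hy])]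
  rw [wp_seq, wp_assign]; refine ⟨by simp, ?_⟩; rw [AExpr.val_r, hkey2, wp_seq]; generalize hA3 : A2.setReg .th _ = A3
  have r3 : ∀ y, y ≠ .th → A3.reg y = A2.reg y := fun y hy => by rw [← hA3]; simp [hy]
  have hd3 : A3.disk = A2.disk := by rw [← hA3]; rfl
  have ha3 : A3.arr = A2.arr := by rw [← hA3]; rfl
  have hP3 : A3.Has P := hA3 ▸ hP2.setReg rfl
  have hx2' : A2.reg .x1 < P .G := by refine lt_of_mul_lt_mul_right (a := P .b) ?_ (Nat.zero_le _); omega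
  have hq3 := hq2.congr hb (A' := A3) (r3 _ (by simp)) (r3 _ (by simp)) (by rw [ha3]) (fun q _ => by rw [hd3])
  refine flush_wp hT.toEnv hP3 hq3 (by rwa [r3 _ (by simp)]) hkey ?_; intro A4 t4 hf4 hq4 hc4 hd4 hx4 hs4 ht4
  rw [r3 _ (by simp)] at hd4 hx4 hs4 ht4; rw [r3 _ (by simp)] at hs4; have hle2 := hq2.le_x1
  have hP4 := hP3.frame hf4 (by decide); rw [wp_seq]
  refine normalize_wp hT.toEnv hP4 hq4 (by omega) (by rw [hf4.reg _ (by simp), r3 _ (by simp), r2 _ (by simp), hx0])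
    (by rw [hf4.reg _ (by simp), ← hA3]; simp) le_rfl
    (hL2.congr hb fun q _ hq' => by rw [hd4 q (by omega), hd3]) ?_
  intro A5 t5 hf5 hd5 hx5 hL5 hq5 ht5
  have r5 : ∀ y, y ∉ [Var.q, .pw, .sb, .off, .ptr, .val, .s1, .s2, .s3, .i, .j, .z1, .cnt, .x1, .key,
      .th, .best, .bj, .o, .x0] → A5.reg y = A.reg y := by
    intro y hy; simp only [List.mem_cons, not_or] at hy
    rw [hf5.reg y (by simp [hy]), hf4.reg y (by simp [hy]), r3 y (by simp [hy]), r2 y (by simp [hy])]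
  have hd5' : ∀ q < 4 * P .G, A5.disk q = A.disk q := by
    intro q hq
    rw [hd5 q (by omega), hd4 q (by omega), hd3, hd2 q (by omega), hd1]
  have ex5 : A5.reg .x1 = A4.reg .x1 := hf5.reg _ (by simp); have huu5 : A5.reg .uu = c := by rw [r5 _ (by simp), huu]
  have h1₅ : A5.arr 1 = A.arr 1 := by rw [hf5.arr _ (by simp), hf4.arr _ (by simp), ha3, hf2.arr _ (by simp), ha1]
  rw [wp_assign]; refine ⟨by simp [huu5]; omega, ?_⟩
  simp only [AExpr.val_add, AExpr.val_r, AExpr.val_ofNat, huu5]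
  -- The requests remain in the queue; going from chunk `c` to `c + 1` only adds their answers.
  have hqs : queueAt P X wd N c + (((farPieces P wd N).filter fun v => qx P v / P .d / P .cu = c).map
      (request P)).map (answer P X) = queueAt P X wd N (c + 1) := by
    rw [queueAt_succ, Multiset.map_map]; congr 1; refine Multiset.map_congr rfl fun v _ => ?_
    obtain ⟨rx, ry, rz⟩ := request_fields_eq hT v; simp only [Function.comp, answer, ry, rz]
  rw [hqs] at hq5
  refine hQ _ t5 ⟨(hP4.frame hf5 (by decide)).setReg rfl, by simp, ?_, ?_, ?_, ?_, ?_, ?_, ?_⟩ ?_ ?_ ?_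
  · rw [setReg_reg, if_neg (by simp), hf5.reg _ (by simp), hc4]
  · simp [hx5, ex5]
  · rw [setReg_reg, if_neg (by simp), hf5.reg _ (by simp), hf4.reg _ (by simp), ← hA3]; simp [mul_add]
  · simp only [setReg_reg, reduceCtorEq, if_false, ex5]
    exact (hq5.mono le_rfl ex5.ge (Nat.zero_le _)).congr hb (by simp) (by simp) rfl (fun _ _ => rfl)
  · simp only [setReg_reg, reduceCtorEq, if_false, ex5]; exact hL5.congr hb fun _ _ _ => rfl
  · exact hS.congr (by omega) hb fun q hq => by rw [setReg_disk, hd5' q (by omega)]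
  · exact hC.congr (by simp [r5]) (by simp [r5]) (by simp [r5]) (by simpa using h1₅)
  · intro q hq hqU o ho; have := Nat.le_mul_of_pos_right q hb; rw [setReg_disk, hd5' _ (by omega)]
    exact htx q hq hqU o ho
  · simp only [setReg_reg, reduceCtorEq, if_false, ex5]; omega
  · simp only [setReg_reg, reduceCtorEq, if_false, ex5]; have h1 := Nat.mul_le_mul_left (P .b) ht5
    have h2 := congrArg (P .b * ·) ht4; have h3 := Nat.mul_le_mul_left (4 * P .b) hE; simp only [mul_add] at *; omega

end

/-- A bound for the number of blocks of messages. -/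
def maxBlocks (P : Var → ℕ) (N : ℕ) : ℕ := 2 * N / P .b + ((P .U + P .cu - 1) / P .cu + 1)

/-- A bound for the cost of the resolution of `N` pieces. -/
def resolveCost (P : Var → ℕ) (N : ℕ) : ℕ :=
  4 * (N / P .b) + 3 + (P .U + P .b - 1) / P .b + 2 * maxBlocks P N + 4 * (maxBlocks P N * log (P .m) (maxBlocks P N)) +
    8 * (((P .U + P .cu - 1) / P .cu) * min (maxBlocks P N) (P .m * (log (P .m) (maxBlocks P N) + 1)))

theorem card_filter_lt_succ (S : Multiset ℕ) (f : ℕ → ℕ) (c : ℕ) : (S.filter fun v => f v < c + 1).card =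
      (S.filter fun v => f v < c).card + (S.filter fun v => f v = c).card := by
  induction S using Multiset.induction with
  | empty => simp
  | cons v S ih =>
    rw [Multiset.filter_cons, Multiset.filter_cons, Multiset.filter_cons, Multiset.card_add,
      Multiset.card_add, Multiset.card_add, ih]
    split_ifs <;> simp <;> omega

/-- All costs telescope over the chunks: blocks of pieces read, blocks of text written, queue blocks
and the level cost. What remains is two extractions per chunk, of at most `4 * E` transfers plus the
delivered messages divided by `b`. Each request and each answer is delivered once, hence at most `2
* N` deliveries. -/
theorem resolve_wp (hT : TextEnv L P X) (hW : Pieces P X wd N) (hend : pieceEnd P wd N = P .n)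
     (hP : A.Has P) (hS : Source P wd N A)
    (hnum : A.reg .num = N)
    (hQ : ∀ A' t', A'.Has P → (∀ q, q * P .b < P .U → ∀ o < P .b, A'.disk (2 * P .G + q) o = unit P X (q * P .b + o)) →
      t' ≤ t + resolveCost P N → Q A' t') :
    L.wp resolve Q A t := by
  have hbl := L.bound_le; have hb := hT.b_pos; have hcu := hT.cu_pos; have hNn := hW.le_n; have hnG := hT.n_lt_G
  have hUn := hT.U_le_n; have hUcu := hT.U_add_cu; have hm2 := hT.two_le_m; rw [resolve, wp_seq]
  refine sendRequests_wp hT hW hP hS hnum ?_; intro A1 t1 hP1 hnum1 hd1 hc1 hx₁ hth1 hq1 hL1 hxb1 ht1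
  simp only [wp_seq, wp_assign]; refine ⟨by simp, by simp, ?_⟩; simp only [AExpr.val_ofNat]
  refine fetch_wp hT.toEnv (p := 0) ((hP1.setReg rfl).setReg rfl)
    (hS.congr (by omega) hb fun q hq => hd1 q (by omega)) (by omega) (by simp) (by simpa using hnum1)
    (fun _ h => by simp at h) ?_
  intro A2 t2 hf2 hd2 hcur2 ht2
  have r2 : ∀ y, y ∉ [Var.uu, .qi, .cur] → A2.reg y = A1.reg y := by
    intro y hy; simp only [List.mem_cons, not_or] at hy; rw [hf2.reg y (by simp [hy])]; simp [hy]
  have hP2 := ((hP1.setReg (x := .uu) (v := 0) rfl).setReg (x := .qi) (v := 0) rfl).frame hf2 (by decide)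
  have ex2 : A2.reg .x1 = A1.reg .x1 := r2 _ (by simp); simp only [setReg_disk] at hd2
  set K := (P .U + P .cu - 1) / P .cu with hK
  set R := (P .U + P .b - 1) / P .b with hR
  set E := min (maxBlocks P N) (P .m * (log (P .m) (maxBlocks P N) + 1)) with hE
  have hKc : ∀ c, c * P .cu < P .U ↔ c < K := fun c => by
    rw [hK, lt_iff_add_one_le (m := c), Nat.le_div_iff_mul_le hcu, succ_mul]; omega
  -- There are at most `N` requests and `N` answers, and each of at most `K + 1` flushes wastes at
  -- most one block.
  have hmax : ∀ x, x * P .b ≤ 2 * N + (K + 1) * P .b → x ≤ maxBlocks P N := fun x hx => by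
    rw [maxBlocks, ← hK, ← add_mul_div_right _ _ hb]; exact (Nat.le_div_iff_mul_le hb).2 hx
  have hEle : ∀ x, x ≤ maxBlocks P N → min x (P .m * (log (P .m) x + 1)) ≤ E := fun x hx =>
    min_le_min hx (Nat.mul_le_mul_left _ (succ_le_succ (log_mono_right hx)))
  have hcf : ∀ p : ℕ → Prop, ∀ [DecidablePred p], ((farPieces P wd N).filter p).card ≤ N := fun p _ =>
    (Multiset.card_le_card (Multiset.filter_le _ _)).trans card_farPieces_le
  obtain ⟨I, hI⟩ : ∃ I : ℕ → ℕ → AState → ℕ → Prop, ∀ c p A' t', I c p A' t' ↔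
      (ChunkState P X wd N c (2 * c) p A' ∧ pieceEnd P wd p ≤ c * P .cu * P .d ∧ Before P wd N c p ∧
      TextBefore P X c A' ∧ c ≤ K ∧
      A'.reg .x1 * P .b ≤ N + P .b + ((farPieces P wd N).filter fun v => qx P v / P .d / P .cu < c).card + c * P .b ∧
      P .b * (t' + A1.reg .x1 + levelCost (P .m) (P .G) (A1.reg .x1)) ≤
        P .b * (t2 + A'.reg .x1 + levelCost (P .m) (P .G) (A'.reg .x1) + p / P .b + min (c * P .m) R) +
        8 * P .b * (E * c) + ((farPieces P wd N).filter fun v => qx P v / P .d / P .cu < c).card +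
        ((farPieces P wd N).filter fun v => qy P v / P .d / P .cu < c).card) := ⟨_, fun _ _ _ _ => Iff.rfl⟩
  refine wp_while (fun A' t' => ∃ c p, I c p A' t') (fun A' => K - A'.reg .uu)
    ⟨0, 0, (hI _ _ _ _).2 ⟨⟨hP2, ?_, ?_, ?_, ?_, ?_, ?_, ?_, ?_, ?_, ?_, ?_⟩, ?_, ?_, ?_, ?_, ?_, ?_⟩⟩ ?_ ?_ ?_
  · rw [hf2.reg _ (by simp)]; simp
  · rw [r2 _ (by simp), hc1]
  · rw [r2 _ (by simp), hx₁, ex2]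
  · rw [r2 _ (by simp), hth1]; simp
  · rw [ex2]
    exact hq1.congr hb (r2 _ (by simp)) ex2 (hf2.arr _ (by simp)) fun q _ => by rw [hd2]
  · rw [ex2]; simpa using hL1.congr hb fun q _ _ => by rw [hd2]
  · exact hS.congr (by omega) hb fun q hq => by rw [hd2, hd1 q (by omega)]
  · rw [r2 _ (by simp), hnum1]
  · rw [hf2.reg _ (by simp)]; simp
  · omega
  · exact hcur2
  · simp [pieceEnd]
  · exact fun _ => Nat.zero_le _
  · intro q hq; simp at hq
  · exact Nat.zero_le _
  · rw [ex2]; omega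
  · simp [ex2]
  · rintro A' t' ⟨c, p, h⟩; obtain ⟨hA, -, -, -, hcK, -⟩ := (hI _ _ _ _).1 h
    have : c * P .cu < P .U + P .cu := by
      rcases c with - | c
      · omega
      · have := (hKc c).2 (by omega); rw [add_mul]; omega
    simp [hA.uu, hA.par .cu rfl]; omega
  · rintro A' t' ⟨c, p, h⟩ hcond
    obtain ⟨hA, hpos, hbef, htx, hcK, hx, ht⟩ := (hI _ _ _ _).1 h
    have hcU : c * P .cu < P .U := by
      have : ((§.uu * §.cu).lt §.U).Holds A' := hcond; simpa [hA.uu, hA.par .cu rfl, hA.par .U rfl] using this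
    have hcK' := (hKc c).1 hcU
    have hcn : c ≤ P .U := (Nat.le_mul_of_pos_right c hcu).trans hcU.le
    have hXc := hcf fun v => qx P v / P .d / P .cu < c
    have hx1 : A'.reg .x1 ≤ maxBlocks P N := by
      refine hmax _ ?_; have h1 : c * P .b ≤ K * P .b := Nat.mul_le_mul_right _ hcK; rw [add_mul, one_mul]; omega
    have hxG : A'.reg .x1 * P .b + N + P .b ≤ P .G * P .b := by
      have h1 : c * P .b ≤ P .n * P .b := Nat.mul_le_mul_right _ (by omega)
      have h2 : (4 * P .n + 4) * P .b ≤ P .G * P .b := Nat.mul_le_mul_right _ hnG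
      have h3 := Nat.le_mul_of_pos_right N hb
      have h4 : N * P .b ≤ P .n * P .b := Nat.mul_le_mul_right _ hNn; rw [add_mul, mul_assoc] at h2; omega
    have hxG' : A'.reg .x1 ≤ P .G :=
      le_of_mul_le_mul_right (show A'.reg .x1 * P .b ≤ P .G * P .b by omega) hb
    rw [wp_seq]
    refine computeChunk_wp hT hW hend hA hcU hpos hbef htx hxG' (hEle _ hx1) ?_
    intro A3 t3 p' hA3 ex3 hpos3 hbef3 htx3 hun3 ht3
    refine answerChunk_wp (E := E) hT hW hA3 hcU htx3 hun3 (by rwa [ex3]) (by rw [ex3]; exact hEle _ hx1) ?_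
    intro A4 t4 hA4 htx4 hx4 ht4; rw [ex3] at hx4 ht4
    refine ⟨⟨c + 1, p', (hI _ _ _ _).2 ⟨hA4, hpos3, hbef3, htx4, hcK', ?_, ?_⟩⟩, by rw [hA4.uu, hA.uu]; omega⟩
    · rw [card_filter_lt_succ, add_mul]; omega
    · rw [card_filter_lt_succ, card_filter_lt_succ]
      have h5 : 8 * P .b * (E * (c + 1)) = 8 * P .b * (E * c) + 2 * (4 * P .b * E) := by ring
      rw [h5]; rw [← hR] at ht3; simp only [mul_add] at *; omega
  · rintro A' t' ⟨c, p, h⟩ hcond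
    obtain ⟨hA, hpos, hbef, htx, hcK, hx, ht⟩ := (hI _ _ _ _).1 h
    have hcU : ¬ c * P .cu < P .U := by
      have : ¬ ((§.uu * §.cu).lt §.U).Holds A' := not_not.2 hcond
      simpa [hA.uu, hA.par .cu rfl, hA.par .U rfl] using this
    have hcK' : c = K := by have := mt (hKc c).2 hcU; omega
    subst hcK'; refine hQ A' t' hA.par ?_ ?_
    · intro q hq; refine htx q ?_ hq
      have h1 : q * P .b < K * P .m * P .b := by rw [mul_assoc, ← hT.cu_eq]; omega
      exact lt_of_mul_lt_mul_right h1 (Nat.zero_le _)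
    · have hXc := hcf fun v => qx P v / P .d / P .cu < K; have hYc := hcf fun v => qy P v / P .d / P .cu < K
      have hx1 : A'.reg .x1 ≤ maxBlocks P N := by refine hmax _ ?_; rw [add_mul, one_mul]; omega
      have h1 := levelCost_le (K := P .G) (x := A'.reg .x1) hm2
      have h2 : A'.reg .x1 * log (P .m) (A'.reg .x1) ≤
          maxBlocks P N * log (P .m) (maxBlocks P N) := Nat.mul_le_mul hx1 (log_mono_right hx1)
      have h3 : P .b * t' ≤ P .b * (t + (N + P .b - 1) / P .b + 1 + 2 * maxBlocks P N +
          4 * (maxBlocks P N * log (P .m) (maxBlocks P N)) + N / P .b + R + 8 * (K * E)) + 2 * N := by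
        have h4 : p / P .b ≤ N / P .b := Nat.div_le_div_right hA.cursor.le
        have h5 : min (K * P .m) R ≤ R := min_le_right _ _
        have h6 : t2 + A'.reg .x1 + levelCost (P .m) (P .G) (A'.reg .x1) + p / P .b + min (K * P .m) R ≤
            t + (N + P .b - 1) / P .b + levelCost (P .m) (P .G) (A1.reg .x1) + A1.reg .x1 + 1 +
            2 * maxBlocks P N + 4 * (maxBlocks P N * log (P .m) (maxBlocks P N)) + N / P .b + R := by
          simp at ht2; omega
        have h7 := Nat.mul_le_mul_left (P .b) h6
        have h8 : P .b * (8 * (K * E)) = 8 * P .b * (E * K) := by ring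
        simp only [mul_add] at *; omega
      -- Only here, after the sum over all chunks, the inequality is divided by `b`; the deliveries
      -- cost `2 * N / b` altogether instead of one rounding per chunk.
      have h4 : t' ≤ (P .b * (t + (N + P .b - 1) / P .b + 1 + 2 * maxBlocks P N +
          4 * (maxBlocks P N * log (P .m) (maxBlocks P N)) + N / P .b + R + 8 * (K * E)) + 2 * N) / P .b :=
        (Nat.le_div_iff_mul_le hb).2 (by rwa [mul_comm])
      rw [mul_add_div hb] at h4
      have h5 : 2 * N / P .b ≤ 2 * (N / P .b) + 1 := by
        rw [← Nat.lt_succ_iff, Nat.div_lt_iff_lt_mul hb]; have := lt_mul_div_succ N hb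
        have h9 : (2 * (N / P .b) + 1).succ * P .b = 2 * (P .b * (N / P .b + 1)) := by rw [succ_eq_add_one]; ring
        omega
      have h6 : (N + P .b - 1) / P .b ≤ N / P .b + 1 := by
        rw [← add_div_right _ hb]; exact Nat.div_le_div_right (by omega)
      rw [resolveCost, ← hK, ← hR, ← hE]; omega

/-! ### Streams of digits and words -/

/-- Read the next digit into `f0`. -/
def next : ACmd :=
  .when ((§.e % §.v3).eq 0) ( .when ((§.e / §.v3 % §.v4).eq 0) (.read (§.v1 + §.e / §.v3 / §.v4) 0 0) ;;
    .cw ≔ .get 0 (§.e / §.v3 % §.v4)) ;;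
  .f0 ≔ §.cw % §.sg ;; .cw ≔ §.cw / §.sg ;; .e ≔ §.e + 1

/-- Write the word `val`. -/
def put : ACmd :=
  .set 1 (§.num % §.rp) §.val ;; .num ≔ §.num + 1 ;;
  .when ((§.num % §.rp).eq 0) (.write (§.v2 + (§.num - 1) / §.rp) 1 0)

/-- Write the last block of words. -/
def putEnd : ACmd := .when (§.num % §.rp) (.write (§.v2 + §.num / §.rp) 1 0)

/-- The layout consists of two blocks. -/
structure IsRaw {mc : Machine} {a : Access} (L : Layout mc a) : Prop where
  narr : L.narr = 2
  cap : L.cap = mc.B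
  blk : L.blk = mc.B
  bound : L.bound = 2 ^ mc.w

/-- Reading the digits `S` in base `sg`, of which `e` are read, from the first `w` words with `k`
digits, where there are `s` words per block. -/
structure Reader (sg k s base w : ℕ) (S : ℕ → ℕ) (e : ℕ) (A : AState) : Prop where
  v1 : A.reg .v1 = base
  v3 : A.reg .v3 = k
  v4 : A.reg .v4 = s
  rsg : A.reg .sg = sg
  re : A.reg .e = e
  word : ∀ i < w, A.disk (base + i / s) (i % s) = ∑ j ∈ range k, S (i * k + j) * sg ^ j
  cw : e % k ≠ 0 → A.reg .cw = A.disk (base + e / k / s) (e / k % s) / sg ^ (e % k)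
  buf : ¬ k * s ∣ e → ∀ o < s, A.arr 0 o = A.disk (base + e / k / s) o

/-- Writing the words `wd`, of which `N` are written, where there are `s` words per block and the
buffer contains values less than `bd`. -/
structure Writer (s base bd : ℕ) (wd : ℕ → ℕ) (N : ℕ) (A : AState) : Prop where
  v2 : A.reg .v2 = base
  rp : A.reg .rp = s
  num : A.reg .num = N
  full : ∀ i, i / s < N / s → A.disk (base + i / s) (i % s) = wd i
  part : ∀ i < N, i / s = N / s → A.arr 1 (i % s) = wd i
  lt : ∀ o < s, A.arr 1 o < bd
  word_lt : ∀ i < N, wd i < bd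

theorem Reader.congr {w e : ℕ} {S : ℕ → ℕ} (h : Reader sg k s base w S e A)
    (hr : ∀ y ∈ [Var.v1, .v3, .v4, .sg, .e, .cw], A'.reg y = A.reg y) (ha : A'.arr 0 = A.arr 0)
    (he : e ≤ w * k) (hd : ∀ q < base + w, A'.disk q = A.disk q) : Reader sg k s base w S e A' := by
  simp only [List.mem_cons, List.not_mem_nil, or_false, forall_eq_or_imp, forall_eq] at hr
  obtain ⟨h1, h3, h4, h5, h6, h7⟩ := hr
  have hle : ∀ i < w, i / s < w := fun i hi => lt_of_le_of_lt (Nat.div_le_self _ _) hi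
  have hw : e % k ≠ 0 → e / k < w := fun h0 => by
    have h8 := div_add_mod' e k
    exact lt_of_mul_lt_mul_right (a := k) (by omega) (Nat.zero_le _)
  refine ⟨h1 ▸ h.v1, h3 ▸ h.v3, h4 ▸ h.v4, h5 ▸ h.rsg, h6 ▸ h.re, fun i hi => ?_, fun h0 => ?_, fun h0 o ho => ?_⟩
  · rw [hd _ (by have := hle i hi; omega), h.word i hi]
  · rw [hd _ (by have := hle _ (hw h0); omega), h7, h.cw h0]
  · rw [ha, h.buf h0 o ho, hd]; rcases Nat.eq_zero_or_pos k with rfl | hk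
    · simp only [Nat.mul_zero, le_zero] at he; simp [he] at h0
    · have h8 : e / k ≤ w := Nat.div_le_of_le_mul (by rwa [mul_comm]); rcases h8.lt_or_eq with h9 | h9
      · have := hle _ h9; omega
      -- All `w` words are consumed. If the buffer is still in use, `s` does not divide `w`, so `s >
      -- 1` and `w / s < w`: the current block is in the protected range.
      · have h10 := div_add_mod' e k; have h11 : e % k = 0 := by rw [h9] at h10; omega
        have h12 : ¬ s ∣ e / k := fun ⟨c, hc⟩ => h0 ⟨c, by rw [← h10, h11, hc]; ring⟩
        have h13 : 1 < s := by rcases s with - | - | s <;> [omega; exact absurd (one_dvd _) h12; omega]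
        have := Nat.div_lt_self (n := e / k) (by
          by_contra h; exact h12 (by rw [show e / k = 0 by omega]; exact dvd_zero _)) h13
        omega

theorem dvd_iff_mod {e : ℕ} : k * s ∣ e ↔ e % k = 0 ∧ e / k % s = 0 := by
  constructor
  · rintro ⟨c, rfl⟩; rcases Nat.eq_zero_or_pos k with rfl | hk
    · simp
    · rw [mul_assoc, mul_mod_right, Nat.mul_div_cancel_left _ hk, mul_mod_right]; exact ⟨rfl, rfl⟩
  · rintro ⟨h1, h2⟩; obtain ⟨c, hc⟩ := dvd_of_mod_eq_zero h2; exact ⟨c, by rw [← div_add_mod e k, h1, hc]; ring⟩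

/-- The current word loses its lowest digit with each step, so it is the stored word divided by `sg
^ (e % k)`. A block is read only when `k * s`, the number of digits per block, divides `e`. -/
theorem next_wp (hR : IsRaw L) {w e : ℕ} {S : ℕ → ℕ}  (h : Reader sg k s base w S e A) (hS : ∀ i, S i < sg) (hs : 0 < s) (hsB : s ≤ mc.B)
    (hk : 0 < k) (he : e < w * k) (hw : base + e + 1 < 2 ^ mc.w) (hdisk : ∀ q o, A.disk q o < 2 ^ mc.w)
    (hQ : ∀ A' t', A'.Frame A [.cw, .f0, .e] [0] → A'.disk = A.disk → A'.reg .f0 = S e →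
      Reader sg k s base w S (e + 1) A' → t' ≤ t + (if k * s ∣ e then 1 else 0) → Q A' t') :
    L.wp next Q A t := by
  have hmod := mod_lt (e / k) hs
  have hek : e / k < w := Nat.div_lt_of_lt_mul (by rwa [mul_comm]); have hds := Nat.div_le_self (e / k) s
  have hde := Nat.div_le_self e k; have hword := h.word _ hek
  have hdig : A.disk (base + e / k / s) (e / k % s) / sg ^ (e % k) % sg = S e := by
    have h1 := sum_digits_div_mod (sg := sg) (by have := hS 0; omega) (c := fun j => S (e / k * k + j)) (d := k)
      (p := e % k) (len := 1) (fun _ _ => hS _) (mod_lt _ hk)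
    rw [pow_one] at h1; rw [hword, h1]; simp [div_add_mod']
  have hfin : ∀ A1 t1, A1.Frame A [.cw] [0] → A1.disk = A.disk →
      A1.reg .cw = A.disk (base + e / k / s) (e / k % s) / sg ^ (e % k) →
      (∀ o < s, A1.arr 0 o = A.disk (base + e / k / s) o) → t1 ≤ t + (if k * s ∣ e then 1 else 0) →
      L.wp (.f0 ≔ §.cw % §.sg ;; .cw ≔ §.cw / §.sg ;; .e ≔ §.e + 1) Q A1 t1 := by
    intro A1 t1 hf1 hd1 hcw hbuf ht1
    have r1 : ∀ y, y ≠ .cw → A1.reg y = A.reg y := fun y hy => hf1.reg y (by simpa); simp [r1, h.re, h.rsg, hcw]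
    refine ⟨by omega, hQ _ _ ?_ hd1 (by simp [hdig]) ⟨by simp [r1, h.v1], by simp [r1, h.v3],
      by simp [r1, h.v4], by simp [r1, h.rsg], by simp, ?_, ?_, ?_⟩ ht1⟩
    · exact (((hf1.mono (by simp) (by simp)).setReg (by simp)).setReg (by simp)).setReg (by simp)
    · intro i hi; simp only [setReg_disk, hd1]; exact h.word i hi
    · intro h0
      have h1 : (e + 1) / k = e / k := by rw [Nat.succ_div, if_neg (by rwa [dvd_iff_mod_eq_zero]), add_zero]
      have h2 : (e + 1) % k = e % k + 1 := by
        have h3 := div_add_mod' (e + 1) k; have h4 := div_add_mod' e k; rw [h1] at h3; omega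
      simp [h1, h2, hd1, Nat.div_div_eq_div_mul, pow_succ]
    · intro h0 o ho
      have h1 : (e + 1) / k / s = e / k / s := by
        rw [Nat.div_div_eq_div_mul, Nat.div_div_eq_div_mul, Nat.succ_div, if_neg h0, add_zero]
      simpa [h1, hd1] using hbuf o ho
  rw [next]
  generalize (Var.f0 ≔ §.cw % §.sg ;; .cw ≔ §.cw / §.sg ;; .e ≔ §.e + 1) = rest at hfin ⊢; rw [wp_seq, wp_when]
  refine ⟨by simp, fun h0 => ?_, fun h0 => ?_⟩
  · simp [h.re, h.v3] at h0; rw [wp_seq, wp_when]; refine ⟨by simp, fun h1 => ?_, fun h1 => ?_⟩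
    · simp [h.re, h.v3, h.v4] at h1; simp only [wp_read, wp_assign]
      simp [h.re, h.v3, h.v4, h.v1, hR.narr, hR.cap, hR.blk, hR.bound]
      refine ⟨⟨by omega, fun o _ => hdisk _ _⟩, by omega,
        hfin ((A.readArr mc.B _ 0 0).setReg .cw _) (t + 1) (by simp) rfl ?_ ?_ ?_⟩
      · simp [h0]; intro hh; omega
      · intro o ho; simp; intro hh; omega
      · rw [if_pos (dvd_iff_mod.2 ⟨h0, h1⟩)]
    · simp [h.re, h.v3, h.v4] at h1; have hb := h.buf fun hd => h1 (dvd_iff_mod.1 hd).2; rw [wp_assign]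
      simp only [AExpr.val_get, AExpr.val_mod, AExpr.val_div, AExpr.val_r, h.re, h.v3, h.v4]
      refine ⟨by simp [h.re, h.v3, h.v4, hR.narr, hR.cap]; omega, ?_⟩
      refine hfin (A.setReg .cw (A.arr 0 (e / k % s))) t (by simp) rfl ?_ (by simpa using hb) (by omega)
      simp [h0, hb _ hmod]
  · simp [h.re, h.v3] at h0
    exact hfin A t (by simp) rfl (h.cw h0) (h.buf fun hd => h0 (dvd_iff_mod.1 hd).1) (by omega)

theorem Writer.congr {bd : ℕ} (h : Writer s base bd wd N A)
    (h1 : A'.reg .v2 = A.reg .v2) (h2 : A'.reg .rp = A.reg .rp) (h3 : A'.reg .num = A.reg .num)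
    (ha : A'.arr 1 = A.arr 1) (hd : A'.disk = A.disk) : Writer s base bd wd N A' :=
  ⟨h1 ▸ h.v2, h2 ▸ h.rp, h3 ▸ h.num, hd ▸ h.full, ha ▸ h.part, ha ▸ h.lt, h.word_lt⟩

theorem put_wp (hR : IsRaw L) {bd : ℕ}  (h : Writer s base bd wd N A) (hs : 0 < s) (hsB : s ≤ mc.B) (hN : base + N + 1 < 2 ^ mc.w)
    (hval : A.reg .val < bd) (hbd : bd ≤ 2 ^ mc.w)
    (hQ : ∀ A' t', A'.Frame A [.num] [1] → Writer s base bd (Function.update wd N (A.reg .val)) (N + 1) A' →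
      (∀ q, q < base ∨ base + N < q → A'.disk q = A.disk q) →
      (∀ q o, A'.disk q o < 2 ^ mc.w ∨ A'.disk q o = A.disk q o) →
      t' ≤ t + (if s ∣ N + 1 then 1 else 0) → Q A' t') :
    L.wp put Q A t := by
  have hmod := mod_lt N hs; have hdN := Nat.div_le_self N s; have hdN0 := Nat.zero_le (N / s)
  have hsucc := @Nat.succ_div N s
  have hup : ∀ i < N, Function.update wd N (A.reg .val) i = wd i := fun i hi =>
    Function.update_of_ne (by omega) _ _
  have hlast : ∀ i, i / s = N / s → i % s = N % s → i = N := fun i h1 h2 => by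
    rw [← div_add_mod' i s, ← div_add_mod' N s, h1, h2]
  have hltN : ∀ i, i / s < N / s → i < N := fun i h1 => by
    by_contra h2; have := Nat.div_le_div_right (c := s) (not_lt.1 h2); omega
  have hval' : ∀ i < N + 1, i / s = N / s →
      (A.setArr 1 (N % s) (A.reg .val)).arr 1 (i % s) = Function.update wd N (A.reg .val) i := by
    intro i hi hq; simp only [setArr_arr, true_and]; split_ifs with h1
    · rw [hlast i hq h1, Function.update_self]
    · have : i < N := by
        rcases Nat.lt_succ_iff_lt_or_eq.1 hi with h2 | rfl
        · exact h2
        · exact absurd rfl h1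
      rw [hup i this, h.part i this hq]
  have hlt' : ∀ o < s, (A.setArr 1 (N % s) (A.reg .val)).arr 1 o < bd := by
    intro o ho; simp only [setArr_arr, true_and]; split_ifs
    · exact hval
    · exact h.lt o ho
  have hwl : ∀ i < N + 1, Function.update wd N (A.reg .val) i < bd := by
    intro i hi; rcases Nat.lt_succ_iff_lt_or_eq.1 hi with h2 | rfl
    · rw [hup i h2]; exact h.word_lt i h2
    · rwa [Function.update_self]
  rw [put, wp_seq, wp_set]; simp only [AExpr.val_mod, AExpr.val_r, h.num, h.rp]
  refine ⟨⟨by simp, by simp, by rw [hR.narr]; omega, by rw [hR.cap]; omega, by rw [hR.bound]; omega⟩, ?_⟩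
  rw [wp_seq, wp_assign]
  simp only [AExpr.val_add, AExpr.val_r, AExpr.val_ofNat, setArr_reg, h.num]; refine ⟨by simp [h.num]; omega, ?_⟩
  rw [wp_when]; refine ⟨by simp, fun h0 => ?_, fun h0 => ?_⟩
  · simp [h.rp] at h0; rw [if_pos (dvd_of_mod_eq_zero h0)] at hsucc; simp [h.rp, h.v2, hR.narr, hR.cap, hR.blk]
    refine ⟨by omega, fun hbw => hQ _ _ (by simp) ⟨by simp [h.v2], by simp [h.rp], by simp, fun i hi => ?_,
      fun i hi h1 => ?_, by simpa using hlt', hwl⟩ ?_ (fun q o => ?_) (by rw [if_pos (dvd_of_mod_eq_zero h0)])⟩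
    · simp only [writeDisk_disk, setReg_disk, setArr_disk, add_right_inj, setReg_arr, zero_add]; split_ifs with h1 h2
      · refine hval' i ?_ h1; have h5 := lt_mul_div_succ i hs
        rw [h1, ← hsucc, Nat.mul_div_cancel' (dvd_of_mod_eq_zero h0)] at h5; exact h5
      · have := mod_lt i hs; omega
      · have h2 := hltN i (by omega); rw [hup i h2]; exact h.full i (by omega)
    · have h2 := div_mul_le_self i s; rw [h1, Nat.div_mul_cancel (dvd_of_mod_eq_zero h0)] at h2; omega
    · intro q hq; funext o; simp; intro h1; omega
    · simp only [writeDisk_disk]; split_ifs with h1 h2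
      · exact .inl (by simpa [hR.bound] using hbw o h2)
      · exact .inl (by positivity)
      · exact .inr rfl
  · simp [h.rp] at h0
    rw [if_neg (by rwa [dvd_iff_mod_eq_zero]), add_zero] at hsucc
    refine hQ _ _ (by simp) ⟨by simp [h.v2], by simp [h.rp], by simp, fun i hi => ?_,
      fun i hi h1 => hval' i hi (by omega), by simpa using hlt', hwl⟩ (fun _ _ => rfl) (fun _ _ => .inr rfl) (by omega)
    have h2 := hltN i (by omega); rw [hup i h2]; exact h.full i (by omega)

/-- The last block may contain stale buffer entries behind the last word. They are below `bd` as
well, which matters because the packed layout can read a block only if all its used words are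
bounded. -/
theorem putEnd_wp (hR : IsRaw L) {bd : ℕ}  (h : Writer s base bd wd N A) (hs : 0 < s) (hsB : s ≤ mc.B) (hN : base + N < 2 ^ mc.w)
    (hQ : ∀ A' t', A'.Frame A [] [] → (∀ q, q < base → A'.disk q = A.disk q) →
      (∀ i < N, A'.disk (base + i / s) (i % s) = wd i) →
      (∀ q, q * s < N → ∀ o < s, A'.disk (base + q) o < bd) → t' ≤ t + 1 → Q A' t') :
    L.wp putEnd Q A t := by
  have hdN := Nat.div_le_self N s; have hdN0 := Nat.zero_le (N / s)
  have hfull : ∀ q < N / s, ∀ o < s, A.disk (base + q) o < bd := by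
    intro q hq o ho
    have h1 : (q * s + o) / s = q := by rw [Nat.add_comm, add_mul_div_right _ _ hs, div_eq_of_lt ho, zero_add]
    have h2 : (q * s + o) % s = o := by rw [Nat.add_comm, add_mul_mod_self_right, mod_eq_of_lt ho]
    have h3 := h.full (q * s + o) (by rwa [h1]); rw [h1, h2] at h3; rw [h3]; refine h.word_lt _ ?_
    exact lt_of_lt_of_le (mul_add_lt_mul hq ho) (div_mul_le_self N s)
  rw [putEnd, wp_when]; refine ⟨by simp, fun h0 => ?_, fun h0 => ?_⟩
  · simp [h.rp, h.v2, h.num, hR.narr, hR.cap, hR.blk]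
    refine ⟨by omega, fun _ => hQ _ _ (by simp) (fun q hq => ?_) (fun i hi => ?_) (fun q hq o ho => ?_) le_rfl⟩
    · funext o; simp; intro h1; omega
    · simp only [writeDisk_disk, add_right_inj, zero_add]; have := mod_lt i hs; split_ifs with h1 h2
      · exact h.part i hi h1
      · omega
      · refine h.full i ?_; have := Nat.div_le_div_right (c := s) hi.le; omega
    · simp only [writeDisk_disk, add_right_inj, zero_add]; split_ifs with h1 h2
      · exact h.lt o ho
      · omega
      · refine hfull q ?_ o ho; have : q ≤ N / s := (Nat.le_div_iff_mul_le hs).2 hq.le; omega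
  · simp [AExpr.Holds, h.rp, h.num] at h0; have hdv := dvd_of_mod_eq_zero h0; have hN' := Nat.div_mul_cancel hdv
    refine hQ _ _ (by simp) (fun _ _ => rfl) (fun i hi => h.full i ?_) (fun q hq => hfull q ?_) (by omega)
    · exact Nat.div_lt_of_lt_mul (by rwa [mul_comm, hN'])
    · exact lt_of_mul_lt_mul_right (by rwa [hN']) (Nat.zero_le _)

theorem ofDigits_take_eq (sg : ℕ) (l : List ℕ) (k : ℕ) :
    ofDigits sg (l.take k) = ∑ j ∈ range k, l.getD j 0 * sg ^ j := by
  induction k generalizing l with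
  | zero => simp
  | succ k ih =>
    rcases l with - | ⟨a, l⟩
    · simp
    · rw [List.take_succ_cons, ofDigits_cons, ih, sum_range_succ', mul_sum]; simp [pow_succ, add_comm]
      exact sum_congr rfl fun j _ => by ring

theorem pack_eq (sg w : ℕ) (l : List ℕ) (i : ℕ) : pack sg w l i =
    ∑ j ∈ range (symbolsPerWord sg w), l.getD (i * symbolsPerWord sg w + j) 0 * sg ^ j := by
  rw [pack, ofDigits_take_eq]; refine sum_congr rfl fun j _ => ?_; simp [List.getD_eq_getElem?_getD]

/-! ### From the encoding to pieces -/

def readNum (x : Var) : ACmd :=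
  x ≔ 0 ;; .pow ≔ 1 ;; .for .j §.d (next ;; x ≔ §x + §.f0 * §.pow ;; .pow ≔ §.pow * §.sg)

/-- Write the pending literals, which start at position `s1`, as a piece. -/
def putLit : ACmd :=
  .when ((§.s1).lt §.pos) (.val ≔ codeE 0 §.acc §.s1 (§.pos - §.s1) ;; put) ;;
  .s1 ≔ §.pos ;; .acc ≔ 0

def parseLit : ACmd :=
  next ;; power .pow (§.pos % §.d) ;; .acc ≔ §.acc + §.f0 * §.pow ;; .pos ≔ §.pos + 1 ;;
  .when ((§.pos % §.d).eq 0) putLit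

/-- Write the longest piece at the current position that stays within a unit and has its source
within a unit. -/
def copyStep : ACmd :=
  .s2 ≔ §.len ;;
  .when ((§.d - §.pos % §.d).lt §.s2) (.s2 ≔ §.d - §.pos % §.d) ;;
  .when ((§.d - §.src % §.d).lt §.s2) (.s2 ≔ §.d - §.src % §.d) ;;
  .val ≔ codeE 1 §.src §.pos §.s2 ;; put ;;
  .src ≔ §.src + §.s2 ;; .pos ≔ §.pos + §.s2 ;; .len ≔ §.len - §.s2

def parseRep : ACmd :=
  readNum .src ;; readNum .len ;; putLit ;; .loop §.len copyStep ;; .s1 ≔ §.pos ;; .acc ≔ 0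

def parse : ACmd :=
  .loop ((§.pos).lt §.n) (next ;; .ite §.f0 parseRep parseLit) ;; putLit ;; putEnd

/-- The state when `e` symbols are read and `N` pieces of total length `s` are written. -/
structure Parsing (P : Var → ℕ) (X S : ℕ → ℕ) (k B W N e s : ℕ) (A : AState) : Prop where
  par : A.Has P
  reader : Reader (P .sg) k B 0 (P .G) S e A
  disk : ∀ q o, A.disk q o < W
  pieces : ∃ wd, Writer (P .b) (P .G) (P .V) wd N A ∧ Pieces P X wd N ∧ pieceEnd P wd N = s

theorem Parsing.frame {S : ℕ → ℕ} {B W e : ℕ}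
    (h : Parsing P X S k B W N e s A) (he : e ≤ P .G) (hk : 0 < k) (hf : A'.Frame A xs [])
    (hp : ∀ x ∈ xs, x.isPar = false)
    (hx : ∀ x ∈ xs, x ∉ [Var.v1, .v3, .v4, .e, .cw, .v2, .rp, .num]) (hd : A'.disk = A.disk) :
    Parsing P X S k B W N e s A' := by
  have r : ∀ y ∈ [Var.v1, .v3, .v4, .e, .cw, .v2, .rp, .num], A'.reg y = A.reg y := fun y hy =>
    hf.reg y fun h' => hx y h' hy
  obtain ⟨hP, hr, hdk, wd, hw, hpc⟩ := h; have hP' := hP.frame hf hp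
  refine ⟨hP', hr.congr (fun y hy => ?_) (hf.arr 0 (by simp))
    (he.trans (Nat.le_mul_of_pos_right _ hk)) fun _ _ => by rw [hd],
    hd ▸ hdk, wd, hw.congr (r _ (by simp)) (r _ (by simp)) (r _ (by simp)) (hf.arr 1 (by simp)) hd, hpc⟩
  by_cases h1 : y = .sg
  · rw [h1, hP' .sg rfl, hP .sg rfl]
  · simp only [List.mem_cons, List.not_mem_nil, or_false] at hy; refine r y ?_
    simp only [List.mem_cons, List.not_mem_nil, or_false]; tauto

section

variable {S : ℕ → ℕ} {e : ℕ}

theorem Pieces.congr {wd' : ℕ → ℕ} (h : Pieces P X wd N) (hw : ∀ i < N, wd' i = wd i) :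
    Pieces P X wd' N ∧ ∀ i ≤ N, pieceEnd P wd' i = pieceEnd P wd i := by
  have h1 : ∀ i ≤ N, pieceEnd P wd' i = pieceEnd P wd i := fun i hi =>
    sum_congr rfl fun j hj => by rw [hw j (by have := mem_range.1 hj; omega)]
  exact ⟨⟨fun i hi => by rw [hw i hi]; exact h.piece i hi, fun i hi => by rw [hw i hi, h1 i hi.le, h.start i hi]⟩, h1⟩

theorem Pieces.snoc (h : Pieces P X wd N) (hv : Piece P X v)
    (hs : qy P v = pieceEnd P wd N) : Pieces P X (Function.update wd N v) (N + 1) ∧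
      pieceEnd P (Function.update wd N v) (N + 1) = qy P v + qz P v := by
  obtain ⟨h1, h2⟩ := h.congr (wd' := Function.update wd N v) fun i hi =>
    Function.update_of_ne (by omega) _ _
  refine ⟨⟨fun i hi => ?_, fun i hi => ?_⟩, ?_⟩
  · rcases Nat.lt_succ_iff_lt_or_eq.1 hi with h3 | rfl
    · exact h1.piece i h3
    · rwa [Function.update_self]
  · rcases Nat.lt_succ_iff_lt_or_eq.1 hi with h3 | rfl
    · exact h1.start i h3
    · rw [Function.update_self, h2 _ le_rfl, hs]
  · rw [pieceEnd, sum_range_succ, Function.update_self]; exact congrArg (· + _) ((h2 N le_rfl).trans hs.symm)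

variable (hT : TextEnv L' P X) (hR : IsRaw L) (hB : 0 < mc.B) (hbB : P .b ≤ mc.B) (hk : 0 < k) (hS : ∀ i, S i < P .sg)
include hT hR

section Read

include hB hk hS

theorem Parsing.next_wp (h : Parsing P X S k mc.B (2 ^ mc.w) N e s A) (he : e < P .G)
    (hQ : ∀ A' t', A'.Frame A [.cw, .f0, .e] [0] → A'.reg .f0 = S e → Parsing P X S k mc.B (2 ^ mc.w) N (e + 1) s A' →
      t' + (e + k * mc.B - 1) / (k * mc.B) ≤ t + (e + 1 + k * mc.B - 1) / (k * mc.B) → Q A' t') :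
    L.wp next Q A t := by
  obtain ⟨hP, hr, hd, wd, hw, hpc⟩ := h; have hG8 := hT.eight_mul_G_lt; have hbl := L'.bound_le
  refine ExtMem.next_wp hR hr hS hB le_rfl hk (lt_of_lt_of_le he (Nat.le_mul_of_pos_right _ hk)) (by omega) hd ?_
  intro A' t' hf hd' hf0 hr' ht'
  refine hQ A' t' hf hf0 ⟨hP.frame hf (by decide), hr', hd' ▸ hd, wd, hw.congr (hf.reg _ (by simp))
    (hf.reg _ (by simp)) (hf.reg _ (by simp)) (hf.arr _ (by simp)) hd', hpc⟩ ?_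
  rw [ceil_succ (Nat.mul_pos hk hB)]; omega

theorem readNum_wp {x : Var} (h : Parsing P X S k mc.B (2 ^ mc.w) N e s A) (hx : x = .src ∨ x = .len) (hv : v < P .D)
    (hSv : ∀ j < P .d, S (e + j) = v / P .sg ^ j % P .sg) (he : e + P .d ≤ P .G)
    (hQ : ∀ A' t', A'.Frame A [.cw, .f0, .e, .j, .pow, x] [0] → A'.reg x = v →
      Parsing P X S k mc.B (2 ^ mc.w) N (e + P .d) s A' →
      t' + (e + k * mc.B - 1) / (k * mc.B) ≤ t + (e + P .d + k * mc.B - 1) / (k * mc.B) → Q A' t') :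
    L.wp (readNum x) Q A t := by
  have hw := L.width; have hbl := L'.bound_le; have hD := hT.D_lt; have hdD := hT.d_lt
  have hx' : x.isPar = false ∧ x ∉ [Var.v1, .v3, .v4, .e, .cw, .v2, .rp, .num] ∧ x ≠ .pow ∧ x ≠ .j ∧
      x ≠ .sg ∧ x ≠ .f0 ∧ x ≠ .cw ∧ x ≠ .e := by rcases hx with rfl | rfl <;> decide
  obtain ⟨hxp, hxl, hx1, hx2, hx3, hx4, hx5, hx6⟩ := hx'
  have hxpar : ∀ y ∈ [x, .pow, .j], y.isPar = false := by
    simp only [List.mem_cons, List.not_mem_nil, or_false]; rintro y (rfl | rfl | rfl)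
    exacts [hxp, rfl, rfl]
  rw [readNum, wp_seq, wp_assign]; refine ⟨by simp, ?_⟩; rw [wp_seq, wp_assign]; refine ⟨by simp, ?_⟩
  obtain ⟨I, hI⟩ : ∃ I : ℕ → AState → ℕ → Prop, ∀ j A' t', I j A' t' ↔
      (A'.Frame A [.cw, .f0, .e, .j, .pow, x] [0] ∧ Parsing P X S k mc.B (2 ^ mc.w) N (e + j) s A' ∧
        A'.reg x = v % P .sg ^ j ∧ A'.reg .pow = P .sg ^ j ∧
        t' + (e + k * mc.B - 1) / (k * mc.B) ≤ t + (e + j + k * mc.B - 1) / (k * mc.B)) :=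
    ⟨_, fun _ _ _ => Iff.rfl⟩
  have hpl : ∀ j ≤ P .d, P .sg ^ j < 2 ^ mc.w := fun j hj => by have := hT.pow_le hj; omega
  refine wp_for (P .d) I (by omega) ((hI _ _ _).2 ⟨?_, ?_, ?_, ?_, le_rfl⟩) ?_ ?_ ?_
  · simp
  · exact h.frame (xs := [x, .pow, .j]) (by omega) hk (by simp) hxpar (by simpa using hxl) rfl
  · simp [hx1, hx2, mod_one]
  · simp
  · intro j A' t' _ h' _; obtain ⟨-, hC, -⟩ := (hI _ _ _).1 h'; simp [hC.par .d rfl]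
  · intro j A' t' hj h' hji; obtain ⟨hf, hC, hxv, hpw, ht⟩ := (hI _ _ _).1 h'; rw [wp_seq]
    refine hC.next_wp hT hR hB hk hS (by omega) ?_; intro A2 t2 hf2 hf0 hC2 ht2
    have r2 : ∀ y, y ∉ [Var.cw, .f0, .e] → A2.reg y = A'.reg y := hf2.reg
    have hmod : v % P .sg ^ (j + 1) = v % P .sg ^ j + S (e + j) * P .sg ^ j := by rw [hSv j hj, mod_pow_succ, mul_comm]
    have hle : v % P .sg ^ (j + 1) ≤ v := mod_le _ _
    have hps : P .sg ^ j * P .sg < 2 ^ mc.w := by rw [← pow_succ]; exact hpl _ hj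
    have hxr : A2.reg x = v % P .sg ^ j := by rw [r2 x (by simp [*]), hxv]
    simp [hxr, hf0, r2, hpw, hC.par .sg rfl, hx1.symm, hps, hji, hx2.symm, hx3.symm]
    refine ⟨⟨by omega, by omega⟩, (hI _ _ _).2 ⟨?_, hC2.frame (xs := [x, .pow, .j]) (by omega) hk (by simp) hxpar (by simpa using hxl) rfl,
      by simp [hx1, hx2, hmod], by simp [pow_succ], by rw [← add_assoc]; omega⟩⟩
    · refine (Frame.setReg (Frame.setReg (Frame.setReg ?_ ?_) ?_) ?_) <;> try simp
      exact (hf2.mono (by simp) (by simp)).trans hf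
  · intro A' t' h' _; obtain ⟨hf, hC, hxv, -, ht⟩ := (hI _ _ _).1 h'; refine hQ A' t' hf ?_ hC ht
    rw [hxv, ← hT.D_eq, mod_eq_of_lt hv]

end Read

include hbB hk

theorem Parsing.put_wp (h : Parsing P X S k mc.B (2 ^ mc.w) N e s A) (he : e ≤ P .G) (hv : Piece P X (A.reg .val))
    (hy : qy P (A.reg .val) = s)
    (hQ : ∀ A' t', A'.Frame A [.num] [1] → Parsing P X S k mc.B (2 ^ mc.w) (N + 1) e (s + qz P (A.reg .val)) A' →
      t' + N / P .b ≤ t + (N + 1) / P .b → Q A' t') :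
    L.wp put Q A t := by
  obtain ⟨hP, hr, hd, wd, hw, hpc, hpe⟩ := h; have hG8 := hT.eight_mul_G_lt; have hbl := L'.bound_le
  have hNn := hpc.le_n; have hnG := hT.n_lt_G; have hVp := hT.V_eq
  have hval : A.reg .val < P .V := by
    have h1 := hT.key_le_pad (k := 2) (by omega); have := hv.lt; have := hT.inf_eq; have := hT.inf_lt; omega
  refine ExtMem.put_wp hR hw hT.b_pos hbB (by omega) hval (by omega) ?_; intro A' t' hf hw' hd' hdl ht'
  obtain ⟨hpc', hpe'⟩ := hpc.snoc hv (hy.trans hpe.symm)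
  refine hQ A' t' hf ⟨hP.frame hf (by decide), hr.congr (fun y hy => hf.reg y ?_) (hf.arr _ (by simp))
    (he.trans (Nat.le_mul_of_pos_right _ hk)) (fun q hq => hd' q (.inl (by omega))),
    fun q o => ?_, _, hw', hpc', by rw [hpe', hy]⟩ ?_
  · rintro hc; simp only [List.mem_singleton] at hc; subst hc; simp at hy
  · rcases hdl q o with h1 | h1
    · exact h1
    · rw [h1]; exact hd q o
  · rw [Nat.succ_div]; omega

/-- The accumulated literals lie in one unit, so their value with its weight is below `D` and fits
in the second component of a piece of kind 0. An empty run produces no piece. -/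
theorem putLit_wp {pos : ℕ} (h : Parsing P X S k mc.B (2 ^ mc.w) N e s A) (he : e ≤ P .G) (hpos : A.reg .pos = pos)
    (hs1 : A.reg .s1 = s) (hacc : A.reg .acc = value (P .sg) (P .d) X s (pos - s)) (hsp : s ≤ pos)
    (hpn : pos ≤ P .n) (hu : s % P .d + (pos - s) ≤ P .d)
    (hQ : ∀ A' t' N', A'.Frame A [.val, .num, .s1, .acc] [1] → A'.reg .s1 = pos → A'.reg .acc = 0 →
      Parsing P X S k mc.B (2 ^ mc.w) N' e pos A' → N' ≤ N + 1 → (s = pos → N' = N) →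
      t' + N / P .b ≤ t + N' / P .b → Q A' t') :
    L.wp putLit Q A t := by
  have hnD := hT.n_lt; have hpad := hT.pad_lt; rw [putLit, wp_seq, wp_when]
  refine ⟨by simp, fun hlt => ?_, fun hlt => ?_⟩
  · simp [hpos, hs1] at hlt
    have hvlt : value (P .sg) (P .d) X s (pos - s) < P .D := by
      rw [hT.D_eq]; exact value_lt (by have := hT.two_le_sg; omega) hT.X_lt hu
    have hval : (codeE 0 §.acc §.s1 (§.pos - §.s1)).val A =
        code (P .D) 0 (value (P .sg) (P .d) X s (pos - s)) s (pos - s) := by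
      rw [val_codeE h.par]; simp [hacc, hs1, hpos]
    generalize hcd : code (P .D) 0 (value (P .sg) (P .d) X s (pos - s)) s (pos - s) = v at hval
    have f1 : qkind P v = 0 := hcd ▸ code.div_div_div hvlt (by omega) (by omega)
    have f2 : qx P v = value (P .sg) (P .d) X s (pos - s) := hcd ▸ code.div_div_mod hvlt (by omega) (by omega)
    have f3 : qy P v = s := hcd ▸ code.div_mod (by omega) (by omega)
    have f4 : qz P v = pos - s := hcd ▸ code.mod (by omega)
    have hvl : v < 1 * P .D * P .D * P .D := hcd ▸ code.lt hvlt (by omega) (by omega)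
    have hk1 := hT.key_le_pad (k := 1) (by omega)
    have hk2 : 1 * P .D * P .D * P .D ≤ 2 * P .D * P .D * P .D :=
      Nat.mul_le_mul_right _ (Nat.mul_le_mul_right _ (Nat.mul_le_mul_right _ (by omega)))
    rw [wp_seq, wp_assign, hval]
    refine ⟨ok_codeE h.par hT.D_pos (by simp) (by simp) (by simp) (by simp) ?_, ?_⟩
    · rw [← val_codeE h.par, hval]; omega
    refine (h.frame (A' := A.setReg .val v) (xs := [.val]) he hk (by simp) (by decide) (by decide) rfl).put_wp
      hT hR hbB hk he ?_ (by simpa using f3) ?_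
    · simp only [setReg_reg, if_true]
      exact ⟨by omega, by omega, by rwa [f3, f4], by omega, fun _ => by rw [f2, f3, f4], fun h => absurd f1 h,
        fun h => absurd f1 h, fun h => absurd f1 h⟩
    intro A' t' hf hC ht'
    have hp' : A'.reg .pos = pos := by rw [hf.reg _ (by simp)]; simpa using hpos
    simp [f4, Nat.add_sub_cancel' hsp] at hC; simp [hp']
    refine hQ _ t' (N + 1) ?_ (by simp) (by simp)
      (hC.frame (xs := [.s1, .acc]) he hk (by simp) (by decide) (by decide) rfl) le_rfl (by omega) ht'
    exact ((hf.mono (by simp) (by simp)).trans (by simp)).setReg (by simp) |>.setReg (by simp)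
  · simp [hpos, hs1] at hlt; have hsp' : s = pos := by omega
    simp [hpos]
    refine hQ _ t N (by simp) (by simp) (by simp) ?_ (by omega) (fun _ => rfl) le_rfl; rw [← hsp']
    exact h.frame (xs := [.s1, .acc]) he hk (by simp) (by decide) (by decide) rfl

/-- Each piece ends at the end of the phrase, at a unit boundary of the target, or at one of the
source. The boundaries that are crossed are counted by the growth of `pos / d` and `src / d`; the 1
is for the end of the phrase. -/
theorem copyLoop_wp {pos src : ℕ}
    (h : Parsing P X S k mc.B (2 ^ mc.w) N e pos A) (he : e ≤ P .G) (hpos : A.reg .pos = pos)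
    (hsrc : A.reg .src = src) (hlen : A.reg .len = len) (hpn : pos + len ≤ P .n) (hsp : src < pos)
    (hX : ∀ j < len, X (src + j) = X (pos + j)) (hl : 0 < len)
    (hQ : ∀ A' t' N', A'.reg .pos = pos + len → Parsing P X S k mc.B (2 ^ mc.w) N' e (pos + len) A' →
      N' + pos / P .d + src / P .d ≤ N + (pos + len) / P .d + (src + len) / P .d + 1 →
      t' + N / P .b ≤ t + N' / P .b → Q A' t') :
    L.wp (.loop §.len copyStep) Q A t := by
  have hbl := L'.bound_le; have hnD := hT.n_lt; have hpad := hT.pad_lt; have hd := hT.d_pos; have hnG := hT.n_lt_G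
  have hG8 := hT.eight_mul_G_lt
  obtain ⟨I, hI⟩ : ∃ I : ℕ → ℕ → AState → ℕ → Prop, ∀ i N' A' t', I i N' A' t' ↔
      (i ≤ len ∧ A'.reg .pos = pos + i ∧ A'.reg .src = src + i ∧ A'.reg .len = len - i ∧
      Parsing P X S k mc.B (2 ^ mc.w) N' e (pos + i) A' ∧
      N' + pos / P .d + src / P .d ≤ N + (pos + i) / P .d + (src + i) / P .d + (if i = len then 1 else 0) ∧
      t' + N / P .b ≤ t + N' / P .b) := ⟨_, fun _ _ _ _ => Iff.rfl⟩
  refine wp_while (fun A' t' => ∃ i N', I i N' A' t') (fun A' => A'.reg .len)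
    ⟨0, N, (hI _ _ _ _).2 ⟨by omega, by simpa, by simpa, by simpa, by simpa, by simp, le_rfl⟩⟩ ?_ ?_ ?_
  · intro A' t' _; simp
  · rintro A' t' ⟨i, N', h'⟩ hc; obtain ⟨hi, hp, hs, hln, hC, hN, ht⟩ := (hI _ _ _ _).1 h'
    have hi' : i < len := by have : A'.reg .len ≠ 0 := hc; omega
    have hP' := hC.par
    obtain ⟨c, hcdef⟩ : ∃ c, c = min (len - i) (min (P .d - (pos + i) % P .d) (P .d - (src + i) % P .d)) := ⟨_, rfl⟩
    have hm1 := mod_lt (pos + i) hd; have hm2 := mod_lt (src + i) hd; have hc0 : 0 < c := by omega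
    have hcl : c ≤ len - i := by omega
    have hcp : c ≤ P .d - (pos + i) % P .d := by omega
    have hcs : c ≤ P .d - (src + i) % P .d := by omega
    have hD' : code (P .D) 1 (src + i) (pos + i) c < 2 * P .D * P .D * P .D :=
      code.lt (k := 1) (by omega) (by omega) (by omega)
    have hk2 := hT.key_le_pad (k := 2) (by omega)
    generalize hcd : code (P .D) 1 (src + i) (pos + i) c = v at hD'
    have f1 : qkind P v = 1 := hcd ▸ code.div_div_div (by omega) (by omega) (by omega)
    have f2 : qx P v = src + i := hcd ▸ code.div_div_mod (by omega) (by omega) (by omega)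
    have f3 : qy P v = pos + i := hcd ▸ code.div_mod (by omega) (by omega)
    have f4 : qz P v = c := hcd ▸ code.mod (by omega); rw [copyStep, wp_seq, wp_assign]; refine ⟨by simp, ?_⟩
    rw [wp_seq, wp_when_assign]; refine ⟨by simp, fun _ => by simp, ?_⟩; rw [wp_seq, wp_when_assign]
    refine ⟨by simp, fun _ => by simp, ?_⟩; generalize hA1 : setReg (setReg _ _ _) _ _ = A1
    have r1 : ∀ y, y ≠ .s2 → A1.reg y = A'.reg y := fun y hy => by rw [← hA1]; simp [hy]
    have hs2 : A1.reg .s2 = c := by rw [← hA1, hcdef]; simp [hp, hs, hln, hP' .d rfl]; split_ifs <;> omega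
    have hf1 : A1.Frame A' [.s2] [] := by rw [← hA1]; simp
    have hd1 : A1.disk = A'.disk := by rw [← hA1]; rfl
    have hC1 := hC.frame he hk hf1 (by decide) (by decide) hd1
    have hval : (codeE 1 §.src §.pos §.s2).val A1 = v := by rw [val_codeE hC1.par]; simp [r1, hs2, hp, hs, hcd]
    rw [wp_seq, wp_assign, hval]
    refine ⟨ok_codeE hC1.par hT.D_pos (by simp) (by simp) (by simp) (by simp) ?_, ?_⟩
    · rw [← val_codeE hC1.par, hval]; omega
    rw [wp_seq]
    refine (hC1.frame (A' := A1.setReg .val v) (xs := [.val]) he hk (by simp) (by decide) (by decide) rfl).put_wp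
      hT hR hbB hk he ?_ (by simpa using f3) ?_
    · simp only [setReg_reg, if_true]
      refine ⟨hD', by omega, by rw [f3, f4]; omega, by omega, fun h => by omega, fun _ => by omega,
        fun _ => by rw [f2, f4]; omega, fun _ j hj => ?_⟩
      rw [f2, f3, add_assoc, add_assoc]; exact hX _ (by omega)
    intro A2 t2 hf2 hC2 ht2
    have r2 : ∀ y, y ∉ [Var.s2, .val, .num] → A2.reg y = A'.reg y := by
      intro y hy; simp only [List.mem_cons, not_or] at hy
      rw [hf2.reg y (by simp [hy]), setReg_reg, if_neg hy.2.1, r1 y hy.1]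
    have hs2' : A2.reg .s2 = c := by rw [hf2.reg _ (by simp)]; simpa using hs2
    simp only [setReg_reg, if_true, f4] at hC2; simp [r2, hp, hs, hln, hs2']
    refine ⟨by omega, by omega, ⟨i + c, N' + 1, (hI _ _ _ _).2 ⟨by omega, by simp [add_assoc], by simp [add_assoc],
      by simp; omega, ?_, ?_, by omega⟩⟩, hi', hc0⟩
    · rw [← add_assoc]
      exact hC2.frame (xs := [.src, .pos, .len]) he hk (by simp) (by decide) (by decide) rfl
    · have hmono : ∀ x, x / P .d ≤ (x + c) / P .d := fun x => Nat.div_le_div_right (by omega)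
      have hjump : ∀ x, c = P .d - x % P .d → (x + c) / P .d = x / P .d + 1 := fun x hx => by
        have h1 := mod_lt x hd; have h2 := div_add_mod' x (P .d)
        rw [show x + c = (x / P .d + 1) * P .d by rw [add_mul]; omega, Nat.mul_div_cancel _ hd]
      have h1 := hmono (pos + i); have h2 := hmono (src + i); rw [← add_assoc, ← add_assoc]; rw [if_neg (by omega)] at hN
      rcases (by omega : c = len - i ∨ c = P .d - (pos + i) % P .d ∨ c = P .d - (src + i) % P .d) with h3 | h3 | h3
      · rw [if_pos (by omega)]; omega
      · have := hjump _ h3; omega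
      · have := hjump _ h3; omega
  · rintro A' t' ⟨i, N', h'⟩ hc; obtain ⟨hi, hp, hs, hln, hC, hN, ht⟩ := (hI _ _ _ _).1 h'
    have hi' : i = len := by have : A'.reg .len = 0 := hc; omega
    subst hi'; rw [if_pos rfl] at hN; exact hQ A' t' N' hp hC hN ht

end

theorem drop_append_left {I l l' : List ℕ} {e : ℕ} (h : I.drop e = l ++ l') :
    I.drop (e + l.length) = l' ∧ ∀ j < l.length, I.getD (e + j) 0 = l.getD j 0 := by
  refine ⟨by rw [← List.drop_drop, h, List.drop_left], fun j hj => ?_⟩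
  have h1 : (I.drop e).getD j 0 = I.getD (e + j) 0 := by simp [List.getD_eq_getElem?_getD]
  rw [← h1, h, List.getD_append _ _ _ _ hj]

/-- The literals from `s` up to `pos` are read but not yet part of a piece. -/
structure Pending (P : Var → ℕ) (X : ℕ → ℕ) (pos s : ℕ) (A : AState) : Prop where
  rpos : A.reg .pos = pos
  start : A.reg .s1 = s
  acc : A.reg .acc = value (P .sg) (P .d) X s (pos - s)
  le : s ≤ pos
  lt : s % P .d + (pos - s) < P .d

section

variable {S : ℕ → ℕ} {e pos : ℕ} (hT : TextEnv L' P X) (hR : IsRaw L) (hB : 0 < mc.B) (hbB : P .b ≤ mc.B) (hk : 0 < k) (hS : ∀ i, S i < P .sg)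
include hT hR hB hbB hk hS

/-- Literals are collected and written at the end of the unit, so a piece is charged to the growth
of `pos / d` rather than to a literal. -/
theorem parseLit_wp (h : Parsing P X S k mc.B (2 ^ mc.w) N e s A) (hp : Pending P X pos s A) (he : e < P .G)
    (hSe : S e = X pos) (hpn : pos < P .n)
    (hQ : ∀ A' t' N' s', Parsing P X S k mc.B (2 ^ mc.w) N' (e + 1) s' A' → Pending P X (pos + 1) s' A' →
      N' + pos / P .d ≤ N + (pos + 1) / P .d →
      t' + (e + k * mc.B - 1) / (k * mc.B) + N / P .b ≤ t + (e + 1 + k * mc.B - 1) / (k * mc.B) + N' / P .b → Q A' t') :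
    L.wp parseLit Q A t := by
  have hw := L.width; have hbl := L'.bound_le; have hnD := hT.n_lt; have hD := hT.D_lt; have hdD := hT.d_lt
  have hd := hT.d_pos; have hsg := hT.two_le_sg; obtain ⟨hp1, hp2, hp3, hp4, hp5⟩ := hp
  have hmod : pos % P .d = s % P .d + (pos - s) := by
    conv_lhs => rw [show pos = s + (pos - s) by omega]; rw [← mod_add_mod, mod_eq_of_lt hp5]
  have hvs : value (P .sg) (P .d) X s (pos + 1 - s) =
      value (P .sg) (P .d) X s (pos - s) + X pos * P .sg ^ (pos % P .d) := by
    rw [show pos + 1 - s = pos - s + 1 by omega, value, sum_range_succ, hmod, show s + (pos - s) = pos by omega]; rfl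
  have hvl : value (P .sg) (P .d) X s (pos + 1 - s) < P .D := by
    rw [hT.D_eq]; exact value_lt (by omega) hT.X_lt (by omega)
  rw [parseLit, wp_seq]; refine h.next_wp hT hR hB hk hS he ?_; intro A1 t1 hf1 hf0 hC1 ht1
  have r1 : ∀ y, y ∉ [Var.cw, .f0, .e] → A1.reg y = A.reg y := hf1.reg; have hP1 := hC1.par
  have hpl : P .sg ^ (pos % P .d) < 2 ^ mc.w := by have := hT.pow_le (mod_lt pos hd).le; omega
  rw [wp_seq]
  refine power_wp (by simp) (by simp) (hP1 .sg rfl) (by omega) (k := pos % P .d)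
    (by have := mod_lt pos hd; omega) hpl (fun v v' => ⟨by simp, ?_⟩) ?_
  · simp [r1, hp1, h.par .d rfl]
  rw [wp_seq, wp_assign]; refine ⟨?_, ?_⟩
  · simp [hf0, hSe, r1, hp3]; omega
  rw [wp_seq, wp_assign]; refine ⟨?_, ?_⟩
  · simp [r1, hp1]; omega
  generalize hA2 : setReg (setReg _ _ _) _ _ = A2
  have r2 : ∀ y, y ∉ [Var.pow, .i, .acc, .pos] → A2.reg y = A1.reg y := fun y hy => by
    simp only [List.mem_cons, not_or] at hy; rw [← hA2]; simp [hy]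
  have hf2 : A2.Frame A1 [.pow, .i, .acc, .pos] [] := by
    rw [← hA2]
    refine (Frame.setReg (Frame.setReg (Frame.setReg (Frame.setReg ?_ ?_) ?_) ?_) ?_) <;> simp
  have hC2 := hC1.frame (by omega) hk hf2 (by decide) (by decide) (by rw [← hA2]; rfl)
  have hpos2 : A2.reg .pos = pos + 1 := by rw [← hA2]; simp [r1, hp1]
  have hacc2 : A2.reg .acc = value (P .sg) (P .d) X s (pos + 1 - s) := by rw [← hA2]; simp [r1, hp3, hf0, hSe, hvs]
  have hs2 : A2.reg .s1 = s := by rw [r2 _ (by simp), r1 _ (by simp), hp2]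
  have hdiv := @Nat.succ_div pos (P .d); have hdm := div_add_mod (pos + 1) (P .d); have hdm' := div_add_mod pos (P .d)
  rw [wp_when]; refine ⟨by simp, fun hc => ?_, fun hc => ?_⟩
  · simp [hpos2, hC2.par .d rfl] at hc
    refine putLit_wp hT hR hbB hk hC2 (by omega) hpos2 hs2 hacc2 (by omega) (by omega) (by omega) ?_
    intro A3 t3 N3 hf3 h1 h2 hC3 hN _ ht3; rw [if_pos (dvd_of_mod_eq_zero hc)] at hdiv
    exact hQ A3 t3 N3 _ hC3 ⟨by rw [hf3.reg _ (by simp), hpos2], h1, by simp [h2, value], le_rfl,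
      by simp [hc, hd]⟩ (by rw [hdiv]; omega) (by omega)
  · simp [hpos2, hC2.par .d rfl] at hc
    rw [if_neg (fun h => hc (mod_eq_zero_of_dvd h)), add_zero] at hdiv
    refine hQ A2 t1 N s hC2 ⟨hpos2, hs2, hacc2, by omega, ?_⟩ (by rw [hdiv]) (by omega); have := hdiv; by_contra hge
    refine hc ?_; have h4 : pos % P .d + 1 = P .d := by omega
    rw [add_mod]; rcases Nat.lt_or_ge 1 (P .d) with h5 | h5
    · rw [mod_eq_of_lt h5, h4, mod_self]
    · rw [show P .d = 1 by omega, mod_one]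

/-- The source may be anywhere, so its unit boundaries do not telescope; they are bounded by `len /
d + 1`. Together with one piece for the pending literals and one for the end of the phrase, this
makes the `3 * d`, after multiplication by `d`. -/
theorem parseRep_wp {src : ℕ} (h : Parsing P X S k mc.B (2 ^ mc.w) N e s A) (hp : Pending P X pos s A)
    (he : e + 2 * P .d ≤ P .G) (hpn : pos + len ≤ P .n) (hsp : src < pos) (hl : 0 < len)
    (hX : ∀ j < len, X (src + j) = X (pos + j))
    (hS1 : ∀ j < P .d, S (e + j) = src / P .sg ^ j % P .sg)
    (hS2 : ∀ j < P .d, S (e + P .d + j) = len / P .sg ^ j % P .sg)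
    (hQ : ∀ A' t' N' s', Parsing P X S k mc.B (2 ^ mc.w) N' (e + 2 * P .d) s' A' → Pending P X (pos + len) s' A' →
      P .d * N' + P .d * (pos / P .d) ≤ P .d * N + P .d * ((pos + len) / P .d) + len + 3 * P .d →
      t' + (e + k * mc.B - 1) / (k * mc.B) + N / P .b ≤
        t + (e + 2 * P .d + k * mc.B - 1) / (k * mc.B) + N' / P .b → Q A' t') :
    L.wp parseRep Q A t := by
  have hnD := hT.n_lt; have hd := hT.d_pos; obtain ⟨hp1, hp2, hp3, hp4, hp5⟩ := hp; rw [parseRep, wp_seq]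
  refine readNum_wp hT hR hB hk hS h (.inl rfl) (by omega) hS1 (by omega) ?_; intro A1 t1 hf1 hv1 hC1 ht1; rw [wp_seq]
  refine readNum_wp hT hR hB hk hS hC1 (.inr rfl) (by omega) hS2 (by omega) ?_; intro A2 t2 hf2 hv2 hC2 ht2
  have r2 : ∀ y, y ∉ [Var.cw, .f0, .e, .j, .pow, .src, .len] → A2.reg y = A.reg y := fun y hy => by
    simp only [List.mem_cons, not_or] at hy; rw [hf2.reg y (by simp [hy]), hf1.reg y (by simp [hy])]
  rw [wp_seq]
  refine putLit_wp hT hR hbB hk hC2 (by omega) (by rw [r2 _ (by simp), hp1])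
    (by rw [r2 _ (by simp), hp2]) (by rw [r2 _ (by simp), hp3]) hp4 (by omega) (by omega) ?_
  intro A3 t3 N3 hf3 h1 h2 hC3 hN3 _ ht3; rw [wp_seq]
  refine copyLoop_wp hT hR hbB hk hC3 (by omega) (by rw [hf3.reg _ (by simp), r2 _ (by simp), hp1])
    (by rw [hf3.reg _ (by simp), hf2.reg _ (by simp), hv1]) (by rw [hf3.reg _ (by simp), hv2]) hpn hsp hX hl ?_
  intro A4 t4 N4 hpos hC4 hN4 ht4; simp [hpos]; rw [show e + P .d + P .d = e + 2 * P .d by ring] at *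
  refine hQ _ t4 N4 _ (hC4.frame (xs := [.s1, .acc]) (by omega) hk (by simp) (by decide) (by decide) rfl)
    ⟨by simp [hpos], by simp, by simp [value], le_rfl, by simp [mod_lt _ hd]⟩ ?_ (by omega)
  have h3 : P .d * ((src + len) / P .d) ≤ P .d * (src / P .d) + P .d + len := by
    have h4 := mul_div_le (src + len) (P .d); have h5 := div_add_mod src (P .d); have h6 := mod_lt src hd; omega
  have h7 := Nat.mul_le_mul_left (P .d) (show N4 + pos / P .d + src / P .d ≤
    N + (pos + len) / P .d + (src + len) / P .d + 2 by omega)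
  simp only [mul_add] at h7; omega

end

open LZ

theorem _root_.LZ.Parses.le {X : List ℕ} {F : List Phrase} {p : ℕ → Phrase → Prop}
    (h : Parses X p i F) : i ≤ X.length := by
  induction F generalizing i with
  | nil => exact le_of_eq h
  | cons f F ih => exact (Nat.le_add_right _ _).trans (ih h.2)

/-- The invariant bounds the symbols read by 2 per literal and `2 * d + 1` per repeat phrase, and
the number of pieces by `d * N ≤ d * (pos / d) + pos + 3 * d * r` after `r` repeat phrases. The
first term pays for boundaries of the target, the second for those of the sources, and the third for
the constants per phrase. -/
theorem parse_wp {Xl : List ℕ} {F : List Phrase} {S : ℕ → ℕ} (hT : TextEnv L' P fun i => Xl.getD i 0) (hR : IsRaw L)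
    (hB : 0 < mc.B) (hbB : P .b ≤ mc.B) (hk : 0 < k) (hS : ∀ i, S i < P .sg)
    (hd : P .d = log (P .sg) (P .n) + 1) (hG : (2 * P .d + 8) * P .n < P .G)
    (hXn : Xl.length = P .n) (hF : Parses Xl (Phrase.IsAt Xl) 0 F)
    (hSe : ∀ i, S i = (encode (P .sg) (P .n) F).getD i 0)
    (h : Parsing P (fun i => Xl.getD i 0) S k mc.B (2 ^ mc.w) 0 0 0 A)
    (hp : Pending P (fun i => Xl.getD i 0) 0 0 A)
    (hQ : ∀ A' t' N wd e, A'.Has P → A'.reg .num = N →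
      Source P wd N A' → Pieces P (fun i => Xl.getD i 0) wd N → pieceEnd P wd N = P .n →
      P .d * N ≤ 2 * P .n + 3 * P .d * repCount F + P .d →
      e ≤ 2 * P .n + (2 * P .d + 1) * repCount F →
      t' ≤ t + (e + k * mc.B - 1) / (k * mc.B) + N / P .b + 1 → Q A' t') :
    L.wp parse Q A t := by
  have hnD := hT.n_lt; have hD := hT.D_lt; have hbl := L'.bound_le; have hn := hT.n_pos
  have hdn : P .d ≤ P .n := by rw [hd]; exact log_lt_self _ (by omega)
  have he_lt : ∀ e pos r, e ≤ 2 * pos + (2 * P .d + 1) * r → r ≤ pos → pos ≤ P .n → e + 3 * P .n < P .G := by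
    intro e pos r h1 h2 h3
    have h4 : (2 * P .d + 1) * r ≤ (2 * P .d + 1) * P .n := Nat.mul_le_mul_left _ (by omega)
    have h5 : (2 * P .d + 8) * P .n = (2 * P .d + 1) * P .n + 7 * P .n := by ring
    omega
  obtain ⟨I, hI⟩ : ∃ I : ℕ → ℕ → ℕ → ℕ → ℕ → List Phrase → AState → ℕ → Prop, ∀ pos e N s r F' A' t',
      I pos e N s r F' A' t' ↔ (Parses Xl (Phrase.IsAt Xl) pos F' ∧
        (encode (P .sg) (P .n) F).drop e = encode (P .sg) (P .n) F' ∧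
        e ≤ 2 * pos + (2 * P .d + 1) * r ∧ r ≤ pos ∧ r + repCount F' = repCount F ∧
        P .d * N ≤ P .d * (pos / P .d) + pos + 3 * P .d * r ∧
        Parsing P (fun i => Xl.getD i 0) S k mc.B (2 ^ mc.w) N e s A' ∧
        Pending P (fun i => Xl.getD i 0) pos s A' ∧
        t' ≤ t + (e + k * mc.B - 1) / (k * mc.B) + N / P .b) := ⟨_, fun _ _ _ _ _ _ _ _ => Iff.rfl⟩
  rw [parse, wp_seq]
  refine wp_while (fun A' t' => ∃ pos e N s r F', I pos e N s r F' A' t')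
    (fun A' => P .n - A'.reg .pos) ⟨0, 0, 0, 0, 0, F, (hI _ _ _ _ _ _ _ _).2 ⟨hF, rfl, by omega, le_rfl,
      by omega, by simp, h, hp, by rw [Nat.zero_div]; exact Nat.le_add_right _ _⟩⟩ ?_ ?_ ?_
  · intro A' t' _; simp
  · rintro A' t' ⟨pos, e, N, s, r, F', h'⟩ hc
    obtain ⟨hF', he, hel, hr, hrc, hN, hC, hpd, ht⟩ := (hI _ _ _ _ _ _ _ _).1 h'; simp [hpd.rpos, hC.par .n rfl] at hc
    have heG := he_lt e pos r hel hr hc.le; rcases F' with - | ⟨f, F'⟩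
    · simp only [Parses] at hF'; omega
    obtain ⟨hf, hF''⟩ := hF'; have hlen := hF''.le
    rw [show encode (P .sg) (P .n) (f :: F') = f.encode (P .sg) (P .n) ++ encode (P .sg) (P .n) F' by simp [encode]] at he
    obtain ⟨he', hget⟩ := drop_append_left he; simp only [← hSe] at hget; rw [wp_seq]
    refine hC.next_wp hT hR hB hk hS (by omega) ?_; intro A1 t1 hf1 hf0 hC1 ht1
    have r1 : ∀ y, y ∉ [Var.cw, .f0, .e] → A1.reg y = A'.reg y := hf1.reg
    have hpd1 : Pending P (fun i => Xl.getD i 0) pos s A1 :=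
      ⟨by rw [r1 _ (by simp), hpd.rpos], by rw [r1 _ (by simp), hpd.start], by rw [r1 _ (by simp), hpd.acc],
        hpd.le, hpd.lt⟩
    rw [wp_ite]; rcases f with c | ⟨p, l⟩
    · have h0 := hget 0 (by simp [Phrase.encode]); have h1 := hget 1 (by simp [Phrase.encode])
      simp [Phrase.encode] at h0 h1
      refine ⟨by simp, fun hne => absurd (hf0.trans h0) hne, fun _ => ?_⟩
      refine parseLit_wp hT hR hB hbB hk hS hC1 hpd1 (by omega) ?_ hc ?_
      · simp only [Phrase.IsAt] at hf; simpa [hf] using h1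
      intro A2 t2 N2 s2 hC2 hpd2 hN2 ht2
      refine ⟨⟨pos + 1, e + 1 + 1, N2, s2, r, F', (hI _ _ _ _ _ _ _ _).2 ⟨hF'', he', by omega, by omega,
        ?_, ?_, hC2, hpd2, by omega⟩⟩, by simp only [hpd.rpos, hpd2.rpos]; omega⟩
      · simpa [repCount] using hrc
      · have := Nat.mul_le_mul_left (P .d) hN2; simp only [mul_add] at this; omega
    · obtain ⟨hp1, hp2, hp3, hp4⟩ := hf
      have hfd : ∀ v j, j < P .d → (fixedDigits (P .sg) (P .d) v).getD j 0 = v / P .sg ^ j % P .sg := by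
        intro v j hj; simp [fixedDigits, List.getD_eq_getElem?_getD, hj]
      have hfl : ∀ v, (fixedDigits (P .sg) (P .d) v).length = P .d := fun v => by simp [fixedDigits]
      rw [Phrase.encode, ← hd] at hget he'
      simp only [List.length_cons, List.length_append, hfl] at hget he'; have h0 := hget 0 (by omega); simp at h0
      refine ⟨by simp, fun _ => ?_, fun h1 => absurd ((hf0.trans h0).trans_ne one_ne_zero) h1⟩
      have hplen : pos + l ≤ P .n := by omega
      refine parseRep_wp hT hR hB hbB hk hS hC1 hpd1 (by omega) hplen hp1 hp2 ?_ ?_ ?_ ?_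
      · intro j hj; simp only [List.getD_eq_getElem?_getD, hp4 j hj]
      · intro j hj; have := hget (j + 1) (by omega)
        rw [List.getD_cons_succ, List.getD_append _ _ _ _ (by rw [hfl]; exact hj), hfd _ _ hj] at this; rw [← this]
        congr 1; ring
      · intro j hj; have := hget (P .d + j + 1) (by omega)
        rw [List.getD_cons_succ, List.getD_append_right _ _ _ _ (by rw [hfl]; omega), hfl,
          Nat.add_sub_cancel_left, hfd _ _ hj] at this
        rw [← this]; congr 1; ring
      intro A2 t2 N2 s2 hC2 hpd2 hN2 ht2
      refine ⟨⟨pos + l, _, N2, s2, r + 1, F', (hI _ _ _ _ _ _ _ _).2 ⟨hF'', ?_, ?_, by omega,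
        ?_, ?_, hC2, hpd2, by omega⟩⟩, by simp only [hpd.rpos, hpd2.rpos]; omega⟩
      · rw [← he']; congr 1; ring
      · rw [mul_add (2 * P .d + 1)]; omega
      · simp [repCount] at hrc ⊢; omega
      · have : 3 * P .d * (r + 1) = 3 * P .d * r + 3 * P .d := by ring
        omega
  · rintro A' t' ⟨pos, e, N, s, r, F', h'⟩ hc
    obtain ⟨hF', he, hel, hr, hrc, hN, hC, hpd, ht⟩ := (hI _ _ _ _ _ _ _ _).1 h'; simp [hpd.rpos, hC.par .n rfl] at hc
    obtain rfl : pos = P .n := le_antisymm (hXn ▸ hF'.le) hc; have heG := he_lt e _ r hel hr le_rfl; rw [wp_seq]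
    refine putLit_wp hT hR hbB hk hC (by omega) hpd.rpos hpd.start hpd.acc hpd.le le_rfl hpd.lt.le ?_
    intro A1 t1 N1 hf1 _ _ hC1 hN1 _ ht1; obtain ⟨hP1, -, -, wd, hW, hpc, hpe⟩ := hC1; have hN₁n := hpc.le_n
    have hG8 := hT.eight_mul_G_lt; refine putEnd_wp hR hW hT.b_pos hbB (by omega) ?_; intro A2 t2 hf2 _ hwd hlt ht2
    obtain ⟨hpc', hpe'⟩ := hpc.congr (wd' := fun i => A2.disk (P .G + i / P .b) (i % P .b)) hwd
    refine hQ A2 t2 N1 _ e (hP1.frame hf2 (by decide)) (by rw [hf2.reg _ (by simp), hW.num]) ?_ hpc'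
      ((hpe' _ le_rfl).trans hpe) ?_ ?_ (by omega)
    · intro q hq o ho; beta_reduce
      rw [show (q * P .b + o) / P .b = q by
        rw [Nat.add_comm, add_mul_div_right _ _ hT.b_pos, div_eq_of_lt ho, zero_add],
        mul_add_mod', mod_eq_of_lt ho]
      exact ⟨rfl, hlt q hq o ho⟩
    · have h1 := Nat.mul_le_mul_left (P .d) hN1; have h2 := mul_div_le (P .n) (P .d)
      have h3 : 3 * P .d * r ≤ 3 * P .d * repCount F := Nat.mul_le_mul_left _ (by omega); rw [mul_add] at h1; omega
    · have h3 : (2 * P .d + 1) * r ≤ (2 * P .d + 1) * repCount F := Nat.mul_le_mul_left _ (by omega); omega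

/-! ### From units to words -/

def putWord : ACmd := .val ≔ §.acc ;; put ;; .acc ≔ 0

def repackStep : ACmd :=
  next ;; power .pow (§.pos % §.k) ;; .acc ≔ §.acc + §.f0 * §.pow ;; .pos ≔ §.pos + 1 ;;
  .when ((§.pos % §.k).eq 0) putWord

def repack : ACmd :=
  .v1 ≔ 2 * §.G ;; .v3 ≔ §.d ;; .v4 ≔ §.b ;; .v2 ≔ 3 * §.G ;; .rp ≔ §.B ;;
  .e ≔ 0 ;; .num ≔ 0 ;; .pos ≔ 0 ;; .acc ≔ 0 ;;
  .loop ((§.pos).lt §.n) repackStep ;; .when (§.pos % §.k) putWord ;; putEnd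

/-- The state when `pos` symbols are read and `N` words are written. -/
structure Repacking (P : Var → ℕ) (X : ℕ → ℕ) (B W pos N : ℕ) (A : AState) : Prop where
  par : A.Has P
  reader : Reader (P .sg) (P .d) (P .b) (2 * P .G) (P .U) X pos A
  disk : ∀ q o, A.disk q o < W
  rpos : A.reg .pos = pos
  words : ∃ wd, Writer B (3 * P .G) W wd N A ∧
    ∀ i < N, wd i = ∑ j ∈ range (P .k), X (i * P .k + j) * P .sg ^ j

section

variable {pos : ℕ} (hT : TextEnv L' P X) (hR : IsRaw L) (hB : 0 < mc.B) (hk : 0 < P .k) (hkw : P .sg ^ P .k ≤ 2 ^ mc.w)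

theorem Repacking.frame {B W : ℕ} (h : Repacking P X B W pos N A) (hpos : pos ≤ P .U * P .d) (hf : A'.Frame A xs [])
    (hp : ∀ x ∈ xs, x.isPar = false)
    (hx : ∀ x ∈ xs, x ∉ [Var.v1, .v3, .v4, .e, .cw, .v2, .rp, .num, .pos]) (hd : A'.disk = A.disk) :
    Repacking P X B W pos N A' := by
  have r : ∀ y ∈ [Var.v1, .v3, .v4, .e, .cw, .v2, .rp, .num, .pos], A'.reg y = A.reg y := fun y hy =>
    hf.reg y fun h' => hx y h' hy
  obtain ⟨hP, hr, hdk, hps, wd, hw, hpc⟩ := h; have hP' := hP.frame hf hp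
  refine ⟨hP', hr.congr (fun y hy => ?_) (hf.arr 0 (by simp)) hpos fun _ _ => by rw [hd],
    hd ▸ hdk, (r _ (by simp)).trans hps, wd,
    hw.congr (r _ (by simp)) (r _ (by simp)) (r _ (by simp)) (hf.arr 1 (by simp)) hd, hpc⟩
  by_cases h1 : y = .sg
  · rw [h1, hP' .sg rfl, hP .sg rfl]
  · simp only [List.mem_cons, List.not_mem_nil, or_false] at hy; refine r y ?_
    simp only [List.mem_cons, List.not_mem_nil, or_false]; tauto

include hT hR hB

theorem putWord_wp (h : Repacking P X mc.B (2 ^ mc.w) pos N A) (hpos : pos ≤ P .U * P .d) (hN : N < P .G)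
    (hacc : A.reg .acc = ∑ j ∈ range (P .k), X (N * P .k + j) * P .sg ^ j)
    (hlt : A.reg .acc < 2 ^ mc.w)
    (hQ : ∀ A' t', Repacking P X mc.B (2 ^ mc.w) pos (N + 1) A' → A'.reg .acc = 0 →
      t' + N / mc.B ≤ t + (N + 1) / mc.B → Q A' t') :
    L.wp putWord Q A t := by
  have hG8 := hT.eight_mul_G_lt; have hbl := L'.bound_le; have hUn := hT.U_le_n; have hnG := hT.n_lt_G
  rw [putWord, wp_seq, wp_assign]; refine ⟨by simp, ?_⟩; generalize hv : (§.acc : AExpr).val A = v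
  replace hv : A.reg .acc = v := hv
  have h₁ := h.frame (A' := A.setReg .val v) (xs := [.val]) hpos (by simp) (by decide) (by decide) rfl
  obtain ⟨hP, hr, hdk, hps, wd, hw, hwd⟩ := h₁; rw [wp_seq]
  refine put_wp hR hw hB le_rfl (by omega) (by simpa [← hv]) le_rfl ?_; intro A2 t2 hf2 hw2 hd2 hdl2 ht2; rw [wp_assign]
  refine ⟨by simp, ?_⟩
  have hR2 : Repacking P X mc.B (2 ^ mc.w) pos (N + 1) A2 := by
    refine ⟨hP.frame hf2 (by decide), hr.congr (fun y hy => hf2.reg y ?_) (hf2.arr _ (by simp)) hpos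
      (fun q hq => hd2 q (.inl (by omega))), fun q o => ?_, by rw [hf2.reg _ (by simp), hps], _, hw2, ?_⟩
    · rintro hc; simp only [List.mem_singleton] at hc; subst hc; simp at hy
    · rcases hdl2 q o with h1 | h1
      · exact h1
      · rw [h1]; exact hdk q o
    · intro i hi; rcases Nat.lt_succ_iff_lt_or_eq.1 hi with h3 | rfl
      · rw [Function.update_of_ne (by omega), hwd i h3]
      · rw [Function.update_self, ← hacc, hv]; simp
  refine hQ _ t2 (hR2.frame (xs := [.acc]) hpos (by simp) (by decide) (by decide) rfl) (by simp) ?_; rw [Nat.succ_div]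
  omega

include hk hkw

theorem repackStep_wp (h : Repacking P X mc.B (2 ^ mc.w) pos (pos / P .k) A) (hpos : pos < P .n) (hbB : P .b ≤ mc.B)
    (hacc : A.reg .acc = ∑ j ∈ range (pos % P .k), X (pos / P .k * P .k + j) * P .sg ^ j)
    (hQ : ∀ A' t', Repacking P X mc.B (2 ^ mc.w) (pos + 1) ((pos + 1) / P .k) A' →
      A'.reg .acc = ∑ j ∈ range ((pos + 1) % P .k), X ((pos + 1) / P .k * P .k + j) * P .sg ^ j →
      t' + (pos + P .d * P .b - 1) / (P .d * P .b) + pos / P .k / mc.B ≤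
        t + (pos + 1 + P .d * P .b - 1) / (P .d * P .b) + (pos + 1) / P .k / mc.B → Q A' t') :
    L.wp repackStep Q A t := by
  have hw := L.width; have hG8 := hT.eight_mul_G_lt; have hbl := L'.bound_le; have hnG := hT.n_lt_G; have hd := hT.d_pos
  have hsg := hT.two_le_sg
  have hUd : P .n ≤ P .U * P .d := by by_contra hc; exact absurd ((hT.lt_U (P .U)).2 (by omega)) (lt_irrefl _)
  have hpk := Nat.div_le_self pos (P .k); have hmk := mod_lt pos hk; have hdm := div_add_mod' pos (P .k)
  have hsum : ∀ j ≤ P .k, ∑ j ∈ range j, X (pos / P .k * P .k + j) * P .sg ^ j < 2 ^ mc.w := by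
    intro j hj
    exact (sum_digits_lt (c := fun j => X (pos / P .k * P .k + j)) fun o _ => hT.X_lt _).trans_le
      ((Nat.pow_le_pow_right (by omega) hj).trans hkw)
  have hkl : P .k < 2 ^ mc.w := (Nat.lt_pow_self (by omega)).trans_le hkw
  have hsucc : ∑ j ∈ range (pos % P .k + 1), X (pos / P .k * P .k + j) * P .sg ^ j =
      A.reg .acc + X pos * P .sg ^ (pos % P .k) := by
    rw [sum_range_succ, ← hacc, hdm]
  have hs1 := hsum _ (succ_le_of_lt hmk); rw [hsucc] at hs1; obtain ⟨hP, hr, hdk, hps, wd, hwr, hwd⟩ := h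
  rw [repackStep, wp_seq]
  refine next_wp hR hr hT.X_lt hT.b_pos hbB hd (by omega) (by omega) hdk ?_; intro A1 t1 hf1 hd1 hf0 hr1 ht1
  have hR1 : Repacking P X mc.B (2 ^ mc.w) (pos + 1) (pos / P .k) (A1.setReg .pos (pos + 1)) :=
    ⟨(hP.frame hf1 (by decide)).setReg rfl, hr1.congr (by simp) rfl (by omega) (fun _ _ => rfl),
      by simpa [hd1] using hdk, by simp, wd, hwr.congr (by simp; exact hf1.reg _ (by simp))
      (by simp; exact hf1.reg _ (by simp)) (by simp; exact hf1.reg _ (by simp))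
      (hf1.arr _ (by simp)) hd1, hwd⟩
  have r1 : ∀ y, y ∉ [Var.cw, .f0, .e] → A1.reg y = A.reg y := hf1.reg; rw [wp_seq]
  refine power_wp (by simp) (by simp) (by rw [r1 _ (by simp), hP .sg rfl]) (by omega) (k := pos % P .k)
    (by omega) ((Nat.pow_lt_pow_right hsg hmk).trans_le hkw) (fun v v' => ⟨by simp, ?_⟩) ?_
  · simp [r1, hps, hP .k rfl]
  rw [wp_seq, wp_assign]; refine ⟨?_, ?_⟩
  · simp [hf0, r1]; omega
  rw [wp_seq, wp_assign]; refine ⟨?_, ?_⟩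
  · simp [r1, hps]; omega
  generalize hA2 : setReg (setReg _ _ _) _ _ = A2
  have hf2 : A2.Frame (A1.setReg .pos (pos + 1)) [.pow, .i, .acc] [] := by
    constructor
    · intro y hy; simp only [List.mem_cons, not_or] at hy; rw [← hA2]
      by_cases h1 : y = .pos <;> simp [hy, h1, r1, hps]
    · intro f _; rw [← hA2]; rfl
  have hR2 := hR1.frame (by omega) hf2 (by decide) (by decide) (by rw [← hA2]; rfl)
  have hacc2 : A2.reg .acc = A.reg .acc + X pos * P .sg ^ (pos % P .k) := by rw [← hA2]; simp [r1, hf0]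
  have hdiv := @Nat.succ_div pos (P .k); have hdm' := div_add_mod' (pos + 1) (P .k); rw [wp_when]
  rw [ceil_succ (Nat.mul_pos hd hT.b_pos)] at hQ; refine ⟨by simp, fun hc => ?_, fun hc => ?_⟩
  · simp [hR2.rpos, hR2.par .k rfl] at hc; rw [if_pos (dvd_of_mod_eq_zero hc)] at hdiv
    have h1 : pos % P .k + 1 = P .k := by rw [hdiv, add_mul] at hdm'; omega
    refine putWord_wp hT hR hB hR2 (by omega) (by omega) (by rw [hacc2, ← hsucc, h1]) (by omega) ?_
    intro A3 t3 hR3 h0 ht3; refine hQ A3 t3 (hdiv ▸ hR3) (by rw [h0, hc]; rfl) ?_; rw [hdiv]; omega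
  · simp [hR2.rpos, hR2.par .k rfl] at hc
    rw [if_neg (fun h => hc (mod_eq_zero_of_dvd h)), add_zero] at hdiv
    refine hQ A2 t1 (hdiv ▸ hR2) ?_ (by rw [hdiv]; omega); rw [hacc2, ← hsucc, hdiv]; rw [hdiv] at hdm'
    rw [show (pos + 1) % P .k = pos % P .k + 1 by omega]

/-- Units are words with `d` digits, so the text is read as a stream of digits and cut anew into
words with `k` digits, in full blocks of `B` words. -/
theorem repack_wp (hP : A.Has P) (hbB : P .b ≤ mc.B)
    (hPB : P .B = mc.B) (hdisk : ∀ q o, A.disk q o < 2 ^ mc.w) (harr : ∀ o < mc.B, A.arr 1 o < 2 ^ mc.w)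
    (hunit : ∀ q, q * P .b < P .U → ∀ o < P .b, A.disk (2 * P .G + q) o = unit P X (q * P .b + o))
    (hQ : ∀ A' t', A'.Has P → (∀ i, i * P .k < P .n → A'.disk (3 * P .G + i / mc.B) (i % mc.B) =
        ∑ j ∈ range (P .k), X (i * P .k + j) * P .sg ^ j) →
      t' ≤ t + (P .n + P .d * P .b - 1) / (P .d * P .b) + (P .n / P .k + 1) / mc.B + 1 → Q A' t') :
    L.wp repack Q A t := by
  have hw := L.width; have hG8 := hT.eight_mul_G_lt; have hbl := L'.bound_le; have hnG := hT.n_lt_G; have hb := hT.b_pos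
  have hUd : P .n ≤ P .U * P .d := by by_contra hc; exact absurd ((hT.lt_U (P .U)).2 (by omega)) (lt_irrefl _)
  rw [repack]
  generalize hloop : ACmd.loop ((§.pos).lt §.n) repackStep = lp; simp [hP .G rfl]; refine ⟨by omega, by omega, ?_⟩
  generalize hA1 : setReg (setReg _ _ _) _ _ = A1
  have hf1 : A1.Frame A [.v1, .v3, .v4, .v2, .rp, .e, .num, .pos, .acc] [] := by rw [← hA1]; simp
  have hd1 : A1.disk = A.disk := by rw [← hA1]; rfl
  have hP1 := hP.frame hf1 (by decide)
  have hR1 : Repacking P X mc.B (2 ^ mc.w) 0 0 A1 := by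
    refine ⟨hP1, ⟨by rw [← hA1]; simp, by rw [← hA1]; simp [hP .d rfl], by rw [← hA1]; simp [hP .b rfl],
      hP1 .sg rfl, by rw [← hA1]; simp, fun i hi => ?_, by simp, by simp⟩, hd1 ▸ hdisk, by rw [← hA1]; simp,
      fun _ => 0, ⟨by rw [← hA1]; simp, by rw [← hA1]; simp [hP .B rfl, hPB], by rw [← hA1]; simp, by simp, by simp,
        by rw [hf1.arr _ (by simp)]; exact harr, by simp⟩, by simp⟩
    have h1 := div_add_mod' i (P .b)
    rw [hd1, hunit _ (by omega) _ (mod_lt _ hb), h1, unit, masked]; simp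
  have hacc1 : A1.reg .acc = 0 := by rw [← hA1]; simp
  subst hloop
  obtain ⟨I, hI⟩ : ∃ I : ℕ → AState → ℕ → Prop, ∀ pos A' t', I pos A' t' ↔ (pos ≤ P .n ∧
      Repacking P X mc.B (2 ^ mc.w) pos (pos / P .k) A' ∧
      A'.reg .acc = ∑ j ∈ range (pos % P .k), X (pos / P .k * P .k + j) * P .sg ^ j ∧
      t' ≤ t + (pos + P .d * P .b - 1) / (P .d * P .b) + pos / P .k / mc.B) := ⟨_, fun _ _ _ => Iff.rfl⟩
  refine wp_while (fun A' t' => ∃ pos, I pos A' t') (fun A' => P .n - A'.reg .pos)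
    ⟨0, (hI _ _ _).2 ⟨by omega, by simpa using hR1, by simpa using hacc1, by
      rw [Nat.zero_div, Nat.zero_div]; exact Nat.le_add_right _ _⟩⟩ ?_ ?_ ?_
  · intro A' t' _; simp
  · rintro A' t' ⟨pos, h'⟩ hc; obtain ⟨-, hC, hacc, ht⟩ := (hI _ _ _).1 h'; simp [hC.rpos, hC.par .n rfl] at hc
    refine repackStep_wp hT hR hB hk hkw hC hc hbB hacc ?_; intro A2 t2 hC2 hacc2 ht2
    refine ⟨⟨pos + 1, (hI _ _ _).2 ⟨hc, hC2, hacc2, by omega⟩⟩, ?_⟩; simp only [hC.rpos, hC2.rpos]; omega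
  · rintro A' t' ⟨pos, h'⟩ hc; obtain ⟨hle, hC, hacc, ht⟩ := (hI _ _ _).1 h'; simp [hC.rpos, hC.par .n rfl] at hc
    obtain rfl : pos = P .n := by omega
    have hend : ∀ A2 t2 N, Repacking P X mc.B (2 ^ mc.w) (P .n) N A2 → (∀ i, i * P .k < P .n → i < N) →
        N ≤ P .n / P .k + 1 → t2 + P .n / P .k / mc.B ≤ t' + N / mc.B → L.wp putEnd Q A2 t2 := by
      rintro A2 t2 N ⟨hP2, -, -, -, wd, hwr, hwd⟩ hlt hN ht2; have := Nat.div_le_self (P .n) (P .k)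
      refine putEnd_wp hR hwr hB le_rfl (by omega) ?_; intro A3 t3 hf3 _ hw3 _ ht3
      refine hQ A3 t3 (hP2.frame hf3 (by decide)) (fun i hi => ?_) ?_
      · rw [hw3 i (hlt i hi), hwd i (hlt i hi)]
      · have := Nat.div_le_div_right (c := mc.B) hN; omega
    have hdm := div_add_mod' (P .n) (P .k); have hmk := mod_lt (P .n) hk; have hnk := Nat.div_le_self (P .n) (P .k)
    rw [wp_seq, wp_when]; refine ⟨by simp, fun h0 => ?_, fun h0 => ?_⟩
    -- The last word is incomplete; its missing digits lie beyond the text and are 0, as in the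
    -- packed representation.
    · have hsum : ∑ j ∈ range (P .n % P .k), X (P .n / P .k * P .k + j) * P .sg ^ j =
          ∑ j ∈ range (P .k), X (P .n / P .k * P .k + j) * P .sg ^ j := by
        refine sum_subset (range_subset_range.2 hmk.le) fun j _ hj => ?_
        rw [hT.X_zero _ (by rw [mem_range] at hj; omega), zero_mul]
      rw [hsum] at hacc; refine putWord_wp hT hR hB hC hUd (by omega) hacc ?_ ?_
      · rw [hacc]
        exact (sum_digits_lt (c := fun j => X (P .n / P .k * P .k + j)) fun o _ => hT.X_lt _).trans_le hkw
      · intro A2 t2 hC2 _ ht2; refine hend A2 t2 _ hC2 (fun i hi => ?_) le_rfl ht2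
        exact lt_succ_of_le ((Nat.le_div_iff_mul_le hk).2 hi.le)
    · replace h0 : A'.reg .pos % A'.reg .k = 0 := not_not.1 h0; rw [hC.rpos, hC.par .k rfl] at h0
      refine hend A' t' _ hC (fun i hi => ?_) (by omega) le_rfl
      rw [lt_div_iff_mul_lt_of_dvd hk.ne' (dvd_of_mod_eq_zero h0)]; exact hi

end

/-! ### Initialization -/

/-- The number of digits of `q + 1` in base `sg`, minus one. -/
def logCount (x : Var) : ACmd :=
  x ≔ 0 ;; .loop ((§.sg - 2).lt §.q) (.q ≔ (§.q - (§.sg - 1)) / §.sg ;; x ≔ §x + 1)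

/-- The parameters are computed from `n`, `x1` (the size of the alphabet), `w`, `M` and `B`. -/
def setup : ACmd :=
  -- `power` always raises `sg`, so 2 takes the place of the alphabet size for a moment. The number
  -- `2 ^ w` is not a word; half of it is computed, and `2 ^ w - 1` as `q1 - 1 + q1`.
  .sg ≔ 2 ;; power .V (§.w / 16) ;; power .q1 (§.w - 1) ;; .sg ≔ §.x1 ;;
  .q ≔ §.q1 - 1 + §.q1 ;; logCount .k ;; .q ≔ §.n - 1 ;; logCount .d ;; .d ≔ §.d + 1 ;; power .D §.d ;;
  -- `M` and `B` may be far larger than any polynomial in `n`. Capping `b` and `m` at `n` keeps all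
  -- parameters of the queue below `V`.
  .b ≔ §.B ;; .when ((§.n).lt §.b) (.b ≔ §.n) ;; .m ≔ §.M / §.B ;; .when ((§.n).lt §.m) (.m ≔ §.n) ;;
  .cu ≔ §.m * §.b ;; .U ≔ (§.n + §.d - 1) / §.d ;; .G ≔ 32 * §.n * §.n ;;
  .pad ≔ (2 * §.U + 2) * §.D * §.D * §.D ;; .inf ≔ §.pad + 1 ;;
  .v3 ≔ §.k ;; .v4 ≔ §.B ;; .v2 ≔ §.G ;; .rp ≔ §.b

/-- The values of the parameters. -/
structure Params (mc : Machine) (n sg : ℕ) (P : Var → ℕ) : Prop where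
  n_eq : P .n = n
  sg_eq : P .sg = sg
  B_eq : P .B = mc.B
  M_eq : P .M = mc.M
  V_eq : P .V = 2 ^ (mc.w / 16)
  k_eq : P .k = symbolsPerWord sg mc.w
  d_eq : P .d = log sg n + 1
  D_eq : P .D = sg ^ P .d
  b_eq : P .b = min mc.B n
  m_eq : P .m = min (mc.M / mc.B) n
  cu_eq : P .cu = P .m * P .b
  U_eq : P .U = (n + P .d - 1) / P .d
  G_eq : P .G = 32 * n * n
  pad_eq : P .pad = (2 * P .U + 2) * P .D * P .D * P .D
  inf_eq : P .inf = P .pad + 1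

/-- The register holds `z - 1` instead of `z`, so that `z = 2 ^ w` is allowed; replacing `z` by `z /
sg` becomes `(z - 1 - (sg - 1)) / sg`. -/
theorem logCount_wp {x : Var} (hx : x ≠ .q) (hx' : x ≠ .sg) (hsg : A.reg .sg = sg) (h2 : 2 ≤ sg) (hy : 0 < y)
    (hyw : y ≤ 2 ^ mc.w) (hq : A.reg .q = y - 1)
    (hQ : ∀ A', A'.Frame A [.q, x] [] → A'.disk = A.disk → A'.reg x = log sg y → Q A' t) :
    L.wp (logCount x) Q A t := by
  have hlog : log sg y < 2 ^ mc.w := (log_lt_self _ hy.ne').trans_le hyw; rw [logCount, wp_seq, wp_assign]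
  refine ⟨by simp, ?_⟩
  refine wp_while (fun A' t' => t' = t ∧ A'.Frame A [.q, x] [] ∧ A'.disk = A.disk ∧ ∃ z, 0 < z ∧
    A'.reg .q = z - 1 ∧ A'.reg x + log sg z = log sg y) (fun A' => A'.reg .q)
    ⟨rfl, by simp, rfl, y, hy, by simp [hx.symm, hq], by simp⟩ ?_ ?_ ?_
  · intro A' t' _; simp
  · rintro A' t' ⟨rfl, hf, hd, z, hz, hqz, hl⟩ hc
    have hs : A'.reg .sg = sg := by rw [hf.reg _ (by simp [hx'.symm]), hsg]
    simp [hs, hqz] at hc; have hle : sg ≤ z := by omega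
    have hdiv : (z - 1 - (sg - 1)) / sg = z / sg - 1 := by rw [show z - 1 - (sg - 1) = z - sg * 1 by omega, sub_mul_div]
    have hlz := log_of_one_lt_of_le (by omega) hle; have hpos := Nat.div_pos hle (by omega)
    have hlt := Nat.div_lt_self hz h2; simp [hs, hqz, hdiv, hx, hx.symm]
    exact ⟨by omega, ⟨hf, hd, z / sg, hpos, rfl, by omega⟩, by omega⟩
  · rintro A' t' ⟨rfl, hf, hd, z, hz, hqz, hl⟩ hc
    have hs : A'.reg .sg = sg := by rw [hf.reg _ (by simp [hx'.symm]), hsg]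
    simp [hs, hqz] at hc; refine hQ A' hf hd ?_; rw [← hl, log_of_lt (by omega), add_zero]

theorem setup_wp (hn : 2 ≤ n) (h2 : 2 ≤ sg) (hrn : A.reg .n = n) (hrs : A.reg .x1 = sg)
    (hrw : A.reg .w = mc.w) (hrM : A.reg .M = mc.M) (hrB : A.reg .B = mc.B)
    (hV : 2 * (sg * n) ^ 3 * (2 * n + 2) + 64 * n * n < 2 ^ mc.w)
    (hQ : ∀ A', A'.Frame A [.sg, .V, .i, .q1, .q, .k, .d, .D, .b, .m, .cu, .U, .G, .pad, .inf, .v3, .v4, .v2, .rp] [] →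
      A'.disk = A.disk → Params mc n sg A'.reg → A'.reg .v3 = A'.reg .k → A'.reg .v4 = mc.B →
      A'.reg .v2 = A'.reg .G → A'.reg .rp = A'.reg .b → Q A' t) :
    L.wp setup Q A t := by
  have hw := L.width
  have hsn : sg ≤ sg * n := Nat.le_mul_of_pos_right _ (by omega)
  have hns : n ≤ sg * n := Nat.le_mul_of_pos_left _ (by omega)
  have hc3 : sg * n ≤ (sg * n) ^ 3 := Nat.le_self_pow (by norm_num) _
  have hc3' : 2 * (sg * n) ^ 3 * 1 ≤ 2 * (sg * n) ^ 3 * (2 * n + 2) := Nat.mul_le_mul_left _ (by omega)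
  have hw0 : 0 < mc.w := by by_contra h0; simp [show mc.w = 0 by omega] at hw
  have hpw : 2 * 2 ^ (mc.w - 1) = 2 ^ mc.w := by rw [← _root_.pow_succ', Nat.sub_add_cancel hw0]
  have hww : mc.w < 2 ^ mc.w := Nat.lt_two_pow_self; have hlog : log sg n < n := log_lt_self _ (by omega)
  rw [setup, wp_seq, wp_assign]; refine ⟨by simp, ?_⟩; rw [wp_seq]
  refine power_wp (sg := 2) (k := mc.w / 16) (by simp) (by simp) (by simp) (by omega) (by omega)
    (Nat.pow_lt_pow_right (by omega) (by omega)) (fun v v' => ⟨by simp, by simp [hrw]⟩) ?_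
  rw [wp_seq]
  refine power_wp (sg := 2) (k := mc.w - 1) (by simp) (by simp) (by simp) (by omega) (by omega)
    (Nat.pow_lt_pow_right (by omega) (by omega)) (fun v v' => ⟨by simp, by simp [hrw]⟩) ?_
  rw [wp_seq, wp_assign]; refine ⟨by simp, ?_⟩; rw [wp_seq, wp_assign]; refine ⟨by simp; omega, ?_⟩
  generalize hA1 : setReg _ .q _ = A1
  have r1 : ∀ y, y ∉ [Var.sg, .V, .i, .q1, .q] → A1.reg y = A.reg y := fun y hy => by
    simp only [List.mem_cons, not_or] at hy; rw [← hA1]; simp [hy]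
  have hf1 : A1.Frame A [.sg, .V, .i, .q1, .q] [] := by rw [← hA1]; simp
  have hd1 : A1.disk = A.disk := by rw [← hA1]; rfl
  have hV1 : A1.reg .V = 2 ^ (mc.w / 16) := by rw [← hA1]; simp
  have hs1 : A1.reg .sg = sg := by rw [← hA1]; simp [hrs]
  rw [wp_seq]
  refine logCount_wp (y := 2 ^ mc.w) (by simp) (by simp) hs1 h2 (by omega) le_rfl (by rw [← hA1]; simp; omega) ?_
  intro A2 hf2 hd2 hk2; rw [wp_seq, wp_assign]; refine ⟨by simp, ?_⟩; rw [wp_seq]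
  refine logCount_wp (y := n) (by simp) (by simp) (by simp [hf2.reg, hs1]) h2 (by omega) (by omega)
    (by simp [hf2.reg, r1, hrn]) ?_
  intro A3 hf3 hd3 hk3
  have r3 : ∀ y, y ∉ [Var.q, .k, .d] → A3.reg y = A1.reg y := fun y hy => by
    simp only [List.mem_cons, not_or] at hy; rw [hf3.reg y (by simp [hy])]; simp [hy, hf2.reg]
  rw [wp_seq, wp_assign]; refine ⟨by simp; omega, ?_⟩
  have hD : sg ^ (log sg n + 1) ≤ sg * n := by
    rw [_root_.pow_succ']; exact Nat.mul_le_mul_left _ (pow_log_le_self _ (by omega))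
  rw [wp_seq]
  refine power_wp (sg := sg) (k := log sg n + 1) (by simp) (by simp) (by simp [r3, hs1]) (by omega) (by omega)
    (by omega) (fun v v' => ⟨by simp, by simp [hk3]⟩) ?_
  generalize hA4 : setReg (setReg _ _ _) .i _ = A4
  have r4 : ∀ y, y ∉ [Var.q, .k, .d, .D, .i] → A4.reg y = A1.reg y := fun y hy => by
    simp only [List.mem_cons, not_or] at hy; rw [← hA4]; simp [hy, r3]
  have r5 : ∀ y, y ∉ [Var.sg, .V, .i, .q1, .q, .k, .d, .D] → A4.reg y = A.reg y := fun y hy => by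
    simp only [List.mem_cons, not_or] at hy; rw [r4 y (by simp [hy]), r1 y (by simp [hy])]
  have hf4 : A4.Frame A [.sg, .V, .i, .q1, .q, .k, .d, .D] [] := ⟨r5, fun f hf => by
    rw [← hA4, ← hf1.arr f hf, ← hf2.arr f hf, ← show _ = A2.arr f from hf3.arr f hf]
    rfl⟩
  have hd4 : A4.disk = A.disk := by rw [← hA4, ← hd1, ← hd2]; exact hd3
  have h4D : A4.reg .D = sg ^ (log sg n + 1) := by rw [← hA4]; simp
  have h4d : A4.reg .d = log sg n + 1 := by rw [← hA4]; simp [hk3]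
  have h4k : A4.reg .k = symbolsPerWord sg mc.w := by rw [← hA4]; simp [hf3.reg, hk2]; rfl
  generalize hd : log sg n + 1 = d at *; have hDp : 0 < sg ^ d := by positivity
  generalize hDd : sg ^ d = D at *; have hb : min mc.B n ≤ n := min_le_right _ _
  have hm : min (mc.M / mc.B) n ≤ n := min_le_right _ _
  have hU : (n + d - 1) / d ≤ n := by
    refine (Nat.div_le_iff_le_mul (by omega)).2 ?_; have := Nat.le_mul_of_pos_right n (show 0 < d by omega); omega
  have hmb : min (mc.M / mc.B) n * min mc.B n ≤ n * n := Nat.mul_le_mul hm hb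
  have hDn : D * D * D ≤ (sg * n) ^ 3 := by rw [pow_succ, sq]; exact Nat.mul_le_mul (Nat.mul_le_mul hD hD) hD
  have hpad : (2 * ((n + d - 1) / d) + 2) * D * D * D ≤ (2 * n + 2) * (sg * n) ^ 3 := by
    rw [mul_assoc, mul_assoc, ← mul_assoc D]; exact Nat.mul_le_mul (by omega) hDn
  have hp1 : 2 * (sg * n) ^ 3 * (2 * n + 2) = 2 * ((2 * n + 2) * (sg * n) ^ 3) := by ring
  have hDD := Nat.le_mul_of_pos_right ((2 * ((n + d - 1) / d) + 2) * D * D) hDp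
  have hDD' := Nat.le_mul_of_pos_right ((2 * ((n + d - 1) / d) + 2) * D) hDp
  have hnn : 64 * n * n = 2 * (32 * n * n) := by ring
  have hnn' := Nat.le_mul_of_pos_right (32 * n) (show 0 < n by omega)
  have hn32 : 32 * n * n = 32 * (n * n) := mul_assoc _ _ _
  have hmin : ∀ x, (if n < x then n else x) = min x n := fun x => by split_ifs <;> omega
  have hrn4 : A4.reg .n = n := by rw [r5 _ (by simp), hrn]
  have hrB4 : A4.reg .B = mc.B := by rw [r5 _ (by simp), hrB]
  have hrM4 : A4.reg .M = mc.M := by rw [r5 _ (by simp), hrM]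
  rw [wp_seq, wp_assign]; refine ⟨by simp, ?_⟩; rw [wp_seq, wp_when_assign]; refine ⟨by simp, fun _ => by simp, ?_⟩
  rw [wp_seq, wp_assign]; refine ⟨by simp, ?_⟩; rw [wp_seq, wp_when_assign]; refine ⟨by simp, fun _ => by simp, ?_⟩
  simp [hrn4, hrB4, hrM4, h4D, h4d, h4k, hmin, -mul_ite, -ite_mul]
  refine ⟨by omega, by omega, ⟨by omega, by omega⟩, ⟨⟨⟨⟨by omega, by omega⟩, by omega⟩, by omega⟩, by omega⟩,
    by omega, ?_⟩
  refine hQ _ ?_ hd4 ⟨?_, ?_, ?_, ?_, ?_, ?_, ?_, ?_, ?_, ?_, ?_, ?_, ?_, ?_, ?_⟩ ?_ ?_ ?_ ?_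
  · simpa using hf4.mono (by simp) (by simp)
  all_goals simp [hrn4, hrB4, hrM4, h4D, h4d, h4k, hV1, hs1, r4, hd, hDd]

/-- All parameters are polynomial in `n`. The largest are `pad`, at most `(2 * n + 2) * (sg * n) ^
3` with `sg ≤ n ^ a`, and the disk addresses, of order `n ^ 4`. The number `4096 * n ^ 4 * n ^ (3 *
a + 3)` dominates both; since `4096 = 2 ^ 12 ≤ n ^ 12`, the exponent `3 * a + 19` suffices. -/
theorem textEnv_of_params {a : ℕ} (hn : 2 ≤ n)
    (hsg : 2 ≤ sg) (hsa : sg ≤ n ^ a) (hB : 1 ≤ mc.B) (hM : 2 * mc.B ≤ mc.M) (hMw : mc.M < 2 ^ mc.w)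
    (hw : n ^ (3 * a + 19) < 2 ^ (mc.w / 16)) (hX : ∀ i, X i < sg) (hX0 : ∀ i, n ≤ i → X i = 0) :
    2 * (sg * n) ^ 3 * (2 * n + 2) + 64 * n * n < 2 ^ mc.w ∧ ∀ P, Params mc n sg P →
      ∃ hp : PackedOk mc (P .V) (P .b), TextEnv (packedLayout mc (P .V) (P .b) hp) P X := by
  have hp0 : 0 < n ^ (3 * a + 3) := by positivity
  have hS : (sg * n) ^ 3 ≤ n ^ (3 * a + 3) := by
    calc (sg * n) ^ 3 ≤ (n ^ a * n) ^ 3 := Nat.pow_le_pow_left (Nat.mul_le_mul_right _ hsa) 3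
      _ = n ^ (3 * a + 3) := by ring
  have hV : 4096 * (n * n * (n * n)) * n ^ (3 * a + 3) < 2 ^ (mc.w / 16) := by
    refine lt_of_le_of_lt ?_ hw
    calc 4096 * (n * n * (n * n)) * n ^ (3 * a + 3) ≤ n ^ 12 * (n * n * (n * n)) * n ^ (3 * a + 3) := by
          refine Nat.mul_le_mul_right _ (Nat.mul_le_mul_right _ ?_)
          exact (show 4096 = 2 ^ 12 by norm_num) ▸ Nat.pow_le_pow_left hn 12
      _ = n ^ (3 * a + 19) := by ring
  generalize n ^ (3 * a + 3) = p at *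
  have hVw : 2 ^ (mc.w / 16) ≤ 2 ^ mc.w := Nat.pow_le_pow_right (by omega) (Nat.div_le_self _ _)
  have hnn : n * 2 ≤ n * n := Nat.mul_le_mul_left _ hn
  have hxx : n * n * 1 ≤ n * n * (n * n) := Nat.mul_le_mul_left _ (by omega)
  have hxp : n * n * (n * n) * 1 ≤ n * n * (n * n) * p := Nat.mul_le_mul_left _ hp0
  have hnp : (2 * n + 2) * p ≤ 2 * (n * n * (n * n)) * p := Nat.mul_le_mul_right _ (by omega); rw [mul_assoc] at hV hnp
  have hSp : (2 * n + 2) * (sg * n) ^ 3 ≤ (2 * n + 2) * p := Nat.mul_le_mul_left _ hS; refine ⟨?_, fun P h => ?_⟩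
  · have h1 : 2 * (sg * n) ^ 3 * (2 * n + 2) = 2 * ((2 * n + 2) * (sg * n) ^ 3) := by ring
    rw [h1, mul_assoc 64]; omega
  have hd0 : 0 < P .d := by rw [h.d_eq]; omega
  have hb : P .b ≤ n := h.b_eq ▸ min_le_right _ _; have hm : P .m ≤ n := h.m_eq ▸ min_le_right _ _
  have hmb : P .m * P .b ≤ mc.M := by
    rw [h.m_eq, h.b_eq]
    exact (Nat.mul_le_mul (min_le_left _ _) (min_le_left _ _)).trans (div_mul_le_self _ _)
  have hMB : 2 ≤ mc.M / mc.B := (Nat.le_div_iff_mul_le hB).2 hM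
  have hD : P .D ≤ sg * n := by
    rw [h.D_eq, h.d_eq, pow_succ']; exact Nat.mul_le_mul_left _ (pow_log_le_self _ (by omega))
  have hU : P .U ≤ n := by
    rw [h.U_eq]; refine (Nat.div_le_iff_le_mul hd0).2 ?_; have := Nat.le_mul_of_pos_right n hd0; omega
  have hpad : P .pad ≤ (2 * n + 2) * (sg * n) ^ 3 := by
    rw [h.pad_eq, mul_assoc, mul_assoc, ← mul_assoc (P .D), pow_succ, sq]
    exact Nat.mul_le_mul (by omega) (Nat.mul_le_mul (Nat.mul_le_mul hD hD) hD)
  have hG : P .G = 32 * (n * n) := by rw [h.G_eq, mul_assoc]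
  have hcu : P .m * P .b ≤ n * n := Nat.mul_le_mul hm hb
  have h64 : 64 ≤ 2 ^ mc.w := by have := Nat.mul_le_mul hnn hnn; omega
  refine ⟨⟨h64, hM, hMw, by rw [h.V_eq]; omega, ?_, by rw [h.b_eq]; exact min_le_left _ _, by rw [h.b_eq]; omega⟩, ?_⟩
  · rw [h.V_eq, ← pow_mul]; exact pow_dvd_pow _ (div_mul_le_self _ _)
  refine { narr := le_rfl, blk := rfl, b_pos := by rw [h.b_eq]; omega, two_le_m := by rw [h.m_eq]; omega,
           cap := hmb, cap_lt := hMw, V_eq := rfl, inf_eq := h.inf_eq, inf_lt := ?_, G_mul := ?_, Gb := ?_,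
           two_le_sg := by rw [h.sg_eq]; exact hsg, d_pos := hd0, D_eq := by rw [h.D_eq, h.sg_eq],
           n_pos := by rw [h.n_eq]; omega, n_lt := ?_, cu_eq := h.cu_eq, lt_U := fun u => ?_,
           pad_eq := h.pad_eq, X_lt := by rw [h.sg_eq]; exact hX, X_zero := by rw [h.n_eq]; exact hX0,
           n_lt_G := by rw [h.n_eq, hG]; omega, U_add_cu := ?_ }
  · change P .inf < P .V; rw [h.inf_eq, h.V_eq]; omega
  · change _ < P .V
    have h1 : 32 * (n * n) * (2 * (32 * (n * n)) + 8) = 2048 * (n * n * (n * n)) + 256 * (n * n) := by ring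
    rw [hG, h1, h.V_eq]; omega
  · change _ < P .V
    have h1 : P .G * P .b ≤ 32 * (n * n) * (n * n) := by rw [hG]; exact Nat.mul_le_mul_left _ (by omega)
    rw [mul_assoc] at h1; rw [h.V_eq]; omega
  · rw [h.n_eq, h.D_eq, h.d_eq]; exact lt_pow_succ_log_self (by omega) _
  · rw [h.U_eq, h.n_eq, Nat.lt_div_iff_mul_lt hd0]; omega
  · change _ < P .V; rw [h.cu_eq, h.V_eq]; omega

theorem encode_lt {Xl : List ℕ} {F : List Phrase} (hsg : 2 ≤ sg) (hX : ∀ x ∈ Xl, x < sg)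
    (hF : Parses Xl (Phrase.IsAt Xl) i F) : ∀ x ∈ encode sg n F, x < sg := by
  have hfd : ∀ v, ∀ x ∈ fixedDigits sg (log sg n + 1) v, x < sg := fun v x hx => by
    obtain ⟨j, -, rfl⟩ := List.mem_map.1 hx; exact mod_lt _ (by omega)
  induction F generalizing i with
  | nil => simp [encode]
  | cons f F ih =>
    intro x hx; rw [encode, List.flatMap_cons, List.mem_append] at hx; rcases hx with hx | hx
    · rcases f with c | ⟨p, l⟩
      · simp only [Phrase.encode, List.mem_cons, List.not_mem_nil, or_false] at hx; rcases hx with rfl | rfl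
        · omega
        · exact hX _ (List.mem_of_getElem? hF.1)
      · simp only [Phrase.encode, List.mem_cons, List.mem_append] at hx; rcases hx with rfl | hx | hx
        · omega
        · exact hfd _ _ hx
        · exact hfd _ _ hx
    · exact ih hF.2 x hx

theorem getD_lt {l : List ℕ} (hsg : 0 < sg) (hl : ∀ x ∈ l, x < sg) (i : ℕ) : l.getD i 0 < sg := by
  rw [List.getD_eq_getElem?_getD]; rcases hi : l[i]? with - | x
  · simpa
  · exact hl _ (List.mem_of_getElem? hi)

/-! ### The whole program and its run. -/

def load (x : Var) (r : ℕ) : Cmd := .assign x.idx (.reg r)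

def loads : Cmd :=
  .seq (load .n 0) <| .seq (load .x1 1) <| .seq (load .w 2) <| .seq (load .M 3) (load .B 4)

/-- Decoding an LZ77-type factorization. -/
def program : Cmd :=
  .seq loads <| .seq ((setup ;; parse).compile rawAccess) <|
  .seq (.seq (.assign 5 (.reg Var.V.idx)) (.assign 6 (.reg Var.b.idx))) <|
  -- Register 3 belongs to the invariant of the raw layout but not to that of the packed one, so it
  -- is restored before the raw layout is used again.
  .seq (resolve.compile packedAccess) <| .seq (.assign 3 (.reg Var.M.idx)) <|
  .seq (repack.compile rawAccess) (.assign 0 (.op .mul (.const 3) (.reg Var.G.idx)))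

/-- Bounds for the cost of decoding. -/
structure DecodeCost (mc : Machine) (n sg z t : ℕ) (P : Var → ℕ) (N e : ℕ) : Prop where
  params : Params mc n sg P
  N_le : N ≤ n
  d_mul_N_le : P .d * N ≤ 2 * n + 3 * P .d * z + P .d
  e_le : e ≤ 2 * n + (2 * P .d + 1) * z
  le : t ≤ (e + P .k * mc.B - 1) / (P .k * mc.B) + N / P .b + resolveCost P N +
    (n + P .d * P .b - 1) / (P .d * P .b) + (n / P .k + 1) / mc.B + 2

theorem Layout.run_of_wp (L : Layout mc a) {c : ACmd} {s : State}
    (hs : s.WF mc) (hi : L.Inv s.reg) (h : L.wp c Q (L.abs s) 0) :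
    ∃ s' t, Run mc (c.compile a) s s' t ∧ s'.WF mc ∧ L.Inv s'.reg ∧ Q (L.abs s') t := by
  obtain ⟨s', t, hr, hi', hq⟩ := L.wp_sound c Q _ 0 h s hs hi rfl
  exact ⟨s', t, hr, hr.wf hs, hi', by rwa [zero_add] at hq⟩

theorem run_set {s : State} (hs : s.WF mc) (x : ℕ) (e : Expr) :
    ∃ s', Run mc (.assign x e) s s' 0 ∧ s'.WF mc ∧ s'.reg x = e.eval mc s ∧ (∀ y, y ≠ x → s'.reg y = s.reg y) ∧
      s'.ram = s.ram ∧ s'.disk = s.disk :=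
  ⟨_, .assign s x e, (Run.assign s x e).wf hs, by simp, fun y hy => by simp [hy], rfl, rfl⟩

theorem loads_run {s0 : State} (hs0 : s0.WF mc) (hz : ∀ x, 5 ≤ x → s0.reg x = 0) :
    ∃ s, Run mc loads s0 s 0 ∧ s.WF mc ∧ (∀ x < 10, s.reg x = s0.reg x) ∧ s.reg Var.n.idx = s0.reg 0 ∧
      s.reg Var.x1.idx = s0.reg 1 ∧ s.reg Var.w.idx = s0.reg 2 ∧ s.reg Var.M.idx = s0.reg 3 ∧
      s.reg Var.B.idx = s0.reg 4 ∧ (∀ x : Var, x ∉ [Var.n, .x1, .w, .M, .B] → s.reg x.idx = 0) ∧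
      s.ram = s0.ram ∧ s.disk = s0.disk := by
  obtain ⟨s1, r1, w1, e1, f1, g1, d1⟩ := run_set hs0 (Var.n.idx) (.reg 0)
  obtain ⟨s2, r2, w2, e2, f2, g2, d2⟩ := run_set w1 (Var.x1.idx) (.reg 1)
  obtain ⟨s3, r3, w3, e3, f3, g3, d3⟩ := run_set w2 (Var.w.idx) (.reg 2)
  obtain ⟨s4, r4, w4, e4, f4, g4, d4⟩ := run_set w3 (Var.M.idx) (.reg 3)
  obtain ⟨s5, r5, w5, e5, f5, g5, d5⟩ := run_set w4 (Var.B.idx) (.reg 4)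
  have hne : ∀ x < 10, ∀ y : Var, x ≠ y.idx := fun x hx y => by have := y.ten_le_idx; omega
  simp only [Expr.eval] at e1 e2 e3 e4 e5
  refine ⟨s5, .seq r1 (.seq r2 (.seq r3 (.seq r4 r5))), w5, fun x hx => ?_, ?_, ?_, ?_, ?_, ?_, fun x hx => ?_,
    by rw [g5, g4, g3, g2, g1], by rw [d5, d4, d3, d2, d1]⟩
  · rw [f5 x (hne x hx _), f4 x (hne x hx _), f3 x (hne x hx _), f2 x (hne x hx _), f1 x (hne x hx _)]
  · rw [f5 _ (by simp), f4 _ (by simp), f3 _ (by simp), f2 _ (by simp), e1]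
  · rw [f5 _ (by simp), f4 _ (by simp), f3 _ (by simp), e2, f1 _ (hne _ (by norm_num) _)]
  · rw [f5 _ (by simp), f4 _ (by simp), e3, f2 _ (hne _ (by norm_num) _), f1 _ (hne _ (by norm_num) _)]
  · rw [f5 _ (by simp), e4, f3 _ (hne _ (by norm_num) _), f2 _ (hne _ (by norm_num) _), f1 _ (hne _ (by norm_num) _)]
  · rw [e5, f4 _ (hne _ (by norm_num) _), f3 _ (hne _ (by norm_num) _), f2 _ (hne _ (by norm_num) _),
      f1 _ (hne _ (by norm_num) _)]
  · simp only [List.mem_cons, not_or] at hx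
    rw [f5 _ (by simp [hx]), f4 _ (by simp [hx]), f3 _ (by simp [hx]), f2 _ (by simp [hx]), f1 _ (by simp [hx])]
    exact hz _ (by have := x.ten_le_idx; omega)

/-- The phases communicate through the disk and the user registers only. The two layouts see the
same disk, the packed one just the first `b ≤ B` words of every block, so facts about these words
carry over from one view to the other. -/
theorem program_run {Xl : List ℕ} {F : List Phrase} {a : ℕ} (hln : Xl.length = n) (hn : 2 ≤ n)
    (hsg : 2 ≤ sg) (hsa : sg ≤ n ^ a) (hB : 1 ≤ mc.B) (hM : 2 * mc.B ≤ mc.M) (hMw : mc.M < 2 ^ mc.w)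
    (hw : n ^ (3 * a + 19) < 2 ^ (mc.w / 16)) (hX : ∀ x ∈ Xl, x < sg)
    (hF : Parses Xl (Phrase.IsAt Xl) 0 F) :
    ∃ s t, Run mc program (initial mc n sg (encode sg n F)) s t ∧ Outputs mc s sg Xl ∧
      ∃ P N e, DecodeCost mc n sg (repCount F) t P N e := by
  have hX' := getD_lt (by omega) hX
  have hX0 : ∀ i, n ≤ i → Xl.getD i 0 = 0 := fun i hi => by
    rw [List.getD_eq_getElem?_getD, List.getElem?_eq_none (by omega)]; rfl
  have hI' := getD_lt (by omega) (encode_lt (n := n) hsg hX hF); obtain ⟨I, hI⟩ : ∃ I, I = encode sg n F := ⟨_, rfl⟩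
  rw [← hI] at hI' ⊢
  obtain ⟨hV, hEnv⟩ := textEnv_of_params hn hsg hsa hB hM hMw hw hX' hX0
  have hVw : 2 ^ (mc.w / 16) ≤ 2 ^ mc.w := Nat.pow_le_pow_right (by omega) (Nat.div_le_self _ _)
  have hna : sg * n ≤ n ^ (3 * a + 19) := by
    calc sg * n ≤ n ^ a * n := Nat.mul_le_mul_right _ hsa
      _ = n ^ (a + 1) := by ring
      _ ≤ _ := Nat.pow_le_pow_right (by omega) (by omega)
  have hsn : sg ≤ sg * n := Nat.le_mul_of_pos_right _ (by omega)
  have hns : n ≤ sg * n := Nat.le_mul_of_pos_left _ (by omega)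
  have hk0 : 0 < symbolsPerWord sg mc.w := log_pos (by omega) (by omega)
  have hkw : sg ^ symbolsPerWord sg mc.w ≤ 2 ^ mc.w := pow_log_le_self _ (by positivity)
  have h64 : 64 ≤ 2 ^ mc.w := by
    have : 2 ^ 19 ≤ n ^ (3 * a + 19) :=
      (Nat.pow_le_pow_left hn 19).trans (Nat.pow_le_pow_right (by omega) (by omega))
    omega
  have hs0 : (initial mc n sg I).WF mc := by
    refine ⟨fun x => ?_, fun x => by simp [initial], fun x => ?_⟩
    · have := Nat.lt_two_pow_self (n := mc.w); simp only [initial]; split_ifs <;> omega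
    · change pack sg mc.w I x < _; rw [pack_eq]; exact (sum_digits_lt fun o _ => hI' _).trans_le hkw
  obtain ⟨s1, r1, w1, hlow, hrn, hrs, hrw, hrM, hrB, hrz, hram, hdisk⟩ := loads_run hs0
    (fun x hx => by simp only [initial]; rw [if_neg, if_neg, if_neg, if_neg, if_neg] <;> omega)
  obtain ⟨L, hLd⟩ : ∃ L, L = rawLayout mc h64 hM hMw := ⟨_, rfl⟩
  have hR : IsRaw L := by subst hLd; exact ⟨rfl, rfl, rfl, rfl⟩
  have hiL : ∀ r, L.Inv r ↔ r 3 = mc.M ∧ r 4 = mc.B := fun r => by rw [hLd]; exact Iff.rfl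
  have haL : ∀ s : State, s.WF mc → ∀ f j, (L.abs s).arr f j < 2 ^ mc.w := fun s hs f j => by
    rw [abs_arr]; split_ifs with h
    · rw [← hR.bound]; exact L.arr_lt _ _ _ hs.ram h.1 h.2
    · positivity
  have hdL : ∀ s : State, s.WF mc → ∀ q o, (L.abs s).disk q o < 2 ^ mc.w := fun s hs q o => by
    rw [abs_disk]; split_ifs
    · exact hs.disk _
    · positivity
  have hi1 : L.Inv s1.reg := (hiL _).2 ⟨hlow 3 (by norm_num), hlow 4 (by norm_num)⟩
  obtain ⟨s2, t2, r2, w2, i2, P, N, wd, e, hP, hA2, hnum, hS, hpc, hpe, hdN, hee, ht2⟩ :=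
    L.run_of_wp (c := setup ;; parse) (Q := fun A t => ∃ P N wd e, Params mc n sg P ∧ A.Has P ∧
      A.reg .num = N ∧ Source P wd N A ∧ Pieces P (fun i => Xl.getD i 0) wd N ∧ pieceEnd P wd N = P .n ∧
      P .d * N ≤ 2 * P .n + 3 * P .d * repCount F + P .d ∧ e ≤ 2 * P .n + (2 * P .d + 1) * repCount F ∧
      t ≤ (e + P .k * mc.B - 1) / (P .k * mc.B) + N / P .b + 1) w1 hi1 (by
    rw [wp_seq]; refine setup_wp hn hsg hrn hrs hrw hrM hrB hV ?_; intro A hf hd hPar h3 h4 h2 hrp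
    obtain ⟨hp, hT⟩ := hEnv _ hPar
    have hr0 : ∀ x, x ∉ [Var.n, .x1, .w, .M, .B, .sg, .V, .i, .q1, .q, .k, .d, .D, .b, .m, .cu, .U, .G, .pad, .inf,
        .v3, .v4, .v2, .rp] → A.reg x = 0 := fun x hx => by
      simp only [List.mem_cons, not_or] at hx; rw [hf.reg x (by simp [hx]), abs_reg, hrz x (by simp [hx])]
    have hlog : log sg n < n := log_lt_self _ (by omega)
    refine parse_wp (F := F) (S := fun i => I.getD i 0) (k := A.reg .k) hT hR hB
      (by rw [hPar.b_eq]; exact min_le_left _ _) (by rw [hPar.k_eq]; exact hk0) (by rw [hPar.sg_eq]; exact hI')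
      (by rw [hPar.d_eq, hPar.sg_eq, hPar.n_eq]) ?_ (by rw [hPar.n_eq, hln]) hF
      (by rw [hPar.sg_eq, hPar.n_eq, hI]; exact fun _ => rfl) ⟨fun _ _ => rfl,
        ⟨hr0 _ (by simp), h3, h4, rfl, hr0 _ (by simp), fun i hi => ?_, by simp, by simp⟩, fun q o => ?_, fun _ => 0,
        ⟨h2, hrp, hr0 _ (by simp), by simp, by simp, fun o _ => ?_, by simp⟩, ⟨by simp, by simp⟩, rfl⟩
      ⟨hr0 _ (by simp), hr0 _ (by simp), by rw [hr0 _ (by simp)]; rfl, le_rfl, by simpa using hT.d_pos⟩ ?_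
    · have h5 : (2 * A.reg .d + 8) * n ≤ (2 * n + 8) * n := Nat.mul_le_mul_right _ (by rw [hPar.d_eq]; omega)
      have h6 := Nat.mul_le_mul_left n hn; rw [add_mul, mul_assoc] at h5; rw [hPar.n_eq, hPar.G_eq, mul_assoc]
      rw [add_mul, mul_assoc] at *; omega
    · rw [hd, abs_disk, hR.blk, if_pos (mod_lt _ hB), hdisk, zero_add, div_add_mod']; change pack sg mc.w I i = _
      rw [pack_eq, hPar.k_eq, hPar.sg_eq]
    · rw [hd]; exact hdL _ w1 _ _
    · rw [hf.arr _ (by simp), abs_arr, hPar.V_eq]; subst hLd; simp [rawLayout, hram, initial]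
    · intro A' t' N wd e hP' h5 h6 h7 h8 h9 h10 h11
      exact ⟨_, N, wd, e, hPar, hP', h5, h6, h7, h8, h9, h10, by omega⟩)
  obtain ⟨hp, hT⟩ := hEnv _ hP
  have hbB : P .b ≤ mc.B := by rw [hP.b_eq]; exact min_le_left _ _
  obtain ⟨s3, r3, w3, e3, f3, g3, d3⟩ := run_set w2 5 (.reg Var.V.idx)
  obtain ⟨s4, r4, w4, e4, f4, g4, d4⟩ := run_set w3 6 (.reg Var.b.idx)
  have hne : ∀ x < 10, ∀ y : Var, y.idx ≠ x := fun x hx y => by have := y.ten_le_idx; omega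
  have hreg4 : ∀ x : Var, s4.reg x.idx = s2.reg x.idx := fun x => by
    rw [f4 _ (hne _ (by norm_num) _), f3 _ (hne _ (by norm_num) _)]
  obtain ⟨L', hLd'⟩ : ∃ L', L' = packedLayout mc (P .V) (P .b) hp := ⟨_, rfl⟩; rw [← hLd'] at hT
  have hi4 : L'.Inv s4.reg := by
    subst hLd'; refine ⟨?_, ?_, ?_⟩
    · rw [f4 _ (by norm_num), f3 _ (by norm_num)]; exact ((hiL _).1 i2).2
    · rw [f4 _ (by norm_num), e3]; exact hA2 .V rfl
    · rw [e4, Expr.eval, f3 _ (hne _ (by norm_num) _)]; exact hA2 .b rfl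
  obtain ⟨s5, t5, r5, w5, i5, hA5, hU, ht5⟩ := L'.run_of_wp (c := resolve) (Q := fun A t => A.Has P ∧
      (∀ q, q * P .b < P .U → ∀ o < P .b, A.disk (2 * P .G + q) o =
        unit P (fun i => Xl.getD i 0) (q * P .b + o)) ∧ t ≤ resolveCost P N) w4 hi4 (by
    refine resolve_wp hT hpc hpe (fun x hx => (hreg4 x).trans (hA2 x hx)) (fun q hq o ho => ?_)
      ((hreg4 _).trans hnum) (fun A' t' h1 h2 h3 => ⟨h1, h2, by omega⟩)
    have := hS q hq o ho; rw [abs_disk, hR.blk, if_pos (by omega)] at this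
    rwa [abs_disk, hT.blk, if_pos ho, d4, d3])
  obtain ⟨s6, r6, w6, e6, f6, g6, d6⟩ := run_set w5 3 (.reg Var.M.idx)
  have hreg6 : ∀ x : Var, s6.reg x.idx = s5.reg x.idx := fun x => f6 _ (hne _ (by norm_num) _)
  have hi6 : L.Inv s6.reg := by
    refine (hiL _).2 ⟨?_, ?_⟩
    · rw [e6]; exact (hA5 .M rfl).trans hP.M_eq
    · rw [f6 _ (by norm_num)]; subst hLd'; exact i5.reg_B
  obtain ⟨s7, t7, r7, w7, -, hA7, hD, ht7⟩ := L.run_of_wp (c := repack) (Q := fun A t => A.Has P ∧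
      (∀ i, i * P .k < P .n → A.disk (3 * P .G + i / mc.B) (i % mc.B) =
        ∑ j ∈ range (P .k), Xl.getD (i * P .k + j) 0 * P .sg ^ j) ∧
      t ≤ (P .n + P .d * P .b - 1) / (P .d * P .b) + (P .n / P .k + 1) / mc.B + 1) w6 hi6 (by
    refine repack_wp hT hR hB (by rw [hP.k_eq]; exact hk0) (by rw [hP.k_eq, hP.sg_eq]; exact hkw)
      (fun x hx => (hreg6 x).trans (hA5 x hx)) hbB hP.B_eq (hdL _ w6) (fun o _ => haL _ w6 _ _)
      (fun q hq o ho => ?_) (fun A' t' h1 h2 h3 => ⟨h1, h2, by omega⟩)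
    have := hU q hq o ho; rw [abs_disk, hT.blk, if_pos ho] at this
    rwa [abs_disk, hR.blk, if_pos (by omega), d6])
  obtain ⟨s8, r8, -, e8, f8, g8, d8⟩ := run_set w7 0 (.op .mul (.const 3) (.reg Var.G.idx))
  have hG8 := hT.eight_mul_G_lt; have hbl := L'.bound_le
  have hreg0 : s8.reg 0 = 3 * P .G := by
    have h1 : s7.reg Var.G.idx = P .G := hA7 .G rfl; simp only [e8, Expr.eval, Op.apply, h1]
    rw [mod_eq_of_lt (show 3 < 2 ^ mc.w by omega), mod_eq_of_lt (by omega)]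
  refine ⟨s8, _, .seq r1 (.seq r2 (.seq (.seq r3 r4) (.seq r5 (.seq r6 (.seq r7 r8))))), fun i hi => ?_,
    P, N, e, hP, ?_, by rwa [hP.n_eq] at hdN, by rwa [hP.n_eq] at hee, ?_⟩
  · rw [hln, ← hP.k_eq, ← hP.n_eq] at hi; have := hD i hi
    rw [abs_disk, hR.blk, if_pos (mod_lt _ hB), add_mul, add_assoc, div_add_mod', ← hreg0, hP.k_eq, hP.sg_eq] at this
    rw [d8, this, pack_eq]
  · exact hP.n_eq ▸ hpc.le_n
  · rw [hP.n_eq] at ht7; omega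

/-! ### The number of repeat phrases -/

theorem _root_.LZ.Parses.mono {X : List ℕ} {P Q : ℕ → Phrase → Prop} (hPQ : ∀ i f, P i f → Q i f) {i : ℕ} {F : List Phrase}
    (h : Parses X P i F) : Parses X Q i F := by
  induction F generalizing i with
  | nil => exact h
  | cons f F ih => exact ⟨hPQ _ _ h.1, ih h.2⟩

theorem _root_.LZ.Phrase.IsGreedyAt.isAt {X : List ℕ} {i : ℕ} {f : Phrase} (h : f.IsGreedyAt X i) : f.IsAt X i := by
  cases f <;> exact h.1

theorem _root_.LZ.Parses.repCount_le {X : List ℕ} {i : ℕ} {F : List Phrase} (h : Parses X (Phrase.IsAt X) i F) :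
    repCount F + i ≤ X.length := by
  induction F generalizing i with
  | nil => simpa [repCount] using h.le
  | cons f F ih =>
    have := ih h.2; rcases f with c | ⟨p, l⟩
    · simp [repCount, Phrase.len] at this ⊢; omega
    · have := h.1.2.1; simp [repCount, Phrase.len] at *; omega

/-- The `k` symbols from position `i` on. -/
def window (X : List ℕ) (k i : ℕ) : Fin k → ℕ := fun j => X.getD (i + j) 0

theorem card_windows_le {X : List ℕ} {σ : ℕ} (hσ : 0 < σ) (hX : ∀ x ∈ X, x < σ) (k i : ℕ) :
    ((range i).image (window X k)).card ≤ σ ^ k := by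
  have h : (range i).image (window X k) ⊆ Fintype.piFinset fun _ => range σ := by
    intro f hf; obtain ⟨i, -, rfl⟩ := mem_image.1 hf
    exact Fintype.mem_piFinset.2 fun j => mem_range.2 (getD_lt hσ hX _)
  simpa using card_le_card h

/-- If a greedy phrase is shorter than `k` and does not end the string, the `k` symbols from its
position on do not occur before. -/
theorem _root_.LZ.Parses.mul_repCount_le {X : List ℕ} {σ : ℕ} (hσ : 0 < σ) (hX : ∀ x ∈ X, x < σ) (k : ℕ) {i : ℕ}
    {F : List Phrase} (h : Parses X (Phrase.IsGreedyAt X) i F) :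
    k * repCount F + k * ((range i).image (window X k)).card + i ≤ X.length + k * σ ^ k + k := by
  induction F generalizing i with
  | nil =>
    have h1 := Nat.mul_le_mul_left k (card_windows_le hσ hX k i); have h2 := h.le; simp [repCount]; omega
  | cons f F ih =>
    have h1 := ih h.2
    have hmono : ∀ j, i ≤ j → ((range i).image (window X k)).card ≤ ((range j).image (window X k)).card := fun j hj =>
      card_le_card (image_subset_image (range_subset_range.2 hj))
    have h2 := Nat.mul_le_mul_left k (hmono _ (Nat.le_add_right i f.len)); rcases f with c | ⟨p, l⟩
    · simp [repCount, Phrase.len] at *; omega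
    obtain ⟨⟨-, hl, hln, -⟩, hmax⟩ := h.1
    have hr : repCount (.rep p l :: F) = repCount F + 1 := by simp [repCount]
    rw [hr, mul_add]; simp only [Phrase.len] at h1 h2 h; rcases Nat.lt_or_ge l k with hlk | hlk
    -- A short phrase that ends the string is the last one; the additional `k` on the right pays for
    -- it.
    · rcases hln.eq_or_lt with hlen | hlt
      · have h3 := (h.2.mono fun _ _ h => h.isAt).repCount_le
        have h4 := Nat.mul_le_mul_left k (card_windows_le hσ hX k i)
        rw [show repCount F = 0 by simp only [Phrase.len] at h3; omega]; omega
      · have hnot : window X k i ∉ (range i).image (window X k) := by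
          intro hmem; obtain ⟨i', hi', heq⟩ := mem_image.1 hmem; rw [mem_range] at hi'
          -- An earlier occurrence of the window would extend the phrase by one symbol, since `l + 1
          -- ≤ k`, contrary to greediness. So each short phrase adds a new window.
          refine absurd (hmax i' (l + 1) ⟨hi', by omega, by omega, fun j hj => ?_⟩) (by omega)
          have h3 := congrFun heq ⟨j, by omega⟩; simp only [window] at h3
          rw [List.getD_eq_getElem _ _ (by omega), List.getD_eq_getElem _ _ (by omega)] at h3
          rw [List.getElem?_eq_getElem (by omega), List.getElem?_eq_getElem (by omega), h3]
        have h3 := card_le_card (s := insert (window X k i) ((range i).image (window X k)))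
          (t := (range (i + l)).image (window X k)) (by
            rw [← image_insert]; refine image_subset_image fun j hj => ?_; simp at hj ⊢
            omega)
        rw [card_insert_of_notMem hnot] at h3; have h4 := Nat.mul_le_mul_left k h3; rw [mul_add] at h4; omega
    · omega

theorem logb_lt {n σ : ℕ} (hn : 2 ≤ n) (hσ : 2 ≤ σ) : 0 < Real.logb σ n ∧ Real.logb σ n < log σ n + 1 := by
  have h1 : (1 : ℝ) < σ := by exact_mod_cast hσ
  refine ⟨Real.logb_pos h1 (by exact_mod_cast hn), ?_⟩; rw [Real.logb_lt_iff_lt_rpow h1 (by positivity)]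
  exact_mod_cast lt_pow_succ_log_self hσ n

/-- For the greedy parsing take `k = log σ n / 2`. At most `n / k` repeat phrases have length at
least `k`, and apart from the last one, each shorter one is charged to one of at most `σ ^ k ≤ √n`
windows. Both are `O(n / log_σ n)`, with total constant 8. If `k = 0`, then `log_σ n < 2` and the
trivial bound `n` suffices. -/
theorem repCount_le_textWords {a σ : ℕ} {X : List ℕ} {F : List Phrase} (hn : 2 ≤ X.length) (hσ : 2 ≤ σ)
    (hX : ∀ x ∈ X, x < σ) (hF : IsLZ77 X F ∨ IsLZ77Type a σ X F) :
    Parses X (Phrase.IsAt X) 0 F ∧ (repCount F : ℝ) ≤ (a + 8 : ℕ) * textWords X.length σ := by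
  obtain ⟨hl0, hl⟩ := logb_lt hn hσ
  have hT0 : 0 < textWords X.length σ := div_pos (by positivity) hl0
  have hTn : textWords X.length σ * Real.logb σ X.length = X.length := div_mul_cancel₀ _ hl0.ne'
  generalize hT : textWords X.length σ = T at *; rcases hF with hF | ⟨hF, hz⟩
  · have hF' := hF.mono fun _ _ h => h.isAt; refine ⟨hF', ?_⟩
    have h1 : (repCount F : ℝ) ≤ X.length := by exact_mod_cast (Nat.le_add_right _ _).trans hF'.repCount_le
    suffices h : (repCount F : ℝ) ≤ 8 * T by push_cast; nlinarith [mul_nonneg (cast_nonneg (α := ℝ) a) hT0.le]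
    obtain ⟨k, hk⟩ : ∃ k, k = log σ X.length / 2 := ⟨_, rfl⟩
    have hk2 : (log σ X.length : ℝ) ≤ 2 * k + 1 := by exact_mod_cast (by omega)
    generalize Real.logb σ X.length = l at *; rcases Nat.eq_zero_or_pos k with h0 | h0
    · rw [h0] at hk2; push_cast at hk2; nlinarith
    · have h2 := Nat.le_trans (Nat.le_add_right _ _) (hF.mul_repCount_le (by omega) hX k)
      have hq : σ ^ k * σ ^ k ≤ X.length := by
        rw [← pow_add]
        exact (Nat.pow_le_pow_right (by omega) (by omega)).trans (pow_log_le_self σ (by omega))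
      have hkq : k + 1 ≤ σ ^ k := Nat.lt_pow_self hσ; generalize σ ^ k = q at *
      have h2' : (k : ℝ) * repCount F ≤ X.length + k * q + k := by exact_mod_cast (Nat.le_add_right _ _).trans h2
      have hq' : (q : ℝ) * q ≤ X.length := by exact_mod_cast hq
      have hkq' : (k : ℝ) + 1 ≤ q := by exact_mod_cast hkq
      have h0' : (1 : ℝ) ≤ k := by exact_mod_cast h0
      have hqT : (q : ℝ) ≤ 2 * T := by
        have : T * l ≤ T * (2 * q) := mul_le_mul_of_nonneg_left (by linarith) hT0.le; nlinarith
      have h3 : T * l ≤ T * (4 * k) := mul_le_mul_of_nonneg_left (by linarith) hT0.le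
      have h4 : (k : ℝ) * q ≤ k * (2 * T) := mul_le_mul_of_nonneg_left hqT (by linarith)
      have h5 : (k : ℝ) * 1 ≤ k * (2 * T) := mul_le_mul_of_nonneg_left (by linarith) (by linarith)
      exact le_of_mul_le_mul_left (by linarith) (show (0 : ℝ) < k by linarith)
  · refine ⟨hF, hz.trans ?_⟩; rw [hT]; push_cast; exact mul_le_mul_of_nonneg_right (by linarith) hT0.le

/-! ### From rounded counts to the I/O bound. -/

theorem cast_div_le_of_le {x : ℝ} (h : (q : ℝ) / b ≤ x) : ((q / b : ℕ) : ℝ) ≤ x :=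
  cast_div_le.trans h

theorem cast_ceil_le (hb : 0 < b) : (((q + b - 1) / b : ℕ) : ℝ) ≤ (q : ℝ) / b + 1 := by
  refine cast_div_le.trans ?_; rw [div_add_one (by positivity)]; gcongr; exact_mod_cast (by omega)

/-- If the fan-in is capped at `n`, then `W ≤ n ^ 3` bounds the logarithm by 3. Otherwise it is the
integer part `m ≥ 2` of `M / B`, and `M / B ≤ m + 1 ≤ m ^ 2` shows that rounding costs a factor 2.
The factor `p ≤ 2 ^ p ≤ m ^ p` adds at most `p`. -/
theorem log_le_mul_max {M B W : ℕ} {T : ℝ} (hn : 2 ≤ n) (hB : 1 ≤ B) (hM : 2 * B ≤ M)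
    (hWn : W ≤ n ^ 3) (hW : (W : ℝ) ≤ p * max 1 (T / B)) :
    (log (min (M / B) n) W : ℝ) ≤ (p + 3 : ℕ) * max 1 (Real.logb (M / B) (T / B)) := by
  have hB0 : (0 : ℝ) < B := by exact_mod_cast hB
  have hm2 : 2 ≤ M / B := (Nat.le_div_iff_mul_le hB).2 hM
  obtain ⟨Λ, hΛ⟩ : ∃ Λ, Λ = max 1 (Real.logb (M / B) (T / B)) := ⟨_, rfl⟩; have hΛ1 : 1 ≤ Λ := hΛ ▸ le_max_left _ _
  have hΛ2 : Real.logb (M / B) (T / B) ≤ Λ := hΛ ▸ le_max_right _ _; rw [← hΛ]; push_cast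
  rcases le_total n (M / B) with h | h
  · rw [min_eq_right h]
    have h1 : log n W ≤ 3 := (log_mono_right hWn).trans (log_pow hn 3).le
    have h2 : (log n W : ℝ) ≤ 3 := by exact_mod_cast h1
    nlinarith
  rw [min_eq_left h]; rcases Nat.eq_zero_or_pos W with rfl | hW0
  · simp; positivity
  have h1 := pow_log_le_self (M / B) hW0.ne'; generalize log (M / B) W = l at *
  have hm2' : (2 : ℝ) ≤ (M / B : ℕ) := by exact_mod_cast hm2
  have hlt : (M : ℝ) / B ≤ ((M / B : ℕ) : ℝ) ^ 2 := by
    rw [div_le_iff₀ hB0]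
    have h3 : M ≤ (M / B + 1) * B := by have h4 := div_add_mod' M B; have h5 := mod_lt M hB; rw [add_mul]; omega
    have h4 : (M : ℝ) ≤ ((M / B : ℕ) + 1) * B := by exact_mod_cast h3
    nlinarith
  have hb2 : (2 : ℝ) ≤ M / B := hm2'.trans cast_div_le; generalize M / B = m at *
  have hlog2 : Real.log 2 ≤ Real.log m := Real.log_le_log two_pos hm2'
  have hlog0 : 0 < Real.log m := (Real.log_pos one_lt_two).trans_le hlog2
  have hlogb : Real.log (M / B) ≤ 2 * Real.log m := by
    have := Real.log_le_log (by linarith) hlt; rwa [Real.log_pow] at this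
  have hlogb0 : 0 < Real.log (M / B) := Real.log_pos (by linarith)
  have hR : Real.log (max 1 (T / B)) ≤ Λ * Real.log (M / B) := by
    rcases le_total (T / B) 1 with h5 | h5
    · rw [max_eq_left h5, Real.log_one]; positivity
    · rw [max_eq_right h5]; rwa [Real.logb, div_le_iff₀ hlogb0] at hΛ2
  have hR0 : (0 : ℝ) < max 1 (T / B) := lt_max_of_lt_left one_pos
  have hp2 : (p : ℝ) ≤ 2 ^ p := by exact_mod_cast Nat.lt_two_pow_self.le
  have h6 : (m : ℝ) ^ l ≤ 2 ^ p * max 1 (T / B) :=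
    le_trans (by exact_mod_cast h1) (hW.trans (by gcongr))
  have h7 := Real.log_le_log (by positivity) h6
  rw [Real.log_pow, Real.log_mul (by positivity) hR0.ne', Real.log_pow] at h7
  have h8 : (l : ℝ) * Real.log m ≤ (p + 2 * Λ) * Real.log m := by nlinarith
  have h9 := le_of_mul_le_mul_right h8 hlog0; nlinarith

set_option maxHeartbeats 1000000 in
-- With `T = n / log_σ n`, the number of units, the number of pieces, and the encoded length in
-- words are all `O(T)`. Each count of blocks is thus a multiple of `R = max 1 (T / B)`, and the
-- logarithm is a multiple of `Λ`. Products of two such factors produce the square `(K + 3) ^ 2`.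
theorem DecodeCost.le_ioBound {z e K : ℕ} (h : DecodeCost mc n sg z t P N e)
    (hn : 2 ≤ n) (hsg : 2 ≤ sg) (hB : 1 ≤ mc.B) (hM : 2 * mc.B ≤ mc.M) (hw : sg * n ≤ 2 ^ mc.w)
    (hz : (z : ℝ) ≤ K * textWords n sg) :
    (t : ℝ) ≤ (1000 * (K + 3) ^ 2 : ℕ) * ioBound n sg mc.M mc.B := by
  obtain ⟨hP, hNn, hdN, he, ht⟩ := h; obtain ⟨hl0, hl⟩ := logb_lt hn hsg
  have hTn : textWords n sg * Real.logb sg n = n := div_mul_cancel₀ _ hl0.ne'; rw [ioBound]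
  have hT0 : 0 < textWords n sg := div_pos (by positivity) hl0; generalize textWords n sg = T at *
  have hn0 : (0 : ℝ) < n := by exact_mod_cast (by omega)
  have hd : P .d = log sg n + 1 := hP.d_eq; have hd0 : (0 : ℝ) < P .d := by rw [hd]; positivity
  have hd1 : 0 < P .d := by omega
  have hdn : (P .d : ℝ) ≤ n := by rw [hd]; exact_mod_cast log_lt_self sg (by omega)
  have hld : Real.logb sg n ≤ P .d := by rw [hd]; push_cast; exact hl.le
  have hndT : (n : ℝ) ≤ P .d * T := by nlinarith
  have hT1 : 1 ≤ T := by by_contra hc; nlinarith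
  have hndT' : (n : ℝ) / P .d ≤ T := (div_le_iff₀ hd0).2 (by linarith)
  have hndn : (n : ℝ) / P .d ≤ n := div_le_self hn0.le (by exact_mod_cast hd1)
  obtain ⟨R, hR⟩ : ∃ R, R = max 1 (T / mc.B) := ⟨_, rfl⟩
  obtain ⟨Λ, hΛ⟩ : ∃ Λ, Λ = max 1 (Real.logb (mc.M / mc.B) (T / mc.B)) := ⟨_, rfl⟩; rw [← hR, ← hΛ]
  have hR1 : 1 ≤ R := hR ▸ le_max_left _ _; have hTB : T / mc.B ≤ R := hR ▸ le_max_right _ _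
  have hΛ1 : 1 ≤ Λ := hΛ ▸ le_max_left _ _; have hb : P .b = min mc.B n := hP.b_eq; have hb1 : 0 < P .b := by omega
  have hdivB : ∀ x c : ℝ, x ≤ c * T → 0 ≤ c → x / mc.B ≤ c * R := fun x c h1 hc => by
    calc x / mc.B ≤ c * T / mc.B := by gcongr
      _ = c * (T / mc.B) := mul_div_assoc _ _ _
      _ ≤ c * R := by gcongr
  -- Since `b = min B n`, two bounds on `x` are needed: for `b = B` the one by `T`, and for `b = n`
  -- the one by `n`, which makes the quotient a constant.
  have hdivb : ∀ x c c' : ℝ, x ≤ c * T → x ≤ c' * n → 0 ≤ c → 0 ≤ c' → x / P .b ≤ (c + c') * R := by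
    intro x c c' h1 h2 hc hc'; have h3 := mul_nonneg hc (by linarith : 0 ≤ R); have h4 : c' * 1 ≤ c' * R := by gcongr
    rw [add_mul]; rcases le_total mc.B n with h5 | h5
    · rw [hb, min_eq_left h5]
      linarith [hdivB x c h1 hc, mul_nonneg hc' (by linarith : 0 ≤ R)]
    · rw [hb, min_eq_right h5]; linarith [(div_le_iff₀ hn0).2 h2]
  have hdK : (P .d : ℝ) * z ≤ P .d * (K * T) := by gcongr
  have hN : (N : ℝ) ≤ (3 * K + 3) * T := by
    have h1 : (P .d : ℝ) * N ≤ 2 * n + 3 * P .d * z + P .d := by exact_mod_cast hdN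
    refine le_of_mul_le_mul_left ?_ hd0; nlinarith
  have hNb := hdivb N _ 1 hN (by rw [one_mul]; exact_mod_cast hNn) (by positivity) zero_le_one
  have hNb' := cast_div_le_of_le hNb
  have hU : ((P .U : ℕ) : ℝ) ≤ n / P .d + 1 := by rw [hP.U_eq]; exact cast_ceil_le hd1
  have hUb := hdivb (P .U) 2 2 (by linarith) (by linarith [show (1 : ℝ) ≤ n by exact_mod_cast (by omega)])
    zero_le_two zero_le_two
  have hUb' := cast_ceil_le (q := P .U) hb1
  have hm2 : 2 ≤ P .m := by rw [hP.m_eq]; exact le_min ((Nat.le_div_iff_mul_le hB).2 hM) hn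
  have hm0 : (0 : ℝ) < P .m := by exact_mod_cast (by omega)
  have hcu1 : 0 < P .cu := by rw [hP.cu_eq]; exact Nat.mul_pos (by omega) hb1
  have hcu : (P .U : ℝ) / P .cu * P .m = P .U / P .b := by
    rw [hP.cu_eq]; push_cast
    rw [div_mul_eq_mul_div, mul_comm (P .U : ℝ), mul_div_mul_left _ _ hm0.ne']
  have hcu' := cast_ceil_le (q := P .U) hcu1; have hUcu0 : 0 ≤ (P .U : ℝ) / P .cu := by positivity
  have hUcu : (P .U : ℝ) / P .cu ≤ P .U / P .b := by
    have : (1 : ℝ) ≤ P .m := by exact_mod_cast (by omega)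
    nlinarith
  obtain ⟨W, hW⟩ : ∃ W, W = maxBlocks P N := ⟨_, rfl⟩; rw [resolveCost, ← hW] at ht
  have hWR : (W : ℝ) ≤ (6 * K + 16 : ℕ) * R := by
    have h1 : ((2 * N / P .b : ℕ) : ℝ) ≤ 2 * (N / P .b) :=
      cast_div_le.trans (by push_cast; rw [mul_div_assoc])
    rw [hW, maxBlocks]; push_cast at h1 ⊢; linarith
  have hWn : W ≤ n ^ 3 := by
    have h1 : 2 * N / P .b ≤ 2 * N := Nat.div_le_self _ _
    have h2 : (P .U + P .cu - 1) / P .cu ≤ P .U := by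
      refine (Nat.div_le_iff_le_mul hcu1).2 ?_; have := Nat.le_mul_of_pos_right (P .U) hcu1; omega
    have h3 : P .U ≤ n := by
      rw [hP.U_eq]; refine (Nat.div_le_iff_le_mul hd1).2 ?_; have := Nat.le_mul_of_pos_right n hd1; omega
    have h4 : 4 * n ≤ n ^ 3 := by rw [pow_succ]; exact Nat.mul_le_mul_right _ (Nat.pow_le_pow_left hn 2)
    rw [hW, maxBlocks]; omega
  clear hW; have hL := log_le_mul_max hn hB hM hWn (hR ▸ hWR); rw [← hP.m_eq, ← hΛ] at hL
  replace hL : (log (P .m) W : ℝ) ≤ (6 * K + 19) * Λ := hL.trans_eq (by push_cast; ring)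
  generalize log (P .m) W = l at *
  have hRΛ : R ≤ R * Λ := le_mul_of_one_le_right (by linarith) hΛ1
  have hWl : (W : ℝ) * l ≤ (6 * K + 16 : ℕ) * (6 * K + 19) * (R * Λ) := by
    calc (W : ℝ) * l ≤ ((6 * K + 16 : ℕ) * R) * ((6 * K + 19) * Λ) := by gcongr
      _ = _ := by ring
  -- The number of chunks is at most `U / cu + 1`. The first part uses the bound `m * (l + 1)`,
  -- where `m` cancels against `cu = m * b`. The extra chunk from rounding uses `W`, because `m * (l
  -- + 1)` may be too large when the text is short compared with `M`.
  have hmin : ((((P .U + P .cu - 1) / P .cu) * min W (P .m * (l + 1)) : ℕ) : ℝ) ≤ P .U / P .b * (l + 1) + W := by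
    have h1 : ((min W (P .m * (l + 1)) : ℕ) : ℝ) ≤ W := by exact_mod_cast min_le_left _ _
    have h2 : ((min W (P .m * (l + 1)) : ℕ) : ℝ) ≤ P .m * (l + 1) := by exact_mod_cast min_le_right _ _
    rw [cast_mul, ← hcu, mul_assoc]; nlinarith
  have hUl : (P .U : ℝ) / P .b * (l + 1) ≤ 4 * (6 * K + 20) * (R * Λ) := by
    calc (P .U : ℝ) / P .b * (l + 1) ≤ ((2 + 2) * R) * ((6 * K + 20) * Λ) :=
          mul_le_mul hUb (by linarith) (by positivity) (by positivity)
      _ = _ := by ring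
  have hk : P .d ≤ P .k := by
    rw [hP.k_eq, hd, symbolsPerWord]; refine le_log_of_pow_le (by omega) ?_; rw [pow_succ']
    exact (Nat.mul_le_mul_left _ (pow_log_le_self _ (by omega))).trans hw
  have hk' : (P .d : ℝ) ≤ P .k := by exact_mod_cast hk
  have hk0 : (0 : ℝ) < P .k := by linarith
  have hC := cast_ceil_le (q := e) (Nat.mul_pos (show 0 < P .k by omega) hB)
  have he' : (e : ℝ) / ((P .k * mc.B : ℕ) : ℝ) ≤ (3 * K + 2) * R := by
    have h1 : (e : ℝ) ≤ 2 * n + (2 * P .d + 1) * z := by exact_mod_cast he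
    have h2 : (1 : ℝ) * z ≤ P .d * z := by gcongr; exact_mod_cast hd1
    rw [cast_mul, ← div_div]; refine hdivB _ _ ((div_le_iff₀ hk0).2 ?_) (by positivity)
    calc (e : ℝ) ≤ (3 * K + 2) * T * P .d := by linarith
      _ ≤ _ := by gcongr
  have hD := cast_ceil_le (q := n) (Nat.mul_pos hd1 hb1)
  have hD' : (n : ℝ) / ((P .d * P .b : ℕ) : ℝ) ≤ (1 + 1) * R := by
    rw [cast_mul, ← div_div]
    exact hdivb _ 1 1 (by linarith) (by linarith) zero_le_one zero_le_one
  have hE : (((n / P .k + 1) / mc.B : ℕ) : ℝ) ≤ 2 * R := by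
    refine cast_div_le.trans (hdivB _ 2 ?_ zero_le_two)
    have h1 : ((n / P .k : ℕ) : ℝ) ≤ T := by refine cast_div_le.trans (le_trans ?_ hndT'); gcongr
    push_cast; linarith
  have ht' : (t : ℝ) ≤ ((e + P .k * mc.B - 1) / (P .k * mc.B) : ℕ) + ((N / P .b : ℕ) : ℝ) +
      (4 * ((N / P .b : ℕ) : ℝ) + 3 + ((P .U + P .b - 1) / P .b : ℕ) + 2 * W + 4 * (W * l) +
        8 * ((((P .U + P .cu - 1) / P .cu) * min W (P .m * (l + 1)) : ℕ) : ℝ)) +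
      ((n + P .d * P .b - 1) / (P .d * P .b) : ℕ) + ((n / P .k + 1) / mc.B : ℕ) + 2 := by
    exact_mod_cast ht
  have hKR : (K : ℝ) * R ≤ K * (R * Λ) := by gcongr
  have hKX : 0 ≤ (K : ℝ) * (R * Λ) := by positivity
  have hKKX : 0 ≤ (K : ℝ) * (K * (R * Λ)) := by positivity
  rw [ge_iff_le.symm]; push_cast at hWR hWl ⊢; rw [mul_assoc]; generalize R * Λ = Y at *; linarith

end ExtMem

theorem theorem2 :
    ∃ P : ExtMem.Cmd, ∀ a : ℕ, ∃ c C : ℕ,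
      ∀ (n σ w M B : ℕ) (X : List ℕ) (F : List LZ.Phrase),
        2 ≤ n → 2 ≤ σ → σ ≤ n ^ a →
        1 ≤ B → 2 * B ≤ M → M < 2 ^ w → n ^ c ≤ 2 ^ w →
        X.length = n → (∀ x ∈ X, x < σ) →
        (LZ.IsLZ77 X F ∨ LZ.IsLZ77Type a σ X F) →
        ∃ (s : ExtMem.State) (t : ℕ),
          ExtMem.Run ⟨w, M, B⟩ P (ExtMem.initial ⟨w, M, B⟩ n σ (LZ.encode σ n F)) s t ∧
          ExtMem.Outputs ⟨w, M, B⟩ s σ X ∧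
          (t : ℝ) ≤ C * LZ.ioBound n σ M B := by
  -- `V` must exceed `n ^ (3 * a + 19)` and sixteen fields share a word. The 17 additional powers of
  -- `n` pay for rounding `w / 16`, which takes 16, and for strictness. The second constant is that
  -- of `le_ioBound` with `K = a + 8`.
  refine ⟨ExtMem.program, fun a => ⟨16 * (3 * a + 19) + 17, 1000 * (a + 8 + 3) ^ 2,
    fun n σ w M B X F hn hσ hσa hB hM hMw hw hX hXσ hF => ?_⟩⟩
  have hwV : n ^ (3 * a + 19) < 2 ^ (w / 16) := by
    -- Rounding `w` down to a multiple of 16 loses less than a factor `2 ^ 16`, and `2 ^ 16 ≤ n ^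
    -- 16`.
    refine lt_of_pow_lt_pow_left₀ 16 (by positivity) (lt_of_mul_lt_mul_right (a := 2 ^ 16) ?_ (by positivity))
    calc (n ^ (3 * a + 19)) ^ 16 * 2 ^ 16 ≤ (n ^ (3 * a + 19)) ^ 16 * n ^ 16 :=
          Nat.mul_le_mul_left _ (Nat.pow_le_pow_left hn 16)
      _ = n ^ (16 * (3 * a + 19) + 16) := by ring
      _ < n ^ (16 * (3 * a + 19) + 17) := Nat.pow_lt_pow_right hn (by omega)
      _ ≤ 2 ^ w := hw
      _ ≤ 2 ^ (w / 16 * 16 + 16) := Nat.pow_le_pow_right (by omega) (by omega)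
      _ = (2 ^ (w / 16)) ^ 16 * 2 ^ 16 := by ring
  obtain ⟨hP, hz⟩ := ExtMem.repCount_le_textWords (hX ▸ hn) hσ hXσ hF
  obtain ⟨s, t, hr, ho, Q, N, e, hc⟩ := ExtMem.program_run (mc := ⟨w, M, B⟩) hX hn hσ hσa hB hM hMw hwV hXσ hP
  refine ⟨s, t, hr, ho, hc.le_ioBound hn hσ hB hM ?_ (hX ▸ hz)⟩
  calc σ * n ≤ n ^ a * n := Nat.mul_le_mul_right _ hσa
    _ = n ^ (a + 1) := by ring
    _ ≤ n ^ (16 * (3 * a + 19) + 17) := Nat.pow_le_pow_right (by omega) (by omega)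
    _ ≤ 2 ^ w := hw
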